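/- Let $K$ be an algebraically closed field, $Q$ a finite quiver, $I\subseteq KQ$ an admissible ideal which is homogeneous with respect to path length, $\Lambda=KQ/I=\bigoplus_{l\ge 0}\Lambda_l$ (graded by path length), $J$ its Jacobson radical, $e_i$ the primitive idempotents belonging to the vertices and $S_i=\Lambda e_i/Je_i$. Let $d\ge 1$, let $T=\bigoplus_{r=1}^{t}S_{e(r)}$ be a finite dimensional semisimple $\Lambda$-module (the $e(r)$ being vertices), and let $\mathbb S=(\mathbb S_l)_{l\ge 0}$ be a sequence of semisimple $\Lambda$-modules. A $\mathbb Z$-graded $\Lambda$-module $M$ has top $T$ with *top degree vector* $h\in\mathbb Z^t$ if it is generated by homogeneous elements $m_r=e(r)m_r$ of degree $h(r)$ ($1\le r\le t$) which are linearly independent modulo $JM$. Fix a set $H\subseteq\mathbb Z^t$ of degree vectors (for instance a single vector, or all of $\mathbb Z^t$). Let $\mathcal C(T)$ be the class of graded $\Lambda$-modules of dimension $d$ with top $T$ and some top degree vector in $H$, and let $\mathcal C(\mathbb S)$ be the class of those $M\in\mathcal C(T)$ with $J^lM/J^{l+1}M\cong\mathbb S_l$ for all $l$. Two graded modules are graded-isomorphic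 if there is an isomorphism between them which is homogeneous of some degree. A family of graded modules over a (reduced, separated, not necessarily irreducible) variety $X$ is a vector bundle of rank $d$ on $X$ which is a direct sum of subbundles indexed by the degrees, with a compatible algebra homomorphism from $\Lambda$ to the endomorphisms of the bundle, such that all fibres have the same top and the same top degree vector; two families over $X$ are equivalent if their fibres at each point are graded-isomorphic. A coarse moduli space of a class is a variety whose points correspond bijectively to the graded-isomorphism classes in it, such that families in the class induce morphisms to it, and which is universal (initial) for this property; a fine moduli space is a variety $Z$ carrying a family $\Gamma$ in the class such that every family in the class over a variety $X$ is equivalent to $\tau^*\Gamma$ for a unique morphism $\tau\colon X\to Z$. A module is local if its top is simple. For a vertex $i$, the local graded Grassmannian $\operatorname{Gr-\mathfrak{Grass}}^{S_i}_{\delta}$ is the variety of homogeneous submodules $C\subseteq Je_i$ with $\dim\Lambda e_i/C=\delta$, a subvariety of a Grassmannian of subspaces of $\Lambda$. Let $\mathcal C$ be $\mathcal C(T)$ or $\mathcal C(\mathbb S)$. (1) If $\mathcal C$ has a coarse moduli space, then every module in $\mathcal C$ is a direct sum of graded local submodules. (2) Conversely, suppose that every module in $\mathcal C$ is a direct sum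 of graded local submodules, and that the differences $|h(r)-h(r')|$, $h\in H$, $1\le r,r'\le t$, are bounded (for instance $H$ is finite). Then $\mathcal C$ is the disjoint union of finitely many subclasses, each closed under graded isomorphism within $\mathcal C$, and each having a fine moduli space $Z$ which is a projective variety. More precisely, for each subclass there are $h\in H$, positive integers $\delta_1,\dots,\delta_t$ and subsets $W_r\subseteq\operatorname{Gr-\mathfrak{Grass}}^{S_{e(r)}}_{\delta_r}$, each open and closed (a union of connected components), such that $Z=\prod_{r=1}^t W_r$ and the fibre of the universal family at $(C_1,\dots,C_t)$ is a direct sum of local modules isomorphic to $\Lambda e(r)/C_r$ and generated in degrees $h(r)$, $1\le r\le t$. -/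

import Mathlib

open Topology Filter

universe u w v

noncomputable section

/-! ### Classical varieties over a field, as spaces with functions -/

/-- A topological space with a sheaf of `K`-valued functions. `RegAt f x` says that `f` is regular
in a neighbourhood of `x`; the sections over an open `U` are the functions which are regular at
all points of `U` (a function defined only near `x` is represented by any extension of it). -/
structure SpaceWithFunctions (K : Type u) [Field K] where
  carrier : Type u
  top : TopologicalSpace carrier
  RegAt : (carrier → K) → carrier → Prop
  regAt_congr : ∀ {f g : carrier → K} {x : carrier}, f =ᶠ[𝓝 x] g → RegAt f x → RegAt g x
  regAt_eventually : ∀ {f : carrier → K} {x : carrier}, RegAt f x → ∀ᶠ y in 𝓝 x, RegAt f y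

namespace SpaceWithFunctions

variable {K : Type u} [Field K]

instance : CoeSort (SpaceWithFunctions K) (Type u) := ⟨SpaceWithFunctions.carrier⟩

instance (X : SpaceWithFunctions K) : TopologicalSpace X := X.top

/-- Morphisms: continuous maps which pull regular functions back to regular functions. -/
structure Hom (X Y : SpaceWithFunctions K) where
  toFun : X → Y
  continuous_toFun : Continuous toFun
  regAt_comp : ∀ (x : X) (f : Y → K), Y.RegAt f (toFun x) → X.RegAt (f ∘ toFun) x

instance (X Y : SpaceWithFunctions K) : CoeFun (Hom X Y) (fun _ => X → Y) := ⟨Hom.toFun⟩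

/-- `X` and `Y` are isomorphic. -/
def IsIso (X Y : SpaceWithFunctions K) : Prop :=
  ∃ (f : Hom X Y) (g : Hom Y X), (∀ x, g (f x) = x) ∧ ∀ y, f (g y) = y

/-- The structure induced on an arbitrary subset: regular functions are locally restrictions of
regular functions. -/
def sub (X : SpaceWithFunctions K) (S : Set X) : SpaceWithFunctions K where
  carrier := S
  top := instTopologicalSpaceSubtype
  RegAt f x := ∃ g : X → K, X.RegAt g x ∧ ∀ᶠ y : S in 𝓝 x, f y = g y
  regAt_congr := by
    rintro f g x hfg ⟨k, hk, hfk⟩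
    exact ⟨k, hk, by filter_upwards [hfg, hfk] with y h1 h2; rw [← h1, h2]⟩
  regAt_eventually := by
    rintro f x ⟨k, hk, hfk⟩
    have h1 : ∀ᶠ y : S in 𝓝 x, X.RegAt k y :=
      continuous_subtype_val.continuousAt.eventually (X.regAt_eventually hk)
    filter_upwards [h1, hfk.eventually_nhds] with y hy1 hy2
    exact ⟨k, hy1, hy2⟩

/-- The quotient structure along a map `q : X → Y`: the quotient topology, and a function is
regular iff its composition with `q` is regular. -/
def quot (X : SpaceWithFunctions K) {Y : Type u} (q : X → Y) : SpaceWithFunctions K where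
  carrier := Y
  top := TopologicalSpace.coinduced q X.top
  RegAt f y := ∃ U : Set Y, IsOpen[TopologicalSpace.coinduced q X.top] U ∧ y ∈ U ∧
    ∀ x, q x ∈ U → X.RegAt (f ∘ q) x
  regAt_congr := by
    let _ := TopologicalSpace.coinduced q X.top
    rintro f g y hfg ⟨U, hU, hyU, h⟩
    obtain ⟨V, hV, hVo, hyV⟩ := eventually_nhds_iff.1 hfg
    refine ⟨U ∩ V, hU.inter hVo, ⟨hyU, hyV⟩, fun x hx => X.regAt_congr ?_ (h x hx.1)⟩
    have hc : Continuous q := continuous_coinduced_rng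
    filter_upwards [(hVo.preimage hc).mem_nhds hx.2] with z hz using hV _ hz
  regAt_eventually := by
    let _ := TopologicalSpace.coinduced q X.top
    rintro f y ⟨U, hU, hyU, h⟩
    filter_upwards [hU.mem_nhds hyU] with z hz using ⟨U, hU, hz, h⟩

/-- The algebra of polynomial functions on a vector space: it is generated by the linear forms. -/
def polyFun (K : Type u) [Field K] (W : Type u) [AddCommGroup W] [Module K W] :
    Subalgebra K (W → K) :=
  Algebra.adjoin K (Set.range fun φ : Module.Dual K W => (φ : W → K))

/-- The finite dimensional vector space `W` as an affine space, with the Zariski topology;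
regular functions are locally quotients of polynomial functions. -/
def affine (K : Type u) [Field K] (W : Type u) [AddCommGroup W] [Module K W] :
    SpaceWithFunctions K where
  carrier := W
  top := TopologicalSpace.generateFrom {U | ∃ p ∈ polyFun K W, U = {x | p x ≠ 0}}
  RegAt f x := ∃ p ∈ polyFun K W, ∃ q ∈ polyFun K W, q x ≠ 0 ∧
    ∀ᶠ y in @nhds W (TopologicalSpace.generateFrom {U | ∃ p ∈ polyFun K W, U = {x | p x ≠ 0}}) x,
      f y * q y = p y
  regAt_congr := by
    rintro f g x hfg ⟨p, hp, q, hq, hx, h⟩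
    exact ⟨p, hp, q, hq, hx, by filter_upwards [hfg, h] with y h1 h2; rw [← h1, h2]⟩
  regAt_eventually := by
    let _ := TopologicalSpace.generateFrom {U | ∃ p ∈ polyFun K W, U = {x | p x ≠ 0}}
    rintro f x ⟨p, hp, q, hq, hx, h⟩
    have ho : IsOpen {x | q x ≠ 0} := TopologicalSpace.isOpen_generateFrom_of_mem ⟨q, hq, rfl⟩
    filter_upwards [h.eventually_nhds, ho.mem_nhds hx] with y h1 h2
    exact ⟨p, hp, q, hq, h2, h1⟩

/-- Affine varieties: closed subsets of some affine `n`-space. -/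
def IsAffineVariety (X : SpaceWithFunctions K) : Prop :=
  ∃ (n : ℕ) (S : Set (affine K (Fin n → K))), IsClosed S ∧ IsIso X ((affine K (Fin n → K)).sub S)

/-- (Not necessarily irreducible) varieties: separated, with a finite open affine cover. -/
def IsVariety (X : SpaceWithFunctions K) : Prop :=
  (∃ (m : ℕ) (U : Fin m → Set X), (∀ i, IsOpen (U i)) ∧ (⋃ i, U i) = Set.univ ∧
    ∀ i, IsAffineVariety (X.sub (U i))) ∧
  ∀ (Y : SpaceWithFunctions K), IsAffineVariety Y → ∀ f g : Hom Y X, IsClosed {y : Y | f y = g y}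

/-- Projective `n`-space, as the quotient of the nonzero vectors of `K ^ (n + 1)`. -/
def projSpace (K : Type u) [Field K] (n : ℕ) : SpaceWithFunctions K :=
  ((affine K (Fin (n + 1) → K)).sub {x : Fin (n + 1) → K | x ≠ 0}).quot
    (Projectivization.mk' K : {x : Fin (n + 1) → K // x ≠ 0} → Projectivization K (Fin (n + 1) → K))

/-- Projective varieties: closed subsets of some projective space. -/
def IsProjectiveVariety (X : SpaceWithFunctions K) : Prop :=
  ∃ (n : ℕ) (S : Set (projSpace K n)), IsClosed S ∧ IsIso X ((projSpace K n).sub S)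

/-- The Grassmannian of `k`-dimensional subspaces of the finite dimensional vector space `W`, as
the quotient of the variety of `k`-frames by the map sending a frame to its span. -/
def grassmannian (K : Type u) [Field K] (W : Type u) [AddCommGroup W] [Module K W] (k : ℕ) :
    SpaceWithFunctions K :=
  ((affine K (Fin k → W)).sub {b : Fin k → W | LinearIndependent K b}).quot
    (Y := {C : Submodule K W // Module.finrank K C = k})
    (fun b : {b : Fin k → W // LinearIndependent K b} =>
      ⟨Submodule.span K (Set.range b.1), by
        simpa using finrank_span_eq_card (R := K) b.2⟩)

/-- `Z`, with the projections `pr`, is the product of the `G r` in the category of varieties. -/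
def IsProductOfVarieties {t : ℕ} (G : Fin t → SpaceWithFunctions K) (Z : SpaceWithFunctions K)
    (pr : ∀ r, Hom Z (G r)) : Prop :=
  IsVariety Z ∧ ∀ X : SpaceWithFunctions K, IsVariety X → ∀ f : ∀ r, Hom X (G r),
    ∃! g : Hom X Z, ∀ r x, pr r (g x) = f r x

end SpaceWithFunctions

/-! ### Path algebras and path-length-graded algebras -/

/-- Defining relations of the path algebra: the vertices are orthogonal idempotents with sum `1`,
and an arrow `α : i ⟶ j` satisfies `e_j α = α = α e_i`. -/
inductive PathAlgebraRel (K : Type u) [Field K] (V : Type w) [Quiver.{v} V] [Fintype V] :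
    FreeAlgebra K (V ⊕ Σ i j : V, (i ⟶ j)) → FreeAlgebra K (V ⊕ Σ i j : V, (i ⟶ j)) → Prop
  | idem (i : V) : PathAlgebraRel K V
      (FreeAlgebra.ι K (Sum.inl i) * FreeAlgebra.ι K (Sum.inl i)) (FreeAlgebra.ι K (Sum.inl i))
  | orth (i j : V) (h : i ≠ j) : PathAlgebraRel K V
      (FreeAlgebra.ι K (Sum.inl i) * FreeAlgebra.ι K (Sum.inl j)) 0
  | total : PathAlgebraRel K V (∑ i : V, FreeAlgebra.ι K (Sum.inl i)) 1
  | source {i j : V} (a : i ⟶ j) : PathAlgebraRel K V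
      (FreeAlgebra.ι K (Sum.inr ⟨i, j, a⟩) * FreeAlgebra.ι K (Sum.inl i))
      (FreeAlgebra.ι K (Sum.inr ⟨i, j, a⟩))
  | target {i j : V} (a : i ⟶ j) : PathAlgebraRel K V
      (FreeAlgebra.ι K (Sum.inl j) * FreeAlgebra.ι K (Sum.inr ⟨i, j, a⟩))
      (FreeAlgebra.ι K (Sum.inr ⟨i, j, a⟩))

/-- The path algebra `K Q` of a quiver with vertex set `V`. -/
abbrev PathAlgebra (K : Type u) [Field K] (V : Type w) [Quiver.{v} V] [Fintype V] :=
  RingQuot (PathAlgebraRel K V)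

namespace PathAlgebra

variable (K : Type u) [Field K] (V : Type w) [Quiver.{v} V] [Fintype V]

variable {V}

/-- The path of length zero at a vertex. -/
def vertex (i : V) : PathAlgebra K V :=
  RingQuot.mkAlgHom K (PathAlgebraRel K V) (FreeAlgebra.ι K (Sum.inl i))

/-- An arrow as an element of the path algebra. -/
def arrow {i j : V} (a : i ⟶ j) : PathAlgebra K V :=
  RingQuot.mkAlgHom K (PathAlgebraRel K V) (FreeAlgebra.ι K (Sum.inr ⟨i, j, a⟩))

/-- A path as an element of the path algebra; in a product `p * q`, the path `q` comes first. -/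
def ofPath {i : V} : {j : V} → Quiver.Path i j → PathAlgebra K V
  | _, .nil => vertex K i
  | _, .cons p a => arrow K a * ofPath p

variable (V)

/-- The span of the paths of length `l`. -/
def degreePart (l : ℕ) : Submodule K (PathAlgebra K V) :=
  Submodule.span K {x | ∃ (i j : V) (p : Quiver.Path i j), p.length = l ∧ x = ofPath K p}

end PathAlgebra

section Algebras

variable {K : Type u} [Field K] {V : Type w} [Quiver.{v} V] [Fintype V]
  {Λ : Type u} [Ring Λ] [Algebra K Λ]

/-- `π` presents `Λ` as a path algebra modulo an admissible ideal (contained in the span of the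
paths of length at least two, containing all sufficiently long paths) which is homogeneous with
respect to path lengths. -/
structure IsPathLengthGraded (π : PathAlgebra K V →ₐ[K] Λ) : Prop where
  surjective : Function.Surjective π
  ker_le : LinearMap.ker π.toLinearMap ≤ ⨆ l ≥ 2, PathAlgebra.degreePart K V l
  long_paths : ∃ N : ℕ, ∀ l ≥ N, PathAlgebra.degreePart K V l ≤ LinearMap.ker π.toLinearMap
  homogeneous : LinearMap.ker π.toLinearMap ≤
    ⨆ l, LinearMap.ker π.toLinearMap ⊓ PathAlgebra.degreePart K V l

/-- The component `Λ_l` of degree `l`. -/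
def algDegree (π : PathAlgebra K V →ₐ[K] Λ) (l : ℕ) : Submodule K Λ :=
  (PathAlgebra.degreePart K V l).map π.toLinearMap

/-- The primitive idempotent `e_i` of `Λ`. -/
def idem (π : PathAlgebra K V →ₐ[K] Λ) (i : V) : Λ := π (PathAlgebra.vertex K i)

/-! ### Radical layers, local modules, graded modules -/

/-- `J ^ l M`, where `J` is the Jacobson radical of `Λ`. -/
def radPow (Λ : Type u) [Ring Λ] (M : Type u) [AddCommGroup M] [Module Λ M] :
    ℕ → Submodule Λ M
  | 0 => ⊤
  | l + 1 => Ring.jacobson Λ • radPow Λ M l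

/-- The radical layer `J ^ l M / J ^ (l + 1) M`. -/
abbrev RadLayer (Λ : Type u) [Ring Λ] (M : Type u) [AddCommGroup M] [Module Λ M] (l : ℕ) :=
  (radPow Λ M l) ⧸ (radPow Λ M (l + 1)).submoduleOf (radPow Λ M l)

/-- A module is local if its top `M / J M` is simple. -/
def IsLocalModule (Λ : Type u) [Ring Λ] (M : Type u) [AddCommGroup M] [Module Λ M] : Prop :=
  IsSimpleModule Λ (M ⧸ (Ring.jacobson Λ • (⊤ : Submodule Λ M)))

/-- A `ℤ`-graded `Λ`-module. -/
structure GrMod (π : PathAlgebra K V →ₐ[K] Λ) where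
  carrier : Type u
  [addCommGroup : AddCommGroup carrier]
  [moduleK : Module K carrier]
  [moduleΛ : Module Λ carrier]
  [tower : IsScalarTower K Λ carrier]
  gr : ℤ → Submodule K carrier
  internal : DirectSum.IsInternal gr
  smul_mem : ∀ (l : ℕ) (n : ℤ) (a : Λ) (m : carrier), a ∈ algDegree π l → m ∈ gr n →
    a • m ∈ gr (l + n)

namespace GrMod

variable {π : PathAlgebra K V →ₐ[K] Λ}

instance : CoeSort (GrMod π) (Type u) := ⟨GrMod.carrier⟩

instance (M : GrMod π) : AddCommGroup M := M.addCommGroup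
instance (M : GrMod π) : Module K M := M.moduleK
instance (M : GrMod π) : Module Λ M := M.moduleΛ
instance (M : GrMod π) : IsScalarTower K Λ M := M.tower

/-- Graded-isomorphic: there is an isomorphism which is homogeneous of some degree `s`. -/
def GradedIso (M N : GrMod π) : Prop :=
  ∃ (f : M ≃ₗ[Λ] N) (s : ℤ), ∀ (l : ℤ) (m : M), m ∈ M.gr l ↔ f m ∈ N.gr (l + s)

/-- Homogeneous submodules. -/
def IsHomogeneousSub (M : GrMod π) (N : Submodule Λ M) : Prop :=
  N.restrictScalars K ≤ ⨆ l, N.restrictScalars K ⊓ M.gr l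

/-- `M` is the direct sum of finitely many graded local submodules. -/
def IsDirectSumOfLocals (M : GrMod π) : Prop :=
  ∃ (n : ℕ) (N : Fin n → Submodule Λ M), DirectSum.IsInternal N ∧
    ∀ i, M.IsHomogeneousSub (N i) ∧ IsLocalModule Λ (N i)

/-- `M` has top `T = ⨁ r, S_{e r}` with top degree vector `h`, where `S_i` is the simple module
`Λ e_i / J e_i`: there is a full sequence of top elements `m r = e_{e r} m r`, homogeneous of
degree `h r`, generating `M` and linearly independent modulo `J M`. -/
def HasTop (M : GrMod π) {t : ℕ} (e : Fin t → V) (h : Fin t → ℤ) : Prop :=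
  ∃ m : Fin t → M, (∀ r, m r ∈ M.gr (h r)) ∧ (∀ r, idem π (e r) • m r = m r) ∧
    Submodule.span Λ (Set.range m) = ⊤ ∧
    LinearIndependent K fun r => (Ring.jacobson Λ • (⊤ : Submodule Λ M)).mkQ (m r)

/-- The class `C(T)`: graded `d`-dimensional modules with top `T = ⨁ r, S_{e r}`, with top
degree vector in `H`. -/
def withTop (π : PathAlgebra K V →ₐ[K] Λ) (d : ℕ) {t : ℕ} (e : Fin t → V)
    (H : Set (Fin t → ℤ)) (M : GrMod π) : Prop :=
  Module.finrank K M = d ∧ ∃ h ∈ H, M.HasTop e h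

/-- The class `C(S)`: those members of `C(T)` which have radical layering `S`. -/
def withLayering (π : PathAlgebra K V →ₐ[K] Λ) (d : ℕ) {t : ℕ} (e : Fin t → V)
    (H : Set (Fin t → ℤ)) (S : ℕ → ModuleCat.{u} Λ) (M : GrMod π) : Prop :=
  withTop π d e H M ∧ ∀ l, Nonempty (RadLayer Λ M l ≃ₗ[Λ] S l)

/-- `M` is the direct sum of local submodules `Λ m_r ≅ Λ e_{e r} / C r`, where `m_r` is
homogeneous of degree `h r`. -/
def SplitsAs (M : GrMod π) {t : ℕ} (e : Fin t → V) (h : Fin t → ℤ)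
    (C : Fin t → Submodule K Λ) : Prop :=
  ∃ m : Fin t → M, (∀ r, m r ∈ M.gr (h r)) ∧ (∀ r, idem π (e r) • m r = m r) ∧
    (∀ r a, a ∈ C r ↔ a ∈ Ideal.span {idem π (e r)} ∧ a • m r = 0) ∧
    DirectSum.IsInternal fun r => Submodule.span Λ {m r}

end GrMod

/-! ### Local graded Grassmannians -/

/-- The local graded Grassmannian `Gr-Grass^{S_i}_d`: the homogeneous submodules `C` of `J e_i` with
`dim (Λ e_i / C) = d`, as a subset of the Grassmannian of subspaces of `Λ`. -/
def localGrass (π : PathAlgebra K V →ₐ[K] Λ) (i : V) (d : ℕ) : SpaceWithFunctions K :=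
  (SpaceWithFunctions.grassmannian K Λ
    (Module.finrank K (Ideal.span {idem π i} : Ideal Λ) - d)).sub
    {C : {C : Submodule K Λ // Module.finrank K C =
        Module.finrank K (Ideal.span {idem π i} : Ideal Λ) - d} |
      Module.finrank K C.1 + d = Module.finrank K (Ideal.span {idem π i} : Ideal Λ) ∧
      (∀ a : Λ, ∀ c ∈ C.1, a * c ∈ C.1) ∧
      (∀ c ∈ C.1, c ∈ Ring.jacobson Λ • (Ideal.span {idem π i} : Ideal Λ)) ∧
      C.1 ≤ ⨆ l, C.1 ⊓ algDegree π l}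

/-- The submodule of `Λ e_i` corresponding to a point of the local graded Grassmannian. -/
def localGrass.submodule {π : PathAlgebra K V →ₐ[K] Λ} {i : V} {d : ℕ}
    (C : localGrass π i d) : Submodule K Λ := C.1.1

/-! ### Families and moduli spaces -/

/-- A family of graded `d`-dimensional `Λ`-modules parametrized by `X`: a vector bundle of rank `d`
on `X`, given by its fibres and by an atlas of local frames with regular transition functions,
which is graded by subbundles (the frames are homogeneous) and on which `Λ` acts by bundle
endomorphisms. All fibres are generated in the same degrees. -/
structure GradedFamily (π : PathAlgebra K V →ₐ[K] Λ) (d : ℕ) (X : SpaceWithFunctions K) where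
  fib : X → GrMod π
  chart : Type u
  U : chart → Set X
  isOpen_U : ∀ i, IsOpen (U i)
  cover : ∀ x, ∃ i, x ∈ U i
  frame : chart → (x : X) → Fin d → fib x
  deg : chart → Fin d → ℤ
  frame_linearIndependent : ∀ i, ∀ x ∈ U i, LinearIndependent K (frame i x)
  frame_span : ∀ i, ∀ x ∈ U i, Submodule.span K (Set.range (frame i x)) = ⊤
  frame_mem : ∀ i, ∀ x ∈ U i, ∀ p, frame i x p ∈ (fib x).gr (deg i p)
  transition : ∀ i j, ∃ A : Fin d → Fin d → X → K, ∀ x ∈ U i ∩ U j,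
    (∀ p q, X.RegAt (A p q) x) ∧ ∀ p, frame j x p = ∑ q, A p q x • frame i x q
  action : ∀ i (a : Λ), ∃ A : Fin d → Fin d → X → K, ∀ x ∈ U i,
    (∀ p q, X.RegAt (A p q) x) ∧ ∀ p, a • frame i x p = ∑ q, A p q x • frame i x q
  sameTop : ∃ (t : ℕ) (e : Fin t → V) (h : Fin t → ℤ), ∀ x, (fib x).HasTop e h

namespace GradedFamily

variable {π : PathAlgebra K V →ₐ[K] Λ} {d : ℕ}

/-- The induced family `τ^* Γ`. -/
def pullback {X Y : SpaceWithFunctions K} (Γ : GradedFamily π d Y)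
    (τ : SpaceWithFunctions.Hom X Y) : GradedFamily π d X where
  fib x := Γ.fib (τ x)
  chart := Γ.chart
  U i := τ ⁻¹' Γ.U i
  isOpen_U i := (Γ.isOpen_U i).preimage τ.continuous_toFun
  cover x := Γ.cover (τ x)
  frame i x := Γ.frame i (τ x)
  deg := Γ.deg
  frame_linearIndependent i x hx := Γ.frame_linearIndependent i (τ x) hx
  frame_span i x hx := Γ.frame_span i (τ x) hx
  frame_mem i x hx := Γ.frame_mem i (τ x) hx
  transition i j := by
    obtain ⟨A, hA⟩ := Γ.transition i j
    exact ⟨fun p q => A p q ∘ τ, fun x hx =>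
      ⟨fun p q => τ.regAt_comp x _ ((hA (τ x) hx).1 p q), (hA (τ x) hx).2⟩⟩
  action i a := by
    obtain ⟨A, hA⟩ := Γ.action i a
    exact ⟨fun p q => A p q ∘ τ, fun x hx =>
      ⟨fun p q => τ.regAt_comp x _ ((hA (τ x) hx).1 p q), (hA (τ x) hx).2⟩⟩
  sameTop := by
    obtain ⟨t, e, h, H⟩ := Γ.sameTop
    exact ⟨t, e, h, fun x => H (τ x)⟩

/-- Equivalence of families over the same base: the fibres are graded-isomorphic. -/
def Equivalent {X : SpaceWithFunctions K} (Δ Δ' : GradedFamily π d X) : Prop :=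
  ∀ x, (Δ.fib x).GradedIso (Δ'.fib x)

/-- All fibres belong to the class `𝒞`. -/
def InClass {X : SpaceWithFunctions K} (Δ : GradedFamily π d X) (𝒞 : GrMod π → Prop) : Prop :=
  ∀ x, 𝒞 (Δ.fib x)

end GradedFamily

/-- `Z` is a coarse moduli space for the graded-isomorphism classes in the class `𝒞` of
`d`-dimensional graded modules: `α` identifies the classes with the points of `Z`, every family
induces a morphism to `Z`, and every assignment `β` of points of a variety `N` to the classes
with the same property (that is, every natural transformation from the functor of equivalence
classes of families to the functor represented by `N`) factors through a unique morphism. -/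
def IsCoarseModuliSpace {π : PathAlgebra K V →ₐ[K] Λ} (d : ℕ) (𝒞 : GrMod π → Prop)
    (Z : SpaceWithFunctions K) : Prop :=
  Z.IsVariety ∧ ∃ α : {M : GrMod π // 𝒞 M} → Z, Function.Surjective α ∧
    (∀ M N, α M = α N ↔ M.1.GradedIso N.1) ∧
    (∀ (X : SpaceWithFunctions K), X.IsVariety → ∀ (Δ : GradedFamily π d X) (hΔ : Δ.InClass 𝒞),
      ∃ f : SpaceWithFunctions.Hom X Z, ∀ x, f x = α ⟨Δ.fib x, hΔ x⟩) ∧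
    ∀ (N : SpaceWithFunctions K), N.IsVariety → ∀ β : {M : GrMod π // 𝒞 M} → N,
      (∀ M M', M.1.GradedIso M'.1 → β M = β M') →
      (∀ (X : SpaceWithFunctions K), X.IsVariety →
        ∀ (Δ : GradedFamily π d X) (hΔ : Δ.InClass 𝒞),
          ∃ f : SpaceWithFunctions.Hom X N, ∀ x, f x = β ⟨Δ.fib x, hΔ x⟩) →
      ∃! ω : SpaceWithFunctions.Hom Z N, ∀ M, ω (α M) = β M

/-- `Z` is a fine moduli space for the class `𝒞` of `d`-dimensional graded modules, with universal
family `Γ`. -/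
def IsFineModuliSpace {π : PathAlgebra K V →ₐ[K] Λ} {d : ℕ} (𝒞 : GrMod π → Prop)
    (Z : SpaceWithFunctions K) (Γ : GradedFamily π d Z) : Prop :=
  Z.IsVariety ∧ Γ.InClass 𝒞 ∧
    ∀ (X : SpaceWithFunctions K), X.IsVariety → ∀ Δ : GradedFamily π d X, Δ.InClass 𝒞 →
      ∃! τ : SpaceWithFunctions.Hom X Z, Δ.Equivalent (Γ.pullback τ)

end Algebras

end

noncomputable section

open Module (finrank)
open Submodule (span subset_span span_le smul_mem mem_span_range_iff_exists_fun)
open Set (range)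

variable {K : Type u} [Field K] {V : Type w} [Quiver.{v} V] [Fintype V]
  {Λ : Type u} [Ring Λ] [Algebra K Λ] {π : PathAlgebra K V →ₐ[K] Λ}

namespace SpaceWithFunctions

/-- The regular germs at each point form a `K`-algebra in which nonvanishing germs are invertible,
and the nonvanishing of a regular function is an open condition. -/
class IsGood (X : SpaceWithFunctions K) : Prop where
  const : ∀ (c : K) (x : X), X.RegAt (fun _ => c) x
  add : ∀ {f g : X → K} {x : X}, X.RegAt f x → X.RegAt g x → X.RegAt (f + g) x
  mul : ∀ {f g : X → K} {x : X}, X.RegAt f x → X.RegAt g x → X.RegAt (f * g) x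
  inv : ∀ {f : X → K} {x : X}, X.RegAt f x → f x ≠ 0 → X.RegAt f⁻¹ x
  ne : ∀ {f : X → K} {x : X}, X.RegAt f x → f x ≠ 0 → ∀ᶠ y in 𝓝 x, f y ≠ 0

/-- The algebra of functions which are regular at `x`. -/
def regAlg (X : SpaceWithFunctions K) [X.IsGood] (x : X) : Subalgebra K (X → K) where
  carrier := {f | X.RegAt f x}
  mul_mem' := IsGood.mul
  add_mem' := IsGood.add
  algebraMap_mem' c := IsGood.const c x

section Good

variable {X : SpaceWithFunctions K} [X.IsGood]

theorem regAlg_inv {x : X} {f : X → K} (hf : f ∈ X.regAlg x) (h : f x ≠ 0) :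
    f⁻¹ ∈ X.regAlg x := IsGood.inv hf h

theorem regAlg_ne {x : X} {f : X → K} (hf : f ∈ X.regAlg x) (h : f x ≠ 0) :
    ∀ᶠ y in 𝓝 x, f y ≠ 0 := IsGood.ne hf h

theorem regAlg_congr {x : X} {f g : X → K} (h : f =ᶠ[𝓝 x] g) (hf : f ∈ X.regAlg x) :
    g ∈ X.regAlg x := X.regAt_congr h hf

end Good

/-! ### Vector valued regular functions -/

section VReg

variable {Y : Type*} {W W' : Type*} [AddCommGroup W] [Module K W] [AddCommGroup W'] [Module K W']

/-- A vector valued function all of whose coordinates belong to the algebra `𝒮`. -/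
def VReg (𝒮 : Subalgebra K (Y → K)) (b : Y → W) : Prop :=
  ∀ φ : Module.Dual K W, (fun y => φ (b y)) ∈ 𝒮

variable {𝒮 : Subalgebra K (Y → K)}

theorem const_mem (c : K) : (fun _ => c) ∈ 𝒮 := 𝒮.algebraMap_mem c

theorem VReg.const (w : W) : VReg 𝒮 fun _ : Y => w := fun φ => const_mem (φ w)

theorem VReg.add {b c : Y → W} (hb : VReg 𝒮 b) (hc : VReg 𝒮 c) : VReg 𝒮 fun y => b y + c y :=
  fun φ => by simp only [map_add]; exact 𝒮.add_mem (hb φ) (hc φ)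

theorem VReg.smul {s : Y → K} {b : Y → W} (hs : s ∈ 𝒮) (hb : VReg 𝒮 b) :
    VReg 𝒮 fun y => s y • b y :=
  fun φ => by simp only [map_smul, smul_eq_mul]; exact 𝒮.mul_mem hs (hb φ)

theorem VReg.neg {b : Y → W} (hb : VReg 𝒮 b) : VReg 𝒮 fun y => - b y :=
  fun φ => by simp only [map_neg]; exact 𝒮.neg_mem (hb φ)

theorem VReg.sub {b c : Y → W} (hb : VReg 𝒮 b) (hc : VReg 𝒮 c) : VReg 𝒮 fun y => b y - c y := by
  simpa [sub_eq_add_neg] using hb.add hc.neg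

theorem sum_mem' {ι : Type*} (s : Finset ι) {f : ι → Y → K} (h : ∀ i ∈ s, f i ∈ 𝒮) :
    (fun y => ∑ i ∈ s, f i y) ∈ 𝒮 := by
  have := 𝒮.sum_mem h
  convert this using 1
  ext y; simp

theorem VReg.sum {ι : Type*} (s : Finset ι) {b : ι → Y → W} (h : ∀ i ∈ s, VReg 𝒮 (b i)) :
    VReg 𝒮 fun y => ∑ i ∈ s, b i y := fun φ => by
  simp only [map_sum]
  exact sum_mem' s fun i hi => h i hi φ

theorem VReg.map {b : Y → W} (hb : VReg 𝒮 b) (A : W →ₗ[K] W') : VReg 𝒮 fun y => A (b y) :=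
  fun φ => hb (φ ∘ₗ A)

theorem vreg_pi {ι : Type*} [Finite ι] {b : Y → ι → W} :
    VReg 𝒮 b ↔ ∀ i, VReg 𝒮 fun y => b y i := by
  classical
  have := Fintype.ofFinite ι
  refine ⟨fun h i => h.map (LinearMap.proj i), fun h => ?_⟩
  have : b = fun y => ∑ i, Pi.single i (b y i) := by
    funext y; exact (Finset.univ_sum_single (b y)).symm
  rw [this]
  exact VReg.sum _ fun i _ => (h i).map (LinearMap.single K (fun _ => W) i)

theorem vreg_field {b : Y → K} : VReg 𝒮 b ↔ b ∈ 𝒮 := by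
  refine ⟨fun h => h LinearMap.id, fun h φ => ?_⟩
  have : (fun y => φ (b y)) = fun y => φ 1 * b y := by
    funext y
    rw [mul_comm, ← smul_eq_mul (b y), ← map_smul, smul_eq_mul, mul_one]
  rw [this]
  exact 𝒮.mul_mem (const_mem (φ 1)) h

theorem VReg.polyFun {W : Type u} [AddCommGroup W] [Module K W] {b : Y → W} (hb : VReg 𝒮 b)
    {p : W → K} (hp : p ∈ polyFun K W) : (fun y => p (b y)) ∈ 𝒮 := by
  refine Algebra.adjoin_induction ?_ ?_ ?_ ?_ hp
  · rintro _ ⟨φ, rfl⟩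
    exact hb φ
  · exact fun r => const_mem r
  · exact fun _ _ _ _ h1 h2 => 𝒮.add_mem h1 h2
  · exact fun _ _ _ _ h1 h2 => 𝒮.mul_mem h1 h2

theorem prod_mem' {ι : Type*} (s : Finset ι) {f : ι → Y → K} (h : ∀ i ∈ s, f i ∈ 𝒮) :
    (fun y => ∏ i ∈ s, f i y) ∈ 𝒮 := by
  have := 𝒮.prod_mem h
  convert this using 1
  ext y; simp

theorem det_mem {ι : Type*} [Fintype ι] [DecidableEq ι] {M : Y → Matrix ι ι K}
    (h : ∀ i j, (fun y => M y i j) ∈ 𝒮) : (fun y => (M y).det) ∈ 𝒮 := by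
  simp only [Matrix.det_apply']
  exact sum_mem' _ fun σ _ => 𝒮.mul_mem (const_mem _) (prod_mem' _ fun i _ => h _ _)

theorem adjugate_mem {ι : Type*} [Fintype ι] [DecidableEq ι] {M : Y → Matrix ι ι K}
    (h : ∀ i j, (fun y => M y i j) ∈ 𝒮) (i j : ι) : (fun y => (M y).adjugate i j) ∈ 𝒮 := by
  simp only [Matrix.adjugate_apply]
  refine det_mem fun a b => ?_
  simp only [Matrix.updateRow_apply]
  split_ifs
  · exact const_mem _
  · exact h _ _

end VReg

/-! ### Affine spaces -/

section Affine

variable {W : Type u} [AddCommGroup W] [Module K W]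

theorem isTopologicalBasis_affine :
    TopologicalSpace.IsTopologicalBasis
      {U : Set (affine K W) | ∃ p ∈ polyFun K W, U = {x | p x ≠ 0}} where
  exists_subset_inter := by
    rintro _ ⟨p, hp, rfl⟩ _ ⟨q, hq, rfl⟩ x ⟨h1, h2⟩
    exact ⟨_, ⟨p * q, (polyFun K W).mul_mem hp hq, rfl⟩, mul_ne_zero h1 h2,
      fun y hy => ⟨left_ne_zero_of_mul hy, right_ne_zero_of_mul hy⟩⟩
  sUnion_eq := Set.eq_univ_of_forall fun _ =>
    ⟨_, ⟨1, (polyFun K W).one_mem, rfl⟩, one_ne_zero⟩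
  eq_generateFrom := rfl

theorem affine_eventually {x : affine K W} {P : affine K W → Prop} :
    (∀ᶠ y in 𝓝 x, P y) ↔ ∃ p ∈ polyFun K W, p x ≠ 0 ∧ ∀ y, p y ≠ 0 → P y := by
  rw [Filter.Eventually, isTopologicalBasis_affine.mem_nhds_iff]
  constructor
  · rintro ⟨_, ⟨p, hp, rfl⟩, hx, h⟩
    exact ⟨p, hp, hx, fun y hy => h hy⟩
  · rintro ⟨p, hp, hx, h⟩
    exact ⟨_, ⟨p, hp, rfl⟩, hx, fun y hy => h y hy⟩

theorem affine_eventually_ne {x : affine K W} {p : W → K} (hp : p ∈ polyFun K W) (hx : p x ≠ 0) :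
    ∀ᶠ y : affine K W in 𝓝 x, p y ≠ 0 :=
  affine_eventually.2 ⟨p, hp, hx, fun _ h => h⟩

theorem regAt_affine {x : affine K W} {f : affine K W → K} : (affine K W).RegAt f x ↔
    ∃ p ∈ polyFun K W, ∃ q ∈ polyFun K W, q x ≠ 0 ∧
      ∀ᶠ y : affine K W in 𝓝 x, f y * q y = p y := Iff.rfl

theorem regAt_polyFun {p : W → K} (hp : p ∈ polyFun K W) (x : affine K W) :
    (affine K W).RegAt p x :=
  ⟨p, hp, 1, (polyFun K W).one_mem, one_ne_zero, Eventually.of_forall fun y => mul_one (p y)⟩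

theorem regAt_affine' {x : affine K W} {f : affine K W → K} (hf : (affine K W).RegAt f x) :
    ∃ p ∈ polyFun K W, ∃ q ∈ polyFun K W, q x ≠ 0 ∧
      ∀ᶠ y : affine K W in 𝓝 x, q y ≠ 0 ∧ f y = p y / q y := by
  obtain ⟨p, hp, q, hq, hx, h⟩ := regAt_affine.1 hf
  refine ⟨p, hp, q, hq, hx, ((affine_eventually_ne hq hx).and h).mono fun y hy => ⟨hy.1, ?_⟩⟩
  exact (eq_div_iff hy.1).2 hy.2

theorem regAt_affine_of {x : affine K W} {f : affine K W → K} {p q : W → K}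
    (hp : p ∈ polyFun K W) (hq : q ∈ polyFun K W) (hx : q x ≠ 0)
    (h : ∀ᶠ y : affine K W in 𝓝 x, q y ≠ 0 ∧ f y = p y / q y) : (affine K W).RegAt f x :=
  ⟨p, hp, q, hq, hx, h.mono fun _ hy => (eq_div_iff hy.1).1 hy.2⟩

instance isGood_affine : (affine K W).IsGood where
  const c x := regAt_polyFun ((polyFun K W).algebraMap_mem c) x
  add := by
    intro f g x hf hg
    obtain ⟨p, hp, q, hq, hx, h⟩ := regAt_affine' hf
    obtain ⟨p', hp', q', hq', hx', h'⟩ := regAt_affine' hg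
    refine regAt_affine_of (add_mem (mul_mem hp hq') (mul_mem hq hp')) (mul_mem hq hq')
      (mul_ne_zero hx hx') ((h.and h').mono fun y hy => ⟨mul_ne_zero hy.1.1 hy.2.1, ?_⟩)
    exact (congrArg₂ (· + ·) hy.1.2 hy.2.2).trans (div_add_div _ _ hy.1.1 hy.2.1)
  mul := by
    intro f g x hf hg
    obtain ⟨p, hp, q, hq, hx, h⟩ := regAt_affine' hf
    obtain ⟨p', hp', q', hq', hx', h'⟩ := regAt_affine' hg
    refine regAt_affine_of (mul_mem hp hp') (mul_mem hq hq')
      (mul_ne_zero hx hx') ((h.and h').mono fun y hy => ⟨mul_ne_zero hy.1.1 hy.2.1, ?_⟩)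
    exact (congrArg₂ (· * ·) hy.1.2 hy.2.2).trans (div_mul_div_comm _ _ _ _)
  inv := by
    intro f x hf hfx
    obtain ⟨p, hp, q, hq, hx, h⟩ := regAt_affine' hf
    have h0 := h.self_of_nhds
    have hpx : p x ≠ 0 := fun h1 => hfx (by rw [h0.2, h1, zero_div])
    refine regAt_affine_of hq hp hpx ((h.and (affine_eventually_ne hp hpx)).mono
      fun y hy => ⟨hy.2, ?_⟩)
    exact (congrArg Inv.inv hy.1.2).trans (inv_div _ _)
  ne := by
    intro f x hf hfx
    obtain ⟨p, hp, q, hq, hx, h⟩ := regAt_affine' hf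
    have h0 := h.self_of_nhds
    have hpx : p x ≠ 0 := fun h1 => hfx (by rw [h0.2, h1, zero_div])
    exact (h.and (affine_eventually_ne hp hpx)).mono fun y hy =>
      hy.1.2.symm ▸ div_ne_zero hy.2 hy.1.1

theorem vreg_affine_id (x : affine K W) : @VReg K _ (affine K W) W _ _
    ((affine K W).regAlg x) (fun y => y) :=
  fun φ => regAt_polyFun (Algebra.subset_adjoin ⟨φ, rfl⟩) x

end Affine

/-! ### Subspaces and quotients -/

section Sub

variable {X : SpaceWithFunctions K}

theorem regAt_sub {S : Set X} {x : X.sub S} {f : X.sub S → K} : (X.sub S).RegAt f x ↔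
    ∃ g : X → K, X.RegAt g x.1 ∧ ∀ᶠ y : X.sub S in 𝓝 x, f y = g y.1 := Iff.rfl

theorem regAt_restrict {S : Set X} {x : X.sub S} {g : X → K} (hg : X.RegAt g x.1) :
    (X.sub S).RegAt (fun y => g y.1) x :=
  ⟨g, hg, Eventually.of_forall fun _ => rfl⟩

theorem continuous_sub_val {S : Set X} : Continuous fun y : X.sub S => y.1 :=
  continuous_subtype_val (p := (· ∈ S))

theorem nhds_sub {S : Set X} (x : X.sub S) : 𝓝 x = comap (fun y : X.sub S => y.1) (𝓝 x.1) :=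
  nhds_subtype_eq_comap (p := (· ∈ S))

theorem regAt_sub' {S : Set X} {x : X.sub S} {f : X.sub S → K} (hf : (X.sub S).RegAt f x) :
    ∃ g : X → K, X.RegAt g x.1 ∧ f x = g x.1 ∧ ∀ᶠ y : X.sub S in 𝓝 x, f y = g y.1 := by
  obtain ⟨g, hg, h⟩ := regAt_sub.1 hf
  exact ⟨g, hg, h.self_of_nhds, h⟩

instance isGood_sub [X.IsGood] (S : Set X) : (X.sub S).IsGood where
  const c x := regAt_restrict (IsGood.const c x.1)
  add := by
    intro f g x hf hg
    obtain ⟨k, hk, -, h⟩ := regAt_sub' hf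
    obtain ⟨k', hk', -, h'⟩ := regAt_sub' hg
    exact ⟨k + k', IsGood.add hk hk', (h.and h').mono fun y hy =>
      congrArg₂ (· + ·) hy.1 hy.2⟩
  mul := by
    intro f g x hf hg
    obtain ⟨k, hk, -, h⟩ := regAt_sub' hf
    obtain ⟨k', hk', -, h'⟩ := regAt_sub' hg
    exact ⟨k * k', IsGood.mul hk hk', (h.and h').mono fun y hy =>
      congrArg₂ (· * ·) hy.1 hy.2⟩
  inv := by
    intro f x hf hx
    obtain ⟨k, hk, h0, h⟩ := regAt_sub' hf
    exact ⟨k⁻¹, IsGood.inv hk (h0 ▸ hx), h.mono fun y hy => congrArg Inv.inv hy⟩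
  ne := by
    intro f x hf hx
    obtain ⟨k, hk, h0, h⟩ := regAt_sub' hf
    have := continuous_sub_val.continuousAt.eventually (IsGood.ne hk (h0 ▸ hx))
    exact (h.and this).mono fun y hy => hy.1.symm ▸ hy.2

theorem VReg.restrict [X.IsGood] {S : Set X} {x : X.sub S} {W : Type*} [AddCommGroup W]
    [Module K W] {b : X → W} (hb : VReg (X.regAlg x.1) b) :
    VReg ((X.sub S).regAlg x) fun y => b y.1 :=
  fun φ => regAt_restrict (hb φ)

variable {Y : Type u} {q : X → Y}

theorem continuous_quot : @Continuous X (X.quot q) _ _ q := continuous_coinduced_rng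

theorem regAt_quot_comp {y : X.quot q} {f : X.quot q → K} (hf : (X.quot q).RegAt f y) {x : X}
    (hx : q x = y) : X.RegAt (fun x => f (q x)) x := by
  obtain ⟨U, -, hU, h⟩ := hf
  exact h x (hx ▸ hU)

theorem regAt_quot_of {y : X.quot q} {f : X.quot q → K}
    (h : ∀ᶠ z : X.quot q in 𝓝 y, ∀ x, q x = z → X.RegAt (fun x => f (q x)) x) :
    (X.quot q).RegAt f y := by
  obtain ⟨U, hU, hUo, hy⟩ := eventually_nhds_iff.1 h
  exact ⟨U, hUo, hy, fun x hx => hU _ hx x rfl⟩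

theorem regAt_quot_eventually {y : X.quot q} {f : X.quot q → K} (hf : (X.quot q).RegAt f y) :
    ∀ᶠ z : X.quot q in 𝓝 y, ∀ x, q x = z → X.RegAt (fun x => f (q x)) x := by
  obtain ⟨U, hU, hy, h⟩ := hf
  exact eventually_nhds_iff.2 ⟨U, fun z hz x hx => h x (by rwa [hx]), hU, hy⟩

instance isGood_quot [X.IsGood] : (X.quot q).IsGood where
  const c y := regAt_quot_of (Eventually.of_forall fun z x _ => IsGood.const c x)
  add h h' := regAt_quot_of <| by
    filter_upwards [regAt_quot_eventually h, regAt_quot_eventually h'] with z h1 h2 x hx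
      using IsGood.add (h1 x hx) (h2 x hx)
  mul h h' := regAt_quot_of <| by
    filter_upwards [regAt_quot_eventually h, regAt_quot_eventually h'] with z h1 h2 x hx
      using IsGood.mul (h1 x hx) (h2 x hx)
  inv := by
    intro f y h hy
    have hne : ∀ᶠ z : X.quot q in 𝓝 y, f z ≠ 0 := by
      obtain ⟨U, hU, hUo, hyU⟩ := eventually_nhds_iff.1 (regAt_quot_eventually h)
      refine eventually_nhds_iff.2 ⟨U ∩ {z | f z ≠ 0}, fun z hz => hz.2, ?_, hyU, hy⟩
      refine isOpen_coinduced.2 (isOpen_iff_mem_nhds.2 fun x hx => ?_)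
      have hUo' : IsOpen (q ⁻¹' U) := isOpen_coinduced.1 hUo
      filter_upwards [hUo'.mem_nhds hx.1, IsGood.ne (hU _ hx.1 x rfl) hx.2] with z h1 h2
      exact ⟨h1, h2⟩
    refine regAt_quot_of ?_
    filter_upwards [regAt_quot_eventually h, hne] with z h1 h2 x hx
    exact IsGood.inv (h1 x hx) (by rwa [hx])
  ne := by
    intro f y h hy
    obtain ⟨U, hU, hUo, hyU⟩ := eventually_nhds_iff.1 (regAt_quot_eventually h)
    refine eventually_nhds_iff.2 ⟨U ∩ {z | f z ≠ 0}, fun z hz => hz.2, ?_, hyU, hy⟩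
    refine isOpen_coinduced.2 (isOpen_iff_mem_nhds.2 fun x hx => ?_)
    have hUo' : IsOpen (q ⁻¹' U) := isOpen_coinduced.1 hUo
    filter_upwards [hUo'.mem_nhds hx.1, IsGood.ne (hU _ hx.1 x rfl) hx.2] with z h1 h2
    exact ⟨h1, h2⟩

end Sub

/-! ### Morphisms -/

section Hom

variable {X Y Z : SpaceWithFunctions K}

@[ext]
theorem Hom.ext {f g : Hom X Y} (h : ∀ x, f x = g x) : f = g := by
  cases f; cases g
  congr
  funext x
  exact h x

/-- The identity. -/
def Hom.id (X : SpaceWithFunctions K) : Hom X X := ⟨fun x => x, continuous_id, fun _ _ h => h⟩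

/-- Composition. -/
def Hom.comp (g : Hom Y Z) (f : Hom X Y) : Hom X Z where
  toFun x := g (f x)
  continuous_toFun := g.continuous_toFun.comp f.continuous_toFun
  regAt_comp x k hk := f.regAt_comp x _ (g.regAt_comp (f x) k hk)

/-- The inclusion of a subspace. -/
def Hom.incl (S : Set X) : Hom (X.sub S) X where
  toFun x := x.1
  continuous_toFun := continuous_sub_val
  regAt_comp _ _ hf := regAt_restrict hf

/-- Corestriction to a subspace. -/
def Hom.codRestrict (f : Hom X Y) (S : Set Y) (h : ∀ x, f x ∈ S) : Hom X (Y.sub S) where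
  toFun x := ⟨f x, h x⟩
  continuous_toFun := Continuous.subtype_mk f.continuous_toFun h
  regAt_comp x k hk := by
    obtain ⟨g, hg, hkg⟩ := regAt_sub.1 hk
    refine X.regAt_congr ?_ (f.regAt_comp x g hg)
    have hc : Continuous fun x => (⟨f x, h x⟩ : Y.sub S) :=
      Continuous.subtype_mk f.continuous_toFun h
    filter_upwards [hc.continuousAt.eventually hkg] with z hz using hz.symm

theorem VReg.comp [X.IsGood] [Y.IsGood] {W : Type*} [AddCommGroup W] [Module K W] {b : Y → W}
    (f : Hom X Y) {x : X} (hb : VReg (Y.regAlg (f x)) b) :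
    VReg (X.regAlg x) fun z => b (f z) :=
  fun φ => f.regAt_comp x _ (hb φ)

theorem VReg.congr [X.IsGood] {W : Type*} [AddCommGroup W] [Module K W] {b c : X → W} {x : X}
    (hb : VReg (X.regAlg x) b) (h : b =ᶠ[𝓝 x] c) : VReg (X.regAlg x) c :=
  fun φ => regAlg_congr (by filter_upwards [h] with y hy; rw [hy]) (hb φ)

/-- `f` is continuous at `x` and pulls back germs of regular functions. -/
def HomAt (f : X → Y) (x : X) : Prop :=
  ContinuousAt f x ∧ ∀ k : Y → K, Y.RegAt k (f x) → X.RegAt (fun z => k (f z)) x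

/-- A map which is a morphism at every point. -/
def Hom.mk' (f : X → Y) (h : ∀ x, HomAt f x) : Hom X Y where
  toFun := f
  continuous_toFun := continuous_iff_continuousAt.2 fun x => (h x).1
  regAt_comp x k hk := (h x).2 k hk

theorem Hom.homAt (f : Hom X Y) (x : X) : HomAt f x :=
  ⟨f.continuous_toFun.continuousAt, f.regAt_comp x⟩

theorem HomAt.congr {f g : X → Y} {x : X} (h : f =ᶠ[𝓝 x] g) (hf : HomAt f x) : HomAt g x := by
  have h0 : f x = g x := h.self_of_nhds
  refine ⟨hf.1.congr h, fun k hk => X.regAt_congr ?_ (hf.2 k (h0 ▸ hk))⟩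
  filter_upwards [h] with z hz
  rw [hz]

theorem HomAt.comp {g : Y → Z} {f : X → Y} {x : X} (hg : HomAt g (f x)) (hf : HomAt f x) :
    HomAt (fun z => g (f z)) x :=
  ⟨hg.1.comp hf.1, fun k hk => hf.2 _ (hg.2 k hk)⟩

theorem homAt_affine [X.IsGood] {W : Type u} [AddCommGroup W] [Module K W] {b : X → W} {x : X}
    (hb : VReg (X.regAlg x) b) : HomAt (Y := affine K W) b x := by
  have hc : ContinuousAt (Y := affine K W) b x := by
    refine fun s hs => ?_
    obtain ⟨p, hp, hx, h⟩ := affine_eventually.1 hs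
    exact mem_map.2 ((regAlg_ne (hb.polyFun hp) hx).mono fun y hy => h _ hy)
  refine ⟨hc, fun k hk => ?_⟩
  obtain ⟨p, hp, q, hq, hx, h⟩ := regAt_affine.1 hk
  have h1 := regAlg_inv (hb.polyFun hq) hx
  refine regAlg_congr ?_ ((X.regAlg x).mul_mem (hb.polyFun hp) h1)
  filter_upwards [hc.eventually h, regAlg_ne (hb.polyFun hq) hx] with y h2 h3
  simp only [Pi.mul_apply, Pi.inv_apply, ← h2]
  exact mul_inv_cancel_right₀ h3 _

theorem homAt_sub {f : X → Y} {S : Set Y} {x : X} (hf : HomAt f x) (h : ∀ x, f x ∈ S) :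
    HomAt (Y := Y.sub S) (fun z => ⟨f z, h z⟩) x := by
  have hc : ContinuousAt (fun z => (⟨f z, h z⟩ : Y.sub S)) x := by
    exact (Topology.IsInducing.subtypeVal (t := S)).continuousAt_iff.2 hf.1
  refine ⟨hc, fun k hk => ?_⟩
  obtain ⟨g, hg, hkg⟩ := regAt_sub.1 hk
  refine X.regAt_congr ?_ (hf.2 g hg)
  filter_upwards [hc.eventually hkg] with z hz using hz.symm

theorem homAt_quot [X.IsGood] {W : Type u} [AddCommGroup W] [Module K W] {S : Set W} {Q : Type u}
    {q : {w // w ∈ S} → Q} {b : X → W} {f : X → Q} {x : X} (hb : VReg (X.regAlg x) b)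
    (h : ∀ᶠ y in 𝓝 x, ∃ hy : b y ∈ S, f y = q ⟨b y, hy⟩) :
    HomAt (Y := ((affine K W).sub (S : Set (affine K W))).quot q) f x := by
  classical
  obtain ⟨hx, hfx⟩ := h.self_of_nhds
  let c : X → {w // w ∈ S} := fun y => if hy : b y ∈ S then ⟨b y, hy⟩ else ⟨b x, hx⟩
  have hcb : (fun y => (c y).1) =ᶠ[𝓝 x] b := by
    filter_upwards [h] with y hy
    simp [c, hy.1]
  have hc : HomAt (Y := (affine K W).sub (S : Set (affine K W))) c x :=
    homAt_sub (Y := affine K W) (homAt_affine (b := fun y => (c y).1) (hb.congr hcb.symm))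
      fun y => (c y).2
  have hq : HomAt (X := (affine K W).sub (S : Set (affine K W)))
      (Y := ((affine K W).sub (S : Set (affine K W))).quot q) q (c x) :=
    ⟨continuous_quot.continuousAt, fun k hk => regAt_quot_comp hk rfl⟩
  refine HomAt.congr ?_ (hq.comp hc)
  filter_upwards [h] with y hy
  obtain ⟨h1, h2⟩ := hy
  simp only [c, h1, h2, dif_pos]
  rfl

end Hom

end SpaceWithFunctions

namespace SpaceWithFunctions

/-! ### Minors and coordinates -/

section Minors

variable {W W' : Type*} [AddCommGroup W] [Module K W] [AddCommGroup W'] [Module K W']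
  {ι : Type*} [Fintype ι] [DecidableEq ι]

theorem exists_dual_family {b : ι → W} (hb : LinearIndependent K b) :
    ∃ φ : ι → Module.Dual K W, ∀ i j, φ i (b j) = if i = j then 1 else 0 := by
  obtain ⟨g, hg⟩ := LinearMap.exists_leftInverse_of_injective (Fintype.linearCombination K b)
    (by
      rw [LinearMap.ker_eq_bot']
      intro c hc
      funext i
      exact Fintype.linearIndependent_iff.1 hb c
        (by simpa [Fintype.linearCombination_apply] using hc) i)
  refine ⟨fun i => LinearMap.proj i ∘ₗ g, fun i j => ?_⟩
  have := LinearMap.congr_fun hg (Pi.single j 1)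
  simp only [LinearMap.coe_comp, Function.comp_apply, Fintype.linearCombination_apply_single,
    one_smul, LinearMap.id_coe, id_eq] at this
  simp [this, Pi.single_apply]

theorem linearIndependent_of_det_ne_zero {b : ι → W} (φ : ι → Module.Dual K W)
    (h : (Matrix.of fun i j => φ i (b j)).det ≠ 0) : LinearIndependent K b := by
  refine LinearIndependent.of_comp (LinearMap.pi φ) ?_
  have := Matrix.linearIndependent_cols_iff_isUnit.2
    ((Matrix.isUnit_iff_isUnit_det _).2 (isUnit_iff_ne_zero.2 h))
  exact this

/-- Linear independence of a regular family at one point is certified by the nonvanishing of a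
minor. -/
theorem exists_minor {Y : Type*} {𝒮 : Subalgebra K (Y → K)} {b : ι → Y → W}
    (hb : ∀ i, VReg 𝒮 (b i)) {y₀ : Y} (h : LinearIndependent K fun i => b i y₀) :
    ∃ m ∈ 𝒮, m y₀ ≠ 0 ∧ ∀ y, m y ≠ 0 → LinearIndependent K fun i => b i y := by
  obtain ⟨φ, hφ⟩ := exists_dual_family h
  refine ⟨fun y => (Matrix.of fun i j => φ i (b j y)).det, det_mem fun i j => hb j (φ i), ?_,
    fun y hy => linearIndependent_of_det_ne_zero φ hy⟩
  have : (Matrix.of fun i j => φ i (b j y₀)) = 1 := by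
    ext i j; simp [hφ, Matrix.one_apply]
  simp [this]

variable {X : SpaceWithFunctions K} [X.IsGood] {x : X}

theorem eventually_linearIndependent {ι : Type*} [Finite ι] {b : ι → X → W}
    (hb : ∀ i, VReg (X.regAlg x) (b i)) (h : LinearIndependent K fun i => b i x) :
    ∀ᶠ y in 𝓝 x, LinearIndependent K fun i => b i y := by
  classical
  have := Fintype.ofFinite ι
  obtain ⟨m, hm, hx, h⟩ := exists_minor hb h
  exact (regAlg_ne hm hx).mono h

theorem exists_regular_coords {ι : Type*} [Fintype ι] {b : ι → X → W}
    (hb : ∀ i, VReg (X.regAlg x) (b i))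
    (h : LinearIndependent K fun i => b i x) {v : X → W} (hv : VReg (X.regAlg x) v)
    (hvb : ∀ᶠ y in 𝓝 x, v y ∈ span K (range fun i => b i y)) :
    ∃ c : ι → X → K, (∀ i, c i ∈ X.regAlg x) ∧ ∀ᶠ y in 𝓝 x, v y = ∑ i, c i y • b i y := by
  classical
  obtain ⟨φ, hφ⟩ := exists_dual_family h
  let M : X → Matrix ι ι K := fun y => Matrix.of fun i j => φ i (b j y)
  have hM : ∀ i j, (fun y => M y i j) ∈ X.regAlg x := fun i j => hb j (φ i)
  have hx : (M x).det ≠ 0 := by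
    have : M x = 1 := by
      ext i j; simp [M, hφ, Matrix.one_apply]
    simp [this]
  have hdet : (fun y => (M y).det) ∈ X.regAlg x := det_mem hM
  refine ⟨fun i y => (M y).det⁻¹ * ∑ j, (M y).adjugate i j * φ j (v y), fun i => ?_, ?_⟩
  · exact (X.regAlg x).mul_mem (regAlg_inv hdet hx)
      (sum_mem' _ fun j _ => (X.regAlg x).mul_mem (adjugate_mem hM i j) (hv (φ j)))
  · filter_upwards [hvb, regAlg_ne hdet hx] with y hy hdy
    obtain ⟨d, hd⟩ := (mem_span_range_iff_exists_fun K).1 hy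
    have h1 : (fun j => φ j (v y)) = (M y).mulVec d := by
      funext j
      simp [← hd, Matrix.mulVec, dotProduct, M, mul_comm]
    have h2 : ∀ i, ∑ j, (M y).adjugate i j * φ j (v y) = (M y).det * d i := by
      intro i
      have : ((M y).adjugate.mulVec fun j => φ j (v y)) = (M y).det • d := by
        rw [h1, Matrix.mulVec_mulVec, Matrix.adjugate_mul, Matrix.smul_mulVec, Matrix.one_mulVec]
      exact congrFun this i
    simp only [h2]
    rw [← hd]
    exact Finset.sum_congr rfl fun i _ => by rw [inv_mul_cancel_left₀ hdy]

end Minors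

/-! ### Regular families of subspaces -/

section RegSub

variable {W W' : Type*} [AddCommGroup W] [Module K W] [AddCommGroup W'] [Module K W']
variable {X : SpaceWithFunctions K} [X.IsGood] {x : X}

theorem span_range_coe_basis {ι : Type*} {C : Submodule K W} (B : Module.Basis ι K C) :
    span K (range fun i => (B i : W)) = C := by
  have := congrArg (Submodule.map C.subtype) B.span_eq
  rw [Submodule.map_span, ← Set.range_comp, Submodule.map_top, Submodule.range_subtype] at this
  exact this

theorem linearIndependent_coe_basis {ι : Type*} {C : Submodule K W} (B : Module.Basis ι K C) :
    LinearIndependent K fun i => (B i : W) := by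
  have h := B.linearIndependent.map' C.subtype C.ker_subtype
  exact h

theorem sum_repr_coe {ι : Type*} [Fintype ι] {C : Submodule K W} (B : Module.Basis ι K C) (z : C) :
    ∑ i, B.repr z i • (B i : W) = z := by
  conv_rhs => rw [← B.sum_repr z]
  simp only [Submodule.coe_sum, Submodule.coe_smul]

/-- A family of subspaces has a regular frame near `x`. -/
def RegSub (C : X → Submodule K W) (x : X) : Prop :=
  ∃ (k : ℕ) (b : Fin k → X → W), (∀ i, VReg (X.regAlg x) (b i)) ∧
    ∀ᶠ y in 𝓝 x, LinearIndependent K (fun i => b i y) ∧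
      span K (range fun i => b i y) = C y

theorem RegSub.of_frame {ι : Type*} [Finite ι] {C : X → Submodule K W} (b : ι → X → W)
    (hb : ∀ i, VReg (X.regAlg x) (b i)) (h : ∀ᶠ y in 𝓝 x, LinearIndependent K (fun i => b i y) ∧
      span K (range fun i => b i y) = C y) : RegSub C x := by
  have := Fintype.ofFinite ι
  let E := Fintype.equivFin ι
  refine ⟨Fintype.card ι, fun i => b (E.symm i), fun i => hb _, h.mono fun y hy => ⟨?_, ?_⟩⟩
  · exact hy.1.comp _ E.symm.injective
  · rw [← hy.2]
    congr 1
    exact E.symm.surjective.range_comp fun i => b i y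

theorem RegSub.congr {C C' : X → Submodule K W} (hC : RegSub C x) (h : ∀ᶠ y in 𝓝 x, C y = C' y) :
    RegSub C' x := by
  obtain ⟨k, b, hb, h'⟩ := hC
  exact ⟨k, b, hb, (h.and h').mono fun y hy => ⟨hy.2.1, hy.1 ▸ hy.2.2⟩⟩

theorem RegSub.const [FiniteDimensional K W] (C : Submodule K W) : RegSub (fun _ : X => C) x :=
  RegSub.of_frame (fun i _ => (Module.finBasis K C i : W)) (fun _ => VReg.const _)
    (Eventually.of_forall fun _ => ⟨linearIndependent_coe_basis _, span_range_coe_basis _⟩)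

/-- A frame of the right size. -/
theorem RegSub.exists_frame {C : X → Submodule K W} (hC : RegSub C x) {k : ℕ}
    (hk : finrank K (C x) = k) : ∃ b : Fin k → X → W, (∀ i, VReg (X.regAlg x) (b i)) ∧
    ∀ᶠ y in 𝓝 x, LinearIndependent K (fun i => b i y) ∧
      span K (range fun i => b i y) = C y := by
  obtain ⟨k', b, hb, h⟩ := hC
  have := h.self_of_nhds
  have hkk : k' = k := by
    rw [← hk, ← this.2, finrank_span_eq_card this.1, Fintype.card_fin]
  subst hkk
  exact ⟨b, hb, h⟩

theorem RegSub.finrank_eq {C : X → Submodule K W} (hC : RegSub C x) :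
    ∀ᶠ y in 𝓝 x, finrank K (C y) = finrank K (C x) := by
  obtain ⟨b, hb, h⟩ := hC.exists_frame rfl
  filter_upwards [h] with y hy
  rw [← hy.2, finrank_span_eq_card hy.1, Fintype.card_fin]

theorem RegSub.comp {X' : SpaceWithFunctions K} [X'.IsGood] {C : X → Submodule K W} {f : X' → X}
    {x : X'} (hC : RegSub C (f x)) (hf : HomAt f x) : RegSub (fun y => C (f y)) x := by
  obtain ⟨k, b, hb, h⟩ := hC
  exact ⟨k, fun i y => b i (f y), fun i φ => hf.2 _ (hb i φ), hf.1.eventually h⟩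

/-- The span of regular vectors is regular if it has constant dimension. -/
theorem RegSub.of_span {ι : Type*} [Finite ι] (v : ι → X → W) (hv : ∀ i, VReg (X.regAlg x) (v i))
    (h : ∀ᶠ y in 𝓝 x, finrank K (span K (range fun i => v i y)) =
      finrank K (span K (range fun i => v i x))) :
    RegSub (fun y => span K (range fun i => v i y)) x := by
  have hfin : ∀ y, FiniteDimensional K (span K (range fun i => v i y)) :=
    fun y => FiniteDimensional.span_of_finite K (Set.finite_range _)
  obtain ⟨f, hf, -, hf2⟩ :=
    Submodule.exists_fun_fin_finrank_span_eq K (range fun i => v i x)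
  choose g hg using hf
  have hli : LinearIndependent K fun i => v (g i) x := by
    convert hf2 using 1
    funext i; exact hg i
  refine ⟨_, fun i => v (g i), fun i => hv _, ?_⟩
  filter_upwards [h, eventually_linearIndependent (fun i => hv (g i)) hli] with y h1 h2
  refine ⟨h2, Submodule.eq_of_le_of_finrank_eq (Submodule.span_mono ?_) ?_⟩
  · rintro _ ⟨i, rfl⟩; exact ⟨g i, rfl⟩
  · rw [finrank_span_eq_card h2, h1, Fintype.card_fin]

theorem RegSub.eventually_notMem {C : X → Submodule K W} (hC : RegSub C x) {v : X → W}
    (hv : VReg (X.regAlg x) v) (h : v x ∉ C x) : ∀ᶠ y in 𝓝 x, v y ∉ C y := by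
  obtain ⟨k, b, hb, hbC⟩ := hC
  have h0 := hbC.self_of_nhds
  have key : ∀ y, (fun i => (Fin.cons v b : Fin (k + 1) → X → W) i y) =
      Fin.cons (v y) fun i => b i y := by
    intro y; funext i; refine Fin.cases ?_ (fun i => ?_) i <;> simp
  have h1 : LinearIndependent K fun i => (Fin.cons v b : Fin (k + 1) → X → W) i x := by
    rw [key, linearIndependent_finCons, h0.2]; exact ⟨h0.1, h⟩
  have h2 : ∀ i, VReg (X.regAlg x) ((Fin.cons v b : Fin (k + 1) → X → W) i) := by
    intro i; refine Fin.cases ?_ (fun i => ?_) i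
    · simpa using hv
    · simpa using hb i
  filter_upwards [hbC, eventually_linearIndependent h2 h1] with y h3 h4
  rw [key, linearIndependent_finCons, h3.2] at h4
  exact h4.2

theorem RegSub.eventually_finrank_map_le {C : X → Submodule K W} (hC : RegSub C x)
    (A : W →ₗ[K] W') : ∀ᶠ y in 𝓝 x,
      finrank K ((C x).map A) ≤ finrank K ((C y).map A) := by
  obtain ⟨k, b, hb, hbC⟩ := hC
  have hmap : ∀ y, span K (range fun i => b i y) = C y →
      (C y).map A = span K (range fun i => A (b i y)) := by
    intro y hy
    rw [← hy, Submodule.map_span, ← Set.range_comp]; rfl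
  have hfin : ∀ y, FiniteDimensional K (span K (range fun i => A (b i y))) :=
    fun y => FiniteDimensional.span_of_finite K (Set.finite_range _)
  obtain ⟨f, hf, -, hf2⟩ :=
    Submodule.exists_fun_fin_finrank_span_eq K (range fun i => A (b i x))
  choose g hg using hf
  have hli : LinearIndependent K fun i => A (b (g i) x) := by
    convert hf2 using 1
    funext i; exact hg i
  rw [hmap x hbC.self_of_nhds.2]
  filter_upwards [hbC, eventually_linearIndependent (fun i => (hb (g i)).map A) hli] with y h1 h2
  rw [hmap y h1.2]
  have := finrank_span_eq_card h2
  rw [Fintype.card_fin] at this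
  rw [← this]
  refine Submodule.finrank_mono (Submodule.span_mono ?_)
  rintro _ ⟨i, rfl⟩; exact ⟨g i, rfl⟩

theorem disjoint_span_of_sum {ι ι' : Type*} {v : ι → W} {v' : ι' → W}
    (h : LinearIndependent K (Sum.elim v v')) :
    Disjoint (span K (range v)) (span K (range v')) :=
  (linearIndependent_sum.1 h).2.2

/-- The preimage of a regular family under a regular linear map is regular if it has constant
dimension. -/
theorem RegSub.comap [FiniteDimensional K W] {A : X → W →ₗ[K] W'}
    (hA : ∀ w, VReg (X.regAlg x) fun y => A y w) {C : X → Submodule K W'} (hC : RegSub C x)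
    (h : ∀ᶠ y in 𝓝 x, finrank K ((C y).comap (A y)) =
      finrank K ((C x).comap (A x))) :
    RegSub (fun y => (C y).comap (A y)) x := by
  obtain ⟨E, hE⟩ := Submodule.exists_isCompl ((C x).comap (A x))
  obtain ⟨k, c, hc, hcC⟩ := hC
  have hc0 := hcC.self_of_nhds
  let e := Module.finBasis K E
  let n := Module.finBasis K ((C x).comap (A x))
  let B : (Fin (finrank K E) ⊕ Fin k) → X → W' := Sum.elim (fun i y => A y (e i)) c
  have hB : ∀ i, VReg (X.regAlg x) (B i) := by
    rintro (i | i)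
    · exact hA _
    · exact hc i
  have hBx : LinearIndependent K fun i => B i x := by
    have h1 : (fun i => B i x) = Sum.elim (fun i => A x (e i)) fun i => c i x := by
      funext i; rcases i with i | i <;> rfl
    have hker : Disjoint E ((C x).comap (A x)) := hE.symm.disjoint
    rw [h1]
    refine LinearIndependent.sum_type ?_ hc0.1 ?_
    · have he : LinearIndependent K fun i => (e i : W) :=
        linearIndependent_coe_basis e
      refine he.map (f := A x) (hker.mono ?_ ?_)
      · rw [span_le]; rintro _ ⟨i, rfl⟩; exact (e i).2
      · intro w hw; rw [LinearMap.mem_ker] at hw; simp [hw]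
    · rw [hc0.2, Submodule.disjoint_def]
      intro z hz hz'
      obtain ⟨a, ha⟩ := (mem_span_range_iff_exists_fun K).1 hz
      have h2 : A x (∑ i, a i • (e i : W)) = z := by simp [← ha]
      have h3 : (∑ i, a i • (e i : W)) ∈ E := E.sum_mem fun i _ => E.smul_mem _ (e i).2
      have h4 := Submodule.disjoint_def.1 hker _ h3 (by simpa [h2] using hz')
      rw [← h2, h4, map_zero]
  have hBe := eventually_linearIndependent hB hBx
  have hmem : ∀ᶠ y in 𝓝 x, ∀ w : W, A y w ∈ span K (range fun i => B i y) := by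
    filter_upwards [hcC, hBe, h] with y h1 h2 h3 w
    have hBy : (fun i => B i y) = Sum.elim (fun i => A y (e i)) fun i => c i y := by
      funext i; rcases i with i | i <;> rfl
    rw [hBy] at h2 ⊢
    rw [Set.Sum.elim_range, Submodule.span_union, h1.2]
    have hdis := disjoint_span_of_sum h2
    have hAe : LinearIndependent K fun i => A y (e i) := (linearIndependent_sum.1 h2).1
    rw [h1.2] at hdis
    have hd : Disjoint E ((C y).comap (A y)) := by
      rw [Submodule.disjoint_def]
      intro z hz hz'
      have hz3 := sum_repr_coe e ⟨z, hz⟩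
      dsimp only at hz3
      have h5 : A y z ∈ span K (range fun i => A y (e i)) := by
        rw [← hz3, map_sum]
        exact sum_mem fun i _ => by
          rw [map_smul]; exact smul_mem _ _ (subset_span ⟨i, rfl⟩)
      have h6 := Submodule.disjoint_def.1 hdis _ h5 hz'
      have h7 : ∑ i, e.repr ⟨z, hz⟩ i • A y (e i) = 0 := by
        rw [← h6]
        conv_rhs => rw [← hz3]
        simp only [map_sum, map_smul]
      have h8 := Fintype.linearIndependent_iff.1 hAe _ h7
      rw [← hz3]
      exact Finset.sum_eq_zero fun i _ => by rw [h8 i, zero_smul]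
    have htop : E ⊔ (C y).comap (A y) = ⊤ := by
      refine Submodule.eq_top_of_disjoint _ _ ?_ hd
      rw [h3, add_comm, Submodule.finrank_add_eq_of_isCompl hE]
    obtain ⟨z, hz, z', hz', rfl⟩ := Submodule.mem_sup.1 (htop ▸ Submodule.mem_top : w ∈ _)
    rw [map_add]
    refine Submodule.add_mem_sup ?_ hz'
    have hz3 := sum_repr_coe e ⟨z, hz⟩
    dsimp only at hz3
    rw [← hz3, map_sum]
    exact sum_mem fun i _ => by
      rw [map_smul]; exact smul_mem _ _ (subset_span ⟨i, rfl⟩)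
  have hco : ∀ j, ∃ a : (Fin (finrank K E) ⊕ Fin k) → X → K, (∀ i, a i ∈ X.regAlg x) ∧
      ∀ᶠ y in 𝓝 x, A y (n j) = ∑ i, a i y • B i y :=
    fun j => exists_regular_coords hB hBx (hA _) (hmem.mono fun y hy => hy _)
  choose a ha haB using hco
  have hv : ∀ j, VReg (X.regAlg x) fun y => (n j : W) - ∑ i, a j (Sum.inl i) y • (e i : W) := by
    intro j
    have h1 : ∀ i, VReg (X.regAlg x) fun y => a j (Sum.inl i) y • (e i : W) := fun i =>
      VReg.smul (ha j (Sum.inl i)) (VReg.const _)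
    have h2 := VReg.sum Finset.univ fun i _ => h1 i
    exact VReg.sub (VReg.const _) h2
  refine RegSub.of_frame _ hv ?_
  filter_upwards [eventually_all.2 haB, h, hcC] with y h1 h2 h3
  have hli : LinearIndependent K fun j => (n j : W) - ∑ i, a j (Sum.inl i) y • (e i : W) := by
    have hn : LinearIndependent K fun j => (n j : W) :=
      linearIndependent_coe_basis n
    rw [Fintype.linearIndependent_iff] at hn ⊢
    intro g hg
    refine hn g ?_
    simp only [smul_sub, Finset.sum_sub_distrib, sub_eq_zero] at hg
    refine Submodule.disjoint_def.1 hE.disjoint _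
      (sum_mem fun i _ => smul_mem _ _ (n i).2) ?_
    rw [hg]
    exact sum_mem fun i _ => smul_mem _ _
      (sum_mem fun i _ => smul_mem _ _ (e i).2)
  refine ⟨hli, Submodule.eq_of_le_of_finrank_eq ?_ ?_⟩
  · rw [span_le]
    rintro _ ⟨j, rfl⟩
    have := h1 j
    rw [Fintype.sum_sum_type] at this
    simp only [SetLike.mem_coe, Submodule.mem_comap, map_sub, map_sum, map_smul]
    rw [this]
    simp only [B, Sum.elim_inl, Sum.elim_inr, add_sub_cancel_left]
    rw [← h3.2]
    exact sum_mem fun i _ => smul_mem _ _ (subset_span ⟨i, rfl⟩)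
  · rw [finrank_span_eq_card hli, h2, Fintype.card_fin]

/-- Products of regular families. -/
theorem RegSub.pi {ι : Type*} [Finite ι] [DecidableEq ι] {C : ι → X → Submodule K W}
    (hC : ∀ i, RegSub (C i) x) :
    RegSub (fun y => Submodule.pi Set.univ fun i => C i y) x := by
  have := Fintype.ofFinite ι
  choose k b hb h using hC
  let v : (Σ i, Fin (k i)) → X → ι → W := fun p y => Pi.single p.1 (b p.1 p.2 y)
  have hv : ∀ p, VReg (X.regAlg x) (v p) := fun p =>
    (hb p.1 p.2).map (LinearMap.single K (fun _ => W) p.1)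
  refine RegSub.of_frame v hv ?_
  filter_upwards [eventually_all.2 h] with y hy
  have hli : LinearIndependent K fun p => v p y :=
    Pi.linearIndependent_single (ιs := fun i => Fin (k i)) (Ms := fun _ => W)
      (fun i j => b i j y) fun i => (hy i).1
  refine ⟨hli, le_antisymm ?_ ?_⟩
  · rw [span_le]
    rintro _ ⟨⟨i, j⟩, rfl⟩
    refine Submodule.mem_pi.2 fun i' _ => ?_
    change (Pi.single i (b i j y) : ι → W) i' ∈ C i' y
    by_cases hi : i' = i
    · subst hi
      rw [Pi.single_eq_same, ← (hy i').2]
      exact subset_span (Set.mem_range_self j)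
    · rw [Pi.single_eq_of_ne hi]
      exact zero_mem _
  · intro f hf
    rw [← Finset.univ_sum_single f]
    refine sum_mem fun i _ => ?_
    have h1 : f i ∈ span K (range fun j => b i j y) := by
      rw [(hy i).2]; exact Submodule.mem_pi.1 hf i trivial
    obtain ⟨a, ha⟩ := (mem_span_range_iff_exists_fun K).1 h1
    have h2 : (Pi.single i (f i) : ι → W) = ∑ j, a j • v ⟨i, j⟩ y := by
      rw [← ha]
      simp only [v, ← Pi.single_smul]
      exact map_sum (LinearMap.single K (fun _ => W) i) _ _
    rw [h2]
    exact sum_mem fun j _ => smul_mem _ _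
      (subset_span (Set.mem_range_self (⟨i, j⟩ : Σ i, Fin (k i))))

end RegSub

/-! ### Grassmannians -/

section Grassmannian

variable {W : Type u} [AddCommGroup W] [Module K W] {k : ℕ}

instance : (grassmannian K W k).IsGood :=
  isGood_quot (X := (affine K (Fin k → W)).sub {b : Fin k → W | LinearIndependent K b})

variable (K W k) in
/-- The frame bundle of the Grassmannian. -/
abbrev frames : SpaceWithFunctions K :=
  (affine K (Fin k → W)).sub {b : Fin k → W | LinearIndependent K b}

/-- The point spanned by a frame. -/
def spanPt (b : frames K W k) : grassmannian K W k :=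
  ⟨span K (range b.1), by simpa using finrank_span_eq_card (R := K) b.2⟩

theorem exists_spanPt [FiniteDimensional K W] (C : grassmannian K W k) :
    ∃ b : frames K W k, spanPt b = C := by
  obtain ⟨C, hC⟩ := C
  let B := Module.finBasisOfFinrankEq K C hC
  exact ⟨⟨fun i => (B i : W), linearIndependent_coe_basis B⟩,
    Subtype.ext (span_range_coe_basis B)⟩

theorem vreg_frames (b : frames K W k) (i : Fin k) :
    VReg ((frames K W k).regAlg b) fun c : frames K W k => (c.1 : Fin k → W) i :=
  ((vreg_affine_id b.1).map (LinearMap.proj i)).restrict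

open Classical in
/-- The vector `v ∈ C` with `φ v = c`. -/
def solve (C : Submodule K W) (φ : Fin k → Module.Dual K W) (c : Fin k → K) : W :=
  if h : ∃ v ∈ C, ∀ i, φ i v = c i then h.choose else 0

theorem mulVec_formula {M : Matrix (Fin k) (Fin k) K} (h : M.det ≠ 0) (c : Fin k → K) :
    M.mulVec (fun i => M.det⁻¹ * ∑ j, M.adjugate i j * c j) = c := by
  have h0 : (fun i => M.det⁻¹ * ∑ j, M.adjugate i j * c j) =
      M.det⁻¹ • M.adjugate.mulVec c := by
    funext i; simp [Matrix.mulVec, dotProduct]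
  rw [h0, Matrix.mulVec_smul, Matrix.mulVec_mulVec, Matrix.mul_adjugate, Matrix.smul_mulVec,
    Matrix.one_mulVec, smul_smul, inv_mul_cancel₀ h, one_smul]

theorem exists_solve {b : Fin k → W} {φ : Fin k → Module.Dual K W} (c : Fin k → K)
    (h : (Matrix.of fun i j => φ i (b j)).det ≠ 0) :
    ∃ v ∈ span K (range b), ∀ i, φ i v = c i := by
  set M : Matrix (Fin k) (Fin k) K := Matrix.of fun i j => φ i (b j) with hM
  refine ⟨∑ i, (M.det⁻¹ * ∑ j, M.adjugate i j * c j) • b i,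
    sum_mem fun i _ => smul_mem _ _ (subset_span ⟨i, rfl⟩),
    fun i => ?_⟩
  rw [← congrFun (mulVec_formula h c) i]
  simp [Matrix.mulVec, dotProduct, M, mul_comm]

theorem solve_spec {b : Fin k → W} {φ : Fin k → Module.Dual K W} (c : Fin k → K)
    (h : (Matrix.of fun i j => φ i (b j)).det ≠ 0) :
    solve (span K (range b)) φ c ∈ span K (range b) ∧
      ∀ i, φ i (solve (span K (range b)) φ c) = c i := by
  rw [solve, dif_pos (exists_solve c h)]
  exact (exists_solve c h).choose_spec

theorem solve_span {b : Fin k → W} {φ : Fin k → Module.Dual K W} (c : Fin k → K)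
    (h : (Matrix.of fun i j => φ i (b j)).det ≠ 0) :
    solve (span K (range b)) φ c =
      ∑ i, ((Matrix.of fun i j => φ i (b j)).det⁻¹ *
        ∑ j, (Matrix.of fun i j => φ i (b j)).adjugate i j * c j) • b i := by
  set M : Matrix (Fin k) (Fin k) K := Matrix.of fun i j => φ i (b j) with hM
  obtain ⟨hs, hs'⟩ := solve_spec c h
  obtain ⟨d, hd⟩ := (mem_span_range_iff_exists_fun K).1 hs
  have h1 : M.mulVec d = c := by
    funext j
    rw [← hs' j, ← hd]
    simp [Matrix.mulVec, dotProduct, M, mul_comm]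
  have hinj : Function.Injective M.mulVec :=
    Matrix.mulVec_injective_iff_isUnit.2 ((Matrix.isUnit_iff_isUnit_det _).2 h.isUnit)
  rw [← hd, hinj (h1.trans (mulVec_formula h c).symm)]

theorem det_ne_zero_of_span_eq {b c : Fin k → W} {φ : Fin k → Module.Dual K W}
    (hbc : span K (range b) = span K (range c))
    (h : (Matrix.of fun i j => φ i (b j)).det ≠ 0) :
    (Matrix.of fun i j => φ i (c j)).det ≠ 0 := by
  refine fun h0 => h ?_
  obtain ⟨v, hv, hv0⟩ := Matrix.exists_vecMul_eq_zero_iff.2 h0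
  refine Matrix.exists_vecMul_eq_zero_iff.1 ⟨v, hv, ?_⟩
  have h1 : ∀ w ∈ span K (range c), ∑ i, v i * φ i w = 0 := by
    intro w hw
    induction hw using Submodule.span_induction with
    | mem w hw =>
      obtain ⟨j, rfl⟩ := hw
      exact congrFun hv0 j
    | zero => simp
    | add x y _ _ hx hy => simp [mul_add, Finset.sum_add_distrib, hx, hy]
    | smul a x _ hx =>
      simp only [map_smul, smul_eq_mul, mul_left_comm _ a]
      rw [← Finset.mul_sum, hx, mul_zero]
  funext j
  refine h1 _ ?_
  rw [← hbc]
  exact subset_span ⟨j, rfl⟩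

theorem det_frames_mem (φ : Fin k → Module.Dual K W) (b : frames K W k) :
    (fun c : frames K W k => (Matrix.of fun i j => φ i ((c.1 : Fin k → W) j)).det) ∈
      (frames K W k).regAlg b :=
  det_mem fun i j => vreg_frames b j (φ i)

theorem isOpen_chart (φ : Fin k → Module.Dual K W) : IsOpen {C : grassmannian K W k |
    ∃ b : frames K W k, spanPt b = C ∧
      (Matrix.of fun i j => φ i ((b.1 : Fin k → W) j)).det ≠ 0} := by
  refine isOpen_coinduced.2 (isOpen_iff_mem_nhds.2 ?_)
  intro b hb
  have hb' : (Matrix.of fun i j => φ i ((b.1 : Fin k → W) j)).det ≠ 0 := by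
    obtain ⟨c, hc, hdet⟩ := hb
    exact det_ne_zero_of_span_eq (congrArg Subtype.val hc) hdet
  refine (regAlg_ne (det_frames_mem φ b) hb').mono fun c hc => ?_
  exact ⟨c, rfl, hc⟩

theorem vreg_solve {φ : Fin k → Module.Dual K W} {C : grassmannian K W k}
    (hC : ∃ b : frames K W k, spanPt b = C ∧
      (Matrix.of fun i j => φ i ((b.1 : Fin k → W) j)).det ≠ 0) (a : Fin k → K) :
    VReg ((grassmannian K W k).regAlg C) fun D : grassmannian K W k => solve D.1 φ a := by
  intro ψ
  refine regAt_quot_of (Filter.mem_of_superset ((isOpen_chart φ).mem_nhds hC) ?_)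
  rintro _ ⟨c', hc', hD⟩ c rfl
  have hdet : (Matrix.of fun i j => φ i ((c.1 : Fin k → W) j)).det ≠ 0 :=
    det_ne_zero_of_span_eq (congrArg Subtype.val hc') hD
  have hfun : ∀ i, (fun d : frames K W k => ((Matrix.of fun i j => φ i ((d.1 : Fin k → W) j)).det⁻¹
      * ∑ l, (Matrix.of fun i j => φ i ((d.1 : Fin k → W) j)).adjugate i l * a l)) ∈
      (frames K W k).regAlg c := fun i =>
    ((frames K W k).regAlg c).mul_mem (regAlg_inv (det_frames_mem φ c) hdet) (sum_mem' _ fun l _ =>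
      ((frames K W k).regAlg c).mul_mem
        (adjugate_mem (fun i j => vreg_frames c j (φ i)) i l) (const_mem _))
  have h1 : ∀ i, VReg ((frames K W k).regAlg c) _ := fun i =>
    VReg.smul (hfun i) (vreg_frames c i)
  have h2 := VReg.sum Finset.univ fun i _ => h1 i
  refine (frames K W k).regAt_congr ?_ (h2 ψ)
  refine (regAlg_ne (det_frames_mem φ c) hdet).mono fun d hd => ?_
  have h3 := solve_span a hd
  exact (congrArg ψ h3).symm

theorem solve_frame [FiniteDimensional K W] {φ : Fin k → Module.Dual K W} {C : grassmannian K W k}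
    (hC : ∃ b : frames K W k, spanPt b = C ∧
      (Matrix.of fun i j => φ i ((b.1 : Fin k → W) j)).det ≠ 0) :
    (∀ i j, φ i (solve C.1 φ (Pi.single j 1)) = if i = j then 1 else 0) ∧
    LinearIndependent K (fun j => solve C.1 φ (Pi.single j 1)) ∧
      span K (range fun j => solve C.1 φ (Pi.single j 1)) = C.1 := by
  obtain ⟨c, rfl, hc⟩ := hC
  have hφ : ∀ i j, φ i (solve (spanPt c).1 φ (Pi.single j 1)) = if i = j then 1 else 0 := by
    intro i j
    have := (solve_spec (Pi.single j 1) hc).2 i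
    rw [Pi.single_apply] at this
    exact this
  have hli : LinearIndependent K fun j => solve (spanPt c).1 φ (Pi.single j 1) := by
    refine linearIndependent_of_det_ne_zero φ ?_
    have : (Matrix.of fun i j => φ i (solve (spanPt c).1 φ (Pi.single j 1))) = 1 := by
      ext i j
      rw [Matrix.of_apply, hφ, Matrix.one_apply]
    rw [this, Matrix.det_one]
    exact one_ne_zero
  refine ⟨hφ, hli, Submodule.eq_of_le_of_finrank_eq ?_ ?_⟩
  · rw [span_le]
    rintro _ ⟨j, rfl⟩
    exact (solve_spec (Pi.single j 1) hc).1
  · rw [finrank_span_eq_card hli, Fintype.card_fin]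
    exact (spanPt c).2.symm

/-- The tautological family on the Grassmannian is regular. -/
theorem regSub_taut [FiniteDimensional K W] (C : grassmannian K W k) :
    RegSub (X := grassmannian K W k) (fun D => D.1) C := by
  classical
  obtain ⟨b, rfl⟩ := exists_spanPt C
  obtain ⟨φ, hφ⟩ := exists_dual_family b.2
  have hbdet : (Matrix.of fun i j => φ i ((b.1 : Fin k → W) j)).det ≠ 0 := by
    have : (Matrix.of fun i j => φ i ((b.1 : Fin k → W) j)) = 1 := by
      ext i j; simpa [Matrix.one_apply] using hφ i j
    simp [this]
  refine ⟨k, fun j D => solve D.1 φ (Pi.single j 1), fun j => vreg_solve ⟨b, rfl, hbdet⟩ _, ?_⟩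
  exact Filter.mem_of_superset ((isOpen_chart φ).mem_nhds ⟨b, rfl, hbdet⟩)
    fun C hC => (solve_frame hC).2

/-- A map to the Grassmannian is a morphism at `x` iff it is given by a regular frame. -/
theorem homAt_grassmannian_iff [FiniteDimensional K W] {X : SpaceWithFunctions K} [X.IsGood]
    {f : X → grassmannian K W k} {x : X} :
    HomAt f x ↔ RegSub (fun y => (f y).1) x := by
  refine ⟨fun h => RegSub.comp (regSub_taut (f x)) h, fun h => ?_⟩
  obtain ⟨b, hb, h⟩ := h.exists_frame (f x).2
  refine homAt_quot (S := {b : Fin k → W | LinearIndependent K b}) (b := fun y i => b i y)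
    (vreg_pi.2 hb) (h.mono fun y hy => ⟨hy.1, Subtype.ext hy.2.symm⟩)

end Grassmannian

end SpaceWithFunctions

namespace SpaceWithFunctions

/-! ### Varieties -/

section Variety

variable {X Y Z : SpaceWithFunctions K}

theorem IsIso.trans (h : IsIso X Y) (h' : IsIso Y Z) : IsIso X Z := by
  obtain ⟨f, g, h1, h2⟩ := h
  obtain ⟨f', g', h1', h2'⟩ := h'
  refine ⟨f'.comp f, g.comp g', fun x => ?_, fun x => ?_⟩
  · exact (congrArg g (h1' _)).trans (h1 x)
  · exact (congrArg f' (h2 _)).trans (h2' x)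

theorem IsIso.isGood [Y.IsGood] (h : IsIso X Y) : X.IsGood := by
  obtain ⟨f, g, h1, h2⟩ := h
  have key : ∀ {k : X → K} {x : X}, X.RegAt k x → Y.RegAt (fun y => k (g y)) (f x) := by
    intro k x hk
    refine g.regAt_comp (f x) k ?_
    rwa [h1]
  have key' : ∀ {k : X → K} {x : X}, Y.RegAt (fun y => k (g y)) (f x) → X.RegAt k x := by
    intro k x hk
    have := f.regAt_comp x _ hk
    refine X.regAt_congr (Eventually.of_forall fun y => ?_) this
    exact congrArg k (h1 y)
  exact
    { const c x := key' (IsGood.const c _)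
      add h h' := key' (IsGood.add (key h) (key h'))
      mul h h' := key' (IsGood.mul (key h) (key h'))
      inv := by
        intro k x h hx
        refine key' (IsGood.inv (key h) ?_)
        rwa [h1]
      ne := by
        intro k x h hx
        have h3 := IsGood.ne (key h) (by rwa [h1])
        have h4 := f.continuous_toFun.continuousAt.eventually h3
        refine h4.mono fun y hy => ?_
        rwa [h1] at hy }

theorem isGood_of_cover {ι : Type*} (U : ι → Set X) (hU : ∀ i, IsOpen (U i))
    (hc : ⋃ i, U i = Set.univ) (hg : ∀ i, (X.sub (U i)).IsGood) : X.IsGood := by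
  have hx : ∀ x : X, ∃ i, x ∈ U i := fun x => by
    simpa using (hc ▸ Set.mem_univ x : x ∈ ⋃ i, U i)
  have key : ∀ {k : X → K} {i : ι} {x : X} (hxi : x ∈ U i), (X.sub (U i)).RegAt (fun y => k y.1)
      ⟨x, hxi⟩ → X.RegAt k x := by
    rintro k i x hxi ⟨g, hg, h⟩
    refine X.regAt_congr ?_ hg
    have h' := (nhds_sub (S := U i) ⟨x, hxi⟩) ▸ h
    obtain ⟨V, hV, hV'⟩ := h'
    filter_upwards [hV, (hU i).mem_nhds hxi] with y h1 h2
    exact (hV' (show (⟨y, h2⟩ : X.sub (U i)) ∈ _ from h1)).symm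
  refine
    { const c x := ?_
      add := ?_
      mul := ?_
      inv := ?_
      ne := ?_ }
  · obtain ⟨i, hi⟩ := hx x
    have := hg i
    exact key hi (IsGood.const c _)
  · intro f g x hf hg'
    obtain ⟨i, hi⟩ := hx x
    have := hg i
    exact key hi (IsGood.add (regAt_restrict (S := U i) (x := ⟨x, hi⟩) hf) (regAt_restrict hg'))
  · intro f g x hf hg'
    obtain ⟨i, hi⟩ := hx x
    have := hg i
    exact key hi (IsGood.mul (regAt_restrict (S := U i) (x := ⟨x, hi⟩) hf) (regAt_restrict hg'))
  · intro f x hf hfx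
    obtain ⟨i, hi⟩ := hx x
    have := hg i
    exact key hi (IsGood.inv (regAt_restrict (S := U i) (x := ⟨x, hi⟩) hf) hfx)
  · intro f x hf hfx
    obtain ⟨i, hi⟩ := hx x
    have := hg i
    have h1 := IsGood.ne (regAt_restrict (S := U i) (x := ⟨x, hi⟩) hf) hfx
    have h1' := (nhds_sub (S := U i) ⟨x, hi⟩) ▸ h1
    obtain ⟨V, hV, hV'⟩ := h1'
    filter_upwards [hV, (hU i).mem_nhds hi] with y h1 h2
    exact hV' (show (⟨y, h2⟩ : X.sub (U i)) ∈ _ from h1)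

theorem IsAffineVariety.isGood (h : IsAffineVariety X) : X.IsGood := by
  obtain ⟨n, S, -, hX⟩ := h
  exact hX.isGood

theorem IsVariety.isGood (h : IsVariety X) : X.IsGood := by
  obtain ⟨⟨m, U, hU, hc, hA⟩, -⟩ := h
  exact isGood_of_cover U hU hc fun i => (hA i).isGood

theorem isAffineVariety_sub_affine {W : Type u} [AddCommGroup W] [Module K W]
    [FiniteDimensional K W] (S : Set (affine K W)) (hS : IsClosed S) :
    IsAffineVariety ((affine K W).sub S) := by
  let E : W ≃ₗ[K] (Fin (finrank K W) → K) := (Module.finBasis K W).equivFun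
  let f : Hom (affine K W) (affine K (Fin (finrank K W) → K)) :=
    Hom.mk' E fun x => homAt_affine ((vreg_affine_id x).map E.toLinearMap)
  let g : Hom (affine K (Fin (finrank K W) → K)) (affine K W) :=
    Hom.mk' E.symm fun x => homAt_affine ((vreg_affine_id x).map E.symm.toLinearMap)
  have hfg : ∀ x, g (f x) = x := E.symm_apply_apply
  have hgf : ∀ x, f (g x) = x := E.apply_symm_apply
  refine ⟨_, g ⁻¹' S, hS.preimage g.continuous_toFun,
    (f.comp (Hom.incl S)).codRestrict _ fun x => ?_,
    (g.comp (Hom.incl (g ⁻¹' S))).codRestrict _ fun x => x.2, fun x => ?_, fun x => ?_⟩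
  · change g (f x.1) ∈ S
    rw [hfg]; exact x.2
  · exact Subtype.ext (hfg x.1)
  · exact Subtype.ext (hgf x.1)

theorem IsAffineVariety.of_iso (h : IsAffineVariety Y) (e : IsIso X Y) : IsAffineVariety X := by
  obtain ⟨n, S, hS, hY⟩ := h
  exact ⟨n, S, hS, e.trans hY⟩

theorem isVariety_affine {W : Type u} [AddCommGroup W] [Module K W]
    [FiniteDimensional K W] : IsVariety (affine K W) := by
  refine ⟨⟨1, fun _ => Set.univ, fun _ => isOpen_univ, Set.iUnion_const _,
    fun _ => isAffineVariety_sub_affine _ isClosed_univ⟩, fun Y hY f g => ?_⟩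
  have := hY.isGood
  rw [← isOpen_compl_iff, isOpen_iff_mem_nhds]
  intro y hy
  let f' : Y → W := fun z => f z
  let g' : Y → W := fun z => g z
  have h1 : f' y - g' y ≠ 0 := sub_ne_zero.2 hy
  obtain ⟨φ, hφ⟩ := Module.Projective.exists_dual_ne_zero K h1
  have hf : VReg (Y.regAlg y) f' := (vreg_affine_id (f y)).comp f
  have hg : VReg (Y.regAlg y) g' := (vreg_affine_id (g y)).comp g
  refine (regAlg_ne ((hf.sub hg) φ) hφ).mono fun z hz hz' => hz ?_
  have hz'' : f' z = g' z := hz'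
  dsimp only
  rw [hz'', sub_self, map_zero]

/-- Two morphisms to a subspace of a Grassmannian agree on a closed set. -/
theorem isClosed_eq_grassmannian {W : Type u} [AddCommGroup W] [Module K W]
    [FiniteDimensional K W] {k : ℕ} {S : Set (grassmannian K W k)} [Y.IsGood]
    (f g : Hom Y ((grassmannian K W k).sub S)) : IsClosed {y : Y | f y = g y} := by
  have hreg : ∀ (f : Hom Y ((grassmannian K W k).sub S)) (y : Y),
      RegSub (fun z => (f z).1.1) y := fun f y =>
    homAt_grassmannian_iff.1 (((Hom.incl S).comp f).homAt y)
  rw [← isOpen_compl_iff, isOpen_iff_mem_nhds]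
  intro y hy
  obtain ⟨b, hb, h⟩ := (hreg f y).exists_frame rfl
  have h0 := h.self_of_nhds
  have : ∃ j, b j y ∉ (g y).1.1 := by
    by_contra! hcon
    refine hy (Subtype.ext (Subtype.ext (Submodule.eq_of_le_of_finrank_eq ?_ ?_)))
    · rw [← h0.2, span_le]
      rintro _ ⟨j, rfl⟩; exact hcon j
    · exact (f y).1.2.trans (g y).1.2.symm
  obtain ⟨j, hj⟩ := this
  filter_upwards [h, (hreg g y).eventually_notMem (hb j) hj] with z h1 h2 h3
  have h3' : f z = g z := h3
  refine h2 ?_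
  rw [← h3', ← h1.2]
  exact subset_span ⟨j, rfl⟩

end Variety

/-! ### Closed subspaces of Grassmannians are varieties -/

section GrassmannianVariety

variable {W : Type u} [AddCommGroup W] [Module K W] [FiniteDimensional K W] {k : ℕ}

open Classical in
/-- The point of the Grassmannian spanned by `b`, or a default value. -/
def spanOr (C : grassmannian K W k) (b : Fin k → W) : grassmannian K W k :=
  if h : LinearIndependent K b then spanPt ⟨b, h⟩ else C

omit [FiniteDimensional K W] in
theorem spanOr_val (C : grassmannian K W k) {b : Fin k → W} (h : LinearIndependent K b) :
    (spanOr C b).1 = span K (range b) := by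
  rw [spanOr, dif_pos h]; rfl

theorem homAt_spanOr {X : SpaceWithFunctions K} [X.IsGood] (C : grassmannian K W k)
    {b : X → Fin k → W} {x : X} (hb : VReg (X.regAlg x) b) (h : LinearIndependent K (b x)) :
    HomAt (fun y => spanOr C (b y)) x :=
  homAt_grassmannian_iff.2 (RegSub.of_frame (fun i y => b y i) (vreg_pi.1 hb)
    ((eventually_linearIndependent (vreg_pi.1 hb) h).mono fun _ hy => ⟨hy, (spanOr_val C hy).symm⟩))

omit [FiniteDimensional K W] in
theorem exists_coord_minor {N : ℕ} (β : Module.Basis (Fin N) K W) {b : Fin k → W}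
    (hb : LinearIndependent K b) :
    ∃ s : Fin k → Fin N, (Matrix.of fun i j => β.coord (s i) (b j)).det ≠ 0 := by
  let R : Fin N → Fin k → K := fun i j => β.coord i (b j)
  have htop : span K (range R) = ⊤ := by
    by_contra hne
    obtain ⟨f, hf0, hf⟩ := Submodule.exists_le_ker_of_lt_top _ (lt_top_iff_ne_top.2 hne)
    refine hf0 ?_
    have h1 : ∑ j, f (Pi.single j 1) • b j = 0 := by
      refine β.ext_elem fun i => ?_
      have h2 : f (R i) = 0 := hf (subset_span ⟨i, rfl⟩)
      rw [← Finset.univ_sum_single (R i), map_sum] at h2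
      simp only [map_sum, map_smul, Finsupp.coe_finsetSum, Finset.sum_apply, Finsupp.smul_apply,
        map_zero, Finsupp.coe_zero, Pi.zero_apply, smul_eq_mul]
      rw [← h2]
      refine Finset.sum_congr rfl fun j _ => ?_
      have : (Pi.single j (R i j) : Fin k → K) = R i j • Pi.single j 1 := by
        rw [← Pi.single_smul, smul_eq_mul, mul_one]
      rw [this, map_smul, smul_eq_mul, mul_comm]; rfl
    have h3 := Fintype.linearIndependent_iff.1 hb _ h1
    refine LinearMap.pi_ext' fun j => LinearMap.ext_ring ?_
    simpa using h3 j
  obtain ⟨f, hf, -, hli⟩ := Submodule.exists_fun_fin_finrank_span_eq K (range R)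
  have hk : finrank K (span K (range R)) = k := by
    rw [htop, finrank_top, Module.finrank_fin_fun]
  choose g hg using hf
  refine ⟨fun i => g (Fin.cast hk.symm i), ?_⟩
  have h1 : LinearIndependent K (fun i : Fin k => f (Fin.cast hk.symm i)) :=
    hli.comp _ (Fin.cast_injective _)
  have h2 : LinearIndependent K (Matrix.of fun i j => β.coord (g (Fin.cast hk.symm i)) (b j)).row := by
    convert h1 using 1
    funext i
    exact hg _
  exact ((Matrix.isUnit_iff_isUnit_det _).1
    (Matrix.linearIndependent_rows_iff_isUnit.1 h2)).ne_zero

theorem isAffineVariety_chart {S : Set (grassmannian K W k)} (hS : IsClosed S)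
    (φ : Fin k → Module.Dual K W) :
    IsAffineVariety (((grassmannian K W k).sub S).sub {C | ∃ b : frames K W k, spanPt b = C.1 ∧
      (Matrix.of fun i j => φ i ((b.1 : Fin k → W) j)).det ≠ 0}) := by
  set U : Set ((grassmannian K W k).sub S) := {C | ∃ b : frames K W k, spanPt b = C.1 ∧
      (Matrix.of fun i j => φ i ((b.1 : Fin k → W) j)).det ≠ 0} with hU
  let A : Set (affine K (Fin k → W)) :=
    {b : Fin k → W | (∀ i j, φ i (b j) = if i = j then 1 else 0) ∧
    ∃ C ∈ S, C.1 = span K (range b)}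
  have hdet : ∀ b : Fin k → W, (∀ i j, φ i (b j) = if i = j then 1 else 0) →
      (Matrix.of fun i j => φ i (b j)) = 1 := by
    intro b hb
    ext i j
    rw [Matrix.of_apply, hb, Matrix.one_apply]
  have hdet' : ∀ b : Fin k → W, (∀ i j, φ i (b j) = if i = j then 1 else 0) →
      (Matrix.of fun i j => φ i (b j)).det ≠ 0 := by
    intro b hb
    rw [hdet b hb, Matrix.det_one]; exact one_ne_zero
  have hli : ∀ b : Fin k → W, (∀ i j, φ i (b j) = if i = j then 1 else 0) →
      LinearIndependent K b := fun b hb => linearIndependent_of_det_ne_zero φ (hdet' b hb)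
  have hid : ∀ b : affine K (Fin k → W), ∀ j, VReg ((affine K (Fin k → W)).regAlg b)
      fun c : affine K (Fin k → W) => (c : Fin k → W) j := fun b j =>
    (vreg_affine_id b).map (LinearMap.proj j)
  have hA : IsClosed A := by
    rw [← isOpen_compl_iff, isOpen_iff_mem_nhds]
    intro b hb
    by_cases hn : ∀ i j, φ i ((b : Fin k → W) j) = if i = j then 1 else 0
    · have hli' := hli b hn
      have hc := (homAt_spanOr (spanPt ⟨b, hli'⟩) (vreg_affine_id b) hli').1
      have hnot : spanOr (spanPt ⟨b, hli'⟩) b ∉ S := fun hmem =>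
        hb ⟨hn, _, hmem, spanOr_val _ hli'⟩
      refine (hc.eventually (hS.isOpen_compl.mem_nhds hnot)).mono fun c hc' hcA => hc' ?_
      obtain ⟨h1, D, hD, hDc⟩ := hcA
      have : spanOr (spanPt ⟨b, hli'⟩) c = D :=
          Subtype.ext ((spanOr_val _ (hli c h1)).trans hDc.symm)
      rw [this]
      exact hD
    · push Not at hn
      obtain ⟨i, j, hij⟩ := hn
      have h1 := ((affine K (Fin k → W)).regAlg b).sub_mem (hid b j (φ i))
        (const_mem (if i = j then 1 else 0))
      refine (regAlg_ne h1 (sub_ne_zero.2 hij)).mono fun c hc hcA => hc ?_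
      exact sub_eq_zero.2 (hcA.1 i j)
  refine (isAffineVariety_sub_affine A hA).of_iso ?_
  have hsolve : ∀ b : Fin k → W, (∀ i j, φ i (b j) = if i = j then 1 else 0) → ∀ j,
      solve (span K (range b)) φ (Pi.single j 1) = b j := by
    intro b hb j
    rw [solve_span _ (hdet' b hb), hdet b hb]
    simp [Matrix.one_apply, Pi.single_apply]
  let F : Hom (((grassmannian K W k).sub S).sub U) (affine K (Fin k → W)) :=
    Hom.mk' (fun C j => solve C.1.1.1 φ (Pi.single j 1)) fun C => homAt_affine <| vreg_pi.2 fun j =>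
      VReg.restrict (X := (grassmannian K W k).sub S) (x := C) <|
        VReg.restrict (X := grassmannian K W k) (x := C.1) (vreg_solve C.2 (Pi.single j 1))
  have hFA : ∀ C, F C ∈ A := fun C =>
    ⟨(solve_frame C.2).1, C.1.1, C.1.2, (solve_frame C.2).2.2.symm⟩
  let G : (affine K (Fin k → W)).sub A → grassmannian K W k := fun b => spanPt ⟨b.1, hli b.1 b.2.1⟩
  have hG : ∀ b, HomAt G b := fun b => by
    refine homAt_grassmannian_iff.2 (RegSub.of_frame (fun j c => (c.1 : Fin k → W) j)
      (fun j => (hid b.1 j).restrict) (Eventually.of_forall fun c => ⟨hli c.1 c.2.1, rfl⟩))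
  have hGS : ∀ b, G b ∈ S := by
    intro b
    obtain ⟨D, hD, hDb⟩ := b.2.2
    have : G b = D := Subtype.ext hDb.symm
    rw [this]; exact hD
  have hGU : ∀ b, (⟨G b, hGS b⟩ : (grassmannian K W k).sub S) ∈ U := fun b =>
    ⟨⟨b.1, hli b.1 b.2.1⟩, rfl, hdet' b.1 b.2.1⟩
  refine ⟨F.codRestrict A hFA, ((Hom.mk' G hG).codRestrict S hGS).codRestrict U hGU, ?_, ?_⟩
  · intro C
    exact Subtype.ext (Subtype.ext (Subtype.ext (solve_frame C.2).2.2))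
  · intro b
    exact Subtype.ext (funext fun j => hsolve b.1 b.2.1 j)

theorem isVariety_grassmannian_sub {S : Set (grassmannian K W k)} (hS : IsClosed S) :
    IsVariety ((grassmannian K W k).sub S) := by
  let β := Module.finBasis K W
  let ι := Fin k → Fin (finrank K W)
  let E := Fintype.equivFin ι
  let φ : ι → Fin k → Module.Dual K W := fun s i => β.coord (s i)
  refine ⟨⟨_, fun i => {C | ∃ b : frames K W k, spanPt b = C.1 ∧
      (Matrix.of fun a j => φ (E.symm i) a ((b.1 : Fin k → W) j)).det ≠ 0}, fun i => ?_, ?_,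
      fun i => isAffineVariety_chart hS _⟩, fun Y hY f g => ?_⟩
  · exact (isOpen_chart (φ (E.symm i))).preimage continuous_sub_val
  · refine Set.eq_univ_of_forall fun C => Set.mem_iUnion.2 ?_
    obtain ⟨b, hb⟩ := exists_spanPt C.1
    obtain ⟨s, hs⟩ := exists_coord_minor β b.2
    exact ⟨E s, b, hb, by simpa [φ] using hs⟩
  · have := hY.isGood
    exact isClosed_eq_grassmannian f g

end GrassmannianVariety

end SpaceWithFunctions

namespace SpaceWithFunctions

/-! ### Projective spaces -/

section Projective

variable {n : ℕ}

instance : (projSpace K n).IsGood :=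
  isGood_quot (X := (affine K (Fin (n + 1) → K)).sub {x : Fin (n + 1) → K | x ≠ 0})

theorem homAt_projSpace {X : SpaceWithFunctions K} [X.IsGood] {f : X → projSpace K n}
    {b : X → Fin (n + 1) → K} {x : X} (hb : VReg (X.regAlg x) b)
    (h : ∀ᶠ y in 𝓝 x, ∃ hy : b y ≠ 0, f y = Projectivization.mk K (b y) hy) : HomAt f x :=
  homAt_quot (S := {x : Fin (n + 1) → K | x ≠ 0}) hb h

/-- The homogeneous coordinates of a point. -/
def hcoord (p : projSpace K n) : Fin (n + 1) → K :=
  Projectivization.rep (K := K) (V := Fin (n + 1) → K) p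

theorem exists_hcoord_mk {x : Fin (n + 1) → K} (hx : x ≠ 0) :
    ∃ a : K, a ≠ 0 ∧ hcoord (Projectivization.mk K x hx : projSpace K n) = a • x := by
  obtain ⟨a, ha⟩ := Projectivization.exists_smul_eq_mk_rep K x hx
  exact ⟨a, a.ne_zero, ha.symm⟩

theorem mk_hcoord (p : projSpace K n) : ∃ h : hcoord p ≠ 0,
    (Projectivization.mk K (hcoord p) h : projSpace K n) = p :=
  ⟨Projectivization.rep_nonzero _, Projectivization.mk_rep _⟩

theorem hcoord_mk_ne {x : Fin (n + 1) → K} (hx : x ≠ 0) (j : Fin (n + 1)) :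
    hcoord (Projectivization.mk K x hx : projSpace K n) j ≠ 0 ↔ x j ≠ 0 := by
  obtain ⟨a, ha, h⟩ := exists_hcoord_mk hx
  rw [h, Pi.smul_apply, smul_eq_mul]
  simp [ha]

theorem hcoord_mk_div {x : Fin (n + 1) → K} (hx : x ≠ 0) (i j : Fin (n + 1)) :
    hcoord (Projectivization.mk K x hx : projSpace K n) i /
      hcoord (Projectivization.mk K x hx : projSpace K n) j = x i / x j := by
  obtain ⟨a, ha, h⟩ := exists_hcoord_mk hx
  rw [h, Pi.smul_apply, Pi.smul_apply, smul_eq_mul, smul_eq_mul, mul_div_mul_left _ _ ha]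

theorem isOpen_hcoord_ne (j : Fin (n + 1)) : IsOpen {p : projSpace K n | hcoord p j ≠ 0} := by
  refine isOpen_coinduced.2 (isOpen_iff_mem_nhds.2 ?_)
  intro x hx
  have hx' : (x.1 : Fin (n + 1) → K) j ≠ 0 := (hcoord_mk_ne x.2 j).1 hx
  have h1 : (fun y : (affine K (Fin (n + 1) → K)).sub {x : Fin (n + 1) → K | x ≠ 0} =>
      (y.1 : Fin (n + 1) → K) j) ∈ regAlg _ x :=
    vreg_field.1 (((vreg_affine_id x.1).map (LinearMap.proj j)).restrict)
  exact (regAlg_ne h1 hx').mono fun y hy => (hcoord_mk_ne y.2 j).2 hy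

theorem regAt_hcoord_div {p : projSpace K n} {j : Fin (n + 1)} (hj : hcoord p j ≠ 0)
    (i : Fin (n + 1)) :
    (fun q : projSpace K n => hcoord q i / hcoord q j) ∈ (projSpace K n).regAlg p := by
  refine regAt_quot_of (Filter.mem_of_superset ((isOpen_hcoord_ne j).mem_nhds hj) ?_)
  rintro _ hz x rfl
  have hx' : (x.1 : Fin (n + 1) → K) j ≠ 0 := (hcoord_mk_ne x.2 j).1 hz
  have h1 : ∀ j, (fun y : (affine K (Fin (n + 1) → K)).sub {x : Fin (n + 1) → K | x ≠ 0} =>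
      (y.1 : Fin (n + 1) → K) j) ∈ regAlg _ x := fun j =>
    vreg_field.1 (((vreg_affine_id x.1).map (LinearMap.proj j)).restrict)
  refine SpaceWithFunctions.regAt_congr _ (Eventually.of_forall fun y => ?_)
    (Subalgebra.mul_mem _ (h1 i) (regAlg_inv (h1 j) hx'))
  exact (div_eq_mul_inv _ _).symm.trans (hcoord_mk_div y.2 i j).symm

end Projective

/-! ### The Plücker embedding -/

section Plucker

variable {W : Type u} [AddCommGroup W] [Module K W] [FiniteDimensional K W] {k n N : ℕ}

/-- The Plücker coordinates of a frame, with respect to a basis; they are indexed by all `k`-tuples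
of basis elements. -/
def plucker (β : Module.Basis (Fin N) K W) (E : Fin (n + 1) ≃ (Fin k → Fin N)) (b : Fin k → W) :
    Fin (n + 1) → K :=
  fun u => (Matrix.of fun i j => β.coord (E u i) (b j)).det

variable (β : Module.Basis (Fin N) K W) (E : Fin (n + 1) ≃ (Fin k → Fin N))

omit [FiniteDimensional K W] in
theorem plucker_ne_zero {b : Fin k → W} (hb : LinearIndependent K b) : plucker β E b ≠ 0 := by
  obtain ⟨s, hs⟩ := exists_coord_minor β hb
  intro h
  exact hs (by simpa [plucker] using congrFun h (E.symm s))

omit [FiniteDimensional K W] in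
theorem plucker_smul {b c : Fin k → W} (h : ∀ j, c j ∈ span K (range b)) :
    ∃ a : K, plucker β E c = a • plucker β E b := by
  choose A hA using fun j => (mem_span_range_iff_exists_fun K).1 (h j)
  refine ⟨(Matrix.of fun i j => A j i).det, ?_⟩
  funext u
  have : (Matrix.of fun i j => β.coord (E u i) (c j)) =
      (Matrix.of fun i j => β.coord (E u i) (b j)) * Matrix.of fun i j => A j i := by
    ext i j
    simp only [Matrix.of_apply, Matrix.mul_apply, ← hA, map_sum, map_smul, smul_eq_mul]
    exact Finset.sum_congr rfl fun _ _ => mul_comm _ _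
  simp only [plucker, this, Matrix.det_mul, Pi.smul_apply, smul_eq_mul, mul_comm]

/-- The Plücker embedding. -/
def pluckerPt (C : grassmannian K W k) : projSpace K n :=
  Projectivization.mk K (plucker β E (exists_spanPt C).choose.1)
    (plucker_ne_zero β E (exists_spanPt C).choose.2)

theorem pluckerPt_eq {C : grassmannian K W k} {b : Fin k → W} (hb : LinearIndependent K b)
    (hC : span K (range b) = C.1) :
    pluckerPt β E C = (Projectivization.mk K (plucker β E b) (plucker_ne_zero β E hb)) := by
  refine (Projectivization.mk_eq_mk_iff' K _ _ _ _).2 ?_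
  have h1 : span K (range (exists_spanPt C).choose.1) = C.1 :=
    congrArg Subtype.val (exists_spanPt C).choose_spec
  obtain ⟨a, ha⟩ := plucker_smul β E (b := b) (c := (exists_spanPt C).choose.1) fun j => by
    rw [hC, ← h1]
    exact subset_span ⟨j, rfl⟩
  exact ⟨a, ha.symm⟩

theorem homAt_pluckerPt (C : grassmannian K W k) :
    HomAt (Y := projSpace K n) (pluckerPt β E) C := by
  obtain ⟨b, hb, h⟩ := (regSub_taut C).exists_frame C.2
  refine homAt_projSpace (b := fun D => plucker β E fun j => b j D) ?_ ?_
  · refine vreg_pi.2 fun u => vreg_field.2 (det_mem fun i j => hb j (β.coord (E u i)))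
  · filter_upwards [h] with D hD
    exact ⟨plucker_ne_zero β E hD.1, pluckerPt_eq β E hD.1 hD.2⟩

/-- The frame reconstructed from the ratios of the Plücker coordinates. -/
def unplucker (u : Fin (n + 1)) (p : projSpace K n) : Fin k → W := fun j =>
  ∑ i, (hcoord p (E.symm (Function.update (E u) j i)) / hcoord p u) • β i

omit [FiniteDimensional K W] in
theorem vreg_unplucker {u : Fin (n + 1)} {p : projSpace K n} (hp : hcoord p u ≠ 0) :
    VReg ((projSpace K n).regAlg p) (unplucker β E u) :=
  vreg_pi.2 fun _ => VReg.sum _ fun _ _ => VReg.smul (regAt_hcoord_div hp _) (VReg.const _)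

theorem det_updateRow_one {k : ℕ} (j : Fin k) (r : Fin k → K) :
    ((1 : Matrix (Fin k) (Fin k) K).updateRow j r).det = r j := by
  rw [← Matrix.cramer_transpose_apply, Matrix.transpose_one, Matrix.cramer_one]
  rfl

omit [FiniteDimensional K W] in
theorem plucker_update {u : Fin (n + 1)} {b : Fin k → W}
    (hb : ∀ i j, β.coord (E u i) (b j) = if i = j then 1 else 0) (j : Fin k) (i : Fin N) :
    plucker β E b (E.symm (Function.update (E u) j i)) = β.coord i (b j) := by
  rw [plucker, ← det_updateRow_one j fun l => β.coord i (b l)]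
  congr 1
  ext a l
  rw [Matrix.of_apply, Equiv.apply_symm_apply, Matrix.updateRow_apply]
  split_ifs with h
  · rw [h, Function.update_self]
  · rw [Function.update_of_ne h, hb, Matrix.one_apply]

/-- On the image of the Plücker embedding, the reconstructed frame spans the original subspace. -/
theorem span_unplucker {u : Fin (n + 1)} {C : grassmannian K W k}
    (hu : hcoord (pluckerPt β E C : projSpace K n) u ≠ 0) :
    (LinearIndependent K (unplucker β E u (pluckerPt β E C)) ∧
      span K (range (unplucker β E u (pluckerPt β E C))) = C.1) ∧
      ∀ v, hcoord (pluckerPt β E C : projSpace K n) v / hcoord (pluckerPt β E C : projSpace K n) u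
        = plucker β E (unplucker β E u (pluckerPt β E C)) v := by
  obtain ⟨c, hc⟩ := exists_spanPt C
  have hcC : span K (range c.1) = C.1 := congrArg Subtype.val hc
  have hdet : (Matrix.of fun i j => β.coord (E u i) ((c.1 : Fin k → W) j)).det ≠ 0 := by
    rw [pluckerPt_eq β E c.2 hcC] at hu
    exact (hcoord_mk_ne _ _).1 hu
  obtain ⟨h1, h2, h3⟩ := solve_frame (φ := fun i => β.coord (E u i)) ⟨c, hc, hdet⟩
  set b : Fin k → W := fun j => solve C.1 (fun i => β.coord (E u i)) (Pi.single j 1) with hb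
  have hpb := pluckerPt_eq β E h2 h3
  have hbu : plucker β E b u = 1 := by
    have : (Matrix.of fun i j => β.coord (E u i) (b j)) = 1 := by
      ext i j; rw [Matrix.of_apply, h1, Matrix.one_apply]
    rw [plucker, this, Matrix.det_one]
  have hrat : ∀ v, hcoord (pluckerPt β E C : projSpace K n) v /
      hcoord (pluckerPt β E C : projSpace K n) u = plucker β E b v := by
    intro v
    rw [hpb, hcoord_mk_div, hbu, div_one]
  have hun : unplucker β E u (pluckerPt β E C) = b := by
    funext j
    refine (Finset.sum_congr rfl fun i _ => ?_).trans (β.sum_repr (b j))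
    rw [hrat, plucker_update β E h1 j i]
    rfl
  rw [hun]
  exact ⟨⟨h2, h3⟩, hrat⟩

/-- Closed subspaces of Grassmannians are projective varieties. -/
theorem isProjectiveVariety_of_isClosed {S : Set (grassmannian K W k)} (hS : IsClosed S)
    (β : Module.Basis (Fin N) K W) (E : Fin (n + 1) ≃ (Fin k → Fin N)) :
    IsProjectiveVariety ((grassmannian K W k).sub S) := by
  let P : Hom (grassmannian K W k) (projSpace K n) := Hom.mk' (pluckerPt β E) (homAt_pluckerPt β E)
  have hex : ∀ p : projSpace K n, ∃ u, hcoord p u ≠ 0 := fun p =>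
    Function.ne_iff.1 (mk_hcoord p).choose
  have hcl : IsClosed (P '' S) := by
    rw [← isOpen_compl_iff, isOpen_iff_mem_nhds]
    intro p hp
    obtain ⟨u, hu⟩ := hex p
    have hun := vreg_unplucker β E hu
    by_cases hE : ∀ v, hcoord p v / hcoord p u = plucker β E (unplucker β E u p) v
    · have hli : LinearIndependent K (unplucker β E u p) := by
        refine linearIndependent_of_det_ne_zero (fun i => β.coord (E u i)) ?_
        have := hE u
        rw [div_self hu] at this
        intro h0
        exact one_ne_zero (this.trans h0)
      let C : grassmannian K W k := spanPt ⟨_, hli⟩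
      have hpC : P C = p := by
        refine (pluckerPt_eq β E hli rfl).trans ?_
        obtain ⟨h0, h1⟩ := mk_hcoord p
        refine Eq.trans ?_ h1
        refine (Projectivization.mk_eq_mk_iff' K _ _ _ _).2 ⟨(hcoord p u)⁻¹, ?_⟩
        funext v
        rw [← hE v, Pi.smul_apply, smul_eq_mul, div_eq_inv_mul]
      have hCS : C ∉ S := fun h => hp ⟨C, h, hpC⟩
      have hc := (homAt_spanOr C hun hli).1
      have hCC : spanOr C (unplucker β E u p) = C := Subtype.ext (spanOr_val C hli)
      have hmem : spanOr C (unplucker β E u p) ∉ S := by rwa [hCC]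
      filter_upwards [hc.eventually (hS.isOpen_compl.mem_nhds hmem),
        (isOpen_hcoord_ne u).mem_nhds hu] with q h1 h2 h3
      obtain ⟨D, hD, rfl⟩ := h3
      obtain ⟨⟨h4, h5⟩, -⟩ := span_unplucker β E h2
      refine h1 ?_
      have : spanOr C (unplucker β E u (P D)) = D := Subtype.ext ((spanOr_val C h4).trans h5)
      rw [this]; exact hD
    · push Not at hE
      obtain ⟨v, hv⟩ := hE
      have h1 : (fun q : projSpace K n => plucker β E (unplucker β E u q) v) ∈
          (projSpace K n).regAlg p :=
        det_mem fun i j => (vreg_pi.1 hun j) (β.coord (E v i))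
      have h2 := ((projSpace K n).regAlg p).sub_mem (regAt_hcoord_div hu v) h1
      filter_upwards [regAlg_ne h2 (sub_ne_zero.2 hv), (isOpen_hcoord_ne u).mem_nhds hu]
        with q h3 h4 h5
      obtain ⟨D, hD, rfl⟩ := h5
      exact h3 (sub_eq_zero.2 ((span_unplucker β E h4).2 v))
  have hinv : ∀ p : (projSpace K n).sub (P '' S), ∃ C ∈ S, P C = p.1 := fun p => p.2
  choose Q hQS hQ using hinv
  have hQh : ∀ p, HomAt Q p := by
    intro p
    obtain ⟨u, hu⟩ := hex p.1
    have hun := (vreg_unplucker β E hu).restrict (S := P '' S)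
    refine homAt_grassmannian_iff.2 (RegSub.of_frame (fun j q => unplucker β E u q.1 j)
      (vreg_pi.1 hun) ?_)
    filter_upwards [((isOpen_hcoord_ne u).preimage continuous_sub_val).mem_nhds hu] with q hq
    have hq' : hcoord (pluckerPt β E (Q q) : projSpace K n) u ≠ 0 := by
      have : pluckerPt β E (Q q) = q.1 := hQ q
      rw [this]; exact hq
    have h1 := (span_unplucker β E hq').1
    have h2 : pluckerPt β E (Q q) = q.1 := hQ q
    rw [h2] at h1
    exact h1
  have hinj : ∀ C D, P C = P D → C = D := by
    intro C D h
    obtain ⟨u, hu⟩ := hex (P C)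
    have h1 := (span_unplucker β E hu).1.2
    have hu' : hcoord (P D) u ≠ 0 := by rw [← h]; exact hu
    have h2 := (span_unplucker β E hu').1.2
    have h' : (pluckerPt β E C : projSpace K n) = pluckerPt β E D := h
    refine Subtype.ext ?_
    rw [← h1, ← h2, h']
  refine ⟨n, P '' S, hcl, (P.comp (Hom.incl S)).codRestrict _ fun C => ⟨C.1, C.2, rfl⟩,
    (Hom.mk' Q hQh).codRestrict S hQS, fun C => ?_, fun p => ?_⟩
  · exact Subtype.ext (hinj _ _ (hQ _))
  · exact Subtype.ext (hQ p)

theorem isProjectiveVariety_grassmannian_sub [Nontrivial W] {S : Set (grassmannian K W k)}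
    (hS : IsClosed S) : IsProjectiveVariety ((grassmannian K W k).sub S) := by
  have hpos : 0 < finrank K W := Module.finrank_pos
  have : NeZero (finrank K W) := ⟨hpos.ne'⟩
  have hcard : Fintype.card (Fin k → Fin (finrank K W)) ≠ 0 := Fintype.card_ne_zero
  obtain ⟨n, hn⟩ := Nat.exists_eq_succ_of_ne_zero hcard
  exact isProjectiveVariety_of_isClosed hS (Module.finBasis K W) (Fintype.equivFinOfCardEq hn).symm

end Plucker

/-! ### Noetherian spaces -/

section Noetherian

variable {W : Type u} [AddCommGroup W] [Module K W] [FiniteDimensional K W] {k : ℕ}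

instance : TopologicalSpace.NoetherianSpace (affine K W) := by
  let B := Module.finBasis K W
  let σ := Fin (finrank K W)
  let φ : W → (MvPolynomial σ K →ₐ[K] K) := fun x => MvPolynomial.aeval fun i => B.coord i x
  let ev : W → PrimeSpectrum (MvPolynomial σ K) := fun x => PrimeSpectrum.comap (φ x).toRingHom ⊥
  have hφ : ∀ p : W → K, p ∈ polyFun K W ↔ ∃ f, ∀ x, φ x f = p x := by
    intro p
    constructor
    · intro hp
      induction hp using Algebra.adjoin_induction with
      | mem p hp =>
        obtain ⟨l, rfl⟩ := hp
        refine ⟨∑ i, MvPolynomial.C (l (B i)) * MvPolynomial.X i, fun x => ?_⟩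
        simp only [φ, map_sum, map_mul, MvPolynomial.aeval_X, MvPolynomial.algHom_C]
        conv_rhs => rw [← B.sum_repr x, map_sum]
        exact Finset.sum_congr rfl fun i _ => by
          rw [map_smul, smul_eq_mul, mul_comm]; rfl
      | algebraMap r => exact ⟨MvPolynomial.C r, fun x => by simp [φ]⟩
      | add f g _ _ hf hg =>
        obtain ⟨a, ha⟩ := hf
        obtain ⟨b, hb⟩ := hg
        exact ⟨a + b, fun x => by rw [map_add, ha, hb]; rfl⟩
      | mul f g _ _ hf hg =>
        obtain ⟨a, ha⟩ := hf
        obtain ⟨b, hb⟩ := hg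
        exact ⟨a * b, fun x => by rw [map_mul, ha, hb]; rfl⟩
    · rintro ⟨f, hf⟩
      have : p = fun x => φ x f := funext fun x => (hf x).symm
      rw [this]
      clear hf this
      induction f using MvPolynomial.induction_on with
      | C a =>
        have : (fun x => φ x (MvPolynomial.C a)) = algebraMap K (W → K) a := by
          funext x; simp [φ]
        rw [this]; exact Subalgebra.algebraMap_mem _ _
      | add f g hf hg =>
        have : (fun x => φ x (f + g)) = (fun x => φ x f) + fun x => φ x g := by
          funext x; exact map_add _ _ _
        rw [this]; exact Subalgebra.add_mem _ hf hg
      | mul_X f i hf =>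
        have : (fun x => φ x (f * MvPolynomial.X i)) = (fun x => φ x f) * (B.coord i : W → K) := by
          funext x
          simp only [map_mul, Pi.mul_apply]
          congr 1
          exact MvPolynomial.aeval_X _ _
        rw [this]; exact Subalgebra.mul_mem _ hf (Algebra.subset_adjoin ⟨_, rfl⟩)
  have hbo : ∀ f, ev ⁻¹' (PrimeSpectrum.basicOpen f : Set _) = {x | φ x f ≠ 0} := by
    intro f
    ext x
    exact not_congr (Submodule.mem_bot K)
  have hind : Topology.IsInducing (X := affine K W) ev := by
    constructor
    rw [PrimeSpectrum.isTopologicalBasis_basic_opens.eq_generateFrom]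
    refine Eq.trans ?_ (induced_generateFrom_eq (f := ev)).symm
    change TopologicalSpace.generateFrom _ = _
    congr 1
    ext U
    constructor
    · rintro ⟨p, hp, rfl⟩
      obtain ⟨f, hf⟩ := (hφ p).1 hp
      refine ⟨_, ⟨f, rfl⟩, ?_⟩
      refine (hbo f).trans ?_
      ext x; simp [hf]
    · rintro ⟨_, ⟨f, rfl⟩, rfl⟩
      exact ⟨fun x => φ x f, (hφ _).2 ⟨f, fun _ => rfl⟩, hbo f⟩
  exact hind.noetherianSpace

instance {X : SpaceWithFunctions K} [TopologicalSpace.NoetherianSpace X] (S : Set X) :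
    TopologicalSpace.NoetherianSpace (X.sub S) :=
  TopologicalSpace.NoetherianSpace.set S

instance : TopologicalSpace.NoetherianSpace (frames K W k) :=
  inferInstanceAs (TopologicalSpace.NoetherianSpace
    ((affine K (Fin k → W)).sub {b : Fin k → W | LinearIndependent K b}))

instance : TopologicalSpace.NoetherianSpace (grassmannian K W k) :=
  TopologicalSpace.noetherianSpace_of_surjective (α := frames K W k) spanPt
    (continuous_quot (X := frames K W k)) exists_spanPt

theorem finite_connectedComponents {α : Type*} [TopologicalSpace α]
    [TopologicalSpace.NoetherianSpace α] : Finite (ConnectedComponents α) := by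
  have := (TopologicalSpace.NoetherianSpace.finite_irreducibleComponents (α := α)).to_subtype
  have hne : ∀ Z : irreducibleComponents α, Z.1.Nonempty := fun Z => Z.2.1.nonempty
  refine Finite.of_surjective (α := irreducibleComponents α)
    (fun Z => ((hne Z).some : ConnectedComponents α)) fun c => ?_
  obtain ⟨x, rfl⟩ := ConnectedComponents.surjective_coe c
  refine ⟨⟨irreducibleComponent x, irreducibleComponent_mem_irreducibleComponents x⟩, ?_⟩
  refine ConnectedComponents.coe_eq_coe'.2 ?_
  exact (isIrreducible_irreducibleComponent (x := x)).isPreirreducible.isPreconnected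
    |>.subset_connectedComponent mem_irreducibleComponent
      (hne ⟨irreducibleComponent x, irreducibleComponent_mem_irreducibleComponents x⟩).some_mem

end Noetherian

end SpaceWithFunctions

/-! ### The structure of path-length-graded algebras -/

namespace PathAlgebra

theorem vertex_mul_vertex (i : V) : vertex K i * vertex K i = vertex K i := by
  rw [vertex, ← map_mul]
  exact RingQuot.mkAlgHom_rel K (PathAlgebraRel.idem i)

theorem vertex_mul_vertex_of_ne {i j : V} (h : i ≠ j) : vertex K i * vertex K j = 0 := by
  rw [vertex, vertex, ← map_mul]
  exact (RingQuot.mkAlgHom_rel K (PathAlgebraRel.orth i j h)).trans (map_zero _)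

theorem sum_vertex : ∑ i : V, vertex K i = 1 := by
  simp only [vertex]
  rw [← map_sum]
  exact (RingQuot.mkAlgHom_rel K PathAlgebraRel.total).trans (map_one _)

theorem arrow_mul_vertex {i j : V} (a : i ⟶ j) : arrow K a * vertex K i = arrow K a := by
  rw [vertex, arrow, ← map_mul]
  exact RingQuot.mkAlgHom_rel K (PathAlgebraRel.source a)

theorem vertex_mul_arrow {i j : V} (a : i ⟶ j) : vertex K j * arrow K a = arrow K a := by
  rw [vertex, arrow, ← map_mul]
  exact RingQuot.mkAlgHom_rel K (PathAlgebraRel.target a)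

theorem vertex_mul_ofPath {i j : V} (p : Quiver.Path i j) :
    vertex K j * ofPath K p = ofPath K p := by
  cases p with
  | nil => exact vertex_mul_vertex i
  | cons p a => rw [ofPath, ← mul_assoc, vertex_mul_arrow]

/-- Induction on the elements of the path algebra, via the generators. -/
theorem mul_mem_of_generators (P : Submodule K (PathAlgebra K V))
    (hv : ∀ i, ∀ y ∈ P, vertex K i * y ∈ P)
    (ha : ∀ {i j : V} (a : i ⟶ j), ∀ y ∈ P, arrow K a * y ∈ P)
    (x : PathAlgebra K V) : ∀ y ∈ P, x * y ∈ P := by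
  obtain ⟨f, rfl⟩ := RingQuot.mkAlgHom_surjective K (PathAlgebraRel K V) x
  induction f using FreeAlgebra.induction with
  | grade0 r =>
    intro y hy
    rw [AlgHom.commutes, ← Algebra.smul_def]
    exact P.smul_mem r hy
  | grade1 s =>
    obtain i | ⟨i, j, a⟩ := s
    · exact hv i
    · exact ha a
  | mul f g hf hg =>
    intro y hy
    rw [map_mul, mul_assoc]
    exact hf _ (hg _ hy)
  | add f g hf hg =>
    intro y hy
    rw [map_add, add_mul]
    exact P.add_mem (hf _ hy) (hg _ hy)

theorem iSup_degreePart : ⨆ l, degreePart K V l = ⊤ := by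
  have hpath : ∀ {i j : V} (p : Quiver.Path i j), ofPath K p ∈ ⨆ l, degreePart K V l :=
    fun {i j} p => Submodule.mem_iSup_of_mem p.length
      (subset_span ⟨i, j, p, rfl, rfl⟩)
  have key : ∀ x : PathAlgebra K V, (∀ {i j : V} (p : Quiver.Path i j),
      x * ofPath K p ∈ ⨆ l, degreePart K V l) →
      ∀ y ∈ ⨆ l, degreePart K V l, x * y ∈ ⨆ l, degreePart K V l := by
    intro x hx y hy
    have : ⨆ l, degreePart K V l ≤ (⨆ l, degreePart K V l).comap (LinearMap.mulLeft K x) := by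
      refine iSup_le fun l => span_le.2 ?_
      rintro _ ⟨i, j, p, -, rfl⟩
      exact hx p
    exact this hy
  refine eq_top_iff.2 fun x _ => ?_
  have := mul_mem_of_generators (⨆ l, degreePart K V l) (fun k => key _ fun {i j} p => ?_)
    (fun {k k'} a => key _ fun {i j} p => ?_) x 1 ?_
  · rwa [mul_one] at this
  · by_cases h : k = j
    · subst h; rw [vertex_mul_ofPath]; exact hpath p
    · rw [← vertex_mul_ofPath p, ← mul_assoc, vertex_mul_vertex_of_ne h, zero_mul]
      exact zero_mem _
  · by_cases h : k = j
    · subst h; exact hpath (p.cons a)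
    · rw [← vertex_mul_ofPath p, ← arrow_mul_vertex a, mul_assoc, ← mul_assoc (vertex K k),
        vertex_mul_vertex_of_ne h, zero_mul, mul_zero]
      exact zero_mem _
  · rw [← sum_vertex]
    exact sum_mem fun i _ => hpath (Quiver.Path.nil : Quiver.Path i i)

theorem finite_degreePart [∀ i j : V, Finite (i ⟶ j)] (l : ℕ) :
    {x : PathAlgebra K V |
      ∃ (i j : V) (p : Quiver.Path i j), p.length = l ∧ x = ofPath K p}.Finite := by
  induction l with
  | zero =>
    refine (Set.finite_range (vertex K : V → PathAlgebra K V)).subset ?_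
    rintro _ ⟨i, j, p, hp, rfl⟩
    obtain rfl := Quiver.Path.eq_of_length_zero p hp
    obtain rfl := Quiver.Path.eq_nil_of_length_zero p hp
    exact ⟨i, rfl⟩
  | succ l ih =>
    have h1 : (range fun s : (Σ i j : V, (i ⟶ j)) => arrow K s.2.2).Finite :=
      Set.finite_range _
    refine (h1.mul ih).subset ?_
    rintro _ ⟨i, j, p, hp, rfl⟩
    cases p with
    | nil => simp at hp
    | cons p a =>
      exact Set.mul_mem_mul ⟨⟨_, _, a⟩, rfl⟩ ⟨_, _, p, by simpa using hp, rfl⟩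

end PathAlgebra

section Algebra

open Polynomial PathAlgebra

theorem idem_mul_self (i : V) : idem π i * idem π i = idem π i := by
  rw [idem, ← map_mul, vertex_mul_vertex]

theorem idem_mul_of_ne {i j : V} (h : i ≠ j) : idem π i * idem π j = 0 := by
  rw [idem, idem, ← map_mul, vertex_mul_vertex_of_ne h, map_zero]

theorem sum_idem : ∑ i : V, idem π i = 1 := by
  simp only [idem]
  rw [← map_sum, sum_vertex, map_one]

theorem idem_mem (i : V) : idem π i ∈ algDegree π 0 :=
  ⟨_, subset_span ⟨i, i, .nil, rfl, rfl⟩, rfl⟩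

theorem algDegree_zero : algDegree π 0 = span K (range (idem π)) := by
  refine le_antisymm ?_ (span_le.2 ?_)
  · rw [algDegree, degreePart, Submodule.map_span, span_le]
    rintro _ ⟨_, ⟨i, j, p, hp, rfl⟩, rfl⟩
    obtain rfl := Quiver.Path.eq_of_length_zero p hp
    obtain rfl := Quiver.Path.eq_nil_of_length_zero p hp
    exact subset_span ⟨i, rfl⟩
  · rintro _ ⟨i, rfl⟩; exact idem_mem i

/-- The degree homomorphism on the path algebra. -/
def pathGrading (π : PathAlgebra K V →ₐ[K] Λ) : PathAlgebra K V →ₐ[K] Λ[X] :=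
  RingQuot.liftAlgHom K ⟨FreeAlgebra.lift K (Sum.elim (fun i => C (idem π i))
    fun s : (Σ i j : V, (i ⟶ j)) => C (π (arrow K s.2.2)) * X), by
    rintro _ _ (i | ⟨i, j, h⟩ | _ | a | a)
    · simp only [map_mul, FreeAlgebra.lift_ι_apply, Sum.elim_inl]
      rw [← C_mul, idem_mul_self]
    · simp only [map_mul, FreeAlgebra.lift_ι_apply, Sum.elim_inl, map_zero]
      rw [← C_mul, idem_mul_of_ne h, C_0]
    · simp only [map_sum, FreeAlgebra.lift_ι_apply, Sum.elim_inl, map_one]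
      rw [← map_sum, sum_idem, C_1]
    · simp only [map_mul, FreeAlgebra.lift_ι_apply, Sum.elim_inl, Sum.elim_inr]
      rw [mul_assoc, X_mul_C, ← mul_assoc, ← C_mul, idem, ← map_mul, arrow_mul_vertex]
    · simp only [map_mul, FreeAlgebra.lift_ι_apply, Sum.elim_inl, Sum.elim_inr]
      rw [← mul_assoc, ← C_mul, idem, ← map_mul, vertex_mul_arrow]⟩

theorem pathGrading_vertex (i : V) : pathGrading π (vertex K i) = C (idem π i) := by
  simp [pathGrading, vertex]

theorem pathGrading_arrow {i j : V} (a : i ⟶ j) :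
    pathGrading π (arrow K a) = C (π (arrow K a)) * X := by
  simp [pathGrading, arrow]

theorem pathGrading_of_mem {l : ℕ} {x : PathAlgebra K V} (hx : x ∈ degreePart K V l) :
    pathGrading π x = C (π x) * X ^ l := by
  induction hx using Submodule.span_induction with
  | mem x hx =>
    obtain ⟨i, j, p, rfl, rfl⟩ := hx
    induction p with
    | nil => simp [ofPath, pathGrading_vertex, idem]
    | cons p a ih =>
      rw [ofPath, map_mul, pathGrading_arrow, ih, map_mul, C_mul, Quiver.Path.length_cons,
          pow_succ',
        mul_assoc, mul_assoc, ← mul_assoc X, X_mul_C, mul_assoc]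
  | zero => simp
  | add x y _ _ hx hy => rw [map_add, hx, hy, map_add, C_add, add_mul]
  | smul r x _ hx => rw [map_smul, hx, map_smul, ← smul_mul_assoc, smul_C]

theorem algDegree_succ_mem {l : ℕ} {P : Submodule K Λ}
    (h : ∀ a ∈ algDegree π 1, ∀ b ∈ algDegree π l, a * b ∈ P) : algDegree π (l + 1) ≤ P := by
  rw [algDegree, degreePart, Submodule.map_span, span_le]
  rintro _ ⟨_, ⟨i, j, p, hp, rfl⟩, rfl⟩
  cases p with
  | nil => simp at hp
  | cons p a =>
    change π (arrow K a * ofPath K p) ∈ P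
    rw [map_mul]
    refine h _ ⟨_, subset_span ⟨_, _, .cons .nil a, rfl, ?_⟩, rfl⟩ _
      ⟨_, subset_span ⟨_, _, p, by simpa using hp, rfl⟩, rfl⟩
    exact (arrow_mul_vertex a).symm

variable (hπ : IsPathLengthGraded π)

include hπ

theorem pathGrading_eq_zero {x : PathAlgebra K V} (hx : π x = 0) : pathGrading π x = 0 := by
  have h1 : LinearMap.ker π.toLinearMap ≤ LinearMap.ker (pathGrading π).toLinearMap := by
    refine hπ.homogeneous.trans (iSup_le fun l y hy => ?_)
    have h2 : π y = 0 := hy.1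
    change pathGrading π y = 0
    rw [pathGrading_of_mem hy.2, h2, C_0, zero_mul]
  exact h1 (show π x = 0 from hx)

theorem exists_grading : ∃ θ : Λ →ₐ[K] Λ[X], ∀ x, θ (π x) = pathGrading π x := by
  obtain ⟨s, hs⟩ := π.toLinearMap.exists_rightInverse_of_surjective
    (LinearMap.range_eq_top.2 hπ.surjective)
  have hs' : ∀ a, π (s a) = a := fun a => LinearMap.congr_fun hs a
  have key : ∀ x y, π x = π y → pathGrading π x = pathGrading π y := by
    intro x y h
    rw [← sub_eq_zero, ← map_sub]
    exact pathGrading_eq_zero hπ (by rw [map_sub, h, sub_self])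
  refine ⟨AlgHom.ofLinearMap ((pathGrading π).toLinearMap ∘ₗ s) ?_ ?_, fun x => ?_⟩
  · change pathGrading π (s 1) = 1
    rw [key (s 1) 1 (by rw [hs', map_one]), map_one]
  · intro a b
    change pathGrading π (s (a * b)) = pathGrading π (s a) * pathGrading π (s b)
    rw [← map_mul]
    exact key _ _ (by rw [hs', map_mul, hs', hs'])
  · exact key _ _ (hs' _)

theorem iSup_algDegree : ⨆ l, algDegree π l = ⊤ := by
  simp only [algDegree]
  rw [← Submodule.map_iSup, iSup_degreePart, Submodule.map_top]
  exact LinearMap.range_eq_top.2 hπ.surjective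

/-- The homomorphism `Λ → Λ[X]`, `a ↦ ∑ a_l X ^ l`. -/
def grading : Λ →ₐ[K] Λ[X] := (exists_grading hπ).choose

theorem grading_of_mem {l : ℕ} {a : Λ} (ha : a ∈ algDegree π l) :
    grading hπ a = C a * X ^ l := by
  obtain ⟨x, hx, rfl⟩ := ha
  exact ((exists_grading hπ).choose_spec x).trans (pathGrading_of_mem hx)

/-- The projection onto the component of degree `l`. -/
def algProj (l : ℕ) : Λ →ₗ[K] Λ := ((lcoeff Λ l).restrictScalars K) ∘ₗ (grading hπ).toLinearMap

theorem algProj_of_mem {l : ℕ} {a : Λ} (ha : a ∈ algDegree π l) (m : ℕ) :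
    algProj hπ m a = if m = l then a else 0 := by
  change (grading hπ a).coeff m = _
  rw [grading_of_mem hπ ha, coeff_C_mul, coeff_X_pow]
  split_ifs <;> simp

theorem algProj_mem (l : ℕ) (a : Λ) : algProj hπ l a ∈ algDegree π l := by
  have ha : a ∈ ⨆ l, algDegree π l := by rw [iSup_algDegree hπ]; trivial
  induction ha using Submodule.iSup_induction' with
  | mem m a ha =>
    rw [algProj_of_mem hπ ha]
    split_ifs with h
    · rwa [h]
    · exact zero_mem _
  | zero => rw [map_zero]; exact zero_mem _
  | add x y _ _ hx hy => rw [map_add]; exact Submodule.add_mem _ hx hy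

theorem grading_eq_iff {l : ℕ} {a : Λ} : a ∈ algDegree π l ↔ grading hπ a = C a * X ^ l := by
  refine ⟨grading_of_mem hπ, fun h => ?_⟩
  have : algProj hπ l a = a := by
    change (grading hπ a).coeff l = a
    rw [h, coeff_C_mul, coeff_X_pow_self, mul_one]
  rw [← this]
  exact algProj_mem hπ l a

theorem algDegree_mul {l m : ℕ} {a b : Λ} (ha : a ∈ algDegree π l) (hb : b ∈ algDegree π m) :
    a * b ∈ algDegree π (l + m) := by
  rw [grading_eq_iff hπ] at *
  rw [map_mul, ha, hb, C_mul, mul_assoc, ← mul_assoc (X ^ l), X_pow_mul_C, pow_add, mul_assoc,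
    mul_assoc]

theorem algProj_mul_left {m : ℕ} {a : Λ} (ha : a ∈ algDegree π m) (l : ℕ) (b : Λ) :
    algProj hπ (m + l) (a * b) = a * algProj hπ l b := by
  change (grading hπ (a * b)).coeff (m + l) = a * (grading hπ b).coeff l
  rw [map_mul, grading_of_mem hπ ha, mul_assoc, coeff_C_mul, add_comm, coeff_X_pow_mul]

theorem algProj_mul_right {m : ℕ} {a : Λ} (ha : a ∈ algDegree π m) (l : ℕ) (b : Λ) :
    algProj hπ (l + m) (b * a) = algProj hπ l b * a := by
  change (grading hπ (b * a)).coeff (l + m) = (grading hπ b).coeff l * a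
  rw [map_mul, grading_of_mem hπ ha, ← mul_assoc, coeff_mul_X_pow, coeff_mul_C]

theorem algProj_algProj (l m : ℕ) (a : Λ) :
    algProj hπ l (algProj hπ m a) = if l = m then algProj hπ m a else 0 :=
  algProj_of_mem hπ (algProj_mem hπ m a) l

theorem algProj_idem_mul (l : ℕ) (i : V) (b : Λ) :
    algProj hπ l (idem π i * b) = idem π i * algProj hπ l b := by
  simpa using algProj_mul_left hπ (idem_mem (π := π) i) l b

theorem algProj_mul_idem (l : ℕ) (i : V) (b : Λ) :
    algProj hπ l (b * idem π i) = algProj hπ l b * idem π i := by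
  simpa using algProj_mul_right hπ (idem_mem (π := π) i) l b

theorem exists_algDegree_eq_bot : ∃ N, ∀ l ≥ N, algDegree π l = ⊥ := by
  obtain ⟨N, hN⟩ := hπ.long_paths
  refine ⟨N, fun l hl => ?_⟩
  refine eq_bot_iff.2 (Submodule.map_le_iff_le_comap.2 ?_)
  exact hN l hl

/-- A bound for the degrees of nonzero elements. -/
def algBound : ℕ := (exists_algDegree_eq_bot hπ).choose

theorem algDegree_eq_bot {l : ℕ} (hl : algBound hπ ≤ l) : algDegree π l = ⊥ :=
  (exists_algDegree_eq_bot hπ).choose_spec l hl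

theorem algProj_eq_zero {l : ℕ} (hl : algBound hπ ≤ l) (a : Λ) : algProj hπ l a = 0 := by
  have := algProj_mem hπ l a
  rwa [algDegree_eq_bot hπ hl, Submodule.mem_bot] at this

theorem sum_algProj (a : Λ) : ∑ l ∈ Finset.range (algBound hπ), algProj hπ l a = a := by
  have ha : a ∈ ⨆ l, algDegree π l := by rw [iSup_algDegree hπ]; trivial
  induction ha using Submodule.iSup_induction' with
  | mem m a ha =>
    simp only [algProj_of_mem hπ ha]
    rw [Finset.sum_ite_eq']
    split_ifs with h
    · rfl
    · rw [Finset.mem_range, not_lt] at h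
      rw [algDegree_eq_bot hπ h, Submodule.mem_bot] at ha
      exact ha.symm
  | zero => simp
  | add x y _ _ hx hy => simp only [map_add, Finset.sum_add_distrib, hx, hy]

/-- Homogeneity of a subspace, in terms of the projections. -/
theorem homogeneous_iff {C : Submodule K Λ} :
    C ≤ ⨆ l, C ⊓ algDegree π l ↔ ∀ l, ∀ c ∈ C, algProj hπ l c ∈ C := by
  constructor
  · intro h l c hc
    have := h hc
    clear hc
    induction this using Submodule.iSup_induction' with
    | mem m a ha =>
      rw [algProj_of_mem hπ ha.2]
      split_ifs
      · exact ha.1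
      · exact zero_mem _
    | zero => rw [map_zero]; exact zero_mem _
    | add x y _ _ hx hy => rw [map_add]; exact Submodule.add_mem _ hx hy
  · intro h c hc
    rw [← sum_algProj hπ c]
    exact sum_mem fun l _ =>
      Submodule.mem_iSup_of_mem l ⟨h l c hc, algProj_mem hπ l c⟩

theorem finiteDimensional_of_graded [∀ i j : V, Finite (i ⟶ j)] : FiniteDimensional K Λ := by
  have h1 : ∀ l, FiniteDimensional K (algDegree π l) := fun l => by
    have : FiniteDimensional K (degreePart K V l) :=
      FiniteDimensional.span_of_finite K (finite_degreePart l)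
    exact inferInstanceAs (FiniteDimensional K ((degreePart K V l).map π.toLinearMap))
  have h2 : (⊤ : Submodule K Λ) = ⨆ l : Fin (algBound hπ), algDegree π l := by
    refine le_antisymm (fun a _ => ?_) le_top
    rw [← sum_algProj hπ a]
    exact sum_mem fun l hl =>
      Submodule.mem_iSup_of_mem ⟨l, Finset.mem_range.1 hl⟩ (algProj_mem hπ l a)
  have : FiniteDimensional K (⊤ : Submodule K Λ) := by rw [h2]; infer_instance
  exact Module.finite_def.2 ((Submodule.fg_iff_finiteDimensional _).2 this)

/-- The elements of degree at least `l`. -/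
def algGE (l : ℕ) : Submodule K Λ := ⨅ m : Fin l, LinearMap.ker (algProj hπ m)

theorem mem_algGE {l : ℕ} {a : Λ} : a ∈ algGE hπ l ↔ ∀ m < l, algProj hπ m a = 0 := by
  simp only [algGE, Submodule.mem_iInf, LinearMap.mem_ker]
  exact ⟨fun h m hm => h ⟨m, hm⟩, fun h m => h m m.2⟩

theorem algDegree_le_algGE {l m : ℕ} (h : l ≤ m) : algDegree π m ≤ algGE hπ l := by
  intro a ha
  rw [mem_algGE]
  intro n hn
  rw [algProj_of_mem hπ ha, if_neg (by omega)]

theorem algGE_le {l : ℕ} {P : Submodule K Λ} (h : ∀ m ≥ l, algDegree π m ≤ P) :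
    algGE hπ l ≤ P := by
  intro a ha
  rw [← sum_algProj hπ a]
  refine sum_mem fun m _ => ?_
  by_cases hm : m < l
  · rw [(mem_algGE hπ).1 ha m hm]; exact zero_mem _
  · exact h m (not_lt.1 hm) (algProj_mem hπ m a)

theorem algGE_mul {l m : ℕ} {a b : Λ} (ha : a ∈ algGE hπ l) (hb : b ∈ algGE hπ m) :
    a * b ∈ algGE hπ (l + m) := by
  have h1 : ∀ l' ≥ l, ∀ a ∈ algDegree π l', a * b ∈ algGE hπ (l + m) := by
    intro l' hl a ha
    have : algGE hπ m ≤ (algGE hπ (l + m)).comap (LinearMap.mulLeft K a) :=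
      algGE_le hπ fun m' hm b hb =>
        algDegree_le_algGE hπ (by omega) (algDegree_mul hπ ha hb)
    exact this hb
  have : algGE hπ l ≤ (algGE hπ (l + m)).comap (LinearMap.mulRight K b) :=
    algGE_le hπ fun l' hl a ha => h1 l' hl a ha
  exact this ha

theorem algGE_bound {a : Λ} (ha : a ∈ algGE hπ (algBound hπ)) : a = 0 := by
  rw [← sum_algProj hπ a]
  exact Finset.sum_eq_zero fun l hl => (mem_algGE hπ).1 ha l (Finset.mem_range.1 hl)

theorem mem_algGE_zero (a : Λ) : a ∈ algGE hπ 0 := (mem_algGE hπ).2 fun m hm => absurd hm (by omega)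

theorem mem_jacobson_iff {a : Λ} : a ∈ Ring.jacobson Λ ↔ a ∈ algGE hπ 1 := by
  have hpow : ∀ (b : Λ), b ∈ algGE hπ 1 → ∀ n, b ^ n ∈ algGE hπ n := by
    intro b hb n
    induction n with
    | zero => exact mem_algGE_zero hπ _
    | succ n ih => rw [pow_succ]; exact algGE_mul hπ ih hb
  have h1 : ∀ a ∈ algGE hπ 1, a ∈ Ring.jacobson Λ := by
    intro a ha
    rw [← Ideal.jacobson_bot, Ideal.mem_jacobson_iff]
    intro y
    have hn : IsNilpotent (y * a) := ⟨algBound hπ, algGE_bound hπ (hpow _ (by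
      simpa using algGE_mul hπ (mem_algGE_zero hπ y) ha) _)⟩
    obtain ⟨z, hz⟩ := hn.isUnit_one_add.exists_left_inv
    refine ⟨z, ?_⟩
    rw [Submodule.mem_bot, sub_eq_zero, ← hz, mul_add, mul_one, mul_assoc, add_comm]
  refine ⟨fun ha => ?_, h1 a⟩
  have h2 : algProj hπ 0 a ∈ Ring.jacobson Λ := by
    have h3 : a - algProj hπ 0 a ∈ Ring.jacobson Λ := by
      refine h1 _ ((mem_algGE hπ).2 fun m hm => ?_)
      obtain rfl : m = 0 := by omega
      rw [map_sub, algProj_algProj, if_pos rfl, sub_self]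
    simpa using Submodule.sub_mem _ ha h3
  have h3 := algProj_mem hπ 0 a
  rw [algDegree_zero] at h3
  obtain ⟨c, hc⟩ := (mem_span_range_iff_exists_fun K).1 h3
  refine (mem_algGE hπ).2 fun m hm => ?_
  obtain rfl : m = 0 := by omega
  rw [← hc] at h2 ⊢
  refine Finset.sum_eq_zero fun i _ => ?_
  have h4 : c i • idem π i ∈ Ring.jacobson Λ := by
    have h5 := (Ring.jacobson Λ).mul_mem_left (idem π i) h2
    rw [Finset.mul_sum, Finset.sum_eq_single i] at h5
    · rwa [mul_smul_comm, idem_mul_self] at h5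
    · intro j _ hj
      rw [mul_smul_comm, idem_mul_of_ne hj.symm, smul_zero]
    · simp
  by_cases hci : c i = 0
  · rw [hci, zero_smul]
  have h5 : idem π i ∈ Ring.jacobson Λ := by
    have := (Ring.jacobson Λ).mul_mem_left (algebraMap K Λ (c i)⁻¹) h4
    rwa [← Algebra.smul_def, smul_smul, inv_mul_cancel₀ hci, one_smul] at this
  rw [← Ideal.jacobson_bot, Ideal.mem_jacobson_iff] at h5
  obtain ⟨z, hz⟩ := h5 (-1)
  rw [Submodule.mem_bot] at hz
  have h6 : (z * -1 * idem π i + z - 1) * idem π i = 0 := by rw [hz, zero_mul]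
  rw [sub_mul, add_mul, mul_assoc, mul_assoc, idem_mul_self] at h6
  have h7 : idem π i = 0 := by
    simpa using h6
  rw [h7, smul_zero]

end Algebra

/-! ### Radical powers and tops of modules -/

section Modules

variable (hπ : IsPathLengthGraded π) {M : Type u} [AddCommGroup M] [Module Λ M]

include hπ

theorem smul_mem_radPow {l : ℕ} : ∀ {a : Λ}, a ∈ algGE hπ l → ∀ x : M, a • x ∈ radPow Λ M l := by
  induction l with
  | zero => intro a _ x; trivial
  | succ l ih =>
    intro a ha x
    let P : Submodule K Λ :=
      { carrier := {a | a • x ∈ radPow Λ M (l + 1)}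
        add_mem' := fun {a b} ha hb => by
          simp only [Set.mem_ofPred_eq, add_smul]; exact Submodule.add_mem _ ha hb
        zero_mem' := by simp
        smul_mem' := fun c a ha => by
          simp only [Set.mem_ofPred_eq, Algebra.smul_def, mul_smul]
          exact smul_mem _ _ ha }
    have : algGE hπ (l + 1) ≤ P := by
      refine algGE_le hπ fun m hm => ?_
      obtain ⟨k, rfl⟩ : ∃ k, m = k + 1 := ⟨m - 1, by omega⟩
      refine algDegree_succ_mem fun a ha b hb => ?_
      change (a * b) • x ∈ Ring.jacobson Λ • radPow Λ M l
      rw [mul_smul]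
      refine Submodule.smul_mem_smul ((mem_jacobson_iff hπ).2 (algDegree_le_algGE hπ le_rfl ha))
        (ih (algDegree_le_algGE hπ (by omega) hb) x)
    exact this ha

theorem mem_radPow_iff {ι : Type*} [Fintype ι] {m : ι → M}
    (hm : span Λ (range m) = ⊤) {l : ℕ} {x : M} :
    x ∈ radPow Λ M l ↔ ∃ f : ι → Λ, (∀ r, f r ∈ algGE hπ l) ∧ x = ∑ r, f r • m r := by
  constructor
  · induction l generalizing x with
    | zero =>
      intro _
      have : x ∈ span Λ (range m) := by rw [hm]; trivial
      obtain ⟨f, hf⟩ := (mem_span_range_iff_exists_fun Λ).1 this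
      exact ⟨f, fun r => mem_algGE_zero hπ _, hf.symm⟩
    | succ l ih =>
      intro hx
      change x ∈ Ring.jacobson Λ • radPow Λ M l at hx
      induction hx using Submodule.smul_induction_on' with
      | smul a ha y hy =>
        obtain ⟨f, hf, rfl⟩ := ih hy
        refine ⟨fun r => a * f r, fun r => ?_, ?_⟩
        · rw [add_comm]; exact algGE_mul hπ ((mem_jacobson_iff hπ).1 ha) (hf r)
        · simp only [Finset.smul_sum, mul_smul]
      | add y _ z _ hy hz =>
        obtain ⟨f, hf, rfl⟩ := hy
        obtain ⟨g, hg, rfl⟩ := hz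
        exact ⟨f + g, fun r => Submodule.add_mem _ (hf r) (hg r), by
          simp only [Pi.add_apply, add_smul, Finset.sum_add_distrib]⟩
  · rintro ⟨f, hf, rfl⟩
    exact sum_mem fun r _ => smul_mem_radPow hπ (hf r) _

theorem smul_radPow_eq_zero {l : ℕ} : ∀ {k : ℕ}, algBound hπ ≤ k + l → ∀ {b : Λ},
    b ∈ algGE hπ k → ∀ {x : M}, x ∈ radPow Λ M l → b • x = 0 := by
  induction l with
  | zero =>
    intro k hk b hb x _
    have : b = 0 := algGE_bound hπ ((mem_algGE hπ).2 fun m hm =>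
      (mem_algGE hπ).1 hb m (by omega))
    rw [this, zero_smul]
  | succ l ih =>
    intro k hk b hb x hx
    change x ∈ Ring.jacobson Λ • radPow Λ M l at hx
    induction hx using Submodule.smul_induction_on' with
    | smul a ha y hy =>
      rw [← mul_smul]
      exact ih (k := k + 1) (by omega) (algGE_mul hπ hb ((mem_jacobson_iff hπ).1 ha)) hy
    | add y _ z _ hy hz => rw [smul_add, hy, hz, add_zero]

/-- Nakayama's lemma. -/
theorem eq_top_of_sup_jacobson {P : Submodule Λ M}
    (hP : P ⊔ Ring.jacobson Λ • (⊤ : Submodule Λ M) = ⊤) : P = ⊤ := by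
  have h1 : ∀ l, P ⊔ radPow Λ M l = ⊤ := by
    intro l
    induction l with
    | zero => exact sup_top_eq _
    | succ l ih =>
      rw [eq_top_iff, ← hP]
      refine sup_le le_sup_left ?_
      rw [← ih, Submodule.smul_sup]
      exact sup_le (Submodule.smul_le_right.trans le_sup_left) le_sup_right
  have h2 : radPow Λ M (algBound hπ) = ⊥ := by
    refine eq_bot_iff.2 fun x hx => ?_
    have := smul_radPow_eq_zero hπ (k := 0) (by omega) (mem_algGE_zero hπ (1 : Λ)) hx
    rwa [one_smul] at this
  have := h1 (algBound hπ)
  rwa [h2, sup_bot_eq] at this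

theorem exists_scalar_idem (a : Λ) : ∃ c : V → K, a - ∑ i, c i • idem π i ∈ algGE hπ 1 := by
  have h3 := algProj_mem hπ 0 a
  rw [algDegree_zero] at h3
  obtain ⟨c, hc⟩ := (mem_span_range_iff_exists_fun K).1 h3
  refine ⟨c, (mem_algGE hπ).2 fun m hm => ?_⟩
  obtain rfl : m = 0 := by omega
  rw [hc, map_sub, algProj_algProj, if_pos rfl, sub_self]

theorem idem_mul_scalar {a : Λ} {c : V → K} (h : a - ∑ i, c i • idem π i ∈ algGE hπ 1) (i : V) :
    idem π i * a - c i • idem π i ∈ algGE hπ 1 ∧ a * idem π i - c i • idem π i ∈ algGE hπ 1 := by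
  have h1 := algGE_mul hπ (mem_algGE_zero hπ (idem π i)) h
  have h2 := algGE_mul hπ h (mem_algGE_zero hπ (idem π i))
  rw [mul_sub, Finset.mul_sum, Finset.sum_eq_single i] at h1
  · rw [sub_mul, Finset.sum_mul, Finset.sum_eq_single i] at h2
    · rw [mul_smul_comm, idem_mul_self] at h1
      rw [smul_mul_assoc, idem_mul_self] at h2
      exact ⟨h1, h2⟩
    · intro j _ hj
      rw [smul_mul_assoc, idem_mul_of_ne hj, smul_zero]
    · simp
  · intro j _ hj
    rw [mul_smul_comm, idem_mul_of_ne hj.symm, smul_zero]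
  · simp

/-- The elements of degree zero between two vertices. -/
theorem scalar_of_degree_zero {a : Λ} {i j : V} (h0 : a ∈ algDegree π 0) (hi : idem π i * a = a)
    (hj : a * idem π j = a) : ∃ c : K, a = c • idem π i ∧ (c ≠ 0 → i = j) := by
  obtain ⟨c, hc⟩ := exists_scalar_idem hπ a
  have h1 := (idem_mul_scalar hπ hc i).1
  have h2 : a = c i • idem π i := by
    have h3 := (mem_algGE hπ).1 h1 0 (by omega)
    rw [hi, map_sub, map_smul, algProj_of_mem hπ h0, algProj_of_mem hπ (idem_mem i), if_pos rfl,
      sub_eq_zero, if_pos rfl] at h3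
    exact h3
  by_cases hij : i = j
  · exact ⟨c i, h2, fun _ => hij⟩
  · refine ⟨0, ?_, fun h => absurd rfl h⟩
    rw [← hj, h2, smul_mul_assoc, idem_mul_of_ne hij, smul_zero, zero_smul]

variable [Module K M] [IsScalarTower K Λ M]

theorem span_top_mkQ {ι : Type*} [Fintype ι] {m : ι → M} {e : ι → V}
    (hm : span Λ (range m) = ⊤) (he : ∀ r, idem π (e r) • m r = m r) :
    span K (range fun r =>
      (Ring.jacobson Λ • (⊤ : Submodule Λ M)).mkQ (m r)) = ⊤ := by
  refine eq_top_iff.2 fun y _ => ?_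
  obtain ⟨x, rfl⟩ := Submodule.mkQ_surjective _ y
  have : x ∈ span Λ (range m) := by rw [hm]; trivial
  obtain ⟨f, rfl⟩ := (mem_span_range_iff_exists_fun Λ).1 this
  rw [map_sum]
  refine sum_mem fun r _ => ?_
  obtain ⟨c, hc⟩ := exists_scalar_idem hπ (f r)
  have h1 := smul_mem_radPow hπ (idem_mul_scalar hπ hc (e r)).2 (m r)
  have h2 : (Ring.jacobson Λ • (⊤ : Submodule Λ M)).mkQ (f r • m r) =
      c (e r) • (Ring.jacobson Λ • (⊤ : Submodule Λ M)).mkQ (m r) := by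
    change _ = Submodule.Quotient.mk (c (e r) • m r)
    refine (Submodule.Quotient.eq _).2 ?_
    rw [sub_smul, mul_smul, smul_assoc, he] at h1
    exact h1
  rw [h2]
  exact smul_mem _ _ (subset_span ⟨r, rfl⟩)

end Modules

/-! ### Radical layers are determined by dimensions -/

section Layers

variable (π)

section

variable {M : Type u} [AddCommGroup M] [Module K M] [Module Λ M] [IsScalarTower K Λ M]

/-- The action of an element of `Λ`. -/
def actL (K : Type u) [Field K] {Λ : Type u} [Ring Λ] [Algebra K Λ] (M : Type u) [AddCommGroup M]
    [Module K M] [Module Λ M] [IsScalarTower K Λ M] (a : Λ) : M →ₗ[K] M :=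
  (Algebra.lsmul K K M : Λ →ₐ[K] Module.End K M) a

@[simp] theorem actL_apply (a : Λ) (x : M) : actL K M a x = a • x := rfl

/-- The subspace `e_i N`. -/
def atVertex (N : Submodule Λ M) (i : V) : Submodule K M :=
  (N.restrictScalars K).map (actL K M (idem π i))

variable {π}

theorem mem_atVertex {N : Submodule Λ M} {i : V} {x : M} :
    x ∈ atVertex (K := K) π N i ↔ x ∈ N ∧ idem π i • x = x := by
  constructor
  · rintro ⟨y, hy, rfl⟩
    exact ⟨N.smul_mem _ hy, by rw [actL_apply, ← mul_smul, idem_mul_self]⟩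
  · rintro ⟨h1, h2⟩
    exact ⟨x, h1, h2⟩

theorem finiteDimensional_layer [FiniteDimensional K M] (N' N : Submodule Λ M) :
    FiniteDimensional K (N ⧸ N'.submoduleOf N) := by
  have h1 : FiniteDimensional K (N.restrictScalars K) := inferInstance
  have h2 : FiniteDimensional K N := h1
  let f : N →ₗ[K] N ⧸ N'.submoduleOf N :=
    { toFun := fun x => Submodule.Quotient.mk x
      map_add' := fun _ _ => rfl
      map_smul' := fun _ _ => rfl }
  exact Module.Finite.of_surjective f (Submodule.Quotient.mk_surjective _)

theorem finrank_atVertex_quotient [FiniteDimensional K M] {N' N : Submodule Λ M} (h : N' ≤ N)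
    (i : V) :
    finrank K (atVertex (K := K) π (⊤ : Submodule Λ (N ⧸ N'.submoduleOf N)) i) +
      finrank K (atVertex (K := K) π N' i) =
      finrank K (atVertex (K := K) π N i) := by
  let g : atVertex (K := K) π N i →ₗ[K]
      atVertex (K := K) π (⊤ : Submodule Λ (N ⧸ N'.submoduleOf N)) i :=
    { toFun := fun x => ⟨Submodule.Quotient.mk ⟨x.1, (mem_atVertex.1 x.2).1⟩,
        mem_atVertex.2 ⟨trivial, congrArg Submodule.Quotient.mk
          (Subtype.ext (mem_atVertex.1 x.2).2)⟩⟩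
      map_add' := fun x y => rfl
      map_smul' := fun c x => rfl }
  have hg : Function.Surjective g := by
    rintro ⟨y, hy⟩
    obtain ⟨⟨x, hx⟩, rfl⟩ := Submodule.Quotient.mk_surjective _ y
    refine ⟨⟨idem π i • x, mem_atVertex.2 ⟨N.smul_mem _ hx, ?_⟩⟩, Subtype.ext ?_⟩
    · rw [← mul_smul, idem_mul_self]
    · exact (mem_atVertex.1 hy).2
  have hker : finrank K (LinearMap.ker g) = finrank K (atVertex (K := K) π N' i) := by
    refine LinearEquiv.finrank_eq (LinearEquiv.ofBijective
      ({ toFun := fun x => ⟨x.1.1, mem_atVertex.2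
          ⟨(Submodule.Quotient.mk_eq_zero (N'.submoduleOf N)).1 (congrArg Subtype.val x.2),
            (mem_atVertex.1 x.1.2).2⟩⟩
         map_add' := fun x y => rfl
         map_smul' := fun c x => rfl } :
        LinearMap.ker g →ₗ[K] atVertex (K := K) π N' i) ⟨?_, ?_⟩)
    · intro x y hxy
      have h1 := congrArg Subtype.val hxy
      exact Subtype.ext (Subtype.ext h1)
    · rintro ⟨x, hx⟩
      obtain ⟨h1, h2⟩ := mem_atVertex.1 hx
      exact ⟨⟨⟨x, mem_atVertex.2 ⟨h h1, h2⟩⟩,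
        Subtype.ext ((Submodule.Quotient.mk_eq_zero _).2 h1)⟩, rfl⟩
  rw [← hker, ← LinearMap.finrank_range_add_finrank_ker g, LinearMap.range_eq_top.2 hg,
    finrank_top]

end

variable {π} (hπ : IsPathLengthGraded π)
  {L L' : Type u} [AddCommGroup L] [Module K L] [Module Λ L] [IsScalarTower K Λ L]
  [AddCommGroup L'] [Module K L'] [Module Λ L'] [IsScalarTower K Λ L']

include hπ in
/-- Modules annihilated by the radical are determined by their dimension vectors. -/
theorem nonempty_linearEquiv_of_finrank [FiniteDimensional K L] [FiniteDimensional K L']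
    (h : ∀ a ∈ Ring.jacobson Λ, ∀ x : L, a • x = 0)
    (h' : ∀ a ∈ Ring.jacobson Λ, ∀ x : L', a • x = 0)
    (hd : ∀ i, finrank K (atVertex (K := K) π (⊤ : Submodule Λ L) i) =
      finrank K (atVertex (K := K) π (⊤ : Submodule Λ L') i)) :
    Nonempty (L ≃ₗ[Λ] L') := by
  let f := fun i => LinearEquiv.ofFinrankEq _ _ (hd i)
  have hmem : ∀ i (x : L), idem π i • x ∈ atVertex (K := K) π (⊤ : Submodule Λ L) i :=
    fun i x => mem_atVertex.2 ⟨trivial, by rw [← mul_smul, idem_mul_self]⟩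
  have hmem' : ∀ i (x : L'), idem π i • x ∈ atVertex (K := K) π (⊤ : Submodule Λ L') i :=
    fun i x => mem_atVertex.2 ⟨trivial, by rw [← mul_smul, idem_mul_self]⟩
  let F : L → L' := fun x => ∑ i, (f i ⟨idem π i • x, hmem i x⟩).1
  have hF : ∀ i x, idem π i • F x = (f i ⟨idem π i • x, hmem i x⟩).1 := by
    intro i x
    simp only [F]
    rw [Finset.smul_sum, Finset.sum_eq_single i]
    · exact (mem_atVertex.1 (f i ⟨idem π i • x, hmem i x⟩).2).2
    · intro j _ hj
      rw [← (mem_atVertex.1 (f j ⟨idem π j • x, hmem j x⟩).2).2, ← mul_smul,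
        idem_mul_of_ne hj.symm, zero_smul]
    · simp
  have hsum : ∀ {N : Type u} [AddCommGroup N] [Module Λ N] (x : N),
      ∑ i, idem π i • x = x := by
    intro N _ _ x
    rw [← Finset.sum_smul, sum_idem, one_smul]
  have hvsmul : ∀ {N : Type u} [AddCommGroup N] [Module K N] [Module Λ N] [IsScalarTower K Λ N],
      (∀ a ∈ Ring.jacobson Λ, ∀ x : N, a • x = 0) → ∀ (a : Λ) (c : V → K),
      a - ∑ i, c i • idem π i ∈ algGE hπ 1 → ∀ (i : V) (x : N),
      idem π i • a • x = c i • idem π i • x := by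
    intro N _ _ _ _ hN a c hc i x
    have := hN _ ((mem_jacobson_iff hπ).2 (idem_mul_scalar hπ hc i).1) x
    rw [sub_smul, sub_eq_zero, mul_smul, smul_assoc] at this
    exact this
  let Fl : L →ₗ[Λ] L' :=
    { toFun := F
      map_add' := fun x y => by
        simp only [F]
        rw [← Finset.sum_add_distrib]
        refine Finset.sum_congr rfl fun i _ => ?_
        rw [← Submodule.coe_add, ← map_add]
        congr 2
        exact Subtype.ext (smul_add _ _ _)
      map_smul' := fun a x => by
        obtain ⟨c, hc⟩ := exists_scalar_idem hπ a
        rw [← hsum (F (a • x)), ← hsum (RingHom.id Λ a • F x)]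
        refine Finset.sum_congr rfl fun i _ => ?_
        rw [RingHom.id_apply, hvsmul h' a c hc, hF, hF]
        rw [← Submodule.coe_smul, ← map_smul]
        congr 2
        exact Subtype.ext (hvsmul h a c hc i x) }
  refine ⟨LinearEquiv.ofBijective Fl ⟨?_, ?_⟩⟩
  · rw [← LinearMap.ker_eq_bot, LinearMap.ker_eq_bot']
    intro x hx
    rw [← hsum x]
    refine Finset.sum_eq_zero fun i _ => ?_
    have h1 : (f i ⟨idem π i • x, hmem i x⟩).1 = 0 := by
      rw [← hF]
      change idem π i • Fl x = 0
      rw [hx, smul_zero]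
    have h2 : f i ⟨idem π i • x, hmem i x⟩ = 0 := Subtype.ext h1
    exact congrArg Subtype.val ((LinearEquiv.map_eq_zero_iff _).1 h2)
  · intro y
    let z := fun i => ((f i).symm ⟨idem π i • y, hmem' i y⟩)
    refine ⟨∑ i, (z i).1, ?_⟩
    rw [← hsum y, ← hsum (Fl _)]
    refine Finset.sum_congr rfl fun i _ => (hF i _).trans ?_
    have h1 : (⟨idem π i • ∑ i, (z i).1, hmem i _⟩ :
        atVertex (K := K) π (⊤ : Submodule Λ L) i) = z i := by
      refine Subtype.ext ?_
      change idem π i • ∑ i, (z i).1 = (z i).1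
      rw [Finset.smul_sum, Finset.sum_eq_single i]
      · exact (mem_atVertex.1 (z i).2).2
      · intro j _ hj
        rw [← (mem_atVertex.1 (z j).2).2, ← mul_smul, idem_mul_of_ne hj.symm, zero_smul]
      · simp
    rw [h1, LinearEquiv.apply_symm_apply]

include hπ in
theorem nonempty_radLayer_equiv [FiniteDimensional K L] [FiniteDimensional K L']
    (hd : ∀ l i, finrank K (atVertex (K := K) π (radPow Λ L l) i) =
      finrank K (atVertex (K := K) π (radPow Λ L' l) i)) (l : ℕ) :
    Nonempty (RadLayer Λ L l ≃ₗ[Λ] RadLayer Λ L' l) := by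
  have key : ∀ {N : Type u} [AddCommGroup N] [Module Λ N],
      ∀ a ∈ Ring.jacobson Λ, ∀ x : RadLayer Λ N l, a • x = 0 := by
    intro N _ _ a ha x
    obtain ⟨x, rfl⟩ := Submodule.Quotient.mk_surjective _ x
    exact (Submodule.Quotient.mk_eq_zero _).2 (Submodule.smul_mem_smul ha x.2)
  have hle : ∀ {N : Type u} [AddCommGroup N] [Module Λ N], radPow Λ N (l + 1) ≤ radPow Λ N l :=
    fun {N} _ _ => Submodule.smul_le_right
  have := finiteDimensional_layer (K := K) (radPow Λ L (l + 1)) (radPow Λ L l)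
  have := finiteDimensional_layer (K := K) (radPow Λ L' (l + 1)) (radPow Λ L' l)
  refine nonempty_linearEquiv_of_finrank hπ key key fun i => ?_
  have h1 := finrank_atVertex_quotient (K := K) (π := π) (hle (N := L)) i
  have h2 := finrank_atVertex_quotient (K := K) (π := π) (hle (N := L')) i
  exact Nat.add_right_cancel (h1.trans ((hd l i).trans (h2.symm.trans
    (congrArg _ (hd (l + 1) i).symm))))

end Layers

/-! ### Graded modules: projections, tops, and splittings -/

section GradedModules

section Internal

variable {R : Type*} [Ring R] {M : Type*} [AddCommGroup M] [Module R M] {ι : Type*} [Fintype ι]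

theorem isInternal_iff_sum [DecidableEq ι] {N : ι → Submodule R M} :
    DirectSum.IsInternal N ↔ (∀ x, ∃ v : ι → M, (∀ i, v i ∈ N i) ∧ x = ∑ i, v i) ∧
      ∀ v : ι → M, (∀ i, v i ∈ N i) → ∑ i, v i = 0 → ∀ i, v i = 0 := by
  rw [DirectSum.isInternal_submodule_iff_iSupIndep_and_iSup_eq_top,
    iSupIndep_iff_finsetSum_eq_zero_imp_eq_zero, and_comm]
  refine and_congr ⟨fun h x => ?_, fun h => ?_⟩ ⟨fun h v hv h0 i => ?_, fun h s v hv h0 i hi => ?_⟩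
  · have : x ∈ ⨆ i, N i := by rw [h]; trivial
    obtain ⟨f, hf, hx⟩ := (Submodule.mem_iSup_iff_exists_finsupp _ _).1 this
    refine ⟨f, hf, ?_⟩
    rw [← hx, Finsupp.sum_fintype]
    exact fun _ => rfl
  · refine eq_top_iff.2 fun x _ => ?_
    obtain ⟨v, hv, rfl⟩ := h x
    exact sum_mem fun i _ => Submodule.mem_iSup_of_mem i (hv i)
  · exact h Finset.univ v (fun i _ => hv i) h0 i (Finset.mem_univ _)
  · have := h (fun i => if i ∈ s then v i else 0) (fun i => ?_) ?_ i
    · simpa [hi] using this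
    · split_ifs with his
      · exact hv i his
      · exact zero_mem _
    · rwa [Finset.sum_ite_mem, Finset.univ_inter]

theorem isInternal_span_iff [DecidableEq ι] {m : ι → M} :
    DirectSum.IsInternal (fun r => span R {m r}) ↔
      span R (range m) = ⊤ ∧
        ∀ f : ι → R, ∑ r, f r • m r = 0 → ∀ r, f r • m r = 0 := by
  rw [isInternal_iff_sum]
  constructor
  · rintro ⟨h1, h2⟩
    refine ⟨eq_top_iff.2 fun x _ => ?_, fun f h0 r => ?_⟩
    · obtain ⟨v, hv, rfl⟩ := h1 x
      exact sum_mem fun i _ =>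
        Submodule.span_mono (Set.singleton_subset_iff.2 (Set.mem_range_self i)) (hv i)
    · exact h2 _ (fun r => smul_mem _ _ (Submodule.mem_span_singleton_self _)) h0 r
  · rintro ⟨h1, h2⟩
    refine ⟨fun x => ?_, fun v hv h0 => ?_⟩
    · have : x ∈ span R (range m) := by rw [h1]; trivial
      obtain ⟨f, hf⟩ := (mem_span_range_iff_exists_fun R).1 this
      exact ⟨fun r => f r • m r,
        fun r => smul_mem _ _ (Submodule.mem_span_singleton_self _), hf.symm⟩
    · choose f hf using fun i => Submodule.mem_span_singleton.1 (hv i)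
      simp only [← hf] at h0 ⊢
      exact h2 f h0

end Internal

namespace GrMod

variable (M : GrMod π)

/-- The projection onto the component of degree `n`. -/
def proj (n : ℤ) : M →ₗ[K] M :=
  letI := M.internal.chooseDecomposition
  (M.gr n).subtype ∘ₗ DirectSum.component K ℤ (fun n => M.gr n) n ∘ₗ
    (DirectSum.decomposeLinearEquiv M.gr).toLinearMap

theorem proj_of_mem {n : ℤ} {x : M} (hx : x ∈ M.gr n) (k : ℤ) :
    M.proj k x = if k = n then x else 0 := by
  let _ := M.internal.chooseDecomposition
  change (DirectSum.decompose M.gr x k : M) = _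
  split_ifs with h
  · subst h; exact DirectSum.decompose_of_mem_same _ hx
  · exact DirectSum.decompose_of_mem_ne _ hx fun h' => h h'.symm

theorem proj_mem (n : ℤ) (x : M) : M.proj n x ∈ M.gr n := by
  let _ := M.internal.chooseDecomposition
  exact (DirectSum.decompose M.gr x n).2

theorem mem_gr_iff {n : ℤ} {x : M} : x ∈ M.gr n ↔ M.proj n x = x :=
  ⟨fun h => by rw [proj_of_mem M h, if_pos rfl], fun h => h ▸ proj_mem M n x⟩

end GrMod

/-- The projection onto the component of degree `n ∈ ℤ`. -/
def algProjZ (hπ : IsPathLengthGraded π) (n : ℤ) : Λ →ₗ[K] Λ :=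
  if 0 ≤ n then algProj hπ n.toNat else 0

variable (hπ : IsPathLengthGraded π)

theorem algProjZ_natCast (l : ℕ) : algProjZ hπ l = algProj hπ l := by
  rw [algProjZ, if_pos (Int.natCast_nonneg l), Int.toNat_natCast]

theorem algProjZ_of_neg {n : ℤ} (h : n < 0) : algProjZ hπ n = 0 := by
  rw [algProjZ, if_neg (by omega)]

theorem algProjZ_of_mem {l : ℕ} {a : Λ} (ha : a ∈ algDegree π l) (n : ℤ) :
    algProjZ hπ n a = if n = l then a else 0 := by
  obtain hn | hn := lt_or_ge n 0
  · rw [algProjZ_of_neg hπ hn, if_neg (by omega)]; rfl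
  · lift n to ℕ using hn
    rw [algProjZ_natCast, algProj_of_mem hπ ha]
    simp

theorem algProjZ_algProjZ (n : ℤ) (a : Λ) : algProjZ hπ n (algProjZ hπ n a) = algProjZ hπ n a := by
  obtain hn | hn := lt_or_ge n 0
  · rw [algProjZ_of_neg hπ hn]; rfl
  · lift n to ℕ using hn
    rw [algProjZ_natCast, algProj_algProj, if_pos rfl]

theorem algProjZ_idem_mul (n : ℤ) (i : V) (a : Λ) :
    algProjZ hπ n (idem π i * a) = idem π i * algProjZ hπ n a := by
  obtain hn | hn := lt_or_ge n 0
  · rw [algProjZ_of_neg hπ hn]; simp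
  · lift n to ℕ using hn
    rw [algProjZ_natCast, algProj_idem_mul]

theorem algProjZ_mul_idem (n : ℤ) (i : V) (a : Λ) :
    algProjZ hπ n (a * idem π i) = algProjZ hπ n a * idem π i := by
  obtain hn | hn := lt_or_ge n 0
  · rw [algProjZ_of_neg hπ hn]; simp
  · lift n to ℕ using hn
    rw [algProjZ_natCast, algProj_mul_idem]

theorem algProjZ_mul {l : ℕ} {a : Λ} (ha : a ∈ algDegree π l) (n : ℤ) (b : Λ) :
    algProjZ hπ (l + n) (a * b) = a * algProjZ hπ n b := by
  have hb : b ∈ ⨆ l, algDegree π l := by rw [iSup_algDegree hπ]; trivial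
  induction hb using Submodule.iSup_induction' with
  | mem m b hb =>
    rw [algProjZ_of_mem hπ hb, algProjZ_of_mem hπ (algDegree_mul hπ ha hb)]
    push_cast
    simp only [add_right_inj]
    split_ifs
    · rfl
    · rw [mul_zero]
  | zero => simp
  | add x y _ _ hx hy => rw [mul_add, map_add, hx, hy, map_add, mul_add]

namespace GrMod

variable {M : GrMod π}

include hπ in
theorem proj_smul_of_mem {k : ℤ} {m : M} (hm : m ∈ M.gr k) (n : ℤ) (a : Λ) :
    M.proj n (a • m) = algProjZ hπ (n - k) a • m := by
  have ha : a ∈ ⨆ l, algDegree π l := by rw [iSup_algDegree hπ]; trivial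
  induction ha using Submodule.iSup_induction' with
  | mem l a ha =>
    rw [proj_of_mem M (M.smul_mem l k a m ha hm), algProjZ_of_mem hπ ha]
    by_cases h : n = l + k
    · rw [if_pos h, if_pos (by omega)]
    · rw [if_neg h, if_neg (by omega), zero_smul]
  | zero => simp
  | add x y _ _ hx hy => rw [add_smul, map_add, hx, hy, map_add, add_smul]

/-- A full sequence of homogeneous top elements. -/
structure IsTopSystem (M : GrMod π) {ι : Type*} (e : ι → V) (h : ι → ℤ) (m : ι → M) : Prop where
  mem : ∀ r, m r ∈ M.gr (h r)
  idem_smul : ∀ r, idem π (e r) • m r = m r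
  span : span Λ (range m) = ⊤
  linearIndependent :
    LinearIndependent K fun r => (Ring.jacobson Λ • (⊤ : Submodule Λ M)).mkQ (m r)

namespace IsTopSystem

variable {ι ι' : Type*} [Fintype ι] [Fintype ι'] {e : ι → V} {h : ι → ℤ} {m : ι → M}
  {e' : ι' → V} {h' : ι' → ℤ} {m' : ι' → M}

/-- The basis of the top of `M` given by the top elements. -/
def basis (hm : M.IsTopSystem e h m) (hπ : IsPathLengthGraded π) :
    Module.Basis ι K (M ⧸ (Ring.jacobson Λ • (⊤ : Submodule Λ M))) :=
  Module.Basis.mk hm.linearIndependent (span_top_mkQ hπ hm.span hm.idem_smul).ge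

theorem basis_apply (hm : M.IsTopSystem e h m) (r : ι) :
    hm.basis hπ r = (Ring.jacobson Λ • (⊤ : Submodule Λ M)).mkQ (m r) :=
  Module.Basis.mk_apply _ _ _

/-- The coefficients of an element of `M` modulo `J M`. -/
def coef (hm : M.IsTopSystem e h m) (hπ : IsPathLengthGraded π) (x : M) (r : ι) : K :=
  (hm.basis hπ).repr ((Ring.jacobson Λ • (⊤ : Submodule Λ M)).mkQ x) r

include hπ in
theorem exists_smul_eq (hm : Submodule.span Λ (range m) = ⊤) (hmh : ∀ r, m r ∈ M.gr (h r))
    (hme : ∀ r, idem π (e r) • m r = m r) {n : ℤ} {i : V} {x : M} (hx : x ∈ M.gr n)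
    (hi : idem π i • x = x) :
    ∃ f : ι → Λ, x = ∑ r, f r • m r ∧ ∀ r, idem π i * f r = f r ∧ f r * idem π (e r) = f r ∧
      algProjZ hπ (n - h r) (f r) = f r := by
  have h1 : x ∈ Submodule.span Λ (range m) := by rw [hm]; trivial
  obtain ⟨f, hf⟩ := (mem_span_range_iff_exists_fun Λ).1 h1
  refine ⟨fun r => idem π i * algProjZ hπ (n - h r) (f r) * idem π (e r), ?_, fun r => ⟨?_, ?_, ?_⟩⟩
  · rw [← hi]
    conv_lhs => rw [← (mem_gr_iff M).1 hx, ← hf, map_sum, Finset.smul_sum]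
    refine Finset.sum_congr rfl fun r _ => ?_
    rw [proj_smul_of_mem hπ (hmh r), mul_smul, hme, mul_smul]
  · rw [← mul_assoc, ← mul_assoc, idem_mul_self]
  · rw [mul_assoc, idem_mul_self]
  · rw [algProjZ_mul_idem, algProjZ_idem_mul, algProjZ_algProjZ]

/-- Expansion of a homogeneous element in terms of the top elements. -/
theorem exists_expansion (hm : M.IsTopSystem e h m) {n : ℤ} {i : V} {x : M} (hx : x ∈ M.gr n)
    (hi : idem π i • x = x) :
    ∃ f : ι → Λ, x = ∑ r, f r • m r ∧ ∀ r, idem π i * f r = f r ∧ f r * idem π (e r) = f r ∧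
      algProjZ hπ (n - h r) (f r) = f r ∧ (n ≤ h r → f r = hm.coef hπ x r • idem π i) ∧
      f r - hm.coef hπ x r • idem π i ∈ algGE hπ 1 ∧
      (hm.coef hπ x r ≠ 0 → e r = i ∧ h r = n) := by
  obtain ⟨f, hf, hf'⟩ := exists_smul_eq hπ hm.span hm.mem hm.idem_smul hx hi
  have key : ∀ r, ∃ c : K, (n ≤ h r → f r = c • idem π i) ∧ f r - c • idem π i ∈ algGE hπ 1 ∧
      (c ≠ 0 → e r = i ∧ h r = n) := by
    intro r
    obtain ⟨h1, h2, h3⟩ := hf' r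
    obtain hn | hn | hn := lt_trichotomy (n - h r) 0
    · rw [algProjZ_of_neg hπ hn] at h3
      have h4 : f r = 0 := h3.symm
      exact ⟨0, fun _ => by rw [h4, zero_smul],
        by rw [h4, zero_smul, sub_zero]; exact zero_mem _, fun h => absurd rfl h⟩
    · rw [hn, ← Nat.cast_zero, algProjZ_natCast] at h3
      obtain ⟨c, h4, h5⟩ := scalar_of_degree_zero hπ (h3 ▸ algProj_mem hπ 0 (f r)) h1 h2
      exact ⟨c, fun _ => h4, by rw [h4, sub_self]; exact zero_mem _,
        fun hc => ⟨(h5 hc).symm, by omega⟩⟩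
    · refine ⟨0, fun h => by omega, ?_, fun h => absurd rfl h⟩
      rw [zero_smul, sub_zero, ← h3]
      lift n - h r to ℕ using hn.le with l hl
      rw [algProjZ_natCast]
      exact algDegree_le_algGE hπ (by omega) (algProj_mem hπ l _)
  choose c hc1 hc2 hc3 using key
  have hcoef : ∀ r, hm.coef hπ x r = c r := by
    have h1 : (Ring.jacobson Λ • (⊤ : Submodule Λ M)).mkQ x = ∑ r, c r • hm.basis hπ r := by
      rw [hf, map_sum]
      refine Finset.sum_congr rfl fun r _ => ?_
      have h2 := smul_mem_radPow hπ (hc2 r) (m r)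
      rw [basis_apply]
      change _ = Submodule.Quotient.mk (c r • m r)
      refine (Submodule.Quotient.eq _).2 ?_
      have h3 : (c r • idem π i) • m r = c r • m r := by
        by_cases h0 : c r = 0
        · rw [h0, zero_smul, zero_smul, zero_smul]
        · rw [smul_assoc, ← (hc3 r h0).1, hm.idem_smul]
      rw [sub_smul, h3] at h2
      exact h2
    intro r
    rw [coef, h1, Module.Basis.repr_sum_self]
  refine ⟨f, hf, fun r => ⟨(hf' r).1, (hf' r).2.1, (hf' r).2.2, ?_, ?_, ?_⟩⟩
  · rw [hcoef]; exact hc1 r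
  · rw [hcoef]; exact hc2 r
  · rw [hcoef]; exact hc3 r

theorem coef_mul_coef [DecidableEq ι] (hm : M.IsTopSystem e h m) (hm' : M.IsTopSystem e' h' m')
    (i j : ι) :
    ∑ a, hm.coef hπ (m' a) i * hm'.coef hπ (m j) a = if i = j then 1 else 0 := by
  classical
  have h1 := congrFun (congrFun
    ((hm.basis hπ).toMatrix_mul_toMatrix_flip (hm'.basis hπ)) i) j
  rw [Matrix.mul_apply, Matrix.one_apply] at h1
  rw [← h1]
  refine Finset.sum_congr rfl fun a _ => ?_
  rw [Module.Basis.toMatrix_apply, Module.Basis.toMatrix_apply, basis_apply, basis_apply]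
  rfl

theorem exists_equiv (hm : M.IsTopSystem e h m) (hm' : M.IsTopSystem e' h' m') :
    ∃ σ : ι' ≃ ι, ∀ a, hm.coef hπ (m' a) (σ a) ≠ 0 := by
  classical
  let ε : ι' ≃ ι := (hm'.basis hπ).indexEquiv (hm.basis hπ)
  let B := (hm'.basis hπ).reindex ε
  have hdet : ((hm.basis hπ).toMatrix B).det ≠ 0 := by
    have := congrArg Matrix.det ((hm.basis hπ).toMatrix_mul_toMatrix_flip B)
    rw [Matrix.det_mul, Matrix.det_one] at this
    exact left_ne_zero_of_mul_eq_one this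
  rw [Matrix.det_apply] at hdet
  obtain ⟨τ, -, hτ⟩ := Finset.exists_ne_zero_of_sum_ne_zero hdet
  have h1 : ∀ r, (hm.basis hπ).toMatrix B (τ r) r ≠ 0 := fun r hr => hτ (by
    have h2 : ∏ i, (hm.basis hπ).toMatrix B (τ i) i = 0 :=
      Finset.prod_eq_zero (Finset.mem_univ r) hr
    rw [h2, smul_zero])
  refine ⟨ε.trans τ, fun a => ?_⟩
  have h2 := h1 (ε a)
  rw [Module.Basis.toMatrix_apply, Module.Basis.reindex_apply, Equiv.symm_apply_apply,
    basis_apply] at h2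
  exact h2

omit [Fintype ι] in
theorem ne_zero (hm : M.IsTopSystem e h m) (r : ι) : m r ≠ 0 := fun h0 =>
  hm.linearIndependent.ne_zero r (by rw [h0, map_zero])

omit [Fintype ι] in
theorem idem_ne_zero (hm : M.IsTopSystem e h m) (r : ι) : idem π (e r) ≠ 0 := fun h0 =>
  hm.ne_zero r (by rw [← hm.idem_smul r, h0, zero_smul])

end IsTopSystem

theorem idem_notMem_algGE {i : V} (hi : idem π i ≠ 0) : idem π i ∉ algGE hπ 1 := by
  intro h
  have := (mem_algGE hπ).1 h 0 (by omega)
  rw [algProj_of_mem hπ (idem_mem i), if_pos rfl] at this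
  exact hi this

theorem smul_eq_zero_iff {i : V} {m : M} {C : Submodule K Λ} (hm : idem π i • m = m)
    (hC : ∀ a, a ∈ C ↔ a ∈ Ideal.span {idem π i} ∧ a • m = 0) (a : Λ) :
    a • m = 0 ↔ a * idem π i ∈ C := by
  rw [hC, mul_smul, hm, and_iff_right]
  exact Ideal.mul_mem_left _ _ (Ideal.mem_span_singleton_self _)

section Splitting

variable {t : ℕ} {e e' : Fin t → V} {h h' : Fin t → ℤ} {C C' : Fin t → Submodule K Λ}

theorem isTopSystem_of_internal {ι : Type*} [Fintype ι] [DecidableEq ι] {e : ι → V} {h : ι → ℤ}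
    {m : ι → M} (hmem : ∀ r, m r ∈ M.gr (h r)) (hid : ∀ r, idem π (e r) • m r = m r)
    (hint : DirectSum.IsInternal fun r => span Λ {m r})
    (hne : ∀ r (a : Λ), a ∈ algGE hπ 1 → m r ≠ a • m r) : M.IsTopSystem e h m := by
  obtain ⟨h1, h2⟩ := isInternal_span_iff.1 hint
  refine ⟨hmem, hid, h1, Fintype.linearIndependent_iff.2 fun c hc r => ?_⟩
  have h3 : ∑ r, c r • m r ∈ radPow Λ M 1 := by
    refine (Submodule.Quotient.mk_eq_zero _).1 ((Eq.trans ?_ hc))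
    change Submodule.mkQ _ _ = _
    rw [map_sum]
    rfl
  obtain ⟨f, hf, hfe⟩ := (mem_radPow_iff hπ h1).1 h3
  have h4 := h2 (fun r => f r - c r • 1) (by
    simp only [sub_smul, Finset.sum_sub_distrib, smul_assoc, one_smul]
    rw [hfe, sub_self]) r
  by_contra hcr
  refine hne r ((c r)⁻¹ • f r) (Submodule.smul_mem _ _ (hf r)) ?_
  rw [sub_smul, sub_eq_zero, smul_assoc, one_smul] at h4
  rw [smul_assoc, h4, smul_smul, inv_mul_cancel₀ hcr, one_smul]

theorem ne_smul_of_le {i : V} {m : M} {D : Submodule K Λ} (hz : ∀ a, a • m = 0 ↔ a * idem π i ∈ D)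
    (hD : D ≤ algGE hπ 1) (hi : idem π i ≠ 0) (a : Λ) (ha : a ∈ algGE hπ 1) : m ≠ a • m := by
  intro h5
  have h6 : (1 - a) • m = 0 := by rw [sub_smul, one_smul, sub_eq_zero]; exact h5
  have h7 := hD ((hz _).1 h6)
  rw [sub_mul, one_mul] at h7
  have h9 := algGE_mul hπ ha (mem_algGE_zero hπ (idem π i))
  rw [add_zero] at h9
  have h8 := (algGE hπ 1).add_mem h7 h9
  rw [sub_add_cancel] at h8
  exact idem_notMem_algGE hπ hi h8

/-- A splitting whose summands are proper quotients gives a top. -/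
theorem SplitsAs.exists_isTopSystem (hs : M.SplitsAs e h C) (hC : ∀ r, C r ≤ algGE hπ 1)
    (he : ∀ r, idem π (e r) ≠ 0) :
    ∃ m : Fin t → M, M.IsTopSystem e h m ∧ (∀ r a, a • m r = 0 ↔ a * idem π (e r) ∈ C r) ∧
      ∀ f : Fin t → Λ, ∑ r, f r • m r = 0 → ∀ r, f r • m r = 0 := by
  obtain ⟨m, h1, h2, h3, h4⟩ := hs
  have hz : ∀ r a, a • m r = 0 ↔ a * idem π (e r) ∈ C r := fun r a =>
    smul_eq_zero_iff (h2 r) (h3 r) a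
  have hi := isInternal_span_iff.1 h4
  have ht : M.IsTopSystem e h m := isTopSystem_of_internal hπ h1 h2 h4 fun r =>
    ne_smul_of_le hπ (hz r) (hC r) (he r)
  exact ⟨m, ht, hz, hi.2⟩

theorem SplitsAs.le_span (hs : M.SplitsAs e h C) (r : Fin t) {a : Λ} (ha : a ∈ C r) :
    a * idem π (e r) = a := by
  obtain ⟨m, -, -, h3, -⟩ := hs
  obtain ⟨b, rfl⟩ := Ideal.mem_span_singleton'.1 ((h3 r a).1 ha).1
  rw [mul_assoc, idem_mul_self]

/-- The Krull–Schmidt theorem for direct sums of local modules. -/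
theorem SplitsAs.krullSchmidt [FiniteDimensional K Λ] (hs : M.SplitsAs e h C)
    (hs' : M.SplitsAs e' h' C') (hC : ∀ r, C r ≤ algGE hπ 1) (hC' : ∀ r, C' r ≤ algGE hπ 1)
    (he : ∀ r, idem π (e r) ≠ 0) (he' : ∀ r, idem π (e' r) ≠ 0) :
    ∃ σ : Equiv.Perm (Fin t), ∀ a, e' a = e (σ a) ∧ h' a = h (σ a) ∧ C' a = C (σ a) := by
  have key : ∀ {e e' : Fin t → V} {h h' : Fin t → ℤ} {C C' : Fin t → Submodule K Λ},
      M.SplitsAs e h C → M.SplitsAs e' h' C' → (∀ r, C r ≤ algGE hπ 1) →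
      (∀ r, C' r ≤ algGE hπ 1) → (∀ r, idem π (e r) ≠ 0) → (∀ r, idem π (e' r) ≠ 0) →
      ∃ σ : Equiv.Perm (Fin t), ∀ a, e' a = e (σ a) ∧ h' a = h (σ a) ∧ C' a ≤ C (σ a) := by
    intro e e' h h' C C' hs hs' hC hC' he he'
    obtain ⟨m, hm, hmC, hmi⟩ := hs.exists_isTopSystem hπ hC he
    obtain ⟨m', hm', hmC', -⟩ := hs'.exists_isTopSystem hπ hC' he'
    obtain ⟨σ, hσ⟩ := hm.exists_equiv hπ hm'
    refine ⟨σ, fun a => ?_⟩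
    obtain ⟨f, hf, hf'⟩ := hm.exists_expansion hπ (hm'.mem a) (hm'.idem_smul a)
    obtain ⟨-, -, -, h1, -, h2⟩ := hf' (σ a)
    obtain ⟨h3, h4⟩ := h2 (hσ a)
    refine ⟨h3.symm, h4.symm, fun c hc => ?_⟩
    have hce : c * idem π (e' a) = c := hs'.le_span a hc
    have h5 : ∑ r, (c * f r) • m r = 0 := by
      simp only [mul_smul]
      rw [← Finset.smul_sum, ← hf]
      exact (hmC' a c).2 (by rwa [hce])
    have h6 := hmi _ h5 (σ a)
    rw [h1 h4.ge, mul_smul_comm, hce, smul_assoc] at h6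
    have h7 := (hmC (σ a) c).1 ((smul_eq_zero_iff_right (hσ a)).1 h6)
    rwa [h3, hce] at h7
  obtain ⟨σ, hσ⟩ := key hs hs' hC hC' he he'
  obtain ⟨τ, hτ⟩ := key hs' hs hC' hC he' he
  have h1 : ∑ a, finrank K (C' a) = ∑ a, finrank K (C (σ a)) := by
    refine le_antisymm (Finset.sum_le_sum fun a _ => Submodule.finrank_mono (hσ a).2.2) ?_
    rw [Equiv.sum_comp σ fun a => finrank K (C a),
      ← Equiv.sum_comp τ fun a => finrank K (C' a)]
    exact Finset.sum_le_sum fun a _ => Submodule.finrank_mono (hτ a).2.2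
  have h2 := (Finset.sum_eq_sum_iff_of_le
    fun a _ => Submodule.finrank_mono (hσ a).2.2).1 h1
  exact ⟨σ, fun a => ⟨(hσ a).1, (hσ a).2.1,
    Submodule.eq_of_le_of_finrank_eq (hσ a).2.2 (h2 a (Finset.mem_univ _))⟩⟩

end Splitting

end GrMod

end GradedModules

section GradedModules

namespace GrMod

/-! ### Graded isomorphisms -/

theorem GradedIso.symm {M N : GrMod π} (h : M.GradedIso N) : N.GradedIso M := by
  obtain ⟨f, s, hf⟩ := h
  refine ⟨f.symm, -s, fun l m => ?_⟩
  rw [hf, LinearEquiv.apply_symm_apply, neg_add_cancel_right]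

theorem sum_smul_map {ι : Type*} [Fintype ι] {M N : GrMod π} (F : M ≃ₗ[Λ] N) (f : ι → Λ)
    (m : ι → M) : ∑ r, f r • F (m r) = F (∑ r, f r • m r) := by
  rw [map_sum]
  exact Finset.sum_congr rfl fun r _ => (map_smul F _ _).symm

/-- Graded modules with generators satisfying the same relations are isomorphic. -/
theorem gradedIso_of_relations (hπ : IsPathLengthGraded π) {ι : Type} [Fintype ι] {M N : GrMod π}
    {h : ι → ℤ} {s : ℤ} {m : ι → M} {n : ι → N} (hm : ∀ r, m r ∈ M.gr (h r))
    (hn : ∀ r, n r ∈ N.gr (h r + s)) (hms : span Λ (range m) = ⊤)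
    (hns : span Λ (range n) = ⊤)
    (hrel : ∀ f : ι → Λ, ∑ r, f r • m r = 0 ↔ ∑ r, f r • n r = 0) :
    ∃ F : M ≃ₗ[Λ] N, (∀ r, F (m r) = n r) ∧
      ∀ (l : ℤ) (x : M), x ∈ M.gr l ↔ F x ∈ N.gr (l + s) := by
  classical
  let φ : (ι → Λ) →ₗ[Λ] M :=
    { toFun := fun f => ∑ r, f r • m r
      map_add' := fun f g => by simp [add_smul, Finset.sum_add_distrib]
      map_smul' := fun a f => by simp [mul_smul, Finset.smul_sum] }
  let ψ : (ι → Λ) →ₗ[Λ] N :=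
    { toFun := fun f => ∑ r, f r • n r
      map_add' := fun f g => by simp [add_smul, Finset.sum_add_distrib]
      map_smul' := fun a f => by simp [mul_smul, Finset.smul_sum] }
  have hφ : Function.Surjective φ := fun x =>
    (mem_span_range_iff_exists_fun Λ).1 (by rw [hms]; trivial)
  have hψ : Function.Surjective ψ := fun x =>
    (mem_span_range_iff_exists_fun Λ).1 (by rw [hns]; trivial)
  have hker : LinearMap.ker φ = LinearMap.ker ψ := Submodule.ext hrel
  let F : M ≃ₗ[Λ] N := ((φ.quotKerEquivOfSurjective hφ).symm.trans
    (Submodule.quotEquivOfEq _ _ hker)).trans (ψ.quotKerEquivOfSurjective hψ)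
  have hF : ∀ f, F (φ f) = ψ f := by
    intro f
    have h1 : (φ.quotKerEquivOfSurjective hφ).symm (φ f) = Submodule.Quotient.mk f := by
      rw [LinearEquiv.symm_apply_eq]; rfl
    change (ψ.quotKerEquivOfSurjective hψ) (Submodule.quotEquivOfEq _ _ hker
      ((φ.quotKerEquivOfSurjective hφ).symm (φ f))) = _
    rw [h1]
    rfl
  refine ⟨F, fun r => ?_, fun l x => ?_⟩
  · have h1 : φ (Pi.single r 1) = m r := by
      change ∑ r', (Pi.single r 1 : ι → Λ) r' • m r' = m r
      rw [Finset.sum_eq_single r]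
      · simp
      · intro b _ hb; simp [hb]
      · simp
    have h2 : ψ (Pi.single r 1) = n r := by
      change ∑ r', (Pi.single r 1 : ι → Λ) r' • n r' = n r
      rw [Finset.sum_eq_single r]
      · simp
      · intro b _ hb; simp [hb]
      · simp
    rw [← h1, hF, h2]
  · obtain ⟨f, rfl⟩ := hφ x
    have h1 : M.proj l (φ f) = φ fun r => algProjZ hπ (l - h r) (f r) := by
      change M.proj l (∑ r, f r • m r) = ∑ r, _
      rw [map_sum]
      exact Finset.sum_congr rfl fun r _ => proj_smul_of_mem hπ (hm r) l _
    have h2 : N.proj (l + s) (ψ f) = ψ fun r => algProjZ hπ (l - h r) (f r) := by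
      change N.proj (l + s) (∑ r, f r • n r) = ∑ r, _
      rw [map_sum]
      refine Finset.sum_congr rfl fun r _ => (proj_smul_of_mem hπ (hn r) _ _).trans ?_
      rw [add_sub_add_right_eq_sub]
    rw [mem_gr_iff, mem_gr_iff, hF, h1, h2, ← hF, ← hF]
    exact F.injective.eq_iff.symm

theorem SplitsAs.congr_iso {M N : GrMod π} {t : ℕ} {e : Fin t → V} {h : Fin t → ℤ}
    {C : Fin t → Submodule K Λ} (hs : M.SplitsAs e h C) {F : M ≃ₗ[Λ] N} {s : ℤ}
    (hF : ∀ (l : ℤ) (m : M), m ∈ M.gr l ↔ F m ∈ N.gr (l + s)) :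
    N.SplitsAs e (fun r => h r + s) C := by
  obtain ⟨m, h1, h2, h3, h4⟩ := hs
  refine ⟨fun r => F (m r), fun r => (hF _ _).1 (h1 r), fun r => ?_, fun r a => ?_, ?_⟩
  · rw [← map_smul, h2]
  · rw [h3, ← map_smul, map_eq_zero_iff F F.injective]
  · obtain ⟨h5, h6⟩ := isInternal_span_iff.1 h4
    refine isInternal_span_iff.2 ⟨?_, fun f hf r => ?_⟩
    · refine eq_top_iff.2 fun y _ => ?_
      obtain ⟨f, hf⟩ := (mem_span_range_iff_exists_fun Λ).1
        (show F.symm y ∈ span Λ (range m) by rw [h5]; trivial)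
      refine (mem_span_range_iff_exists_fun Λ).2 ⟨f, ?_⟩
      rw [sum_smul_map, hf, LinearEquiv.apply_symm_apply]
    · rw [sum_smul_map, map_eq_zero_iff F F.injective] at hf
      rw [← map_smul, h6 f hf r, map_zero]

theorem SplitsAs.relations {M : GrMod π} {t : ℕ} {e : Fin t → V} {h : Fin t → ℤ}
    {C : Fin t → Submodule K Λ} (hs : M.SplitsAs e h C) :
    ∃ m : Fin t → M, (∀ r, m r ∈ M.gr (h r)) ∧ (∀ r, idem π (e r) • m r = m r) ∧
      span Λ (range m) = ⊤ ∧
      ∀ f : Fin t → Λ, ∑ r, f r • m r = 0 ↔ ∀ r, f r * idem π (e r) ∈ C r := by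
  obtain ⟨m, h1, h2, h3, h4⟩ := hs
  obtain ⟨h5, h6⟩ := isInternal_span_iff.1 h4
  refine ⟨m, h1, h2, h5, fun f => ?_⟩
  have h7 : ∀ r, f r * idem π (e r) ∈ C r ↔ f r • m r = 0 := fun r =>
    (smul_eq_zero_iff (h2 r) (h3 r) _).symm
  simp only [h7]
  exact ⟨h6 f, fun h => Finset.sum_eq_zero fun r _ => h r⟩

theorem SplitsAs.of_relations {M : GrMod π} {t : ℕ} {e : Fin t → V} {h : Fin t → ℤ}
    {C : Fin t → Submodule K Λ} (hC : ∀ r, ∀ a ∈ C r, a * idem π (e r) = a)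
    {m : Fin t → M} (h1 : ∀ r, m r ∈ M.gr (h r)) (h2 : ∀ r, idem π (e r) • m r = m r)
    (h3 : span Λ (range m) = ⊤)
    (h4 : ∀ f : Fin t → Λ, ∑ r, f r • m r = 0 ↔ ∀ r, f r * idem π (e r) ∈ C r) :
    M.SplitsAs e h C := by
  have h5 : ∀ r a, a • m r = 0 ↔ a * idem π (e r) ∈ C r := by
    intro r a
    have h6 := h4 (Pi.single r a)
    rw [Finset.sum_eq_single r (fun b _ hb => by rw [Pi.single_eq_of_ne hb, zero_smul])
      (fun h => absurd (Finset.mem_univ r) h), Pi.single_eq_same] at h6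
    rw [h6]
    refine ⟨fun h => by simpa using h r, fun h b => ?_⟩
    by_cases hb : b = r
    · subst hb; simpa using h
    · rw [Pi.single_eq_of_ne hb, zero_mul]; exact zero_mem _
  refine ⟨m, h1, h2, fun r a => ?_, isInternal_span_iff.2 ⟨h3, fun f hf r => ?_⟩⟩
  · rw [h5]
    constructor
    · intro ha
      rw [hC r a ha]
      refine ⟨?_, ha⟩
      rw [← hC r a ha]
      exact Ideal.mul_mem_left _ _ (Ideal.mem_span_singleton_self _)
    · rintro ⟨ha, ha'⟩
      obtain ⟨b, rfl⟩ := Ideal.mem_span_singleton'.1 ha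
      rwa [mul_assoc, idem_mul_self] at ha'
  · exact (h5 r _).2 ((h4 f).1 hf r)

theorem SplitsAs.gradedIso (hπ : IsPathLengthGraded π) {M N : GrMod π} {t : ℕ} {e : Fin t → V}
    {h : Fin t → ℤ} {C : Fin t → Submodule K Λ} {s : ℤ} (hM : M.SplitsAs e h C)
    (hN : N.SplitsAs e (fun r => h r + s) C) : M.GradedIso N := by
  obtain ⟨m, h1, -, h2, h3⟩ := hM.relations
  obtain ⟨n, h4, -, h5, h6⟩ := hN.relations
  obtain ⟨F, -, hF⟩ := gradedIso_of_relations hπ h1 h4 h2 h5 fun f => (h3 f).trans (h6 f).symm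
  exact ⟨F, s, hF⟩

theorem SplitsAs.perm {M : GrMod π} {t : ℕ} {e : Fin t → V} {h : Fin t → ℤ}
    {C : Fin t → Submodule K Λ} (hs : M.SplitsAs e h C) (σ : Equiv.Perm (Fin t)) :
    M.SplitsAs (e ∘ σ) (h ∘ σ) (C ∘ σ) := by
  obtain ⟨m, h1, h2, h3, h4⟩ := hs
  obtain ⟨h5, h6⟩ := isInternal_span_iff.1 h4
  refine ⟨m ∘ σ, fun r => h1 _, fun r => h2 _, fun r => h3 _, ?_⟩
  refine isInternal_span_iff.2 ⟨?_, fun f hf r => ?_⟩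
  · rw [Set.range_comp, Equiv.range_eq_univ, Set.image_univ, h5]
  · have := h6 (f ∘ σ.symm) (by
      rw [← hf, ← Equiv.sum_comp σ]
      simp) (σ r)
    simpa using this

/-! ### Direct sums of local submodules -/

variable (hπ : IsPathLengthGraded π) {M : GrMod π}

include hπ

/-- A homogeneous local submodule is generated by a homogeneous element. -/
theorem exists_local_generator {N : Submodule Λ M} (hN : M.IsHomogeneousSub N)
    (hl : IsLocalModule Λ N) :
    ∃ (x : M) (k : ℤ) (i : V), x ∈ M.gr k ∧ idem π i • x = x ∧ span Λ {x} = N ∧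
      ∀ a ∈ algGE hπ 1, x ≠ a • x := by
  have hco : IsCoatom (Ring.jacobson Λ • (⊤ : Submodule Λ N)) := isSimpleModule_iff_isCoatom.1 hl
  have h1 : ∃ (x : N) (k : ℤ) (i : V), x.1 ∈ M.gr k ∧ idem π i • x.1 = x.1 ∧
      x ∉ Ring.jacobson Λ • (⊤ : Submodule Λ N) := by
    by_contra! hcon
    refine hco.1 (eq_top_iff.2 fun y _ => ?_)
    have h2 : N.restrictScalars K ≤
        ((Ring.jacobson Λ • (⊤ : Submodule Λ N)).map N.subtype).restrictScalars K := by
      refine hN.trans (iSup_le fun l x hx => ?_)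
      have hx2 : x = ∑ i, idem π i • x := by rw [← Finset.sum_smul, sum_idem, one_smul]
      rw [hx2]
      refine sum_mem fun i _ => ?_
      refine ⟨⟨idem π i • x, N.smul_mem _ hx.1⟩, hcon _ l i ?_ ?_, rfl⟩
      · have := M.smul_mem 0 l _ x (idem_mem i) hx.2
        rwa [Nat.cast_zero, zero_add] at this
      · change idem π i • idem π i • x = idem π i • x
        rw [← mul_smul, idem_mul_self]
    obtain ⟨z, hz, hzy⟩ := h2 y.2
    rwa [← Subtype.ext hzy]
  obtain ⟨x, k, i, hk, hi, hx⟩ := h1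
  have h2 : span Λ {x} = ⊤ := by
    refine eq_top_of_sup_jacobson hπ (hco.2 _ ?_)
    refine lt_of_le_of_ne le_sup_right fun heq => hx ?_
    rw [heq]
    exact Submodule.mem_sup_left (Submodule.mem_span_singleton_self x)
  refine ⟨x.1, k, i, hk, hi, ?_, fun a ha hax => hx ?_⟩
  · have := congrArg (Submodule.map N.subtype) h2
    rwa [Submodule.map_span, Set.image_singleton, Submodule.map_top, Submodule.range_subtype]
      at this
  · have h3 : x = a • x := Subtype.ext hax
    rw [h3]
    exact Submodule.smul_mem_smul ((mem_jacobson_iff hπ).2 ha) trivial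

theorem exists_splitsAs (hM : M.IsDirectSumOfLocals) {t : ℕ} {e : Fin t → V} {h : Fin t → ℤ}
    (ht : M.HasTop e h) : ∃ C, M.SplitsAs e h C ∧ ∀ r, C r ≤ algGE hπ 1 := by
  obtain ⟨n, N, hN, hNl⟩ := hM
  choose x k i hk hi hspan hne using fun j => exists_local_generator hπ (hNl j).1 (hNl j).2
  have hfun : (fun j => span Λ {x j}) = N := funext hspan
  rw [← hfun] at hN
  have hx : M.IsTopSystem i k x := isTopSystem_of_internal hπ hk hi hN hne
  obtain ⟨m, hm1, hm2, hm3, hm4⟩ := ht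
  have hm : M.IsTopSystem e h m := ⟨hm1, hm2, hm3, hm4⟩
  obtain ⟨σ, hσ⟩ := hm.exists_equiv hπ hx
  have hσ' : ∀ j, e (σ j) = i j ∧ h (σ j) = k j := by
    intro j
    obtain ⟨f, -, hf⟩ := hm.exists_expansion hπ (hk j) (hi j)
    exact (hf (σ j)).2.2.2.2.2 (hσ j)
  obtain ⟨hx3, hx4⟩ := isInternal_span_iff.1 hN
  let C : Fin t → Submodule K Λ := fun r =>
    (Ideal.span {idem π (e r)} : Ideal Λ).restrictScalars K ⊓
      LinearMap.ker ((LinearMap.toSpanSingleton Λ M (x (σ.symm r))).restrictScalars K)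
  have hek : ∀ r, i (σ.symm r) = e r ∧ k (σ.symm r) = h r := fun r => by
    have := hσ' (σ.symm r)
    rw [Equiv.apply_symm_apply] at this
    exact ⟨this.1.symm, this.2.symm⟩
  have hid : ∀ r, idem π (e r) • x (σ.symm r) = x (σ.symm r) := fun r => by
    rw [← (hek r).1]; exact hi _
  refine ⟨C, ⟨fun r => x (σ.symm r), fun r => ?_, hid, fun r a => Iff.rfl, ?_⟩, fun r a ha => ?_⟩
  · rw [← (hek r).2]; exact hk _
  · refine isInternal_span_iff.2 ⟨?_, fun f hf r => ?_⟩
    · have : (fun r => x (σ.symm r)) = x ∘ σ.symm := rfl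
      rw [this, Set.range_comp, Equiv.range_eq_univ, Set.image_univ, hx3]
    · have := hx4 (f ∘ σ) (by
        rw [← hf, ← Equiv.sum_comp σ]
        simp) (σ.symm r)
      simpa using this
  · obtain ⟨ha1, ha2⟩ := ha
    have ha3 : a • x (σ.symm r) = 0 := ha2
    have ha4 : a * idem π (e r) = a := by
      obtain ⟨b, rfl⟩ := Ideal.mem_span_singleton'.1 ha1
      rw [mul_assoc, idem_mul_self]
    obtain ⟨c, hc⟩ := exists_scalar_idem hπ a
    have h1 := (idem_mul_scalar hπ hc (e r)).2
    rw [ha4] at h1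
    by_cases hcr : c (e r) = 0
    · rwa [hcr, zero_smul, sub_zero] at h1
    · refine absurd ?_ (hne (σ.symm r) (-(c (e r))⁻¹ • (a - c (e r) • idem π (e r)))
        (Submodule.smul_mem _ _ h1))
      rw [smul_assoc, sub_smul, ha3, zero_sub, smul_assoc, hid, neg_smul_neg, smul_smul,
        inv_mul_cancel₀ hcr, one_smul]

end GrMod

end GradedModules

/-! ### Bases adapted to a filtration by cyclic submodules -/

namespace GrMod

variable {M : GrMod π} {t : ℕ} {e : Fin t → V} {h : Fin t → ℤ} {m : Fin t → M}

/-- The submodule generated by the first `k` generators. -/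
def filt (m : Fin t → M) (k : ℕ) : Submodule Λ M := span Λ (m '' {r | r.1 < k})

theorem filt_mono (m : Fin t → M) {k l : ℕ} (hkl : k ≤ l) : filt m k ≤ filt m l :=
  Submodule.span_mono (Set.image_mono fun _ hr => lt_of_lt_of_le hr hkl)

theorem mem_filt {r : Fin t} {k : ℕ} (h : r.1 < k) : m r ∈ filt m k :=
  subset_span ⟨r, h, rfl⟩

theorem mem_filt_iff {k : ℕ} {x : M} :
    x ∈ filt m k ↔ ∃ f : Fin t → Λ, (∀ r, ¬ r.1 < k → f r = 0) ∧ x = ∑ r, f r • m r := by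
  constructor
  · intro hx
    induction hx using Submodule.span_induction with
    | mem x hx =>
      obtain ⟨r, hr, rfl⟩ := hx
      refine ⟨Pi.single r 1, fun r' hr' => ?_, ?_⟩
      · rw [Pi.single_eq_of_ne]
        rintro rfl
        exact hr' hr
      · rw [Finset.sum_eq_single r (fun b _ hb => by rw [Pi.single_eq_of_ne hb, zero_smul])
          (fun h => absurd (Finset.mem_univ r) h), Pi.single_eq_same, one_smul]
    | zero => exact ⟨0, fun _ _ => rfl, by simp⟩
    | add x y _ _ hx hy =>
      obtain ⟨f, hf, rfl⟩ := hx
      obtain ⟨g, hg, rfl⟩ := hy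
      exact ⟨f + g, fun r hr => by rw [Pi.add_apply, hf r hr, hg r hr, add_zero],
        by simp [add_smul, Finset.sum_add_distrib]⟩
    | smul a x _ hx =>
      obtain ⟨f, hf, rfl⟩ := hx
      exact ⟨a • f, fun r hr => by rw [Pi.smul_apply, hf r hr, smul_zero],
        by simp [Finset.smul_sum, mul_smul]⟩
  · rintro ⟨f, hf, rfl⟩
    refine sum_mem fun r _ => ?_
    by_cases hr : r.1 < k
    · exact Submodule.smul_mem _ _ (mem_filt hr)
    · rw [hf r hr, zero_smul]; exact zero_mem _

theorem filt_eq_top (hm : span Λ (range m) = ⊤) : filt m t = ⊤ := by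
  rw [filt, ← hm, ← Set.image_univ]
  congr 2
  ext r
  simp

variable (hπ : IsPathLengthGraded π)

include hπ

theorem IsTopSystem.notMem_filt (hm : M.IsTopSystem e h m) (r : Fin t) : m r ∉ filt m r := by
  intro hr
  obtain ⟨f, hf, hfe⟩ := mem_filt_iff.1 hr
  have h1 : hm.coef hπ (m r) r = 1 := by
    rw [IsTopSystem.coef, ← hm.basis_apply hπ, Module.Basis.repr_self, Finsupp.single_eq_same]
  have h2 : hm.coef hπ (m r) r = 0 := by
    choose c hc using fun s => exists_scalar_idem hπ (f s)
    have h3 : (Ring.jacobson Λ • (⊤ : Submodule Λ M)).mkQ (m r) =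
        ∑ s, (if s.1 < r.1 then c s (e s) else 0) • hm.basis hπ s := by
      conv_lhs => rw [hfe]
      rw [map_sum]
      refine Finset.sum_congr rfl fun s _ => ?_
      rw [hm.basis_apply]
      split_ifs with hs
      · have h4 := smul_mem_radPow hπ (idem_mul_scalar hπ (hc s) (e s)).2 (m s)
        rw [sub_smul, mul_smul, smul_assoc, hm.idem_smul] at h4
        exact (Submodule.Quotient.eq _).2 h4
      · rw [hf s hs, zero_smul, zero_smul, map_zero]
    rw [IsTopSystem.coef, h3, Module.Basis.repr_sum_self, if_neg (lt_irrefl _)]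
  exact one_ne_zero (h1.symm.trans h2)

theorem exists_adapted_set (hm : M.IsTopSystem e h m) : ∀ k ≤ t, ∃ B : Set M,
    LinearIndepOn K id B ∧
    (∀ j ≤ k, span K (B ∩ filt m j) = (filt m j).restrictScalars K) ∧
    (∀ x ∈ B, ∃ (r : Fin t) (l : ℕ) (i : V) (a : Λ), r.1 < k ∧ a ∈ algDegree π l ∧
      idem π i * a = a ∧ x = a • m r ∧ x ∉ filt m r) ∧
    ∀ r : Fin t, r.1 < k → m r ∈ B := by
  intro k
  induction k with
  | zero =>
    intro _
    refine ⟨∅, linearIndepOn_empty K id, fun j hj => ?_, fun x hx => absurd hx (Set.notMem_empty x),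
      fun r hr => absurd hr (Nat.not_lt_zero _)⟩
    obtain rfl : j = 0 := by omega
    have : filt m 0 = ⊥ := by
      rw [filt]
      convert Submodule.span_empty
      ext x
      simp
    rw [this]
    simp
  | succ k ih =>
    intro hk
    obtain ⟨B, hB1, hB2, hB3, hB4⟩ := ih (by omega)
    let κ : Fin t := ⟨k, by omega⟩
    have hBF : span K B = (filt m k).restrictScalars K := by
      refine le_antisymm (span_le.2 fun x hx => ?_) ?_
      · obtain ⟨r, l, i, a, hr, -, -, rfl, -⟩ := hB3 x hx
        exact Submodule.smul_mem _ _ (mem_filt hr)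
      · rw [← hB2 k le_rfl]
        exact Submodule.span_mono Set.inter_subset_left
    have hκ : m κ ∉ span K B := by
      rw [hBF]; exact hm.notMem_filt hπ κ
    let T : Set M := {x | ∃ (l : ℕ) (i : V) (a : Λ), a ∈ algDegree π l ∧ idem π i * a = a ∧
      x = a • m κ}
    have hκT : m κ ∈ T := ⟨0, e κ, idem π (e κ), idem_mem _, idem_mul_self _,
      (hm.idem_smul κ).symm⟩
    have hsub : insert (m κ) B ⊆ B ∪ T :=
      Set.insert_subset (Or.inr hκT) Set.subset_union_left
    obtain ⟨B', hB'1, hB'2, hB'3, hB'4⟩ :=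
      exists_linearIndepOn_id_extension (hB1.id_insert hκ) hsub
    have hBB' : B ⊆ B' := (Set.subset_insert _ _).trans hB'2
    refine ⟨B', hB'4, fun j hj => ?_, fun x hx => ?_, fun r hr => ?_⟩
    · refine le_antisymm (span_le.2 fun x hx => hx.2) ?_
      obtain hj | rfl : j ≤ k ∨ j = k + 1 := by omega
      · rw [← hB2 j hj]
        exact Submodule.span_mono (Set.inter_subset_inter_left _ hBB')
      · have hB'F : B' ∩ filt m (k + 1) = B' := by
          refine Set.inter_eq_left.2 fun x hx => ?_
          obtain hx | ⟨l, i, a, -, -, rfl⟩ := hB'1 hx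
          · exact filt_mono m (Nat.le_succ k) (by
              have : x ∈ span K B := subset_span hx
              rwa [hBF] at this)
          · exact Submodule.smul_mem _ _ (mem_filt (Nat.lt_succ_self k))
        rw [hB'F]
        intro x hx
        obtain ⟨f, hf, rfl⟩ := mem_filt_iff.1 hx
        refine sum_mem fun r _ => ?_
        by_cases hr : r.1 < k + 1
        · obtain hr | hr : r.1 < k ∨ r.1 = k := by omega
          · have : f r • m r ∈ span K B := by
              rw [hBF]; exact Submodule.smul_mem _ _ (mem_filt hr)
            exact Submodule.span_mono hBB' this
          · obtain rfl : r = κ := Fin.ext hr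
            have h1 : f κ • m κ =
                ∑ l ∈ Finset.range (algBound hπ), ∑ i, (idem π i * algProj hπ l (f κ)) • m κ := by
              conv_lhs => rw [← sum_algProj hπ (f κ)]
              rw [Finset.sum_smul]
              refine Finset.sum_congr rfl fun l _ => ?_
              rw [← Finset.sum_smul, ← Finset.sum_mul, sum_idem, one_mul]
            rw [h1]
            refine sum_mem fun l _ => sum_mem fun i _ =>
              hB'3 (Or.inr ⟨l, i, _, ?_, ?_, rfl⟩)
            · rw [← algProj_idem_mul]; exact algProj_mem hπ l _
            · rw [← mul_assoc, idem_mul_self]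
        · rw [hf r hr, zero_smul]; exact zero_mem _
    · by_cases hxB : x ∈ B
      · obtain ⟨r, l, i, a, h1, h2⟩ := hB3 x hxB
        exact ⟨r, l, i, a, h1.trans (Nat.lt_succ_self k), h2⟩
      · obtain hx' | ⟨l, i, a, h1, h2, h3⟩ := hB'1 hx
        · exact absurd hx' hxB
        · refine ⟨κ, l, i, a, Nat.lt_succ_self k, h1, h2, h3, fun hxF => ?_⟩
          have h4 : x ∈ span K B := by rw [hBF]; exact hxF
          refine (hB'4.mono (Set.insert_subset hx hBB')).notMem_span_of_insert hxB ?_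
          rwa [Set.image_id]
    · obtain hr | hr : r.1 < k ∨ r.1 = k := by omega
      · exact hBB' (hB4 r hr)
      · obtain rfl : r = κ := Fin.ext hr
        exact hB'2 (Set.mem_insert _ _)

/-- A basis adapted to the filtration of `M` by the submodules generated by initial segments of the
top elements. -/
theorem exists_adapted_basis (hm : M.IsTopSystem e h m) {d : ℕ} (hd : 0 < d)
    (hMd : finrank K M = d) :
    ∃ (b : Module.Basis (Fin d) K M) (w : Fin d → Fin t) (l : Fin d → ℕ) (i : Fin d → V)
      (a : Fin d → Λ) (p : Fin t → Fin d),
      (∀ q, a q ∈ algDegree π (l q) ∧ idem π (i q) * a q = a q ∧ b q = a q • m (w q)) ∧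
      (∀ k, b (p k) = m k ∧ w (p k) = k ∧ l (p k) = 0) ∧
      ∀ k, ∀ x ∈ filt m k, ∀ q, b.repr x q ≠ 0 → (w q).1 < k := by
  have : FiniteDimensional K M := Module.finite_of_finrank_pos (by omega)
  obtain ⟨B, hB1, hB2, hB3, hB4⟩ := exists_adapted_set hπ hm t le_rfl
  have hspan : span K B = ⊤ := by
    refine eq_top_iff.2 (le_trans ?_ (Submodule.span_mono (Set.inter_subset_left (t := filt m t))))
    rw [hB2 t le_rfl, filt_eq_top hm.span]
    exact fun _ _ => trivial
  let b₀ : Module.Basis B K M := Module.Basis.mk (v := fun x : B => (x : M)) hB1 (by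
    rw [Subtype.range_coe, hspan])
  have : Finite B := Module.Finite.finite_basis b₀
  have := Fintype.ofFinite B
  let ε : B ≃ Fin d := Fintype.equivFinOfCardEq (by
    rw [← Module.finrank_eq_card_basis b₀, hMd])
  have hb₀ : ∀ x, b₀ x = x.1 := fun x => Module.Basis.mk_apply _ _ _
  let b := b₀.reindex ε
  have hb : ∀ q, b q = (ε.symm q).1 := fun q => by
    rw [Module.Basis.reindex_apply, hb₀]
  choose w l i a hw hl hi ha hn using fun q : Fin d => hB3 (ε.symm q).1 (ε.symm q).2
  refine ⟨b, w, l, i, a, fun k => ε ⟨m k, hB4 k k.2⟩, fun q => ⟨hl q, hi q, (hb q).trans (ha q)⟩,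
    fun k => ?_, fun k x hx q hq => ?_⟩
  · have h1 : b (ε ⟨m k, hB4 k k.2⟩) = m k := by rw [hb, Equiv.symm_apply_apply]
    have h2 : m k = a (ε ⟨m k, hB4 k k.2⟩) • m (w (ε ⟨m k, hB4 k k.2⟩)) := by
      rw [← ha, Equiv.symm_apply_apply]
    have h3 : w (ε ⟨m k, hB4 k k.2⟩) = k := by
      refine le_antisymm (not_lt.1 fun hlt => ?_) (not_lt.1 fun hlt => ?_)
      · refine hn (ε ⟨m k, hB4 k k.2⟩) ?_
        rw [Equiv.symm_apply_apply]
        exact mem_filt hlt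
      · refine hm.notMem_filt hπ k ?_
        rw [h2]
        exact Submodule.smul_mem _ _ (mem_filt hlt)
    refine ⟨h1, h3, ?_⟩
    have h4 := M.smul_mem _ _ _ _ (hl (ε ⟨m k, hB4 k k.2⟩)) (hm.mem (w (ε ⟨m k, hB4 k k.2⟩)))
    rw [← h2, h3] at h4
    by_contra h5
    have h6 := (proj_of_mem M h4 (h k)).symm.trans (proj_of_mem M (hm.mem k) (h k))
    rw [if_pos rfl, if_neg (fun h7 => h5 (by simpa using h7))] at h6
    exact hm.ne_zero k h6.symm
  · by_cases hk : k ≤ t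
    · have h1 : x ∈ span K (B ∩ filt m k) := by rw [hB2 k hk]; exact hx
      have h2 : B ∩ filt m k = b '' {q | b q ∈ filt m k} := by
        ext y
        constructor
        · rintro ⟨hy, hyF⟩
          have : b (ε ⟨y, hy⟩) = y := by rw [hb, Equiv.symm_apply_apply]
          have h5 : b (ε ⟨y, hy⟩) ∈ filt m k := by rw [this]; exact hyF
          exact ⟨ε ⟨y, hy⟩, h5, this⟩
        · rintro ⟨q, hq, rfl⟩
          exact ⟨by rw [hb]; exact (ε.symm q).2, hq⟩
      rw [h2, Module.Basis.mem_span_image] at h1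
      have h3 : b q ∈ filt m k := h1 (Finsupp.mem_support_iff.2 hq)
      by_contra h4
      refine hn q (filt_mono m (not_lt.1 h4) ?_)
      rwa [← hb]
    · exact (w q).2.trans (not_le.1 hk)

end GrMod

/-! ### Graded modules given by matrices -/

section Matrices

theorem isInternal_of_proj {M : Type*} [AddCommGroup M] [Module K M] {gr : ℤ → Submodule K M}
    (p : ℤ → M →ₗ[K] M) (hp : ∀ n k x, x ∈ gr n → p k x = if k = n then x else 0)
    (htop : ∀ x, x ∈ ⨆ n, gr n) : DirectSum.IsInternal gr := by
  refine DirectSum.isInternal_submodule_of_iSupIndep_of_iSup_eq_top ?_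
    (eq_top_iff.2 fun x _ => htop x)
  refine (iSupIndep_iff_finsetSum_eq_zero_imp_eq_zero _).2 fun s v hv h0 k hk => ?_
  have h1 := congrArg (p k) h0
  rw [map_sum, map_zero, Finset.sum_eq_single k] at h1
  · rwa [hp k k _ (hv k hk), if_pos rfl] at h1
  · intro n hn hnk
    rw [hp n k _ (hv n hn), if_neg hnk.symm]
  · exact fun h => absurd hk h

/-- The vectors supported on a set of coordinates. -/
def supportedOn (K : Type u) [Field K] {d : ℕ} (s : Fin d → Prop) : Submodule K (Fin d → K) where
  carrier := {v | ∀ q, v q ≠ 0 → s q}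
  add_mem' := by
    intro v v' hv hv' q hq
    by_contra hs
    refine hq ?_
    have h1 : v q = 0 := by_contra fun h => hs (hv q h)
    have h2 : v' q = 0 := by_contra fun h => hs (hv' q h)
    rw [Pi.add_apply, h1, h2, add_zero]
  zero_mem' := fun q hq => absurd rfl hq
  smul_mem' := by
    intro c v hv q hq
    refine hv q fun h => hq ?_
    rw [Pi.smul_apply, h, smul_zero]

theorem single_mem_supportedOn {d : ℕ} {s : Fin d → Prop} {q : Fin d} (c : K) (hq : s q) :
    Pi.single q c ∈ supportedOn K s := by
  intro q' hq'
  by_cases h : q' = q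
  · rwa [h]
  · rw [Pi.single_eq_of_ne h] at hq'; exact absurd rfl hq'

namespace GrMod

variable {d : ℕ}

/-- The graded module with underlying space `K ^ d` given by a matrix representation. -/
def ofMatrix (ρ : Λ →ₐ[K] Matrix (Fin d) (Fin d) K) (deg : Fin d → ℤ)
    (hρ : ∀ (l : ℕ) (a : Λ), a ∈ algDegree π l → ∀ q s, ρ a q s ≠ 0 → deg q = l + deg s) :
    GrMod π where
  carrier := Fin d → K
  addCommGroup := inferInstance
  moduleK := inferInstance
  moduleΛ := Module.compHom (Fin d → K)
    ((Matrix.toLinAlgEquiv' (R := K) (n := Fin d)).toAlgHom.comp ρ).toRingHom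
  tower := by
    let _ : Module Λ (Fin d → K) := Module.compHom (Fin d → K)
      ((Matrix.toLinAlgEquiv' (R := K) (n := Fin d)).toAlgHom.comp ρ).toRingHom
    exact ⟨fun c a v => LinearMap.congr_fun
      (map_smul ((Matrix.toLinAlgEquiv' (R := K) (n := Fin d)).toAlgHom.comp ρ) c a) v⟩
  gr n := supportedOn K fun q => deg q = n
  internal := by
    refine isInternal_of_proj (fun k => LinearMap.pi fun q =>
      if deg q = k then LinearMap.proj q else 0) (fun n k v hv => ?_) fun v => ?_
    · funext q
      rw [LinearMap.pi_apply]
      by_cases hq : v q = 0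
      · split_ifs <;> simp [hq]
      · have := hv q hq
        simp only [this, eq_comm (a := n)]
        split_ifs <;> simp
    · rw [pi_eq_sum_univ' v]
      refine sum_mem fun q _ => Submodule.smul_mem _ _ (Submodule.mem_iSup_of_mem (deg q) ?_)
      have := single_mem_supportedOn (K := K) (s := fun q' => deg q' = deg q) (q := q) 1 rfl
      convert this using 1
  smul_mem := by
    intro l n a v ha hv q hq
    change ∑ s, ρ a q s * v s ≠ 0 at hq
    obtain ⟨s, -, hs⟩ := Finset.exists_ne_zero_of_sum_ne_zero hq
    rw [hρ l a ha q s (left_ne_zero_of_mul hs), hv s (right_ne_zero_of_mul hs)]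

variable {ρ : Λ →ₐ[K] Matrix (Fin d) (Fin d) K} {deg : Fin d → ℤ}
    {hρ : ∀ (l : ℕ) (a : Λ), a ∈ algDegree π l → ∀ q s, ρ a q s ≠ 0 → deg q = l + deg s}

/-- The basis vectors. -/
def ofMatrix.single (ρ : Λ →ₐ[K] Matrix (Fin d) (Fin d) K) (deg : Fin d → ℤ)
    (hρ : ∀ (l : ℕ) (a : Λ), a ∈ algDegree π l → ∀ q s, ρ a q s ≠ 0 → deg q = l + deg s)
    (q : Fin d) : ofMatrix ρ deg hρ := (Pi.single q 1 : Fin d → K)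

/-- The coordinates. -/
def ofMatrix.coord (ρ : Λ →ₐ[K] Matrix (Fin d) (Fin d) K) (deg : Fin d → ℤ)
    (hρ : ∀ (l : ℕ) (a : Λ), a ∈ algDegree π l → ∀ q s, ρ a q s ≠ 0 → deg q = l + deg s)
    (q : Fin d) : ofMatrix ρ deg hρ →ₗ[K] K := LinearMap.proj (R := K) (φ := fun _ : Fin d => K) q

theorem ofMatrix.coord_smul_single (a : Λ) (q s : Fin d) :
    ofMatrix.coord ρ deg hρ q (a • ofMatrix.single ρ deg hρ s) = ρ a q s := by
  change (ρ a).mulVec (Pi.single s 1) q = _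
  rw [Matrix.mulVec_single_one]
  rfl

theorem ofMatrix.coord_single (q s : Fin d) : ofMatrix.coord ρ deg hρ q
    (ofMatrix.single ρ deg hρ s) = if q = s then 1 else 0 := Pi.single_apply _ _ _

theorem ofMatrix.ext {x y : ofMatrix ρ deg hρ}
    (h : ∀ q, ofMatrix.coord ρ deg hρ q x = ofMatrix.coord ρ deg hρ q y) : x = y := funext h

theorem ofMatrix.sum_single (x : ofMatrix ρ deg hρ) :
    x = ∑ q, ofMatrix.coord ρ deg hρ q x • ofMatrix.single ρ deg hρ q := by
  refine ofMatrix.ext fun q => ?_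
  rw [map_sum]
  simp only [map_smul, ofMatrix.coord_single, smul_eq_mul, mul_ite, mul_one, mul_zero,
    Finset.sum_ite_eq, Finset.mem_univ, if_true]

theorem ofMatrix.single_mem (q : Fin d) :
    ofMatrix.single ρ deg hρ q ∈ (ofMatrix ρ deg hρ).gr (deg q) :=
  single_mem_supportedOn (s := fun q' => deg q' = deg q) 1 rfl

end GrMod

/-- Rescaling of a filtered matrix representation. -/
def rees {d : ℕ} (A : Λ →ₐ[K] Matrix (Fin d) (Fin d) K) (w : Fin d → ℕ)
    (hA : ∀ a q s, A a q s ≠ 0 → w q ≤ w s) (c : K) : Λ →ₐ[K] Matrix (Fin d) (Fin d) K :=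
  AlgHom.ofLinearMap
    { toFun := fun a => Matrix.of fun q s => c ^ (w s - w q) * A a q s
      map_add' := fun a b => by ext q s; simp [mul_add]
      map_smul' := fun k a => by ext q s; simp; ring }
    (by
      ext q s
      change c ^ (w s - w q) * A 1 q s = _
      rw [map_one, Matrix.one_apply]
      split_ifs with h
      · rw [h, Nat.sub_self, pow_zero, mul_one]
      · rw [mul_zero])
    (fun a b => by
      ext q s
      change c ^ (w s - w q) * A (a * b) q s =
        ∑ r, (c ^ (w r - w q) * A a q r) * (c ^ (w s - w r) * A b r s)
      rw [map_mul, Matrix.mul_apply, Finset.mul_sum]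
      refine Finset.sum_congr rfl fun r _ => ?_
      by_cases h1 : A a q r = 0
      · rw [h1]; ring
      by_cases h2 : A b r s = 0
      · rw [h2]; ring
      have h3 := hA _ _ _ h1
      have h4 := hA _ _ _ h2
      rw [show w s - w q = (w r - w q) + (w s - w r) by omega, pow_add]
      ring)

end Matrices

/-! ### The degeneration of a graded module to a direct sum of local modules -/

namespace GrMod

/-- A basis adapted to the filtration by the submodules generated by initial segments of a
sequence of top elements. -/
structure AdaptedBasis (M : GrMod π) {t : ℕ} (m : Fin t → M) (d : ℕ) where
  b : Module.Basis (Fin d) K M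
  w : Fin d → Fin t
  l : Fin d → ℕ
  i : Fin d → V
  a : Fin d → Λ
  p : Fin t → Fin d
  a_mem : ∀ q, a q ∈ algDegree π (l q)
  idem_mul : ∀ q, idem π (i q) * a q = a q
  b_eq : ∀ q, b q = a q • m (w q)
  b_p : ∀ k, b (p k) = m k
  w_p : ∀ k, w (p k) = k
  l_p : ∀ k, l (p k) = 0
  filt_le : ∀ k, ∀ x ∈ filt m k, ∀ q, b.repr x q ≠ 0 → (w q).1 < k

variable {M : GrMod π} {t : ℕ} {e : Fin t → V} {h : Fin t → ℤ} {m : Fin t → M} {d : ℕ}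

theorem IsTopSystem.nonempty_adaptedBasis (hπ : IsPathLengthGraded π) (hm : M.IsTopSystem e h m)
    (hd : 0 < d) (hMd : finrank K M = d) : Nonempty (AdaptedBasis M m d) := by
  obtain ⟨b, w, l, i, a, p, h1, h2, h3⟩ := exists_adapted_basis hπ hm hd hMd
  exact ⟨⟨b, w, l, i, a, p, fun q => (h1 q).1, fun q => (h1 q).2.1, fun q => (h1 q).2.2,
    fun k => (h2 k).1, fun k => (h2 k).2.1, fun k => (h2 k).2.2, h3⟩⟩

namespace AdaptedBasis

variable (B : AdaptedBasis M m d)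

/-- The matrix representation on the adapted basis. -/
def matrix : Λ →ₐ[K] Matrix (Fin d) (Fin d) K :=
  (LinearMap.toMatrixAlgEquiv B.b).toAlgHom.comp (Algebra.lsmul K K M)

theorem matrix_apply (a : Λ) (q s : Fin d) : B.matrix a q s = B.b.repr (a • B.b s) q :=
  LinearMap.toMatrixAlgEquiv_apply _ _ _ _

theorem le_of_matrix (a : Λ) (q s : Fin d) (hq : B.matrix a q s ≠ 0) : (B.w q).1 ≤ (B.w s).1 := by
  rw [matrix_apply] at hq
  refine Nat.lt_succ_iff.1 (B.filt_le _ _ ?_ q hq)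
  rw [B.b_eq]
  exact Submodule.smul_mem _ _ (Submodule.smul_mem _ _ (mem_filt (Nat.lt_succ_self _)))

/-- The degrees of the basis elements. -/
def deg (h : Fin t → ℤ) (q : Fin d) : ℤ := B.l q + h (B.w q)

theorem b_mem (hm : M.IsTopSystem e h m) (q : Fin d) : B.b q ∈ M.gr (B.deg h q) := by
  rw [B.b_eq]
  exact M.smul_mem _ _ _ _ (B.a_mem q) (hm.mem _)

theorem deg_of_repr (hm : M.IsTopSystem e h m) {n : ℤ} {x : M} (hx : x ∈ M.gr n) {q : Fin d}
    (hq : B.b.repr x q ≠ 0) : B.deg h q = n := by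
  have h1 : x = ∑ s, (if n = B.deg h s then B.b.repr x s else 0) • B.b s := by
    conv_lhs => rw [← (mem_gr_iff M).1 hx, ← B.b.sum_repr x, map_sum]
    refine Finset.sum_congr rfl fun s _ => ?_
    rw [map_smul, proj_of_mem M (B.b_mem hm s)]
    split_ifs
    · rfl
    · rw [smul_zero, zero_smul]
  rw [h1, Module.Basis.repr_sum_self] at hq
  by_contra h2
  exact hq (if_neg fun h3 => h2 h3.symm)

theorem deg_of_matrix (hm : M.IsTopSystem e h m) (l : ℕ) (a : Λ) (ha : a ∈ algDegree π l)
    (q s : Fin d) (hq : B.matrix a q s ≠ 0) : B.deg h q = l + B.deg h s := by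
  rw [matrix_apply] at hq
  exact B.deg_of_repr hm (M.smul_mem _ _ _ _ ha (B.b_mem hm s)) hq

/-- The rescaled representation. -/
def rep (c : K) : Λ →ₐ[K] Matrix (Fin d) (Fin d) K :=
  rees B.matrix (fun q => (B.w q).1) B.le_of_matrix c

theorem rep_apply (c : K) (a : Λ) (q s : Fin d) :
    B.rep c a q s = c ^ ((B.w s).1 - (B.w q).1) * B.matrix a q s := rfl

theorem deg_of_rep (hm : M.IsTopSystem e h m) (c : K) (l : ℕ) (a : Λ) (ha : a ∈ algDegree π l)
    (q s : Fin d) (hq : B.rep c a q s ≠ 0) : B.deg h q = l + B.deg h s :=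
  B.deg_of_matrix hm l a ha q s (right_ne_zero_of_mul hq)

/-- The fibre at `c` of the degeneration. -/
def fibre (hm : M.IsTopSystem e h m) (c : K) : GrMod π :=
  ofMatrix (B.rep c) (B.deg h) (B.deg_of_rep hm c)

/-- The basis of the fibre. -/
def vec (hm : M.IsTopSystem e h m) (c : K) (q : Fin d) : B.fibre hm c :=
  ofMatrix.single (B.rep c) (B.deg h) (B.deg_of_rep hm c) q

/-- The coordinates on the fibre. -/
def coord (hm : M.IsTopSystem e h m) (c : K) (q : Fin d) : B.fibre hm c →ₗ[K] K :=
  ofMatrix.coord (B.rep c) (B.deg h) (B.deg_of_rep hm c) q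

variable (hm : M.IsTopSystem e h m) (c : K)

theorem coord_smul_vec (a : Λ) (q s : Fin d) :
    B.coord hm c q (a • B.vec hm c s) = B.rep c a q s := ofMatrix.coord_smul_single _ _ _

theorem coord_vec (q s : Fin d) : B.coord hm c q (B.vec hm c s) = if q = s then 1 else 0 :=
  ofMatrix.coord_single _ _

theorem fibre_ext {x y : B.fibre hm c} (hxy : ∀ q, B.coord hm c q x = B.coord hm c q y) : x = y :=
  ofMatrix.ext hxy

theorem sum_vec (x : B.fibre hm c) : x = ∑ q, B.coord hm c q x • B.vec hm c q :=
  ofMatrix.sum_single x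

theorem smul_gen {a : Λ} {k : Fin t} {q : Fin d} (ha : a • m k = B.b q) (hk : B.w q = k) :
    a • B.vec hm c (B.p k) = B.vec hm c q := by
  refine B.fibre_ext hm c fun q' => ?_
  rw [coord_smul_vec, coord_vec, rep_apply, matrix_apply, B.b_p, ha, Module.Basis.repr_self,
    Finsupp.single_apply, B.w_p]
  by_cases hq : q' = q
  · rw [if_pos hq.symm, if_pos hq, hq, hk, Nat.sub_self, pow_zero, mul_one]
  · rw [if_neg (fun h => hq h.symm), if_neg hq, mul_zero]

theorem vec_eq (q : Fin d) : B.a q • B.vec hm c (B.p (B.w q)) = B.vec hm c q :=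
  B.smul_gen hm c (B.b_eq q).symm rfl

theorem gen_mem (k : Fin t) : B.vec hm c (B.p k) ∈ (B.fibre hm c).gr (h k) := by
  have h1 : B.deg h (B.p k) = h k := by rw [deg, B.l_p, B.w_p, Nat.cast_zero, zero_add]
  have h2 : B.vec hm c (B.p k) ∈ (B.fibre hm c).gr (B.deg h (B.p k)) := ofMatrix.single_mem _
  rwa [h1] at h2

theorem idem_smul_gen (k : Fin t) : idem π (e k) • B.vec hm c (B.p k) = B.vec hm c (B.p k) :=
  B.smul_gen hm c (by rw [hm.idem_smul, B.b_p]) (B.w_p k)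

theorem span_gen : span Λ (range fun k => B.vec hm c (B.p k)) = ⊤ := by
  refine eq_top_iff.2 fun x _ => ?_
  rw [B.sum_vec hm c x]
  refine sum_mem fun q _ => ?_
  rw [← B.vec_eq, ← smul_assoc]
  exact Submodule.smul_mem _ _ (subset_span ⟨_, rfl⟩)

variable (hπ : IsPathLengthGraded π) (hmono : Monotone h)

include hπ hmono

theorem mem_radPow_fibre {l : ℕ} {x : B.fibre hm c} :
    x ∈ radPow Λ (B.fibre hm c) l ↔ ∀ q, B.coord hm c q x ≠ 0 → l ≤ B.l q := by
  constructor
  · intro hx q hq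
    obtain ⟨f, hf, rfl⟩ := (mem_radPow_iff hπ (B.span_gen hm c)).1 hx
    by_contra hlq
    refine hq ?_
    rw [map_sum]
    refine Finset.sum_eq_zero fun r _ => ?_
    rw [coord_smul_vec, rep_apply]
    have h1 : algGE hπ l ≤ LinearMap.ker
        ((Matrix.entryLinearMap K K q (B.p r)) ∘ₗ B.matrix.toLinearMap) := by
      refine algGE_le hπ fun n hn a ha => ?_
      change B.matrix a q (B.p r) = 0
      by_contra h2
      have h3 := B.deg_of_matrix hm n a ha _ _ h2
      have h4 := B.le_of_matrix _ _ _ h2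
      rw [deg, deg, B.l_p, B.w_p] at h3
      rw [B.w_p] at h4
      have h5 := hmono (show B.w q ≤ r from h4)
      omega
    have h2 : B.matrix (f r) q (B.p r) = 0 := h1 (hf r)
    rw [h2, mul_zero]
  · intro hx
    rw [B.sum_vec hm c x]
    refine sum_mem fun q _ => ?_
    by_cases hq : B.coord hm c q x = 0
    · rw [hq, zero_smul]; exact zero_mem _
    · rw [← B.vec_eq, ← smul_assoc]
      exact smul_mem_radPow hπ (Submodule.smul_mem _ _
        (algDegree_le_algGE hπ (hx q hq) (B.a_mem q))) _

theorem isTopSystem_fibre :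
    (B.fibre hm c).IsTopSystem e h fun k => B.vec hm c (B.p k) := by
  refine ⟨B.gen_mem hm c, B.idem_smul_gen hm c, B.span_gen hm c,
    Fintype.linearIndependent_iff.2 fun g hg k => ?_⟩
  have h1 : ∑ r, g r • B.vec hm c (B.p r) ∈ radPow Λ (B.fibre hm c) 1 := by
    refine (Submodule.Quotient.mk_eq_zero _).1 ((Eq.trans ?_ hg))
    change Submodule.mkQ _ _ = _
    rw [map_sum]
    rfl
  by_contra hk
  have h2 := (B.mem_radPow_fibre hm c hπ hmono).1 h1 (B.p k) (by
    rw [map_sum, Finset.sum_eq_single k]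
    · rwa [map_smul, coord_vec, if_pos rfl, smul_eq_mul, mul_one]
    · intro r _ hr
      rw [map_smul, coord_vec, if_neg, smul_zero]
      intro hpr
      refine hr ?_
      rw [← B.w_p r, ← hpr, B.w_p]
    · simp)
  rw [B.l_p] at h2
  omega

theorem mem_atVertex_fibre {l : ℕ} {j : V} {x : B.fibre hm c} :
    x ∈ atVertex (K := K) π (radPow Λ (B.fibre hm c) l) j ↔
      ∀ q, B.coord hm c q x ≠ 0 → l ≤ B.l q ∧ B.i q = j := by
  classical
  have h1 : ∀ q, idem π j • B.vec hm c q = if B.i q = j then B.vec hm c q else 0 := by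
    intro q
    rw [← B.vec_eq, ← B.idem_mul, ← mul_smul, ← mul_assoc]
    split_ifs with hq
    · rw [hq, idem_mul_self]
    · rw [idem_mul_of_ne (fun h => hq h.symm), zero_mul, zero_smul]
  have h2 : ∀ q, B.coord hm c q (idem π j • x) =
      if B.i q = j then B.coord hm c q x else 0 := by
    intro q
    conv_lhs => rw [B.sum_vec hm c x, Finset.smul_sum, map_sum]
    rw [Finset.sum_eq_single q]
    · rw [← smul_comm, h1, map_smul]
      split_ifs
      · rw [coord_vec, if_pos rfl, smul_eq_mul, mul_one]
      · rw [map_zero, smul_zero]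
    · intro s _ hs
      rw [← smul_comm, h1, map_smul]
      split_ifs
      · rw [coord_vec, if_neg (fun h => hs h.symm), smul_zero]
      · rw [map_zero, smul_zero]
    · simp
  rw [mem_atVertex, B.mem_radPow_fibre hm c hπ hmono]
  constructor
  · rintro ⟨h3, h4⟩ q hq
    refine ⟨h3 q hq, ?_⟩
    rw [← h4, h2] at hq
    by_contra h5
    rw [if_neg h5] at hq
    exact hq rfl
  · intro h3
    refine ⟨fun q hq => (h3 q hq).1, B.fibre_ext hm c fun q => ?_⟩
    rw [h2]
    split_ifs with h4
    · rfl
    · by_contra h5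
      exact h4 (h3 q (fun h => h5 h.symm)).2

theorem finrank_atVertex_fibre (c' : K) (l : ℕ) (j : V) :
    finrank K (atVertex (K := K) π (radPow Λ (B.fibre hm c) l) j) =
      finrank K (atVertex (K := K) π (radPow Λ (B.fibre hm c') l) j) := by
  have key : ∀ c, atVertex (K := K) π (radPow Λ (B.fibre hm c) l) j =
      supportedOn K (d := d) fun q => l ≤ B.l q ∧ B.i q = j := fun c =>
    Submodule.ext fun x => B.mem_atVertex_fibre hm c hπ hmono
  exact (congrArg (fun P : Submodule K (Fin d → K) => finrank K P) (key c)).trans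
    (congrArg (fun P : Submodule K (Fin d → K) => finrank K P) (key c').symm)

omit hmono in
theorem gradedIso_fibre (hc : c ≠ 0) : ∃ F : M ≃ₗ[Λ] B.fibre hm c,
    ∀ (l : ℤ) (x : M), x ∈ M.gr l ↔ F x ∈ (B.fibre hm c).gr (l + 0) := by
  have h1 : span Λ (range fun k : Fin t => c ^ k.1 • m k) = ⊤ := by
    rw [eq_top_iff, ← hm.span, span_le]
    rintro _ ⟨k, rfl⟩
    have h2 : m k = ((c ^ k.1)⁻¹ • (1 : Λ)) • c ^ k.1 • m k := by
      rw [smul_assoc, one_smul, smul_smul, inv_mul_cancel₀ (pow_ne_zero _ hc), one_smul]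
    rw [h2]
    exact Submodule.smul_mem _ _ (subset_span ⟨k, rfl⟩)
  have hrel : ∀ f : Fin t → Λ, ∑ k, f k • c ^ k.1 • m k = 0 ↔
      ∑ k, f k • B.vec hm c (B.p k) = 0 := by
    intro f
    have h2 : ∀ q, B.b.repr (∑ k, f k • c ^ k.1 • m k) q =
        c ^ (B.w q).1 * B.coord hm c q (∑ k, f k • B.vec hm c (B.p k)) := by
      intro q
      rw [map_sum, map_sum, Finset.mul_sum, Finsupp.finsetSum_apply]
      refine Finset.sum_congr rfl fun k _ => ?_
      rw [coord_smul_vec, rep_apply, matrix_apply, smul_comm, map_smul, Finsupp.smul_apply,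
        smul_eq_mul, B.b_p, B.w_p]
      by_cases h3 : B.b.repr (f k • m k) q = 0
      · rw [h3, mul_zero, mul_zero, mul_zero]
      · have h4 := B.le_of_matrix (f k) q (B.p k) (by rwa [matrix_apply, B.b_p])
        rw [B.w_p] at h4
        rw [← mul_assoc, ← pow_add, Nat.add_sub_cancel' h4]
    constructor
    · intro h3
      refine B.fibre_ext hm c fun q => ?_
      have h4 := h2 q
      rw [h3, map_zero, Finsupp.zero_apply] at h4
      rw [map_zero]
      exact (mul_eq_zero.1 h4.symm).resolve_left (pow_ne_zero _ hc)
    · intro h3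
      refine B.b.repr.injective (Finsupp.ext fun q => ?_)
      rw [h2, h3, map_zero, mul_zero, map_zero, Finsupp.zero_apply]
  obtain ⟨F, -, hF⟩ := gradedIso_of_relations hπ (M := M) (N := B.fibre hm c) (h := h) (s := 0)
    (m := fun k => c ^ k.1 • m k) (n := fun k => B.vec hm c (B.p k))
    (fun k => (M.gr _).smul_mem _ (hm.mem k))
    (fun k => by rw [add_zero]; exact B.gen_mem hm c k) h1 (B.span_gen hm c) hrel
  exact ⟨F, hF⟩

omit hπ hmono in
theorem isInternal_fibre_zero : DirectSum.IsInternal fun k =>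
    span Λ {B.vec hm 0 (B.p k)} := by
  refine isInternal_span_iff.2 ⟨B.span_gen hm 0, fun f hf k => ?_⟩
  have h1 : ∀ r q, r ≠ B.w q → B.coord hm 0 q (f r • B.vec hm 0 (B.p r)) = 0 := by
    intro r q hr
    rw [coord_smul_vec, rep_apply, B.w_p]
    by_cases h2 : B.matrix (f r) q (B.p r) = 0
    · rw [h2, mul_zero]
    · have h3 := B.le_of_matrix _ _ _ h2
      rw [B.w_p] at h3
      have h4 : (B.w q).1 ≠ r.1 := fun h => hr (Fin.ext h.symm)
      rw [zero_pow (by omega), zero_mul]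
  refine B.fibre_ext hm 0 fun q => ?_
  rw [map_zero]
  by_cases hk : k = B.w q
  · have h2 := congrArg (B.coord hm 0 q) hf
    rw [map_sum, map_zero, Finset.sum_eq_single k (fun r _ hr => h1 r q (hk ▸ hr))
      (fun h => absurd (Finset.mem_univ k) h)] at h2
    exact h2
  · exact h1 k q hk

end AdaptedBasis

theorem isLocalModule_span (hπ : IsPathLengthGraded π) {x : M} {i : V} (hi : idem π i • x = x)
    (hx : ∀ a ∈ algGE hπ 1, x ≠ a • x) : IsLocalModule Λ (span Λ {x}) := by
  refine isSimpleModule_iff_isCoatom.2 ?_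
  have hgen : ∀ y : span Λ {x}, ∃ a : Λ,
      y = a • ⟨x, Submodule.mem_span_singleton_self x⟩ := fun y => by
    obtain ⟨a, ha⟩ := Submodule.mem_span_singleton.1 y.2
    exact ⟨a, Subtype.ext ha.symm⟩
  set x' : span Λ {x} := ⟨x, Submodule.mem_span_singleton_self x⟩ with hx'
  have hspan : span Λ (range fun _ : Unit => x') = ⊤ := by
    refine eq_top_iff.2 fun y _ => ?_
    obtain ⟨a, rfl⟩ := hgen y
    exact Submodule.smul_mem _ _ (subset_span ⟨(), rfl⟩)
  constructor
  · intro htop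
    have h1 : x' ∈ radPow Λ (span Λ {x}) 1 := by
      change x' ∈ Ring.jacobson Λ • (⊤ : Submodule Λ (span Λ {x}))
      rw [htop]; trivial
    obtain ⟨f, hf, hfx⟩ := (mem_radPow_iff hπ hspan).1 h1
    refine hx (f ()) (hf ()) ?_
    simpa [hx'] using congrArg Subtype.val hfx
  · intro Q hQ
    obtain ⟨y, hyQ, hyP⟩ := SetLike.exists_of_lt hQ
    obtain ⟨a, rfl⟩ := hgen y
    obtain ⟨c, hc⟩ := exists_scalar_idem hπ a
    have h1 := (idem_mul_scalar hπ hc i).2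
    have h2 : (a * idem π i) • x' = a • x' := by
      rw [mul_smul]
      congr 1
      exact Subtype.ext hi
    have h3 : (a * idem π i - c i • idem π i) • x' ∈
        Ring.jacobson Λ • (⊤ : Submodule Λ (span Λ {x})) :=
      Submodule.smul_mem_smul ((mem_jacobson_iff hπ).2 h1) trivial
    have h4 : (c i • idem π i) • x' = c i • x' := Subtype.ext (by
      change (c i • idem π i) • x = c i • x
      rw [smul_assoc, hi])
    have hci : c i ≠ 0 := by
      intro h0
      rw [h0, zero_smul, sub_zero, h2] at h3
      exact hyP h3
    have h5 : x' ∈ Q := by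
      have h6 : ((c i)⁻¹ • (1 : Λ)) • c i • x' ∈ Q := by
        refine Q.smul_mem _ ?_
        have h7 := Q.sub_mem hyQ (hQ.le h3)
        rwa [sub_smul, h2, h4, sub_sub_cancel] at h7
      rwa [smul_assoc, one_smul, smul_smul, inv_mul_cancel₀ hci, one_smul] at h6
    refine eq_top_iff.2 fun y _ => ?_
    obtain ⟨b, rfl⟩ := hgen y
    exact Q.smul_mem b h5

theorem isHomogeneousSub_span (hπ : IsPathLengthGraded π) {x : M} {n : ℤ} (hx : x ∈ M.gr n) :
    M.IsHomogeneousSub (span Λ {x}) := by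
  intro y hy
  obtain ⟨a, rfl⟩ := Submodule.mem_span_singleton.1 hy
  rw [← sum_algProj hπ a, Finset.sum_smul]
  refine sum_mem fun l _ => Submodule.mem_iSup_of_mem ((l : ℤ) + n) ⟨?_, ?_⟩
  · exact Submodule.smul_mem _ _ (Submodule.mem_span_singleton_self x)
  · exact M.smul_mem _ _ _ _ (algProj_mem hπ l a) hx

theorem IsDirectSumOfLocals.congr {M N : GrMod π} (hM : M.IsDirectSumOfLocals)
    (hMN : M.GradedIso N) : N.IsDirectSumOfLocals := by
  obtain ⟨n, P, hP, hPl⟩ := hM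
  obtain ⟨F, s, hF⟩ := hMN
  refine ⟨n, fun j => (P j).map F.toLinearMap, ?_, fun j => ⟨?_, ?_⟩⟩
  · obtain ⟨h1, h2⟩ := isInternal_iff_sum.1 hP
    refine isInternal_iff_sum.2 ⟨fun y => ?_, fun v hv h0 j => ?_⟩
    · obtain ⟨v, hv, hy⟩ := h1 (F.symm y)
      refine ⟨fun j => F (v j), fun j => ⟨v j, hv j, rfl⟩, ?_⟩
      rw [← map_sum, ← hy, LinearEquiv.apply_symm_apply]
    · choose u hu huv using hv
      have h3 : ∀ j, F (u j) = v j := huv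
      have h4 := h2 u hu (F.injective (by
        rw [map_sum, map_zero, ← h0]
        exact Finset.sum_congr rfl fun j _ => h3 j)) j
      rw [← h3, h4, map_zero]
  · rintro _ ⟨x, hx, rfl⟩
    have hx' := (hPl j).1 hx
    clear hx
    induction hx' using Submodule.iSup_induction' with
    | mem l x hx => exact Submodule.mem_iSup_of_mem (l + s) ⟨⟨x, hx.1, rfl⟩, (hF l x).1 hx.2⟩
    | zero => rw [map_zero]; exact zero_mem _
    | add x y _ _ hx hy => rw [map_add]; exact Submodule.add_mem _ hx hy
  · let G : P j ≃ₗ[Λ] (P j).map F.toLinearMap := F.submoduleMap (P j)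
    have h1 : (Ring.jacobson Λ • (⊤ : Submodule Λ (P j))).map G.toLinearMap =
        Ring.jacobson Λ • (⊤ : Submodule Λ ((P j).map F.toLinearMap)) := by
      rw [Submodule.map_smul'', Submodule.map_top, LinearEquiv.range]
    have h2 := (hPl j).2
    have h3 : IsSimpleModule Λ (P j ⧸ (Ring.jacobson Λ • (⊤ : Submodule Λ (P j)))) := h2
    exact IsSimpleModule.congr (Submodule.Quotient.equiv _ _ G h1).symm

/-- The radical layers are invariant under isomorphism. -/
theorem finrank_atVertex_congr {L L' : Type u} [AddCommGroup L] [Module K L] [Module Λ L]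
    [IsScalarTower K Λ L] [AddCommGroup L'] [Module K L'] [Module Λ L'] [IsScalarTower K Λ L']
    (F : L ≃ₗ[Λ] L') (l : ℕ) (j : V) :
    finrank K (atVertex (K := K) π (radPow Λ L l) j) =
      finrank K (atVertex (K := K) π (radPow Λ L' l) j) := by
  have h1 : (radPow Λ L l).map F.toLinearMap = radPow Λ L' l := by
    induction l with
    | zero => exact (Submodule.map_top _).trans (LinearEquiv.range F)
    | succ l ih =>
      change (Ring.jacobson Λ • radPow Λ L l).map F.toLinearMap = Ring.jacobson Λ • radPow Λ L' l
      rw [Submodule.map_smul'', ih]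
  have h2 : ∀ (c : K) (x : L), F (c • x) = c • F x := fun c x => by
    rw [← one_smul Λ x, ← smul_assoc, map_smul, smul_assoc, one_smul, one_smul]
  let F' : L ≃ₗ[K] L' := { F with map_smul' := h2 }
  have h3 : (atVertex (K := K) π (radPow Λ L l) j).map F'.toLinearMap =
      atVertex (K := K) π (radPow Λ L' l) j := by
    ext y
    constructor
    · rintro ⟨x, hx, rfl⟩
      obtain ⟨h4, h5⟩ := mem_atVertex.1 hx
      refine mem_atVertex.2 ⟨h1 ▸ ⟨x, h4, rfl⟩, ?_⟩
      change idem π j • F x = F x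
      rw [← map_smul, h5]
    · intro hy
      obtain ⟨h4, h5⟩ := mem_atVertex.1 hy
      rw [← h1] at h4
      obtain ⟨x, hx, rfl⟩ := h4
      refine ⟨x, mem_atVertex.2 ⟨hx, F.injective ?_⟩, rfl⟩
      rw [map_smul]
      exact h5
  rw [← h3]
  exact (LinearEquiv.finrank_map_eq F' _).symm

end GrMod

namespace SpaceWithFunctions

/-- Constant morphisms. -/
def Hom.const (X : SpaceWithFunctions K) [X.IsGood] {Y : SpaceWithFunctions K} (y : Y) :
    Hom X Y where
  toFun _ := y
  continuous_toFun := continuous_const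
  regAt_comp _ f _ := IsGood.const (f y) _

theorem eq_zero_of_polyFun [Infinite K] {p : K → K} (hp : p ∈ polyFun K K)
    (h : ∀ y ≠ 0, p y = 0) : p 0 = 0 := by
  have h1 : ∃ g : Polynomial K, ∀ y, p y = g.eval y := by
    clear h
    induction hp using Algebra.adjoin_induction with
    | mem p hp =>
      obtain ⟨l, rfl⟩ := hp
      refine ⟨Polynomial.C (l 1) * Polynomial.X, fun y => ?_⟩
      rw [Polynomial.eval_mul, Polynomial.eval_C, Polynomial.eval_X, mul_comm, ← smul_eq_mul,
        ← map_smul, smul_eq_mul, mul_one]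
    | algebraMap r => exact ⟨Polynomial.C r, fun y => by simp⟩
    | add f g _ _ hf hg =>
      obtain ⟨a, ha⟩ := hf
      obtain ⟨b, hb⟩ := hg
      exact ⟨a + b, fun y => by rw [Polynomial.eval_add, ← ha, ← hb]; rfl⟩
    | mul f g _ _ hf hg =>
      obtain ⟨a, ha⟩ := hf
      obtain ⟨b, hb⟩ := hg
      exact ⟨a * b, fun y => by rw [Polynomial.eval_mul, ← ha, ← hb]; rfl⟩
  obtain ⟨g, hg⟩ := h1
  have h2 : g * Polynomial.X = 0 := by
    refine Polynomial.funext fun y => ?_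
    rw [Polynomial.eval_mul, Polynomial.eval_X, Polynomial.eval_zero, ← hg]
    by_cases hy : y = 0
    · rw [hy, mul_zero]
    · rw [h y hy, zero_mul]
  have h3 : g = 0 := (mul_eq_zero.1 h2).resolve_right Polynomial.X_ne_zero
  rw [hg, h3, Polynomial.eval_zero]

/-- A morphism on the affine line is determined by its restriction to the complement of a point. -/
theorem eq_of_forall_ne_zero [Infinite K] {Z : SpaceWithFunctions K} (hZ : Z.IsVariety)
    (f : Hom (affine K K) Z) (z : Z) (h : ∀ c : K, c ≠ 0 → f c = z) : f (0 : K) = z := by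
  have hcl := hZ.2 (affine K K) (IsAffineVariety.of_iso
    (isAffineVariety_sub_affine Set.univ isClosed_univ)
    ⟨(Hom.id _).codRestrict Set.univ fun _ => trivial, Hom.incl _, fun _ => rfl, fun _ => rfl⟩) f (Hom.const _ z)
  by_contra h0
  have h1 : ∀ᶠ c : affine K K in 𝓝 (0 : K), f c ≠ z := hcl.isOpen_compl.mem_nhds h0
  obtain ⟨p, hp, hp0, hpz⟩ := affine_eventually.1 h1
  refine hp0 (eq_zero_of_polyFun hp fun y hy => ?_)
  by_contra hpy
  exact hpz y hpy (h y hy)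

end SpaceWithFunctions

namespace GrMod

open SpaceWithFunctions

theorem IsTopSystem.comp_equiv {M : GrMod π} {ι ι' : Type*} {e : ι → V} {h : ι → ℤ} {m : ι → M}
    (hm : M.IsTopSystem e h m) (σ : ι' ≃ ι) : M.IsTopSystem (e ∘ σ) (h ∘ σ) (m ∘ σ) := by
  refine ⟨fun r => hm.mem _, fun r => hm.idem_smul _, ?_, ?_⟩
  · rw [Set.range_comp, Equiv.range_eq_univ, Set.image_univ, hm.span]
  · exact hm.linearIndependent.comp σ σ.injective

theorem IsTopSystem.hasTop {M : GrMod π} {t : ℕ} {e : Fin t → V} {h : Fin t → ℤ} {m : Fin t → M}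
    (hm : M.IsTopSystem e h m) : M.HasTop e h :=
  ⟨m, hm.mem, hm.idem_smul, hm.span, hm.linearIndependent⟩

theorem HasTop.exists_isTopSystem {M : GrMod π} {t : ℕ} {e : Fin t → V} {h : Fin t → ℤ}
    (ht : M.HasTop e h) : ∃ m, M.IsTopSystem e h m := by
  obtain ⟨m, h1, h2, h3, h4⟩ := ht
  exact ⟨m, h1, h2, h3, h4⟩

/-- The class of modules with given top, or with given radical layering. -/
def IsClass (π : PathAlgebra K V →ₐ[K] Λ) (d : ℕ) {t : ℕ} (e : Fin t → V) (H : Set (Fin t → ℤ))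
    (𝒞 : GrMod π → Prop) : Prop :=
  𝒞 = withTop π d e H ∨ ∃ S : ℕ → ModuleCat.{u} Λ, 𝒞 = withLayering π d e H S

variable {d t : ℕ} {e : Fin t → V} {H : Set (Fin t → ℤ)} {𝒞 : GrMod π → Prop}

theorem IsClass.withTop (h𝒞 : IsClass π d e H 𝒞) {M : GrMod π} (hM : 𝒞 M) : withTop π d e H M := by
  obtain rfl | ⟨S, rfl⟩ := h𝒞
  · exact hM
  · exact hM.1

/-- Membership in the class only depends on the top and on the dimensions of the radical layers. -/
theorem IsClass.congr (h𝒞 : IsClass π d e H 𝒞) (hπ : IsPathLengthGraded π) (hd : 0 < d)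
    {M N : GrMod π} (hM : 𝒞 M) (hN : GrMod.withTop π d e H N)
    (hdim : ∀ l j, finrank K (atVertex (K := K) π (radPow Λ M l) j) =
      finrank K (atVertex (K := K) π (radPow Λ N l) j)) : 𝒞 N := by
  have hMt := h𝒞.withTop hM
  obtain rfl | ⟨S, rfl⟩ := h𝒞
  · exact hN
  · have : FiniteDimensional K M := Module.finite_of_finrank_pos (by rw [hMt.1]; exact hd)
    have : FiniteDimensional K N := Module.finite_of_finrank_pos (by rw [hN.1]; exact hd)
    refine ⟨hN, fun l => ?_⟩
    obtain ⟨F⟩ := hM.2 l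
    obtain ⟨G⟩ := nonempty_radLayer_equiv hπ hdim l
    exact ⟨G.symm.trans F⟩

section

variable {M : GrMod π} {h : Fin t → ℤ} {m : Fin t → M} (B : AdaptedBasis M m d)
  (hm : M.IsTopSystem e h m)

theorem AdaptedBasis.linearIndependent_vec (c : K) : LinearIndependent K (B.vec hm c) :=
  Fintype.linearIndependent_iff.2 fun g hg q => by
    have := congrArg (B.coord hm c q) hg
    rw [map_sum, map_zero, Finset.sum_eq_single q] at this
    · rwa [map_smul, B.coord_vec, if_pos rfl, smul_eq_mul, mul_one] at this
    · intro r _ hr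
      rw [map_smul, B.coord_vec, if_neg hr.symm, smul_zero]
    · simp

theorem AdaptedBasis.span_vec (c : K) : span K (range (B.vec hm c)) = ⊤ :=
  eq_top_iff.2 fun x _ => by
    rw [B.sum_vec hm c x]
    exact Submodule.sum_mem _ fun q _ => Submodule.smul_mem _ _ (subset_span ⟨q, rfl⟩)

theorem AdaptedBasis.smul_vec (c : K) (a : Λ) (p : Fin d) :
    a • B.vec hm c p = ∑ q, B.rep c a q p • B.vec hm c q := by
  refine (B.sum_vec hm c _).trans (Finset.sum_congr rfl fun q _ => ?_)
  rw [B.coord_smul_vec]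

theorem AdaptedBasis.regAt_rep (a : Λ) (q p : Fin d) (c : affine K K) :
    (affine K K).RegAt (fun c : affine K K => B.rep (show K from c) a q p) c := by
  have h1 : VReg (Y := affine K K) (W := K) ((affine K K).regAlg c) fun y => y :=
    vreg_affine_id (W := K) c
  have h2 := Subalgebra.pow_mem _ (vreg_field.1 h1) ((B.w p).1 - (B.w q).1)
  exact Subalgebra.mul_mem _ h2 (const_mem (𝒮 := (affine K K).regAlg c) (B.matrix a q p))

/-- The family over the affine line given by the degeneration. -/
def AdaptedBasis.family (hπ : IsPathLengthGraded π) (hmono : Monotone h) :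
    GradedFamily π d (affine K K) where
  fib c := B.fibre hm c
  chart := PUnit
  U _ := Set.univ
  isOpen_U _ := isOpen_univ
  cover x := ⟨PUnit.unit, trivial⟩
  frame _ c q := B.vec hm c q
  deg _ := B.deg h
  frame_linearIndependent _ c _ := B.linearIndependent_vec hm c
  frame_span _ c _ := B.span_vec hm c
  frame_mem _ c _ q := ofMatrix.single_mem q
  transition _ _ := ⟨fun p q _ => if p = q then 1 else 0, fun x _ =>
    ⟨fun p q => IsGood.const _ _, fun p => by simp⟩⟩
  action _ a := ⟨fun p q c => B.rep (show K from c) a q p, fun c _ =>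
    ⟨fun p q => B.regAt_rep a q p c, fun p => B.smul_vec hm c a p⟩⟩
  sameTop := ⟨t, e, h, fun c => (B.isTopSystem_fibre hm c hπ hmono).hasTop⟩

end

theorem IsClass.isDirectSumOfLocals [Infinite K] (h𝒞 : IsClass π d e H 𝒞)
    (hπ : IsPathLengthGraded π) (hd : 0 < d) {Z : SpaceWithFunctions K}
    (hZ : IsCoarseModuliSpace d 𝒞 Z) {M : GrMod π} (hM : 𝒞 M) : M.IsDirectSumOfLocals := by
  obtain ⟨hMd, h, hH, hMt⟩ := h𝒞.withTop hM
  obtain ⟨m, hm⟩ := hMt.exists_isTopSystem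
  let σ := Tuple.sort h
  have hmono : Monotone (h ∘ σ) := Tuple.monotone_sort h
  have hm' := hm.comp_equiv σ
  obtain ⟨B⟩ := hm'.nonempty_adaptedBasis hπ hd hMd
  have hiso : ∀ c : K, c ≠ 0 → M.GradedIso (B.fibre hm' c) := fun c hc => by
    obtain ⟨F, hF⟩ := B.gradedIso_fibre hm' c hπ hc
    exact ⟨F, 0, hF⟩
  have hclass : ∀ c, 𝒞 (B.fibre hm' c) := by
    intro c
    refine h𝒞.congr hπ hd hM ⟨Module.finrank_fin_fun K, h, hH, ?_⟩ fun l j => ?_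
    · have h1 := ((B.isTopSystem_fibre hm' c hπ hmono).comp_equiv σ.symm).hasTop
      rwa [Function.comp_assoc, Function.comp_assoc, Equiv.self_comp_symm, Function.comp_id,
        Function.comp_id] at h1
    · obtain ⟨F, -, -⟩ := hiso 1 one_ne_zero
      rw [finrank_atVertex_congr F l j, B.finrank_atVertex_fibre hm' 1 hπ hmono c]
  obtain ⟨hZv, α, -, hα, hαf, -⟩ := hZ
  obtain ⟨f, hf⟩ := hαf _ isVariety_affine (B.family hm' hπ hmono) hclass
  have h0 := eq_of_forall_ne_zero hZv f (α ⟨M, hM⟩) fun c hc =>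
    (hf c).trans ((hα _ _).2 (hiso c hc).symm)
  have h1 : (B.fibre hm' 0).GradedIso M := (hα _ _).1 ((hf (0 : K)).symm.trans h0)
  refine IsDirectSumOfLocals.congr ?_ h1
  have h2 := B.isTopSystem_fibre hm' 0 hπ hmono
  refine ⟨t, _, B.isInternal_fibre_zero hm', fun k =>
    ⟨isHomogeneousSub_span hπ (h2.mem k), isLocalModule_span hπ (h2.idem_smul k) ?_⟩⟩
  intro a ha hax
  refine h2.linearIndependent.ne_zero k ((Submodule.Quotient.mk_eq_zero _).2 ?_)
  have := smul_mem_radPow hπ ha (B.vec hm' 0 (B.p k))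
  rw [← hax] at this
  exact this

end GrMod

namespace SpaceWithFunctions

section RegSub

variable {W W' : Type*} [AddCommGroup W] [Module K W] [AddCommGroup W'] [Module K W']
variable {X : SpaceWithFunctions K} [X.IsGood] {x : X}

/-- Every vector of a fibre of a regular family extends to a regular section. -/
theorem RegSub.exists_section {C : X → Submodule K W} (hC : RegSub C x) {v : W} (hv : v ∈ C x) :
    ∃ b : X → W, VReg (X.regAlg x) b ∧ b x = v ∧ ∀ᶠ y in 𝓝 x, b y ∈ C y := by
  obtain ⟨k, b, hb, h⟩ := hC
  rw [← h.self_of_nhds.2, mem_span_range_iff_exists_fun] at hv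
  obtain ⟨c, hc⟩ := hv
  refine ⟨fun y => ∑ i, c i • b i y, VReg.sum _ fun i _ => VReg.smul (const_mem _) (hb i), hc, ?_⟩
  filter_upwards [h] with y hy
  rw [← hy.2]
  exact sum_mem fun i _ => smul_mem _ _ (subset_span ⟨i, rfl⟩)

/-- The image of a regular family under a linear map is regular if it has constant dimension. -/
theorem RegSub.map {C : X → Submodule K W} (hC : RegSub C x) (A : W →ₗ[K] W')
    (h : ∀ᶠ y in 𝓝 x, finrank K ((C y).map A) = finrank K ((C x).map A)) :
    RegSub (fun y => (C y).map A) x := by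
  obtain ⟨k, b, hb, hbC⟩ := hC
  have hmap : ∀ y, span K (range fun i => b i y) = C y →
      span K (range fun i => A (b i y)) = (C y).map A := by
    intro y hy
    rw [← hy, Submodule.map_span, ← Set.range_comp]; rfl
  refine (RegSub.of_span (fun i y => A (b i y)) (fun i => (hb i).map A) ?_).congr ?_
  · filter_upwards [h, hbC] with y h1 h2
    rw [hmap y h2.2, hmap x hbC.self_of_nhds.2, h1]
  · filter_upwards [hbC] with y h2 using hmap y h2.2

/-- If the preimage of a regular family under a regular linear map vanishes at a point, then it
vanishes in a neighbourhood. -/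
theorem RegSub.eventually_comap_eq_bot [FiniteDimensional K W] {A : X → W →ₗ[K] W'}
    (hA : ∀ w, VReg (X.regAlg x) fun y => A y w) {C : X → Submodule K W'} (hC : RegSub C x)
    (h : (C x).comap (A x) = ⊥) : ∀ᶠ y in 𝓝 x, (C y).comap (A y) = ⊥ := by
  obtain ⟨k, c, hc, hcC⟩ := hC
  let n := Module.finBasis K W
  let B : (Fin (finrank K W) ⊕ Fin k) → X → W' := Sum.elim (fun i y => A y (n i)) c
  have hB : ∀ i, VReg (X.regAlg x) (B i) := by
    rintro (i | i)
    · exact hA _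
    · exact hc i
  have hBy : ∀ y, (fun i => B i y) = Sum.elim (fun i => A y (n i)) fun i => c i y := by
    intro y; funext i; rcases i with i | i <;> rfl
  have key : ∀ y, LinearIndependent K (fun i => c i y) →
      span K (range fun i => c i y) = C y →
      (LinearIndependent K (fun i => B i y) ↔ (C y).comap (A y) = ⊥) := by
    intro y h1 h2
    have hr : span K (range fun i => A y (n i)) = LinearMap.range (A y) := by
      rw [LinearMap.range_eq_map, ← n.span_eq, Submodule.map_span, ← Set.range_comp]; rfl
    rw [hBy, linearIndependent_sum]
    constructor
    · rintro ⟨h3, -, h4⟩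
      refine (Submodule.eq_bot_iff _).2 fun w hw => ?_
      have h5 : A y w = 0 := by
        refine Submodule.disjoint_def.1 h4 _ ?_ ?_
        · exact hr ▸ LinearMap.mem_range_self _ _
        · exact h2 ▸ hw
      have h6 : ∑ i, n.repr w i • A y (n i) = 0 := by
        rw [← h5]; conv_rhs => rw [← n.sum_repr w]
        simp only [map_sum, map_smul]
      rw [← n.sum_repr w]
      exact Finset.sum_eq_zero fun i _ => by
        rw [Fintype.linearIndependent_iff.1 h3 _ h6 i, zero_smul]
    · intro h3
      have hker : LinearMap.ker (A y) = ⊥ := by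
        rw [eq_bot_iff, ← h3]
        intro w hw
        rw [Submodule.mem_comap, LinearMap.mem_ker.1 hw]; exact zero_mem _
      refine ⟨n.linearIndependent.map' (A y) hker, h1, ?_⟩
      refine Submodule.disjoint_def.2 fun w hw hw' => ?_
      change w ∈ span K (range fun i => A y (n i)) at hw
      change w ∈ span K (range fun i => c i y) at hw'
      rw [hr] at hw; rw [h2] at hw'
      obtain ⟨z, rfl⟩ := hw
      have : z ∈ (C y).comap (A y) := hw'
      rw [h3, Submodule.mem_bot] at this
      rw [this, map_zero]
  have h0 := hcC.self_of_nhds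
  filter_upwards [hcC, eventually_linearIndependent hB ((key x h0.1 h0.2).2 h)] with y h1 h2
  exact (key y h1.1 h1.2).1 h2

/-- A linear complement of a fibre of a regular family is a complement of the nearby fibres. -/
theorem RegSub.eventually_sup_eq_top [FiniteDimensional K W] {C : X → Submodule K W}
    (hC : RegSub C x) {E : Submodule K W} (hE : IsCompl (C x) E) : ∀ᶠ y in 𝓝 x, C y ⊔ E = ⊤ := by
  have h1 : (C x).comap E.subtype = ⊥ := by
    refine (Submodule.eq_bot_iff _).2 fun z hz => Subtype.ext ?_
    exact Submodule.disjoint_def.1 hE.disjoint _ hz z.2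
  filter_upwards [hC.finrank_eq,
    hC.eventually_comap_eq_bot (A := fun _ => E.subtype) (fun w => VReg.const _) h1] with y h2 h3
  have h4 : C y ⊓ E = ⊥ := by
    refine (Submodule.eq_bot_iff _).2 fun z hz => ?_
    have : (⟨z, hz.2⟩ : E) ∈ (C y).comap E.subtype := hz.1
    rw [h3, Submodule.mem_bot] at this
    exact congrArg Subtype.val this
  refine Submodule.eq_top_of_finrank_eq ?_
  have h5 := Submodule.finrank_sup_add_finrank_inf_eq (C y) E
  rw [h4, finrank_bot, add_zero, h2, Submodule.finrank_add_eq_of_isCompl hE] at h5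
  exact h5

/-- An inclusion between the fibres of two regular families of subspaces which are stable under
certain operators persists in a neighbourhood if it is rigid. -/
theorem RegSub.eventually_le_of_rigid [FiniteDimensional K W] {C C' : X → Submodule K W}
    (hC : RegSub C x) (hC' : RegSub C' x) {O : Type*} [Finite O] (o : O → W →ₗ[K] W)
    (hO : ∀ᶠ y in 𝓝 x, ∀ i, ∀ c ∈ C y, o i c ∈ C y)
    (hO' : ∀ᶠ y in 𝓝 x, ∀ i, ∀ c ∈ C' y, o i c ∈ C' y)
    (hrig : ∀ ψ : W →ₗ[K] W, (∀ i, ∀ c ∈ C x, o i (ψ c) - ψ (o i c) ∈ C' x) →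
      ∀ c ∈ C x, ψ c ∈ C' x) : ∀ᶠ y in 𝓝 x, C y ≤ C' y := by
  classical
  obtain ⟨E, hE⟩ := Submodule.exists_isCompl (C' x)
  obtain ⟨k, c, hc, hcC⟩ := hC
  have hcx := hcC.self_of_nhds
  have hcoord : ∀ (i : O) (p : Fin k), ∃ a : Fin k → X → K, (∀ q, a q ∈ X.regAlg x) ∧
      ∀ᶠ y in 𝓝 x, o i (c p y) = ∑ q, a q y • c q y := by
    intro i p
    refine exists_regular_coords hc hcx.1 ((hc p).map (o i)) ?_
    filter_upwards [hcC, hO] with y h1 h2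
    rw [h1.2]
    exact h2 i _ (h1.2 ▸ subset_span ⟨p, rfl⟩)
  choose a ha ha' using hcoord
  let L : X → (Fin k → E) →ₗ[K] (O × Fin k → W) := fun y => LinearMap.pi fun ip =>
    o ip.1 ∘ₗ E.subtype ∘ₗ LinearMap.proj ip.2 -
      ∑ q, a ip.1 ip.2 q y • (E.subtype ∘ₗ LinearMap.proj q)
  have hL : ∀ y ψ (ip : O × Fin k), L y ψ ip =
      o ip.1 (ψ ip.2) - ∑ q, a ip.1 ip.2 q y • (ψ q : W) := by
    intro y ψ ip
    simp [L, LinearMap.sum_apply]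
  have hLreg : ∀ ψ, VReg (X.regAlg x) fun y => L y ψ := by
    intro ψ
    rw [vreg_pi]
    intro ip
    simp only [hL]
    exact (VReg.const _).sub (VReg.sum _ fun q _ => VReg.smul (ha _ _ q) (VReg.const _))
  have hbot : (Submodule.pi Set.univ fun _ : O × Fin k => C' x).comap (L x) = ⊥ := by
    refine (Submodule.eq_bot_iff _).2 fun ψ hψ => ?_
    have h1 : ∀ i p, o i (ψ p) - ∑ q, a i p q x • (ψ q : W) ∈ C' x := by
      intro i p
      have := hψ (i, p) (Set.mem_univ _)
      rwa [hL] at this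
    obtain ⟨Ψ, hΨ⟩ := LinearMap.exists_extend
      ((Module.Basis.span hcx.1).constr K fun p => (ψ p : W))
    have h2 : ∀ p, Ψ (c p x) = ψ p := by
      intro p
      have h3 := LinearMap.congr_fun hΨ (Module.Basis.span hcx.1 p)
      rw [Module.Basis.constr_basis, LinearMap.comp_apply, Submodule.subtype_apply,
        Module.Basis.span_apply] at h3
      exact h3
    have h3 : ∀ z ∈ C x, Ψ z ∈ C' x := by
      refine hrig Ψ fun i z hz => ?_
      rw [← hcx.2] at hz
      have h4 : span K (range fun p => c p x) ≤
          (C' x).comap (o i ∘ₗ Ψ - Ψ ∘ₗ o i) := by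
        rw [span_le]
        rintro _ ⟨p, rfl⟩
        change o i (Ψ (c p x)) - Ψ (o i (c p x)) ∈ C' x
        rw [(ha' i p).self_of_nhds, h2, map_sum]
        simp only [map_smul, h2]
        exact h1 i p
      exact h4 hz
    funext p
    refine Subtype.ext (Submodule.disjoint_def.1 hE.disjoint _ ?_ (ψ p).2)
    rw [← h2]
    exact h3 _ (hcx.2 ▸ subset_span ⟨p, rfl⟩)
  have hfin : ∀ᶠ y in 𝓝 x, ∀ i p, o i (c p y) = ∑ q, a i p q y • c q y :=
    eventually_all.2 fun i => eventually_all.2 fun p => ha' i p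
  filter_upwards [hcC, hfin, hO', hC'.eventually_sup_eq_top hE,
    (RegSub.pi fun _ => hC').eventually_comap_eq_bot hLreg hbot] with y h1 h2 h3 h4 h5
  have h6 : ∀ p, ∃ z : E, c p y - z ∈ C' y := by
    intro p
    obtain ⟨u, hu, z, hz, huz⟩ := Submodule.mem_sup.1 (h4 ▸ Submodule.mem_top : c p y ∈ C' y ⊔ E)
    exact ⟨⟨z, hz⟩, by rw [← huz]; simpa using hu⟩
  choose ψ hψ using h6
  have h7 : ψ ∈ (Submodule.pi Set.univ fun _ : O × Fin k => C' y).comap (L y) := by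
    rintro ⟨i, p⟩ -
    change L y ψ (i, p) ∈ C' y
    have h8 : L y ψ (i, p) = (∑ q, a i p q y • (c q y - (ψ q : W))) - o i (c p y - ψ p) := by
      rw [hL]
      simp only [smul_sub, Finset.sum_sub_distrib, map_sub]
      rw [← h2 i p]
      abel
    rw [h8]
    exact sub_mem (sum_mem fun q _ => smul_mem _ _ (hψ q)) (h3 i _ (hψ p))
  rw [h5, Submodule.mem_bot] at h7
  rw [← h1.2, span_le]
  rintro _ ⟨p, rfl⟩
  have := hψ p
  rw [h7] at this
  simpa using this

end RegSub

end SpaceWithFunctions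

section MatrixAction

variable {ι : Type*} [Fintype ι] [DecidableEq ι]

/-- The action of square matrices on tuples of vectors. -/
def matAct (K : Type u) [Field K] (ι : Type*) [Fintype ι] [DecidableEq ι] (W : Type*)
    [AddCommGroup W] [Module K W] : Matrix ι ι K →ₐ[K] Module.End K (ι → W) :=
  AlgHom.ofLinearMap
    { toFun := fun g =>
        { toFun := fun f i => ∑ j, g i j • f j
          map_add' := fun f f' => by
            funext i; simp [smul_add, Finset.sum_add_distrib]
          map_smul' := fun c f => by
            funext i; simp [Finset.smul_sum, smul_comm c] }
      map_add' := fun g g' => by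
        ext f i; simp [add_smul, Finset.sum_add_distrib]
      map_smul' := fun c g => by
        ext f i; simp [Finset.smul_sum, mul_smul] }
    (by
      refine LinearMap.ext fun f => funext fun i => ?_
      simp [Matrix.one_apply])
    (fun g g' => by
      refine LinearMap.ext fun f => funext fun i => ?_
      change ∑ j, (g * g') i j • f j = ∑ j, g i j • ∑ k, g' j k • f k
      simp only [Matrix.mul_apply, Finset.sum_smul, Finset.smul_sum, mul_smul]
      exact Finset.sum_comm)

variable {W : Type*} [AddCommGroup W] [Module K W]

theorem matAct_apply (g : Matrix ι ι K) (f : ι → W) (i : ι) :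
    matAct K ι W g f i = ∑ j, g i j • f j := rfl

theorem matAct_mul (g g' : Matrix ι ι K) (f : ι → W) :
    matAct K ι W (g * g') f = matAct K ι W g (matAct K ι W g' f) := by
  rw [map_mul]; rfl

theorem matAct_one (f : ι → W) : matAct K ι W 1 f = f := by
  rw [map_one]; rfl

theorem matAct_single (g : Matrix ι ι K) (j : ι) (w : W) (i : ι) :
    matAct K ι W g (Pi.single j w) i = g i j • w := by
  rw [matAct_apply, Finset.sum_eq_single j (fun k _ hk => by rw [Pi.single_eq_of_ne hk, smul_zero])
    (fun h => absurd (Finset.mem_univ _) h), Pi.single_eq_same]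

theorem matAct_diagonal (l : ι → K) (f : ι → W) (i : ι) :
    matAct K ι W (Matrix.diagonal l) f i = l i • f i := by
  rw [matAct_apply, Finset.sum_eq_single i
    (fun k _ hk => by rw [Matrix.diagonal_apply_ne _ hk.symm, zero_smul])
    (fun h => absurd (Finset.mem_univ _) h), Matrix.diagonal_apply_eq]

theorem matAct_aeval_mem {D : Submodule K (ι → W)} {T : Matrix ι ι K}
    (hT : ∀ f ∈ D, matAct K ι W T f ∈ D) (p : Polynomial K) {f : ι → W} (hf : f ∈ D) :
    matAct K ι W (Polynomial.aeval T p) f ∈ D := by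
  induction p using Polynomial.induction_on' with
  | add p q hp hq => rw [map_add, map_add]; exact add_mem hp hq
  | monomial n c =>
    rw [Polynomial.aeval_monomial, ← Algebra.smul_def, map_smul]
    refine D.smul_mem _ ?_
    induction n with
    | zero => rwa [pow_zero, matAct_one]
    | succ n ih => rw [pow_succ', matAct_mul]; exact hT _ ih

theorem aeval_mul_of_mul_eq {T S : Matrix ι ι K} {l : ι → K}
    (h : T * S = S * Matrix.diagonal l) (p : Polynomial K) :
    Polynomial.aeval T p * S = S * Matrix.diagonal fun i => p.eval (l i) := by
  induction p using Polynomial.induction_on' with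
  | add p q hp hq =>
    rw [map_add, add_mul, hp, hq, ← mul_add, Matrix.diagonal_add]
    simp only [Polynomial.eval_add]
  | monomial n c =>
    have hn : T ^ n * S = S * Matrix.diagonal fun i => l i ^ n := by
      induction n with
      | zero => simp
      | succ n ih =>
        rw [pow_succ, mul_assoc, h, ← mul_assoc, ih, mul_assoc, Matrix.diagonal_mul_diagonal]
        simp only [pow_succ]
    rw [Polynomial.aeval_monomial, ← Algebra.smul_def, smul_mul_assoc, hn, ← mul_smul_comm,
      ← Matrix.diagonal_smul]
    simp only [Polynomial.eval_monomial, Pi.smul_def, smul_eq_mul]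

section Eigenbasis

variable {D : Submodule K (ι → W)} {T S : Matrix ι ι K} {l : ι → K}

theorem matAct_single_inv_mem (hS : IsUnit S) (hl : Function.Injective l)
    (hTS : T * S = S * Matrix.diagonal l) (hT : ∀ f ∈ D, matAct K ι W T f ∈ D) {f : ι → W}
    (hf : f ∈ D) (i : ι) : matAct K ι W S (Pi.single i (matAct K ι W S⁻¹ f i)) ∈ D := by
  have hdet := (Matrix.isUnit_iff_isUnit_det _).1 hS
  have h1 := matAct_aeval_mem hT (Lagrange.basis Finset.univ l i) hf
  have h2 := aeval_mul_of_mul_eq hTS (Lagrange.basis Finset.univ l i)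
  have h3 : f = matAct K ι W S (matAct K ι W S⁻¹ f) := by
    rw [← matAct_mul, Matrix.mul_nonsing_inv _ hdet, matAct_one]
  rw [h3, ← matAct_mul, h2, matAct_mul] at h1
  convert h1 using 2
  funext j
  rw [matAct_diagonal]
  by_cases hj : j = i
  · subst hj
    rw [Pi.single_eq_same, Lagrange.eval_basis_self hl.injOn (Finset.mem_univ _), one_smul]
  · rw [Pi.single_eq_of_ne hj, Lagrange.eval_basis_of_ne (Ne.symm hj) (Finset.mem_univ _), zero_smul]

/-- If a space of tuples is, up to a linear change of the coordinates, a product of subspaces, then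
the components of the space along the eigenvectors of a matrix which preserves it and which has
pairwise different eigenvalues are among the factors. -/
theorem exists_factor_eq (hS : IsUnit S) (hl : Function.Injective l)
    (hTS : T * S = S * Matrix.diagonal l) (hT : ∀ f ∈ D, matAct K ι W T f ∈ D)
    {C : ι → Submodule K W} {G : Matrix ι ι K} (hG : IsUnit G)
    (hD : ∀ f, f ∈ D ↔ ∀ i, matAct K ι W G f i ∈ C i) (i : ι) :
    ∃ j, ∀ w, matAct K ι W S (Pi.single i w) ∈ D ↔ w ∈ C j := by
  have hdS := (Matrix.isUnit_iff_isUnit_det _).1 hS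
  have hdG := (Matrix.isUnit_iff_isUnit_det _).1 hG
  have h1 : (S⁻¹ * G⁻¹ * (G * S)) i i = 1 := by
    rw [mul_assoc, ← mul_assoc G⁻¹, Matrix.nonsing_inv_mul _ hdG, one_mul,
      Matrix.nonsing_inv_mul _ hdS, Matrix.one_apply_eq]
  rw [Matrix.mul_apply] at h1
  obtain ⟨j, -, hj⟩ := Finset.exists_ne_zero_of_sum_ne_zero (h1 ▸ one_ne_zero)
  refine ⟨j, fun w => ⟨fun hw => ?_, fun hw => ?_⟩⟩
  · have := (hD _).1 hw j
    rw [← matAct_mul, matAct_single] at this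
    exact (Submodule.smul_mem_iff _ (right_ne_zero_of_mul hj)).1 this
  · have h2 : matAct K ι W G⁻¹ (Pi.single j w) ∈ D := by
      refine (hD _).2 fun a => ?_
      rw [← matAct_mul, Matrix.mul_nonsing_inv _ hdG, matAct_one]
      by_cases ha : a = j
      · subst ha; rwa [Pi.single_eq_same]
      · rw [Pi.single_eq_of_ne ha]; exact zero_mem _
    have h3 := matAct_single_inv_mem hS hl hTS hT h2 i
    rw [← matAct_mul, matAct_single, Pi.single_smul, map_smul] at h3
    exact (Submodule.smul_mem_iff _ (left_ne_zero_of_mul hj)).1 h3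

end Eigenbasis

/-- A matrix whose characteristic polynomial has no multiple roots has an eigenbasis. -/
theorem exists_eigenbasis [IsAlgClosed K] {T : Matrix ι ι K}
    (h : (Polynomial.aeval T (Polynomial.derivative T.charpoly)).det ≠ 0) :
    ∃ (S : Matrix ι ι K) (l : ι → K), IsUnit S ∧ Function.Injective l ∧
      T * S = S * Matrix.diagonal l := by
  classical
  have hev : ∀ c, T.charpoly.IsRoot c → ∃ v : ι → K, v ≠ 0 ∧ T.mulVec v = c • v := by
    intro c hc
    rw [Polynomial.IsRoot, Matrix.eval_charpoly] at hc
    obtain ⟨v, hv, hv'⟩ := Matrix.exists_mulVec_eq_zero_iff.2 hc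
    refine ⟨v, hv, ?_⟩
    rw [Matrix.sub_mulVec, sub_eq_zero] at hv'
    rw [← hv', Matrix.scalar_apply]
    funext i
    simp [Matrix.mulVec_diagonal]
  have hpv : ∀ (p : Polynomial K) (c : K) (v : ι → K), T.mulVec v = c • v →
      (Polynomial.aeval T p).mulVec v = p.eval c • v := by
    intro p c v hv
    induction p using Polynomial.induction_on' with
    | add p q hp hq => rw [map_add, Matrix.add_mulVec, hp, hq, Polynomial.eval_add, add_smul]
    | monomial n a =>
      have hn : (T ^ n).mulVec v = c ^ n • v := by
        induction n with
        | zero => simp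
        | succ n ih =>
          rw [pow_succ, ← Matrix.mulVec_mulVec, hv, Matrix.mulVec_smul, ih, smul_smul, pow_succ']
      rw [Polynomial.aeval_monomial, ← Algebra.smul_def, Matrix.smul_mulVec, hn,
        Polynomial.eval_monomial, smul_smul]
  have hne : T.charpoly ≠ 0 := T.charpoly_monic.ne_zero
  have hnd : T.charpoly.roots.Nodup := by
    rw [Multiset.nodup_iff_count_le_one]
    intro c
    rw [Polynomial.count_roots]
    by_contra! hc
    obtain ⟨h2, h1⟩ := (Polynomial.one_lt_rootMultiplicity_iff_isRoot hne).1 hc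
    obtain ⟨v, hv, hTv⟩ := hev c h2
    refine h (Matrix.exists_mulVec_eq_zero_iff.1 ⟨v, hv, ?_⟩)
    rw [hpv _ c v hTv, h1.eq_zero, zero_smul]
  have hcard : Fintype.card T.charpoly.roots.toFinset = Fintype.card ι := by
    rw [Fintype.card_coe, Multiset.toFinset_card_of_nodup hnd,
      ← (IsAlgClosed.splits T.charpoly).natDegree_eq_card_roots, Matrix.charpoly_natDegree_eq_dim]
  obtain ⟨E⟩ := Fintype.card_eq.1 hcard.symm
  have hroot : ∀ i, T.charpoly.IsRoot (E i : K) := fun i =>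
    Polynomial.isRoot_of_mem_roots (Multiset.mem_toFinset.1 (E i).2)
  choose v hv hTv using fun i => hev _ (hroot i)
  have hinj : Function.Injective fun i => (E i : K) := Subtype.val_injective.comp E.injective
  have hli : LinearIndependent K v := by
    refine Module.End.eigenvectors_linearIndependent' (Matrix.toLin' T) _ hinj v fun i => ?_
    refine ⟨Module.End.mem_eigenspace_iff.2 ?_, hv i⟩
    rw [Matrix.toLin'_apply]
    exact hTv i
  refine ⟨Matrix.of fun a i => v i a, fun i => E i, ?_, hinj, ?_⟩
  · exact Matrix.linearIndependent_cols_iff_isUnit.1 hli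
  · ext a i
    rw [Matrix.mul_diagonal]
    have := congrFun (hTv i) a
    simpa [Matrix.mulVec, dotProduct, Matrix.mul_apply, mul_comm] using this

/-- The adjugate of a singular matrix with an eigenbasis is a multiple of the projection onto the
kernel. -/
theorem exists_adjugate_eq {T S : Matrix ι ι K} {l : ι → K} (hS : IsUnit S)
    (hTS : T * S = S * Matrix.diagonal l) (i : ι) :
    ∃ c : K, (T - Matrix.scalar ι (l i)).adjugate =
      c • (S * Matrix.diagonal (Pi.single i 1) * S⁻¹) := by
  have hdS := (Matrix.isUnit_iff_isUnit_det _).1 hS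
  have hT : T - Matrix.scalar ι (l i) = S * Matrix.diagonal (fun j => l j - l i) * S⁻¹ := by
    have h1 : T = S * Matrix.diagonal l * S⁻¹ := by
      rw [← hTS, mul_assoc, Matrix.mul_nonsing_inv _ hdS, mul_one]
    have h2 : Matrix.scalar ι (l i) = S * Matrix.diagonal (fun _ => l i) * S⁻¹ := by
      rw [← Matrix.scalar_apply, ← (Matrix.scalar_commute (l i) (fun r => mul_comm _ _) S).eq,
        mul_assoc, Matrix.mul_nonsing_inv _ hdS, mul_one]
    rw [← Matrix.diagonal_sub, mul_sub, sub_mul, ← h1, ← h2]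
  refine ⟨S⁻¹.det * S.det * ∏ j ∈ Finset.univ.erase i, (l j - l i), ?_⟩
  rw [hT, Matrix.adjugate_mul_distrib, Matrix.adjugate_mul_distrib, Matrix.adjugate_diagonal]
  have h4 : ∀ A : Matrix ι ι K, IsUnit A.det → A.adjugate = A.det • A⁻¹ := fun A hA => by
    rw [Matrix.inv_def, smul_smul, Ring.mul_inverse_cancel _ hA, one_smul]
  have h3 : S⁻¹.adjugate = S⁻¹.det • S := by
    rw [h4 _ (by rw [Matrix.det_nonsing_inv]; exact hdS.ringInverse),
      Matrix.nonsing_inv_nonsing_inv _ hdS]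
  have h5 := h4 S hdS
  have h6 : (Matrix.diagonal fun a => ∏ j ∈ Finset.univ.erase a, (l j - l i)) =
      (∏ j ∈ Finset.univ.erase i, (l j - l i)) • Matrix.diagonal (Pi.single i 1) := by
    rw [← Matrix.diagonal_smul]
    congr 1
    funext a
    by_cases ha : a = i
    · subst ha; simp
    · rw [Pi.smul_apply, Pi.single_eq_of_ne ha, smul_zero]
      exact Finset.prod_eq_zero (Finset.mem_erase.2 ⟨Ne.symm ha, Finset.mem_univ i⟩) (sub_self _)
  rw [h3, h5, h6]
  simp only [smul_mul_assoc, mul_smul_comm, smul_smul, mul_assoc]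
  congr 1
  ring

theorem matAct_smul (c : K) (g : Matrix ι ι K) (f : ι → W) :
    matAct K ι W (c • g) f = c • matAct K ι W g f := by
  rw [map_smul]; rfl

/-- If `p` vanishes at the eigenvalues of `T`, except possibly at those whose eigenvectors belong to
the factor `C j₀`, then `p(T)` maps `D` to `C j₀`. -/
theorem matAct_aeval_mem_factor [IsAlgClosed K] [FiniteDimensional K W]
    {D : Submodule K (ι → W)} {C : ι → Submodule K W} {G T : Matrix ι ι K} (hG : IsUnit G)
    (hD : ∀ f, f ∈ D ↔ ∀ i, matAct K ι W G f i ∈ C i) (hT : ∀ f ∈ D, matAct K ι W T f ∈ D)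
    (hdet : (Polynomial.aeval T (Polynomial.derivative T.charpoly)).det ≠ 0) {j₀ : ι} {k : ℕ}
    {p : Polynomial K} {b : Fin k → ι → W} (hb : ∀ s, b s ∈ D) {E : Submodule K W}
    (hE : k + finrank K E = finrank K W)
    (hp : ∀ c, p.eval c ≠ 0 →
      (LinearIndependent K fun s => matAct K ι W (T - Matrix.scalar ι c).adjugate (b s) j₀) ∧
      (∀ z ∈ E, matAct K ι W (T - Matrix.scalar ι c).adjugate (Pi.single j₀ z) ∈ D → z = 0) ∧
      ∀ i, span K (range fun s =>
        matAct K ι W (T - Matrix.scalar ι c).adjugate (b s) j₀) = C i → i = j₀)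
    {f : ι → W} (hf : f ∈ D) : matAct K ι W (Polynomial.aeval T p) f j₀ ∈ C j₀ := by
  obtain ⟨S, l, hS, hl, hTS⟩ := exists_eigenbasis hdet
  have hdS := (Matrix.isUnit_iff_isUnit_det _).1 hS
  have h1 : matAct K ι W (Polynomial.aeval T p) f =
      matAct K ι W S (matAct K ι W (Matrix.diagonal fun i => p.eval (l i))
        (matAct K ι W S⁻¹ f)) := by
    rw [← matAct_mul, ← matAct_mul, ← aeval_mul_of_mul_eq hTS, mul_assoc,
      Matrix.mul_nonsing_inv _ hdS, mul_one]
  rw [h1, matAct_apply]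
  refine sum_mem fun i _ => smul_mem _ _ ?_
  rw [matAct_diagonal]
  by_cases hpi : p.eval (l i) = 0
  · rw [hpi, zero_smul]; exact zero_mem _
  refine smul_mem _ _ ?_
  obtain ⟨j, hj⟩ := exists_factor_eq hS hl hTS hT hG hD i
  obtain ⟨h2, h3, h4⟩ := hp _ hpi
  obtain ⟨c, hc⟩ := exists_adjugate_eq hS hTS i
  have hadj : ∀ f', matAct K ι W (T - Matrix.scalar ι (l i)).adjugate f' =
      c • matAct K ι W S (Pi.single i (matAct K ι W S⁻¹ f' i)) := by
    intro f'
    rw [hc, matAct_smul, matAct_mul, matAct_mul]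
    congr 2
    funext a
    rw [matAct_diagonal]
    by_cases ha : a = i
    · subst ha; rw [Pi.single_eq_same, Pi.single_eq_same, one_smul]
    · rw [Pi.single_eq_of_ne ha, Pi.single_eq_of_ne ha, zero_smul]
  have h5 : ∀ s, matAct K ι W (T - Matrix.scalar ι (l i)).adjugate (b s) j₀ ∈ C j := by
    intro s
    rw [hadj, Pi.smul_apply, matAct_single]
    exact smul_mem _ _ (smul_mem _ _
      ((hj _).1 (matAct_single_inv_mem hS hl hTS hT (hb s) i)))
  have h6 : C j ⊓ E = ⊥ := by
    refine (Submodule.eq_bot_iff _).2 fun z hz => h3 z hz.2 ?_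
    rw [hadj, matAct_single, Pi.single_smul, map_smul]
    exact D.smul_mem _ (D.smul_mem _ ((hj z).2 hz.1))
  have h7 : finrank K (C j) ≤ k := by
    have h8 := Submodule.finrank_sup_add_finrank_inf_eq (C j) E
    rw [h6, finrank_bot, add_zero] at h8
    have h9 := Submodule.finrank_le (C j ⊔ E)
    omega
  have h8 : span K (range fun s =>
      matAct K ι W (T - Matrix.scalar ι (l i)).adjugate (b s) j₀) = C j := by
    refine Submodule.eq_of_le_of_finrank_le (span_le.2 ?_) ?_
    · rintro _ ⟨s, rfl⟩; exact h5 s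
    · rw [finrank_span_eq_card h2, Fintype.card_fin]; exact h7
  rw [h4 j h8] at hj
  exact (hj _).1 (matAct_single_inv_mem hS hl hTS hT hf i)

section Stabilizer

/-- The matrices which preserve a space of tuples. -/
def matStab (D : Submodule K (ι → W)) : Submodule K (Matrix ι ι K) where
  carrier := {g | ∀ f ∈ D, matAct K ι W g f ∈ D}
  add_mem' ha hb f hf := by
    rw [map_add]; exact add_mem (ha f hf) (hb f hf)
  zero_mem' f _ := by
    rw [map_zero]; exact zero_mem _
  smul_mem' c g hg f hf := by
    rw [matAct_smul]; exact D.smul_mem _ (hg f hf)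

theorem mem_matStab {D : Submodule K (ι → W)} {g : Matrix ι ι K} :
    g ∈ matStab D ↔ ∀ f ∈ D, matAct K ι W g f ∈ D := Iff.rfl

theorem finrank_matStab {D D' : Submodule K (ι → W)} {G : Matrix ι ι K} (hG : IsUnit G)
    (h : ∀ f, f ∈ D ↔ matAct K ι W G f ∈ D') :
    finrank K (matStab D) = finrank K (matStab D') := by
  have hdG := (Matrix.isUnit_iff_isUnit_det _).1 hG
  have h1 : ∀ f, f ∈ D' ↔ matAct K ι W G⁻¹ f ∈ D := by
    intro f
    rw [h, ← matAct_mul, Matrix.mul_nonsing_inv _ hdG, matAct_one]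
  let F : Matrix ι ι K ≃ₗ[K] Matrix ι ι K := LinearEquiv.ofLinearMap
    (LinearMap.mulLeftRight K (G, G⁻¹)) (LinearMap.mulLeftRight K (G⁻¹, G))
    (LinearMap.ext fun g => by
      change G * (G⁻¹ * g * G) * G⁻¹ = g
      rw [mul_assoc, mul_assoc, Matrix.mul_nonsing_inv _ hdG, mul_one, ← mul_assoc,
        Matrix.mul_nonsing_inv _ hdG, one_mul])
    (LinearMap.ext fun g => by
      change G⁻¹ * (G * g * G⁻¹) * G = g
      rw [mul_assoc, mul_assoc, Matrix.nonsing_inv_mul _ hdG, mul_one, ← mul_assoc,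
        Matrix.nonsing_inv_mul _ hdG, one_mul])
  have hF : ∀ g, F g = G * g * G⁻¹ := fun g => rfl
  have h2 : matStab D = (matStab D').comap F.toLinearMap := by
    ext g
    rw [Submodule.mem_comap, LinearEquiv.coe_coe, hF, mem_matStab, mem_matStab]
    constructor
    · intro hg f hf
      rw [mul_assoc, matAct_mul, ← h, matAct_mul]
      exact hg _ ((h1 f).1 hf)
    · intro hg f hf
      have := hg _ ((h f).1 hf)
      rw [← matAct_mul, mul_assoc, Matrix.nonsing_inv_mul _ hdG, mul_one, matAct_mul, ← h] at this
      exact this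
  rw [h2, Submodule.comap_equiv_eq_map_symm]
  exact LinearEquiv.finrank_map_eq _ _

theorem mem_matStab_pi {C : ι → Submodule K W} {g : Matrix ι ι K} :
    g ∈ matStab (Submodule.pi Set.univ C) ↔ ∀ i j, g i j ≠ 0 → C j ≤ C i := by
  constructor
  · intro hg i j hij w hw
    have := hg (Pi.single j w) (fun a _ => by
      by_cases ha : a = j
      · subst ha; rwa [Pi.single_eq_same]
      · rw [Pi.single_eq_of_ne ha]; exact zero_mem _) i (Set.mem_univ _)
    rw [matAct_single] at this
    exact (Submodule.smul_mem_iff _ hij).1 this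
  · intro hg f hf i _
    rw [matAct_apply]
    refine sum_mem fun j _ => ?_
    by_cases hij : g i j = 0
    · rw [hij, zero_smul]; exact zero_mem _
    · exact smul_mem _ _ (hg i j hij (hf j (Set.mem_univ _)))

end Stabilizer

end MatrixAction

namespace SpaceWithFunctions

section PolynomialFunctions

variable {Y : Type*} (𝒮 : Subalgebra K (Y → K))

/-- Evaluation at a point. -/
def evalAt (y : Y) : 𝒮 →ₐ[K] K := (Pi.evalAlgHom K (fun _ : Y => K) y).comp 𝒮.val

/-- A polynomial with coefficients in an algebra of functions on `Y`, as a function on `Y × K`. -/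
def polyEval : Polynomial 𝒮 →ₐ[K] (Y × K → K) :=
  AlgHom.pi fun p => Polynomial.eval₂AlgHom (evalAt 𝒮 p.1) p.2 fun _ => Commute.all _ _

theorem polyEval_apply (f : Polynomial 𝒮) (y : Y) (c : K) :
    polyEval 𝒮 f (y, c) = (f.map (evalAt 𝒮 y).toRingHom).eval c := by
  rw [Polynomial.eval_map]; rfl

theorem comp_fst_mem {a : Y → K} (ha : a ∈ 𝒮) : (fun p : Y × K => a p.1) ∈ (polyEval 𝒮).range := by
  refine ⟨Polynomial.C ⟨a, ha⟩, funext fun p => ?_⟩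
  change polyEval 𝒮 _ (p.1, p.2) = _
  rw [polyEval_apply, Polynomial.map_C, Polynomial.eval_C]; rfl

theorem snd_mem : (fun p : Y × K => p.2) ∈ (polyEval 𝒮).range := by
  refine ⟨Polynomial.X, funext fun p => ?_⟩
  change polyEval 𝒮 _ (p.1, p.2) = _
  rw [polyEval_apply, Polynomial.map_X, Polynomial.eval_X]

variable {𝒮}

theorem VReg.comp_fst {W : Type*} [AddCommGroup W] [Module K W] {b : Y → W} (hb : VReg 𝒮 b) :
    VReg (polyEval 𝒮).range fun p : Y × K => b p.1 := fun φ => comp_fst_mem 𝒮 (hb φ)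

variable {ι : Type*} [Fintype ι] [DecidableEq ι]

theorem VReg.matAct {W : Type*} [AddCommGroup W] [Module K W] {g : Y → Matrix ι ι K}
    (hg : ∀ i j, (fun y => g y i j) ∈ 𝒮) {f : Y → ι → W} (hf : VReg 𝒮 f) :
    VReg 𝒮 fun y => matAct K ι W (g y) (f y) :=
  vreg_pi.2 fun i => VReg.sum _ fun j _ => VReg.smul (hg i j) (vreg_pi.1 hf j)

theorem map_aeval_matrix (M : Matrix ι ι 𝒮) (f : Polynomial 𝒮) (y : Y) :
    (Polynomial.aeval M f).map (evalAt 𝒮 y) =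
      Polynomial.aeval (M.map (evalAt 𝒮 y)) (f.map (evalAt 𝒮 y).toRingHom) := by
  rw [Polynomial.aeval_def, Polynomial.aeval_def, Polynomial.eval₂_map]
  refine (Polynomial.hom_eval₂ f (algebraMap 𝒮 (Matrix ι ι 𝒮))
    ((evalAt 𝒮 y).toRingHom.mapMatrix) M).trans ?_
  refine congrArg₂ (fun g (N : Matrix ι ι K) => Polynomial.eval₂ g N f)
    (RingHom.ext fun a => ?_) rfl
  ext i j
  by_cases hij : i = j
  · subst hij; simp [Matrix.algebraMap_matrix_apply]
  · simp [Matrix.algebraMap_matrix_apply, hij]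

/-- A matrix of regular functions, in a polynomial with regular coefficients. -/
theorem aeval_mem {T : Y → Matrix ι ι K} (hT : ∀ i j, (fun y => T y i j) ∈ 𝒮) (f : Polynomial 𝒮)
    (i j : ι) :
    (fun y => (Polynomial.aeval (T y) (f.map (evalAt 𝒮 y).toRingHom)) i j) ∈ 𝒮 := by
  let M : Matrix ι ι 𝒮 := Matrix.of fun i j => ⟨_, hT i j⟩
  have h : (fun y => (Polynomial.aeval (T y) (f.map (evalAt 𝒮 y).toRingHom)) i j) =
      ((Polynomial.aeval M f) i j : 𝒮) := by
    funext y
    exact (congrFun (congrFun (map_aeval_matrix M f y) i) j).symm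
  rw [h]
  exact Subtype.property _

theorem det_derivative_charpoly_mem {T : Y → Matrix ι ι K} (hT : ∀ i j, (fun y => T y i j) ∈ 𝒮) :
    (fun y => (Polynomial.aeval (T y) (Polynomial.derivative (T y).charpoly)).det) ∈ 𝒮 := by
  let M : Matrix ι ι 𝒮 := Matrix.of fun i j => ⟨_, hT i j⟩
  refine det_mem fun i j => ?_
  have h := aeval_mem hT (Polynomial.derivative M.charpoly) i j
  have h' : ∀ y, (Polynomial.derivative M.charpoly).map (evalAt 𝒮 y).toRingHom =
      Polynomial.derivative (T y).charpoly := by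
    intro y
    rw [← Polynomial.derivative_map, ← Matrix.charpoly_map]; rfl
  simpa only [h'] using h

end PolynomialFunctions

theorem det_derivative_charpoly_diagonal {ι : Type*} [Fintype ι] [DecidableEq ι] {t : ι → K}
    (ht : Function.Injective t) : (Polynomial.aeval (Matrix.diagonal t)
      (Polynomial.derivative (Matrix.diagonal t).charpoly)).det ≠ 0 := by
  have h1 := aeval_mul_of_mul_eq (T := Matrix.diagonal t) (S := 1) (l := t)
    (by rw [mul_one, one_mul]) (Polynomial.derivative (Matrix.diagonal t).charpoly)
  rw [mul_one, one_mul] at h1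
  rw [h1, Matrix.det_diagonal, Finset.prod_ne_zero_iff]
  intro i _
  have h2 : (Matrix.diagonal t).charpoly.Separable := by
    rw [Matrix.charpoly_diagonal]
    exact Polynomial.separable_prod_X_sub_C_iff.2 ht
  have h3 := h2.aeval_derivative_ne_zero (x := t i) (by
    rw [Polynomial.coe_aeval_eq_eval, Matrix.charpoly_diagonal, Polynomial.eval_prod]
    exact Finset.prod_eq_zero (Finset.mem_univ i) (by simp))
  rwa [Polynomial.coe_aeval_eq_eval] at h3

section Splitting

variable {X : SpaceWithFunctions K} [X.IsGood] {x : X}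
variable {ι : Type*} [Fintype ι] [DecidableEq ι]

theorem RegSub.matStab {W : Type*} [AddCommGroup W] [Module K W] {D : X → Submodule K (ι → W)}
    (hD : RegSub D x)
    (h : ∀ᶠ y in 𝓝 x, finrank K (matStab (D y)) = finrank K (matStab (D x))) :
    RegSub (fun y => _root_.matStab (D y)) x := by
  obtain ⟨m, b, hb, hbD⟩ := id hD
  let A : X → Matrix ι ι K →ₗ[K] (Fin m → ι → W) := fun y => LinearMap.pi fun s =>
    (LinearMap.applyₗ (b s y)) ∘ₗ (matAct K ι W).toLinearMap
  have hA : ∀ y g s, A y g s = matAct K ι W g (b s y) := fun y g s => rfl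
  have hstab : ∀ᶠ y in 𝓝 x, (Submodule.pi Set.univ fun _ : Fin m => D y).comap (A y) =
      _root_.matStab (D y) := by
    filter_upwards [hbD] with y hy
    ext g
    constructor
    · intro hg
      have h1 : span K (range fun s => b s y) ≤ (D y).comap (matAct K ι W g) := by
        rw [span_le]
        rintro _ ⟨s, rfl⟩
        exact hg s (Set.mem_univ _)
      rw [hy.2] at h1
      exact h1
    · intro hg s _
      exact hg _ (hy.2 ▸ subset_span ⟨s, rfl⟩)
  refine (RegSub.comap (A := A) (fun g => vreg_pi.2 fun s =>
    VReg.matAct (g := fun _ => g) (fun i j => const_mem (g i j)) (hb s)) (RegSub.pi fun _ => hD)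
    ?_).congr hstab
  filter_upwards [h, hstab] with y h1 h2
  rw [h2, hstab.self_of_nhds, h1]

/-- Suppose that the fibres of a regular family of spaces of tuples are, up to a linear change of
the coordinates, products of subspaces whose inclusion relations do not depend on the point. Then a
factor which can be distinguished from the others by a polynomial function is regular. -/
theorem RegSub.of_splitting [IsAlgClosed K] {W : Type u} [AddCommGroup W] [Module K W]
    [FiniteDimensional K W] {D : X → Submodule K (ι → W)} (hD : RegSub D x)
    {C : ι → X → Submodule K W} (hx : D x = Submodule.pi Set.univ fun i => C i x)
    (hG : ∀ᶠ y in 𝓝 x, ∃ G : Matrix ι ι K, IsUnit G ∧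
      ∀ f, f ∈ D y ↔ ∀ i, matAct K ι W G f i ∈ C i y)
    (hle : ∀ᶠ y in 𝓝 x, ∀ i j, C i y ≤ C j y ↔ C i x ≤ C j x) {j₀ : ι} {k : ℕ}
    {c : Fin k → W} (hc : LinearIndependent K c) (hcC : span K (range c) = C j₀ x)
    {Φ : (Fin k → W) → K} (hΦ : Φ ∈ polyFun K (Fin k → W)) (hΦc : Φ c ≠ 0)
    (hlabel : ∀ᶠ y in 𝓝 x, ∀ i, ∀ b : Fin k → W, LinearIndependent K b →
      span K (range b) = C i y → Φ b ≠ 0 → i = j₀)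
    (hk : ∀ᶠ y in 𝓝 x, finrank K (C j₀ y) = k) : RegSub (C j₀) x := by
  obtain ⟨t, ht⟩ : ∃ t : ι → K, Function.Injective t :=
    ⟨fun i => Infinite.natEmbedding K (Fintype.equivFin ι i),
      (Infinite.natEmbedding K).injective.comp
        (Fin.val_injective.comp (Fintype.equivFin ι).injective)⟩
  -- a regular matrix which preserves the family, with different eigenvalues at `x`
  have hstab : RegSub (fun y => _root_.matStab (D y)) x := by
    refine hD.matStab ?_
    have h1 : ∀ y, (∃ G : Matrix ι ι K, IsUnit G ∧
        ∀ f, f ∈ D y ↔ ∀ i, matAct K ι W G f i ∈ C i y) →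
        finrank K (_root_.matStab (D y)) =
          finrank K (_root_.matStab (Submodule.pi Set.univ fun i => C i y)) := by
      rintro y ⟨G, hG, h⟩
      exact finrank_matStab hG fun f => (h f).trans ⟨fun h i _ => h i, fun h i => h i trivial⟩
    filter_upwards [hG, hle] with y h2 h3
    rw [h1 y h2, h1 x hG.self_of_nhds]
    have h4 : _root_.matStab (Submodule.pi Set.univ fun i => C i y) =
        _root_.matStab (Submodule.pi Set.univ fun i => C i x) := by
      ext g
      simp only [mem_matStab_pi, h3]
    rw [h4]
  obtain ⟨T, hTreg, hTx, hTD⟩ := hstab.exists_section (v := Matrix.diagonal t) (by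
    rw [hx, mem_matStab_pi]
    intro i j hij
    by_cases h : i = j
    · rw [h]
    · exact absurd (Matrix.diagonal_apply_ne _ h) hij)
  have hT : ∀ i j, (fun y => T y i j) ∈ X.regAlg x := fun i j =>
    vreg_field.1 (hTreg.map (Matrix.entryLinearMap K K i j))
  have hδ := regAlg_ne (det_derivative_charpoly_mem hT) (by
    rw [hTx]; exact det_derivative_charpoly_diagonal ht)
  -- the adjugates of `T - c`
  let A : X × K → Matrix ι ι K := fun p => (T p.1 - Matrix.scalar ι p.2).adjugate
  have hA : ∀ i j, (fun p => A p i j) ∈ (polyEval (X.regAlg x)).range := by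
    refine adjugate_mem fun i j => ?_
    refine sub_mem (comp_fst_mem _ (hT i j)) ?_
    by_cases hij : i = j
    · subst hij
      simpa using snd_mem (X.regAlg x)
    · have h1 : (fun p : X × K => Matrix.scalar ι p.2 i j) = 0 := by
        funext p; simp [hij]
      rw [h1]
      exact zero_mem _
  let a : K := ∏ j ∈ Finset.univ.erase j₀, (t j - t j₀)
  have ha : a ≠ 0 := Finset.prod_ne_zero_iff.2 fun j hj =>
    sub_ne_zero.2 fun h => (Finset.mem_erase.1 hj).1 (ht h)
  have hAx : ∀ f : ι → W, matAct K ι W (A (x, t j₀)) f = Pi.single j₀ (a • f j₀) := by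
    intro f
    have h1 : A (x, t j₀) = Matrix.diagonal fun i => ∏ j ∈ Finset.univ.erase i, (t j - t j₀) := by
      change (T x - Matrix.scalar ι (t j₀)).adjugate = _
      rw [hTx, Matrix.scalar_apply, Matrix.diagonal_sub, Matrix.adjugate_diagonal]
    rw [h1]
    funext i
    rw [matAct_diagonal]
    by_cases hi : i = j₀
    · subst hi; rw [Pi.single_eq_same]
    · rw [Pi.single_eq_of_ne hi, Finset.prod_eq_zero
        (Finset.mem_erase.2 ⟨Ne.symm hi, Finset.mem_univ j₀⟩) (sub_self _), zero_smul]
  -- sections of the family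
  have hsec : ∀ s : Fin k, ∃ b : X → ι → W, VReg (X.regAlg x) b ∧
      b x = Pi.single j₀ (a⁻¹ • c s) ∧ ∀ᶠ y in 𝓝 x, b y ∈ D y := by
    intro s
    refine hD.exists_section ?_
    rw [hx]
    intro i _
    by_cases hi : i = j₀
    · subst hi
      rw [Pi.single_eq_same]
      change _ ∈ C i x
      rw [← hcC]
      exact smul_mem _ _ (subset_span ⟨s, rfl⟩)
    · rw [Pi.single_eq_of_ne hi]; exact zero_mem _
  choose b hb hbx hbD using hsec
  let B : Fin k → X × K → W := fun s p => matAct K ι W (A p) (b s p.1) j₀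
  have hB : ∀ s, VReg (polyEval (X.regAlg x)).range (B s) := fun s =>
    vreg_pi.1 (VReg.matAct hA (hb s).comp_fst) j₀
  have hBx : ∀ s, B s (x, t j₀) = c s := by
    intro s
    change matAct K ι W (A (x, t j₀)) (b s x) j₀ = _
    rw [hAx, hbx, Pi.single_eq_same, Pi.single_eq_same, smul_smul, mul_inv_cancel₀ ha, one_smul]
  obtain ⟨m₁, hm₁, hm₁x, hm₁'⟩ := exists_minor hB (y₀ := (x, t j₀)) (by simpa only [hBx] using hc)
  -- vectors complementary to the family
  obtain ⟨E, hE⟩ := Submodule.exists_isCompl (C j₀ x)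
  let ε := Module.finBasis K E
  obtain ⟨n, β, hβ, hβD⟩ := id hD
  let F : Fin (finrank K E) ⊕ Fin n → X × K → ι → W := Sum.elim
    (fun u p => matAct K ι W (A p) (Pi.single j₀ (ε u : W))) fun s p => β s p.1
  have hF : ∀ i, VReg (polyEval (X.regAlg x)).range (F i) := by
    rintro (i | i)
    · exact VReg.matAct hA (VReg.const _)
    · exact (hβ i).comp_fst
  have hFp : ∀ p, (fun i => F i p) = Sum.elim
      (fun u => matAct K ι W (A p) (Pi.single j₀ (ε u : W))) fun s => β s p.1 := by
    intro p; funext i; rcases i with i | i <;> rfl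
  have hFx : LinearIndependent K fun i => F i (x, t j₀) := by
    rw [hFp]
    have h1 : (fun u => matAct K ι W (A (x, t j₀)) (Pi.single j₀ (ε u : W))) =
        fun u => (LinearMap.single K (fun _ : ι => W) j₀ ∘ₗ (a • E.subtype)) (ε u) := by
      funext u
      rw [hAx, Pi.single_eq_same]; rfl
    have h2 : Function.Injective (LinearMap.single K (fun _ : ι => W) j₀ ∘ₗ (a • E.subtype)) := by
      intro z z' hz
      have h3 : a • (z : W) = a • (z' : W) := by
        have := congrFun hz j₀
        simpa using this
      exact Subtype.ext (smul_right_injective W ha h3)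
    rw [h1]
    refine LinearIndependent.sum_type (ε.linearIndependent.map' _ (LinearMap.ker_eq_bot.2 h2))
      hβD.self_of_nhds.1 ?_
    change Disjoint _ (span K (range fun s => β s x))
    rw [hβD.self_of_nhds.2, hx, Submodule.disjoint_def]
    intro f hf hf'
    have h3 : span K (range fun u =>
        (LinearMap.single K (fun _ : ι => W) j₀ ∘ₗ (a • E.subtype)) (ε u)) ≤
        E.map (LinearMap.single K (fun _ : ι => W) j₀) := by
      rw [span_le]
      rintro _ ⟨u, rfl⟩
      exact ⟨a • (ε u : W), E.smul_mem _ (ε u).2, rfl⟩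
    obtain ⟨z, hz, rfl⟩ := h3 hf
    have h4 := hf' j₀ trivial
    rw [LinearMap.single_apply, Pi.single_eq_same] at h4
    rw [Submodule.disjoint_def.1 hE.disjoint z h4 hz, map_zero]
  obtain ⟨m₂, hm₂, hm₂x, hm₂'⟩ := exists_minor hF (y₀ := (x, t j₀)) hFx
  -- a polynomial in `T` which is a multiple of the projection belonging to `C j₀`
  have hΦB : (fun p => Φ fun s => B s p) ∈ (polyEval (X.regAlg x)).range :=
    VReg.polyFun (b := fun p s => B s p) (vreg_pi.2 hB) hΦ
  obtain ⟨f, hf⟩ := mul_mem hΦB (mul_mem hm₁ hm₂)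
  have hfe : ∀ y c, (f.map (evalAt (X.regAlg x) y).toRingHom).eval c =
      Φ (fun s => B s (y, c)) * (m₁ (y, c) * m₂ (y, c)) := by
    intro y c
    rw [← polyEval_apply]
    exact congrFun hf (y, c)
  let Q : X → Matrix ι ι K := fun y =>
    Polynomial.aeval (T y) (f.map (evalAt (X.regAlg x) y).toRingHom)
  have hQ : ∀ i j, (fun y => Q y i j) ∈ X.regAlg x := aeval_mem hT f
  have hQb : ∀ s, VReg (X.regAlg x) fun y => matAct K ι W (Q y) (b s y) j₀ := fun s =>
    vreg_pi.1 (VReg.matAct hQ (hb s)) j₀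
  have hQx : ∃ q : K, q ≠ 0 ∧ ∀ s, matAct K ι W (Q x) (b s x) j₀ = q • c s := by
    refine ⟨(f.map (evalAt (X.regAlg x) x).toRingHom).eval (t j₀) * a⁻¹,
      mul_ne_zero ?_ (inv_ne_zero ha), fun s => ?_⟩
    · rw [hfe]
      simp only [hBx]
      exact mul_ne_zero hΦc (mul_ne_zero hm₁x hm₂x)
    · have h1 := aeval_mul_of_mul_eq (T := Matrix.diagonal t) (S := 1) (l := t)
        (by rw [mul_one, one_mul]) (f.map (evalAt (X.regAlg x) x).toRingHom)
      rw [mul_one, one_mul] at h1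
      change matAct K ι W (Polynomial.aeval (T x) _) (b s x) j₀ = _
      rw [hTx, h1, matAct_diagonal, hbx, Pi.single_eq_same, smul_smul]
  obtain ⟨q, hq, hQx⟩ := hQx
  have hind : LinearIndependent K fun s => matAct K ι W (Q x) (b s x) j₀ := by
    simp only [hQx]
    exact hc.units_smul fun _ => Units.mk0 q hq
  refine RegSub.of_frame (fun s y => matAct K ι W (Q y) (b s y) j₀) hQb ?_
  filter_upwards [eventually_linearIndependent hQb hind, hG, hTD, hδ, hβD, hlabel, hk,
    eventually_all.2 hbD] with y h1 ⟨G, hG, hGD⟩ h3 h4 h5 h6 h7 h8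
  have hk' : finrank K (C j₀ x) = k := hk.self_of_nhds
  refine ⟨h1, Submodule.eq_of_le_of_finrank_le ?_ ?_⟩
  · rw [span_le]
    rintro _ ⟨s, rfl⟩
    refine matAct_aeval_mem_factor hG hGD (T := T y) h3 h4 h8 (E := E)
      (by rw [← hk']; exact Submodule.finrank_add_eq_of_isCompl hE) (fun c hc => ?_) (h8 s)
    rw [hfe] at hc
    have hB' := hm₁' (y, c) (left_ne_zero_of_mul (right_ne_zero_of_mul hc))
    refine ⟨hB', fun z hz hzD => ?_, fun i hi => h6 i _ hB' hi (left_ne_zero_of_mul hc)⟩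
    have hF' := hm₂' (y, c) (right_ne_zero_of_mul (right_ne_zero_of_mul hc))
    rw [hFp, linearIndependent_sum] at hF'
    have h9 : matAct K ι W (A (y, c)) (Pi.single j₀ z) =
        ∑ u, ε.repr ⟨z, hz⟩ u • matAct K ι W (A (y, c)) (Pi.single j₀ (ε u : W)) := by
      have h10 : z = ∑ u, ε.repr ⟨z, hz⟩ u • (ε u : W) := (sum_repr_coe ε ⟨z, hz⟩).symm
      have h11 : Pi.single j₀ z = ∑ u, ε.repr ⟨z, hz⟩ u • (Pi.single j₀ (ε u : W) : ι → W) := by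
        funext i
        rw [Finset.sum_apply]
        by_cases hi : i = j₀
        · subst hi
          simpa only [Pi.smul_apply, Pi.single_eq_same] using h10
        · simp [Pi.single_eq_of_ne hi]
      rw [h11, map_sum]
      simp only [map_smul]
    have h12 : matAct K ι W (A (y, c)) (Pi.single j₀ z) = 0 := by
      refine Submodule.disjoint_def.1 hF'.2.2 _ ?_ ?_
      · change _ ∈ span K (range fun u =>
          matAct K ι W (A (y, c)) (Pi.single j₀ (ε u : W)))
        rw [h9]
        exact sum_mem fun u _ => smul_mem _ _ (subset_span ⟨u, rfl⟩)
      · change _ ∈ span K (range fun s => β s y)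
        rw [h5.2]
        exact hzD
    rw [h9] at h12
    have h13 := Fintype.linearIndependent_iff.1 hF'.1 _ h12
    have h14 : (⟨z, hz⟩ : E) = 0 := by
      rw [← ε.sum_repr ⟨z, hz⟩]
      exact Finset.sum_eq_zero fun u _ => by rw [h13 u, zero_smul]
    exact congrArg Subtype.val h14
  · rw [finrank_span_eq_card h1, Fintype.card_fin, h7]

end Splitting

end SpaceWithFunctions

section LocalSubmodules

open SpaceWithFunctions

theorem isClopen_connectedComponent_of_finite {α : Type*} [TopologicalSpace α]
    [Finite (ConnectedComponents α)] (x : α) : IsClopen (connectedComponent x) := by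
  refine ⟨isClosed_connectedComponent, ?_⟩
  have h : (connectedComponent x)ᶜ =
      ⋃ c ∈ {c : ConnectedComponents α | c ≠ x}, ((↑) : α → ConnectedComponents α) ⁻¹' {c} := by
    ext y
    simp only [Set.mem_compl_iff, Set.mem_iUnion, Set.mem_preimage, Set.mem_singleton_iff,
      exists_prop]
    rw [← ConnectedComponents.coe_eq_coe']
    exact ⟨fun h => ⟨_, h, rfl⟩, fun ⟨c, hc, hy⟩ => hy ▸ hc⟩
  rw [← isClosed_compl_iff, h]
  refine Set.Finite.isClosed_biUnion (Set.toFinite _) fun c _ => ?_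
  obtain ⟨z, rfl⟩ := ConnectedComponents.surjective_coe c
  rw [connectedComponents_preimage_singleton]
  exact isClosed_connectedComponent

namespace SpaceWithFunctions

variable {W : Type u} [AddCommGroup W] [Module K W] [FiniteDimensional K W] {k : ℕ}

theorem isClosed_stable (o : W →ₗ[K] W) :
    IsClosed {C : grassmannian K W k | ∀ c ∈ C.1, o c ∈ C.1} := by
  rw [← isOpen_compl_iff, isOpen_iff_eventually]
  intro C hC
  have hC' : ∃ c ∈ C.1, o c ∉ C.1 := by
    by_contra! h; exact hC h
  obtain ⟨c, hc, hoc⟩ := hC'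
  obtain ⟨b, hb, hbC, hbm⟩ := (regSub_taut C).exists_section hc
  filter_upwards [hbm, (regSub_taut C).eventually_notMem (hb.map o) (by rw [hbC]; exact hoc)]
    with D h1 h2 h3 using h2 (h3 _ h1)

theorem isClosed_le (P : Submodule K W) : IsClosed {C : grassmannian K W k | C.1 ≤ P} := by
  rw [← isOpen_compl_iff, isOpen_iff_eventually]
  intro C hC
  have hC' : ∃ c ∈ C.1, c ∉ P := by
    by_contra! h; exact hC h
  obtain ⟨c, hc, hcP⟩ := hC'
  obtain ⟨b, hb, hbC, hbm⟩ := (regSub_taut C).exists_section hc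
  filter_upwards [hbm, (RegSub.const P).eventually_notMem hb (by rw [hbC]; exact hcP)]
    with D h1 h2 h3 using h2 (h3 h1)

/-- The dimension of the image of a regular family of subspaces under an idempotent endomorphism
which preserves them is locally constant. -/
theorem RegSub.eventually_finrank_map_eq {X : SpaceWithFunctions K} [X.IsGood] {x : X}
    {C : X → Submodule K W} (hC : RegSub C x) {p : W →ₗ[K] W} (hp : ∀ w, p (p w) = p w)
    (h : ∀ᶠ y in 𝓝 x, ∀ c ∈ C y, p c ∈ C y) :
    ∀ᶠ y in 𝓝 x, finrank K ((C y).map p) = finrank K ((C x).map p) := by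
  have key : ∀ y, (∀ c ∈ C y, p c ∈ C y) → finrank K ((C y).map p) +
      finrank K ((C y).map (LinearMap.id - p)) = finrank K (C y) := by
    intro y hy
    have h1 : (C y).map p ⊔ (C y).map (LinearMap.id - p) = C y := by
      refine le_antisymm (sup_le ?_ ?_) fun c hc => ?_
      · rintro _ ⟨c, hc, rfl⟩; exact hy c hc
      · rintro _ ⟨c, hc, rfl⟩; exact sub_mem hc (hy c hc)
      · have : c = p c + (LinearMap.id - p : W →ₗ[K] W) c := by simp
        rw [this]
        exact Submodule.add_mem_sup ⟨c, hc, rfl⟩ ⟨c, hc, rfl⟩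
    have h2 : (C y).map p ⊓ (C y).map (LinearMap.id - p) = ⊥ := by
      refine (Submodule.eq_bot_iff _).2 ?_
      rintro _ ⟨⟨c, -, rfl⟩, ⟨c', -, hc'⟩⟩
      have h3 := congrArg p hc'
      rw [hp] at h3
      rw [← h3]
      simp [hp]
    have h3 := Submodule.finrank_sup_add_finrank_inf_eq ((C y).map p)
      ((C y).map (LinearMap.id - p))
    rw [h1, h2, finrank_bot, add_zero] at h3
    exact h3.symm
  have hx := key x h.self_of_nhds
  filter_upwards [h, hC.finrank_eq, hC.eventually_finrank_map_le p,
    hC.eventually_finrank_map_le (LinearMap.id - p)] with y h1 h2 h3 h4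
  have := key y h1
  omega

end SpaceWithFunctions

variable (hπ : IsPathLengthGraded π)

/-- The homogeneous submodules of `J e_i`. -/
structure IsLocalSub (i : V) (C : Submodule K Λ) : Prop where
  mul_mem : ∀ a : Λ, ∀ c ∈ C, a * c ∈ C
  le : C ≤ algGE hπ 1
  mul_idem : ∀ c ∈ C, c * idem π i = c
  proj_mem : ∀ l, ∀ c ∈ C, algProj hπ l c ∈ C

theorem mem_span_idem {i : V} {a : Λ} : a ∈ Ideal.span {idem π i} ↔ a * idem π i = a := by
  rw [Ideal.mem_span_singleton']
  constructor
  · rintro ⟨b, rfl⟩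
    rw [mul_assoc, idem_mul_self]
  · exact fun h => ⟨a, h⟩

theorem mem_jacobson_smul_iff {i : V} {c : Λ} :
    c ∈ Ring.jacobson Λ • (Ideal.span {idem π i} : Ideal Λ) ↔
      c ∈ algGE hπ 1 ∧ c * idem π i = c := by
  constructor
  · intro hc
    refine ⟨?_, mem_span_idem.1 (Submodule.smul_le_right hc)⟩
    refine Submodule.smul_induction_on (p := fun c => c ∈ algGE hπ 1) hc (fun a ha b _ => ?_)
      fun a b ha hb => add_mem ha hb
    have := algGE_mul hπ ((mem_jacobson_iff hπ).1 ha) (mem_algGE_zero hπ b)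
    rw [add_zero] at this
    exact this
  · rintro ⟨h1, h2⟩
    rw [← h2]
    exact Submodule.smul_mem_smul ((mem_jacobson_iff hπ).2 h1)
      (Ideal.subset_span (Set.mem_singleton _))

theorem isLocalSub_iff {i : V} {C : Submodule K Λ} : IsLocalSub hπ i C ↔
    (∀ a : Λ, ∀ c ∈ C, a * c ∈ C) ∧
      (∀ c ∈ C, c ∈ Ring.jacobson Λ • (Ideal.span {idem π i} : Ideal Λ)) ∧
      C ≤ ⨆ l, C ⊓ algDegree π l := by
  rw [homogeneous_iff hπ]
  simp only [mem_jacobson_smul_iff hπ]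
  exact ⟨fun h => ⟨h.1, fun c hc => ⟨h.2 hc, h.3 c hc⟩, h.4⟩,
    fun h => ⟨h.1, fun c hc => (h.2.1 c hc).1, fun c hc => (h.2.1 c hc).2, h.2.2⟩⟩

theorem localGrass.isLocalSub {i : V} {δ : ℕ} (x : localGrass π i δ) :
    IsLocalSub hπ i (localGrass.submodule x) := (isLocalSub_iff hπ).2 x.2.2

theorem localGrass.finrank_add {i : V} {δ : ℕ} (x : localGrass π i δ) :
    finrank K (localGrass.submodule x) + δ = finrank K (Ideal.span {idem π i} : Ideal Λ) := x.2.1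

theorem localGrass.ext {i : V} {δ : ℕ} {x y : localGrass π i δ}
    (h : localGrass.submodule x = localGrass.submodule y) :
    x = y := Subtype.ext (Subtype.ext h)

theorem IsLocalSub.exists_point [FiniteDimensional K Λ] {i : V} {C : Submodule K Λ}
    (hC : IsLocalSub hπ i C) : ∃ (δ : ℕ) (x : localGrass π i δ), localGrass.submodule x = C := by
  have h1 : finrank K C ≤ finrank K (Ideal.span {idem π i} : Ideal Λ) := by
    have : C ≤ (Ideal.span {idem π i} : Ideal Λ).restrictScalars K := fun c hc =>
      mem_span_idem.2 (hC.mul_idem c hc)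
    exact Submodule.finrank_mono this
  let n := finrank K (Ideal.span {idem π i} : Ideal Λ)
  have h2 : finrank K C = n - (n - finrank K C) := by omega
  exact ⟨n - finrank K C, ⟨⟨C, h2⟩, by
    refine ⟨?_, (isLocalSub_iff hπ).1 hC⟩
    change finrank K C + (n - finrank K C) = n
    omega⟩, rfl⟩

instance {i : V} {δ : ℕ} : (localGrass π i δ).IsGood :=
  inferInstanceAs (((SpaceWithFunctions.grassmannian K Λ _).sub _).IsGood)

instance [FiniteDimensional K Λ] {i : V} {δ : ℕ} :
    TopologicalSpace.NoetherianSpace (localGrass π i δ) :=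
  inferInstanceAs (TopologicalSpace.NoetherianSpace ((SpaceWithFunctions.grassmannian K Λ _).sub _))

theorem isClosed_localGrass [FiniteDimensional K Λ] (hπ : IsPathLengthGraded π) (i : V) (δ : ℕ) :
    IsClosed {C : SpaceWithFunctions.grassmannian K Λ
        (finrank K (Ideal.span {idem π i} : Ideal Λ) - δ) |
      finrank K C.1 + δ = finrank K (Ideal.span {idem π i} : Ideal Λ) ∧
      (∀ a : Λ, ∀ c ∈ C.1, a * c ∈ C.1) ∧
      (∀ c ∈ C.1, c ∈ Ring.jacobson Λ • (Ideal.span {idem π i} : Ideal Λ)) ∧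
      C.1 ≤ ⨆ l, C.1 ⊓ algDegree π l} := by
  let P : Submodule K Λ :=
    (Ring.jacobson Λ • (Ideal.span {idem π i} : Ideal Λ)).restrictScalars K
  have h : {C : SpaceWithFunctions.grassmannian K Λ
        (finrank K (Ideal.span {idem π i} : Ideal Λ) - δ) |
      finrank K C.1 + δ = finrank K (Ideal.span {idem π i} : Ideal Λ) ∧
      (∀ a : Λ, ∀ c ∈ C.1, a * c ∈ C.1) ∧
      (∀ c ∈ C.1, c ∈ Ring.jacobson Λ • (Ideal.span {idem π i} : Ideal Λ)) ∧
      C.1 ≤ ⨆ l, C.1 ⊓ algDegree π l} =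
      {C | finrank K (Ideal.span {idem π i} : Ideal Λ) - δ + δ =
        finrank K (Ideal.span {idem π i} : Ideal Λ)} ∩
      ((⋂ a : Λ, {C | ∀ c ∈ C.1, LinearMap.mulLeft K a c ∈ C.1}) ∩
      ({C | C.1 ≤ P} ∩ ⋂ l : ℕ, {C | ∀ c ∈ C.1, algProj hπ l c ∈ C.1})) := by
    ext C
    have h1 : finrank K C.1 = finrank K (Ideal.span {idem π i} : Ideal Λ) - δ := C.2
    refine and_congr (by rw [h1]; rfl) (and_congr ?_ (and_congr Iff.rfl ?_))
    · rw [Set.mem_iInter]; rfl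
    · rw [Set.mem_iInter]; exact homogeneous_iff hπ
  rw [h]
  exact isClosed_const.inter ((isClosed_iInter fun a => isClosed_stable _).inter
    ((isClosed_le P).inter (isClosed_iInter fun l => isClosed_stable _)))

theorem localGrass.regSub [FiniteDimensional K Λ] {i : V} {δ : ℕ} (x : localGrass π i δ) :
    RegSub (fun y : localGrass π i δ => (localGrass.submodule y)) x :=
  (regSub_taut x.1).comp (Hom.homAt (Hom.incl _) x)

variable (π) in
/-- The submodules in the connected component of `C` in the local graded Grassmannian. -/
def localComp (i : V) (C : Submodule K Λ) : Set (Submodule K Λ) :=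
  {D | ∃ (δ : ℕ) (x y : localGrass π i δ), localGrass.submodule x = C ∧ localGrass.submodule y = D ∧
    y ∈ connectedComponent x}

theorem localGrass.delta_eq {i : V} {δ δ' : ℕ} {x : localGrass π i δ} {y : localGrass π i δ'}
    (h : localGrass.submodule x = localGrass.submodule y) : δ = δ' := by
  have h1 := localGrass.finrank_add x
  have h2 := localGrass.finrank_add y
  rw [h] at h1
  omega

theorem localGrass.mem_localComp {i : V} {δ : ℕ} {x y : localGrass π i δ} :
    localGrass.submodule y ∈ localComp π i (localGrass.submodule x) ↔ y ∈ connectedComponent x := by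
  constructor
  · rintro ⟨δ', x', y', hx, hy, h⟩
    obtain rfl := localGrass.delta_eq hx
    rw [localGrass.ext hx, localGrass.ext hy] at h
    exact h
  · exact fun h => ⟨δ, x, y, rfl, rfl, h⟩

theorem isLocalSub_of_mem_localComp {i : V} {C D : Submodule K Λ} (h : D ∈ localComp π i C) :
    IsLocalSub hπ i D := by
  obtain ⟨δ, x, y, rfl, rfl, -⟩ := h
  exact localGrass.isLocalSub hπ y

theorem IsLocalSub.mem_localComp [FiniteDimensional K Λ] {i : V} {C : Submodule K Λ}
    (hC : IsLocalSub hπ i C) : C ∈ localComp π i C := by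
  obtain ⟨δ, x, rfl⟩ := hC.exists_point hπ
  exact localGrass.mem_localComp.2 mem_connectedComponent

theorem finrank_eq_of_mem_localComp {i : V} {C D : Submodule K Λ} (h : D ∈ localComp π i C) :
    finrank K D = finrank K C := by
  obtain ⟨δ, x, y, rfl, rfl, -⟩ := h
  exact y.1.2.trans x.1.2.symm

theorem localComp_eq {i : V} {C D : Submodule K Λ} (h : D ∈ localComp π i C) :
    localComp π i D = localComp π i C := by
  obtain ⟨δ, x, y, rfl, rfl, hxy⟩ := h
  ext E
  constructor
  · rintro ⟨δ', x', y', hx, rfl, h'⟩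
    obtain rfl := localGrass.delta_eq hx
    rw [localGrass.ext hx, ← connectedComponent_eq hxy] at h'
    exact localGrass.mem_localComp.2 h'
  · rintro ⟨δ', x', y', hx, rfl, h'⟩
    obtain rfl := localGrass.delta_eq hx
    rw [localGrass.ext hx, connectedComponent_eq hxy] at h'
    exact localGrass.mem_localComp.2 h'

/-- A property of homogeneous submodules which defines clopen subsets of the local graded
Grassmannians is constant on their connected components. -/
theorem iff_of_mem_localComp {i : V} {P : Submodule K Λ → Prop}
    (hP : ∀ (δ : ℕ) (x : localGrass π i δ),
      ∀ᶠ y in 𝓝 x, P (localGrass.submodule y) ↔ P (localGrass.submodule x))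
    {C D : Submodule K Λ} (h : D ∈ localComp π i C) : P D ↔ P C := by
  obtain ⟨δ, x, y, rfl, rfl, hxy⟩ := h
  have hclopen : IsClopen
      {z : localGrass π i δ | P (localGrass.submodule z) ↔ P (localGrass.submodule x)} := by
    constructor
    · rw [← isOpen_compl_iff, isOpen_iff_eventually]
      intro z hz
      filter_upwards [hP δ z] with z' h1 h2
      exact hz (h1.symm.trans h2)
    · rw [isOpen_iff_eventually]
      intro z hz
      filter_upwards [hP δ z] with z' h1
      exact h1.trans hz
  exact hclopen.connectedComponent_subset
    (Iff.rfl : P (localGrass.submodule x) ↔ P (localGrass.submodule x)) hxy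

theorem finite_localComp [FiniteDimensional K Λ] (i : V) :
    {S | ∃ C, IsLocalSub hπ i C ∧ S = localComp π i C}.Finite := by
  have h : {S | ∃ C, IsLocalSub hπ i C ∧ S = localComp π i C} ⊆
      ⋃ δ ∈ Set.Iic (finrank K (Ideal.span {idem π i} : Ideal Λ)),
        range fun c : ConnectedComponents (localGrass π i δ) =>
          localComp π i (localGrass.submodule (Quot.out c)) := by
    rintro _ ⟨C, hC, rfl⟩
    obtain ⟨δ, x, rfl⟩ := hC.exists_point hπ
    refine Set.mem_iUnion₂.2 ⟨δ, ?_, (x : ConnectedComponents (localGrass π i δ)), ?_⟩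
    · have := localGrass.finrank_add x
      rw [Set.mem_Iic]; omega
    · refine (localComp_eq (localGrass.mem_localComp.2 ?_)).symm
      rw [← ConnectedComponents.coe_eq_coe']
      exact (Quot.out_eq (x : ConnectedComponents (localGrass π i δ))).symm
  refine Set.Finite.subset (Set.Finite.biUnion (Set.finite_Iic _) fun δ _ => ?_) h
  have := finite_connectedComponents (α := localGrass π i δ)
  exact Set.finite_range _

theorem finrank_map_of_mem_localComp [FiniteDimensional K Λ] {i : V} {C D : Submodule K Λ}
    (h : D ∈ localComp π i C) {p : Λ →ₗ[K] Λ} (hp : ∀ w, p (p w) = p w)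
    (hpC : ∀ C, IsLocalSub hπ i C → ∀ c ∈ C, p c ∈ C) :
    finrank K (D.map p) = finrank K (C.map p) := by
  refine (iff_of_mem_localComp (P := fun E => finrank K (E.map p) =
    finrank K (C.map p)) (fun δ x => ?_) h).2 rfl
  filter_upwards [(localGrass.regSub x).eventually_finrank_map_eq hp
    (Eventually.of_forall fun y => hpC _ (localGrass.isLocalSub hπ y))] with y hy
  rw [hy]

end LocalSubmodules

section Dimensions

variable {W W' : Type*} [AddCommGroup W] [Module K W] [AddCommGroup W'] [Module K W']

theorem finrank_map_add_finrank_inf_ker [FiniteDimensional K W] (X : Submodule K W)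
    (f : W →ₗ[K] W') : finrank K (X.map f) +
      finrank K (X ⊓ LinearMap.ker f : Submodule K W) = finrank K X := by
  have h1 := LinearMap.finrank_range_add_finrank_ker (f.domRestrict X)
  have h2 := Submodule.finrank_map_subtype_eq X (LinearMap.ker (f.domRestrict X))
  have h3 : (LinearMap.ker (f.domRestrict X)).map X.subtype = X ⊓ LinearMap.ker f := by
    ext w
    exact ⟨fun ⟨z, hz, hzw⟩ => hzw ▸ ⟨z.2, hz⟩, fun hw => ⟨⟨w, hw.1⟩, hw.2, rfl⟩⟩
  rwa [LinearMap.range_domRestrict, ← h2, h3] at h1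

theorem finrank_comap_eq [FiniteDimensional K W] (f : W →ₗ[K] W') {C : Submodule K W'}
    (hC : C ≤ LinearMap.range f) : finrank K (C.comap f) =
      finrank K C + finrank K (LinearMap.ker f) := by
  rw [← finrank_map_add_finrank_inf_ker (C.comap f) f, Submodule.map_comap_eq,
    inf_eq_right.2 hC, inf_eq_right.2 (LinearMap.ker_le_comap f)]

theorem finrank_submodule_pi [FiniteDimensional K W] {ι : Type*} [Fintype ι]
    (C : ι → Submodule K W) : finrank K (Submodule.pi Set.univ C) =
      ∑ i, finrank K (C i) := by
  rw [← Module.finrank_pi_fintype]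
  refine LinearEquiv.finrank_eq (LinearEquiv.ofBijective
    (LinearMap.pi fun i => LinearMap.codRestrict (C i)
      (LinearMap.proj i ∘ₗ (Submodule.pi Set.univ C).subtype) fun f => f.2 i trivial) ⟨?_, ?_⟩)
  · intro f g hfg
    refine Subtype.ext (funext fun i => ?_)
    exact congrArg Subtype.val (congrFun hfg i)
  · intro g
    exact ⟨⟨fun i => g i, fun i _ => (g i).2⟩, rfl⟩

end Dimensions

section QuotientModules

variable (hπ : IsPathLengthGraded π) {t : ℕ}

/-- The projection onto the elements of degree `n` of the free module on generators of degrees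
`h r`. -/
def freeProj (h : Fin t → ℤ) (n : ℤ) : (Fin t → Λ) →ₗ[K] (Fin t → Λ) :=
  LinearMap.pi fun r => algProjZ hπ (n - h r) ∘ₗ LinearMap.proj r

theorem freeProj_apply (h : Fin t → ℤ) (n : ℤ) (f : Fin t → Λ) (r : Fin t) :
    freeProj hπ h n f r = algProjZ hπ (n - h r) (f r) := rfl

theorem algProjZ_algProjZ_of_ne {n k : ℤ} (hnk : n ≠ k) (a : Λ) :
    algProjZ hπ n (algProjZ hπ k a) = 0 := by
  by_cases hk : 0 ≤ k
  · lift k to ℕ using hk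
    rw [algProjZ_natCast, algProjZ_of_mem hπ (algProj_mem hπ _ _), if_neg hnk]
  · rw [algProjZ_of_neg hπ (by omega : k < 0)]; simp

theorem freeProj_freeProj (h : Fin t → ℤ) (n k : ℤ) (f : Fin t → Λ) :
    freeProj hπ h n (freeProj hπ h k f) = if n = k then freeProj hπ h k f else 0 := by
  funext r
  by_cases hnk : n = k
  · subst hnk; rw [if_pos rfl]; exact algProjZ_algProjZ hπ _ _
  · rw [if_neg hnk]; exact algProjZ_algProjZ_of_ne hπ (by omega) _

theorem freeProj_single (h : Fin t → ℤ) (n : ℤ) (r : Fin t) (a : Λ) :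
    freeProj hπ h n (Pi.single r a) = Pi.single r (algProjZ hπ (n - h r) a) := by
  funext s
  rw [freeProj_apply]
  by_cases hs : s = r
  · subst hs; rw [Pi.single_eq_same, Pi.single_eq_same]
  · rw [Pi.single_eq_of_ne hs, Pi.single_eq_of_ne hs, map_zero]

theorem mem_iSup_range_freeProj (h : Fin t → ℤ) (f : Fin t → Λ) :
    f ∈ ⨆ n, LinearMap.range (freeProj hπ h n) := by
  have h1 : f = ∑ r, ∑ l ∈ Finset.range (algBound hπ), Pi.single r (algProj hπ l (f r)) := by
    funext s
    rw [Finset.sum_apply, Finset.sum_eq_single s]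
    · rw [Finset.sum_apply]
      simp only [Pi.single_eq_same]
      exact (sum_algProj hπ (f s)).symm
    · intro r _ hr
      rw [Finset.sum_apply]
      exact Finset.sum_eq_zero fun l _ => Pi.single_eq_of_ne hr.symm _
    · exact fun h => absurd (Finset.mem_univ _) h
  rw [h1]
  refine sum_mem fun r _ => sum_mem fun l _ => ?_
  refine Submodule.mem_iSup_of_mem (l + h r : ℤ) ⟨Pi.single r (f r), ?_⟩
  rw [freeProj_single, add_sub_cancel_right, algProjZ_natCast]

theorem freeProj_smul (h : Fin t → ℤ) {l : ℕ} {a : Λ} (ha : a ∈ algDegree π l) (n : ℤ)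
    (f : Fin t → Λ) : freeProj hπ h (l + n) (a • f) = a • freeProj hπ h n f := by
  funext r
  rw [freeProj_apply, Pi.smul_apply, Pi.smul_apply, smul_eq_mul, smul_eq_mul, freeProj_apply,
    add_sub_assoc, algProjZ_mul hπ ha]

/-- The quotient of the free module on generators of degrees `h r` by a graded submodule. -/
def quotMod (h : Fin t → ℤ) (N : Submodule Λ (Fin t → Λ))
    (hN : ∀ n, ∀ f ∈ N, freeProj hπ h n f ∈ N) : GrMod π where
  carrier := (Fin t → Λ) ⧸ N
  gr n := (LinearMap.range (freeProj hπ h n)).map (N.mkQ.restrictScalars K)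
  internal := by
    let p : ℤ → ((Fin t → Λ) ⧸ N) →ₗ[K] ((Fin t → Λ) ⧸ N) := fun n =>
      (Submodule.Quotient.restrictScalarsEquiv K N).toLinearMap ∘ₗ
        (N.restrictScalars K).mapQ (N.restrictScalars K) (freeProj hπ h n) (hN n) ∘ₗ
        (Submodule.Quotient.restrictScalarsEquiv K N).symm.toLinearMap
    have hp : ∀ n f, p n (N.mkQ f) = N.mkQ (freeProj hπ h n f) := fun n f => rfl
    refine isInternal_of_proj p ?_ ?_
    · rintro n k _ ⟨_, ⟨f, rfl⟩, rfl⟩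
      change p k (N.mkQ (freeProj hπ h n f)) = if k = n then N.mkQ (freeProj hπ h n f) else 0
      rw [hp, freeProj_freeProj]
      split_ifs
      · rfl
      · exact map_zero _
    · intro x
      obtain ⟨f, rfl⟩ := N.mkQ_surjective x
      rw [← Submodule.map_iSup]
      exact ⟨f, mem_iSup_range_freeProj hπ h f, rfl⟩
  smul_mem l n a x ha hx := by
    obtain ⟨_, ⟨f, rfl⟩, rfl⟩ := hx
    exact ⟨_, ⟨a • f, freeProj_smul hπ h ha n f⟩, map_smul N.mkQ a _⟩

namespace quotMod

variable {h : Fin t → ℤ} {N : Submodule Λ (Fin t → Λ)} {hN : ∀ n, ∀ f ∈ N, freeProj hπ h n f ∈ N}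

/-- The quotient map. -/
def mk (h : Fin t → ℤ) (N : Submodule Λ (Fin t → Λ))
    (hN : ∀ n, ∀ f ∈ N, freeProj hπ h n f ∈ N) : (Fin t → Λ) →ₗ[Λ] quotMod hπ h N hN := N.mkQ

theorem mk_surjective : Function.Surjective (mk hπ h N hN) := N.mkQ_surjective

theorem mk_eq_zero {f : Fin t → Λ} : mk hπ h N hN f = 0 ↔ f ∈ N := Submodule.Quotient.mk_eq_zero N

theorem mk_mem {n : ℤ} {f : Fin t → Λ} (hf : freeProj hπ h n f = f) :
    mk hπ h N hN f ∈ (quotMod hπ h N hN).gr n := ⟨f, ⟨f, hf⟩, rfl⟩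

/-- The generators. -/
def gen (h : Fin t → ℤ) (N : Submodule Λ (Fin t → Λ))
    (hN : ∀ n, ∀ f ∈ N, freeProj hπ h n f ∈ N) (e : Fin t → V) (r : Fin t) :
    quotMod hπ h N hN := mk hπ h N hN (Pi.single r (idem π (e r)))

variable {e : Fin t → V}

theorem sum_smul_gen (f : Fin t → Λ) : ∑ r, f r • gen hπ h N hN e r =
    mk hπ h N hN fun r => f r * idem π (e r) := by
  have h1 : (fun r => f r * idem π (e r)) = ∑ r, f r • (Pi.single r (idem π (e r)) : Fin t → Λ) := by
    funext s
    rw [Finset.sum_apply, Finset.sum_eq_single s]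
    · rw [Pi.smul_apply, Pi.single_eq_same, smul_eq_mul]
    · intro r _ hr
      rw [Pi.smul_apply, Pi.single_eq_of_ne hr.symm, smul_zero]
    · exact fun h => absurd (Finset.mem_univ _) h
  rw [h1, map_sum]
  simp only [map_smul]
  rfl

theorem gen_mem (r : Fin t) : gen hπ h N hN e r ∈ (quotMod hπ h N hN).gr (h r) := by
  refine mk_mem hπ ?_
  have h1 : algProjZ hπ (h r - h r) (idem π (e r)) = idem π (e r) := by
    rw [sub_self, algProjZ_of_mem hπ (idem_mem (e r)), if_pos (by simp)]
  rw [freeProj_single, h1]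

theorem idem_smul_gen (r : Fin t) :
    idem π (e r) • gen hπ h N hN e r = gen hπ h N hN e r := by
  rw [gen, ← map_smul, ← Pi.single_smul, smul_eq_mul, idem_mul_self]

variable (hNe : ∀ f : Fin t → Λ, (∀ r, f r * idem π (e r) = 0) → f ∈ N)

include hNe in
theorem mk_mul_idem (f : Fin t → Λ) :
    (mk hπ h N hN fun r => f r * idem π (e r)) = mk hπ h N hN f := by
  rw [← sub_eq_zero, ← map_sub, mk_eq_zero]
  refine hNe _ fun r => ?_
  change (f r * idem π (e r) - f r) * idem π (e r) = 0
  rw [sub_mul, mul_assoc, idem_mul_self, sub_self]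

include hNe in
theorem sum_smul_gen_eq_zero_iff (f : Fin t → Λ) :
    ∑ r, f r • gen hπ h N hN e r = 0 ↔ f ∈ N := by
  rw [sum_smul_gen, mk_mul_idem hπ hNe, mk_eq_zero]

include hNe in
theorem span_gen : span Λ (range (gen hπ h N hN e)) = ⊤ := by
  refine eq_top_iff.2 fun x _ => ?_
  obtain ⟨f, rfl⟩ := mk_surjective hπ x
  rw [← mk_mul_idem hπ hNe, ← sum_smul_gen]
  exact sum_mem fun r _ => smul_mem _ _ (subset_span ⟨r, rfl⟩)

include hNe in
theorem isTopSystem (hNJ : ∀ f ∈ N, ∀ r, f r * idem π (e r) ∈ algGE hπ 1)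
    (he : ∀ r, idem π (e r) ≠ 0) : (quotMod hπ h N hN).IsTopSystem e h (gen hπ h N hN e) := by
  refine ⟨gen_mem hπ, idem_smul_gen hπ, span_gen hπ hNe, ?_⟩
  rw [Fintype.linearIndependent_iff]
  intro c hc r
  have h1 : ∑ r, c r • gen hπ h N hN e r ∈ radPow Λ (quotMod hπ h N hN) 1 := by
    have h2 : (Ring.jacobson Λ • (⊤ : Submodule Λ (quotMod hπ h N hN))).mkQ
        (∑ r, (c r • idem π (e r)) • gen hπ h N hN e r) = 0 := by
      rw [map_sum, ← hc]
      refine Finset.sum_congr rfl fun r _ => ?_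
      rw [smul_assoc, idem_smul_gen]
      rfl
    have h3 := (Submodule.Quotient.mk_eq_zero _).1 h2
    have h4 : ∑ r, c r • gen hπ h N hN e r =
        ∑ r, (c r • idem π (e r)) • gen hπ h N hN e r :=
      Finset.sum_congr rfl fun r _ => by rw [smul_assoc, idem_smul_gen]
    rw [h4]
    exact h3
  obtain ⟨g, hg, hgx⟩ := (mem_radPow_iff hπ (span_gen hπ hNe)).1 h1
  have h2 : (fun r => c r • idem π (e r) - g r) ∈ N := by
    rw [← sum_smul_gen_eq_zero_iff hπ (hN := hN) hNe]
    simp only [sub_smul, Finset.sum_sub_distrib, smul_assoc, idem_smul_gen, ← hgx, sub_self]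
  have h3 := hNJ _ h2 r
  change (c r • idem π (e r) - g r) * idem π (e r) ∈ _ at h3
  rw [sub_mul, smul_mul_assoc, idem_mul_self] at h3
  have h4 : g r * idem π (e r) ∈ algGE hπ 1 := by
    have := algGE_mul hπ (hg r) (mem_algGE_zero hπ (idem π (e r)))
    rw [add_zero] at this
    exact this
  have h5 : c r • idem π (e r) ∈ algGE hπ 1 := by
    have := add_mem h3 h4
    rwa [sub_add_cancel] at this
  by_contra hcr
  exact GrMod.idem_notMem_algGE hπ (he r) ((Submodule.smul_mem_iff _ hcr).1 h5)

variable (e) in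
/-- The elements of the free module which give the elements of `e_k J ^ l M`. -/
def layer (k : V) (l : ℕ) : Submodule K (Fin t → Λ) where
  carrier := {f | ∀ r, f r ∈ algGE hπ l ∧ idem π k * f r = f r ∧ f r * idem π (e r) = f r}
  add_mem' ha hb r := ⟨add_mem (ha r).1 (hb r).1, by
    rw [Pi.add_apply, mul_add, (ha r).2.1, (hb r).2.1], by
    rw [Pi.add_apply, add_mul, (ha r).2.2, (hb r).2.2]⟩
  zero_mem' r := ⟨zero_mem _, mul_zero _, zero_mul _⟩
  smul_mem' c f hf r := ⟨smul_mem _ _ (hf r).1, by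
    rw [Pi.smul_apply, mul_smul_comm, (hf r).2.1], by
    rw [Pi.smul_apply, smul_mul_assoc, (hf r).2.2]⟩

theorem algGE_mul_right {l : ℕ} {a : Λ} (ha : a ∈ algGE hπ l) (b : Λ) : a * b ∈ algGE hπ l := by
  have := algGE_mul hπ ha (mem_algGE_zero hπ b)
  rwa [add_zero] at this

theorem algGE_mul_left {l : ℕ} {a : Λ} (ha : a ∈ algGE hπ l) (b : Λ) : b * a ∈ algGE hπ l := by
  have := algGE_mul hπ (mem_algGE_zero hπ b) ha
  rwa [zero_add] at this

include hNe in
theorem finrank_atVertex [FiniteDimensional K Λ] (k : V) (l : ℕ) :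
    finrank K (atVertex (K := K) π (radPow Λ (quotMod hπ h N hN) l) k) +
      finrank K (layer hπ e k l ⊓ N.restrictScalars K : Submodule K (Fin t → Λ)) =
      finrank K (layer hπ e k l) := by
  have h0 := finrank_map_add_finrank_inf_ker (layer hπ e k l)
    ((mk hπ h N hN).restrictScalars K)
  have h3 : LinearMap.ker ((mk hπ h N hN).restrictScalars K) = N.restrictScalars K := by
    ext f; exact mk_eq_zero hπ
  have h1 : atVertex (K := K) π (radPow Λ (quotMod hπ h N hN) l) k =
      (layer hπ e k l).map ((mk hπ h N hN).restrictScalars K) := by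
    ext x
    rw [mem_atVertex]
    constructor
    · rintro ⟨hx, hx'⟩
      obtain ⟨f, hf, rfl⟩ := (mem_radPow_iff hπ (span_gen hπ hNe)).1 hx
      refine ⟨fun r => idem π k * f r * idem π (e r), fun r => ⟨?_, ?_, ?_⟩, ?_⟩
      · exact algGE_mul_right hπ (algGE_mul_left hπ (hf r) _) _
      · rw [← mul_assoc, ← mul_assoc, idem_mul_self]
      · rw [mul_assoc, idem_mul_self]
      · rw [← hx', Finset.smul_sum]
        simp only [smul_smul]
        exact (sum_smul_gen hπ (fun r => idem π k * f r)).symm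
    · rintro ⟨f, hf, rfl⟩
      have h2 : mk hπ h N hN f = ∑ r, f r • gen hπ h N hN e r := by
        rw [sum_smul_gen, mk_mul_idem hπ hNe]
      refine ⟨(mem_radPow_iff hπ (span_gen hπ hNe)).2 ⟨f, fun r => (hf r).1, h2⟩, ?_⟩
      change idem π k • mk hπ h N hN f = mk hπ h N hN f
      rw [← map_smul]
      congr 1
      funext r
      exact (hf r).2.1
  rw [h1, ← h3, h0]

theorem finrank_eq [FiniteDimensional K Λ] : finrank K (quotMod hπ h N hN) +
    finrank K (N.restrictScalars K) = finrank K (Fin t → Λ) := by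
  have h1 := LinearMap.finrank_range_add_finrank_ker ((mk hπ h N hN).restrictScalars K)
  have h3 : LinearMap.range ((mk hπ h N hN).restrictScalars K) = ⊤ :=
    LinearMap.range_eq_top.2 (mk_surjective hπ)
  rw [h3, finrank_top] at h1
  have h2 : LinearMap.ker ((mk hπ h N hN).restrictScalars K) = N.restrictScalars K := by
    ext f; exact mk_eq_zero hπ
  rwa [h2] at h1

end quotMod

end QuotientModules

section ProductModules

variable (hπ : IsPathLengthGraded π) {t : ℕ}

/-- The projection onto the part of `e_k Λ` of degrees at least `l`. -/
def truncProj (k : V) (l : ℕ) : Λ →ₗ[K] Λ :=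
  LinearMap.mulLeft K (idem π k) ∘ₗ (LinearMap.id - ∑ m ∈ Finset.range l, algProj hπ m)

theorem truncProj_apply (k : V) (l : ℕ) (a : Λ) :
    truncProj hπ k l a = idem π k * (a - ∑ m ∈ Finset.range l, algProj hπ m a) := by
  simp [truncProj, LinearMap.sum_apply]

theorem truncProj_mem (k : V) (l : ℕ) (a : Λ) : truncProj hπ k l a ∈ algGE hπ l := by
  rw [mem_algGE]
  intro m hm
  rw [truncProj_apply, algProj_idem_mul, map_sub, map_sum]
  simp only [algProj_algProj]
  rw [Finset.sum_ite_eq (Finset.range l) m fun m => algProj hπ m a,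
    if_pos (Finset.mem_range.2 hm), sub_self, mul_zero]

theorem idem_mul_truncProj (k : V) (l : ℕ) (a : Λ) :
    idem π k * truncProj hπ k l a = truncProj hπ k l a := by
  rw [truncProj_apply, ← mul_assoc, idem_mul_self]

theorem truncProj_mul_idem (k : V) (l : ℕ) (i : V) (a : Λ) :
    truncProj hπ k l (a * idem π i) = truncProj hπ k l a * idem π i := by
  simp only [truncProj_apply, algProj_mul_idem, mul_assoc, sub_mul, Finset.sum_mul]

theorem truncProj_eq_self {k : V} {l : ℕ} {a : Λ} (h : a ∈ algGE hπ l) (hk : idem π k * a = a) :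
    truncProj hπ k l a = a := by
  rw [truncProj_apply, Finset.sum_eq_zero fun m hm =>
    (mem_algGE hπ).1 h m (Finset.mem_range.1 hm), sub_zero, hk]

theorem truncProj_truncProj (k : V) (l : ℕ) (a : Λ) :
    truncProj hπ k l (truncProj hπ k l a) = truncProj hπ k l a :=
  truncProj_eq_self hπ (truncProj_mem hπ k l a) (idem_mul_truncProj hπ k l a)

theorem IsLocalSub.truncProj_mem {i : V} {C : Submodule K Λ} (hC : IsLocalSub hπ i C) (k : V)
    (l : ℕ) {c : Λ} (hc : c ∈ C) : truncProj hπ k l c ∈ C := by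
  rw [truncProj_apply]
  exact hC.mul_mem _ _ (sub_mem hc (sum_mem fun m _ => hC.proj_mem m c hc))

theorem IsLocalSub.algProjZ_mem {i : V} {C : Submodule K Λ} (hC : IsLocalSub hπ i C) (n : ℤ)
    {c : Λ} (hc : c ∈ C) : algProjZ hπ n c ∈ C := by
  by_cases hn : 0 ≤ n
  · lift n to ℕ using hn
    rw [algProjZ_natCast]; exact hC.proj_mem _ _ hc
  · rw [algProjZ_of_neg hπ (by omega)]; exact zero_mem _

variable {e : Fin t → V} {C : Fin t → Submodule K Λ}

/-- The relations of the direct sum of the modules `Λ e_r / C_r`. -/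
def prodSub (hC : ∀ r, IsLocalSub hπ (e r) (C r)) : Submodule Λ (Fin t → Λ) where
  carrier := {f | ∀ r, f r * idem π (e r) ∈ C r}
  add_mem' ha hb r := by
    rw [Pi.add_apply, add_mul]; exact add_mem (ha r) (hb r)
  zero_mem' r := by
    rw [Pi.zero_apply, zero_mul]; exact zero_mem _
  smul_mem' a f hf r := by
    rw [Pi.smul_apply, smul_eq_mul, mul_assoc]; exact (hC r).mul_mem _ _ (hf r)

variable (hC : ∀ r, IsLocalSub hπ (e r) (C r))

theorem freeProj_mem_prodSub (h : Fin t → ℤ) (n : ℤ) (f : Fin t → Λ) (hf : f ∈ prodSub hπ hC) :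
    freeProj hπ h n f ∈ prodSub hπ hC := by
  intro r
  rw [freeProj_apply, ← algProjZ_mul_idem]
  exact (hC r).algProjZ_mem hπ _ (hf r)

theorem mem_prodSub_of_mul_idem (f : Fin t → Λ) (hf : ∀ r, f r * idem π (e r) = 0) :
    f ∈ prodSub hπ hC := fun r => by
  rw [hf r]; exact zero_mem _

/-- The direct sum of the local modules `Λ e_r / C_r`, generated in degrees `h r`. -/
def prodMod (h : Fin t → ℤ) : GrMod π :=
  quotMod hπ h (prodSub hπ hC) (freeProj_mem_prodSub hπ hC h)

theorem prodMod_splitsAs (h : Fin t → ℤ) : (prodMod hπ hC h).SplitsAs e h C :=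
  GrMod.SplitsAs.of_relations (fun r a ha => (hC r).mul_idem a ha) (quotMod.gen_mem hπ)
    (quotMod.idem_smul_gen hπ) (quotMod.span_gen hπ (mem_prodSub_of_mul_idem hπ hC))
    (quotMod.sum_smul_gen_eq_zero_iff hπ (mem_prodSub_of_mul_idem hπ hC))

theorem prodMod_hasTop (h : Fin t → ℤ) (he : ∀ r, idem π (e r) ≠ 0) :
    (prodMod hπ hC h).HasTop e h :=
  (quotMod.isTopSystem hπ (mem_prodSub_of_mul_idem hπ hC) (fun _ hf r => (hC r).le (hf r))
    he).hasTop

theorem layer_inf_prodSub (k : V) (l : ℕ) :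
    quotMod.layer hπ e k l ⊓ (prodSub hπ hC).restrictScalars K =
      Submodule.pi Set.univ fun r => (C r).map (truncProj hπ k l) := by
  ext f
  constructor
  · rintro ⟨h1, h2⟩ r -
    obtain ⟨h3, h4, h5⟩ := h1 r
    exact ⟨f r, by rw [← h5]; exact h2 r, truncProj_eq_self hπ h3 h4⟩
  · intro hf
    have h1 : ∀ r, ∃ c ∈ C r, truncProj hπ k l c = f r := fun r => hf r trivial
    refine ⟨fun r => ?_, fun r => ?_⟩
    · obtain ⟨c, hc, hcf⟩ := h1 r
      refine ⟨hcf ▸ truncProj_mem hπ k l c, hcf ▸ idem_mul_truncProj hπ k l c, ?_⟩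
      rw [← hcf, ← truncProj_mul_idem, (hC r).mul_idem c hc]
    · obtain ⟨c, hc, hcf⟩ := h1 r
      rw [← hcf, ← truncProj_mul_idem, (hC r).mul_idem c hc]
      exact (hC r).truncProj_mem hπ k l hc

theorem finrank_prodSub [FiniteDimensional K Λ] :
    finrank K ((prodSub hπ hC).restrictScalars K) =
      ∑ r, (finrank K (C r) +
        finrank K (LinearMap.ker (LinearMap.mulRight K (idem π (e r))))) := by
  have h1 : (prodSub hπ hC).restrictScalars K =
      Submodule.pi Set.univ fun r => (C r).comap (LinearMap.mulRight K (idem π (e r))) := by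
    ext f
    exact ⟨fun hf r _ => hf r, fun hf r => hf r trivial⟩
  rw [h1, finrank_submodule_pi]
  refine Finset.sum_congr rfl fun r _ => finrank_comap_eq _ fun c hc => ⟨c, (hC r).mul_idem c hc⟩

namespace GrMod

variable {M : GrMod π} {h : Fin t → ℤ}

theorem SplitsAs.isLocalSub (hs : M.SplitsAs e h C) (hCJ : ∀ r, C r ≤ algGE hπ 1) (r : Fin t) :
    IsLocalSub hπ (e r) (C r) := by
  obtain ⟨m, hm, -, hmC, -⟩ := hs
  refine ⟨fun a c hc => ?_, hCJ r, fun c hc => mem_span_idem.1 ((hmC r c).1 hc).1,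
    fun l c hc => ?_⟩
  · rw [hmC] at hc ⊢
    exact ⟨Ideal.mul_mem_left _ _ hc.1, by rw [mul_smul, hc.2, smul_zero]⟩
  · rw [hmC, mem_span_idem] at hc ⊢
    refine ⟨by rw [← algProj_mul_idem, hc.1], ?_⟩
    have h1 := GrMod.proj_smul_of_mem hπ (hm r) (l + h r) c
    rw [hc.2, map_zero, add_sub_cancel_right, algProjZ_natCast] at h1
    exact h1.symm

theorem SplitsAs.gradedIso_prodMod {s : ℤ} (hs : M.SplitsAs e (fun r => h r + s) C) :
    (prodMod hπ hC h).GradedIso M :=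
  SplitsAs.gradedIso hπ (prodMod_splitsAs hπ hC h) hs

theorem GradedIso.finrank_atVertex {N : GrMod π} (hMN : M.GradedIso N) (l : ℕ) (k : V) :
    finrank K (atVertex (K := K) π (radPow Λ M l) k) =
      finrank K (atVertex (K := K) π (radPow Λ N l) k) := by
  obtain ⟨F, -, -⟩ := hMN
  exact finrank_atVertex_congr F l k

theorem GradedIso.finrank_eq {N : GrMod π} (hMN : M.GradedIso N) :
    finrank K M = finrank K N := by
  obtain ⟨F, -, -⟩ := hMN
  exact LinearEquiv.finrank_eq (F.restrictScalars K)

variable {d : ℕ} {H : Set (Fin t → ℤ)} {𝒞 : GrMod π → Prop}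

theorem IsClass.idem_ne_zero (h𝒞 : IsClass π d e H 𝒞) (hM : 𝒞 M) (r : Fin t) :
    idem π (e r) ≠ 0 := by
  obtain ⟨-, h', -, ht⟩ := h𝒞.withTop hM
  obtain ⟨m, hm⟩ := ht.exists_isTopSystem
  exact hm.idem_ne_zero r

/-- Criterion for a quotient of a free module to belong to the class of a direct sum of local
modules. -/
theorem IsClass.quotMod [FiniteDimensional K Λ] (h𝒞 : IsClass π d e H 𝒞) (hd : 0 < d)
    (hM : 𝒞 M) {s : ℤ} {h' : Fin t → ℤ} (hs : M.SplitsAs e (fun r => h' r + s) C)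
    (hh : h ∈ H) {N : Submodule Λ (Fin t → Λ)} (hN : ∀ n, ∀ f ∈ N, freeProj hπ h n f ∈ N)
    (hNe : ∀ f : Fin t → Λ, (∀ r, f r * idem π (e r) = 0) → f ∈ N)
    (hNJ : ∀ f ∈ N, ∀ r, f r * idem π (e r) ∈ algGE hπ 1)
    (hdim : finrank K (N.restrictScalars K) =
      finrank K ((prodSub hπ hC).restrictScalars K))
    (hlayer : ∀ k l, finrank K
      (quotMod.layer hπ e k l ⊓ N.restrictScalars K : Submodule K (Fin t → Λ)) =
      finrank K (quotMod.layer hπ e k l ⊓ (prodSub hπ hC).restrictScalars K :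
        Submodule K (Fin t → Λ))) : 𝒞 (quotMod hπ h N hN) := by
  have hiso := hs.gradedIso_prodMod hπ hC
  refine h𝒞.congr hπ hd hM ⟨?_, h, hh, ?_⟩ fun l k => ?_
  · have h1 := quotMod.finrank_eq hπ (hN := hN)
    have h2 := quotMod.finrank_eq hπ (hN := freeProj_mem_prodSub hπ hC h')
    have h3 : finrank K (prodMod hπ hC h') = d :=
      hiso.finrank_eq.trans (h𝒞.withTop hM).1
    rw [← hdim] at h2
    change finrank K (prodMod hπ hC h') + _ = _ at h2
    omega
  · exact (quotMod.isTopSystem hπ hNe hNJ (h𝒞.idem_ne_zero hM)).hasTop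
  · rw [← hiso.finrank_atVertex]
    have h1 := quotMod.finrank_atVertex hπ (hN := hN) hNe k l
    have h2 := quotMod.finrank_atVertex hπ (hN := freeProj_mem_prodSub hπ hC h')
      (mem_prodSub_of_mul_idem hπ hC) k l
    rw [← hlayer] at h2
    change finrank K (atVertex (K := K) π (radPow Λ (prodMod hπ hC h') l) k) + _ = _ at h2
    omega

/-- The direct sums of local modules belonging to points of the same connected components belong
to the same class. -/
theorem IsClass.prodMod [FiniteDimensional K Λ] (h𝒞 : IsClass π d e H 𝒞) (hd : 0 < d) (hM : 𝒞 M)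
    {s : ℤ} {h' : Fin t → ℤ} (hs : M.SplitsAs e (fun r => h' r + s) C) (hh : h ∈ H)
    {D : Fin t → Submodule K Λ} (hCl : ∀ r, IsLocalSub hπ (e r) (C r))
    (hD : ∀ r, IsLocalSub hπ (e r) (D r))
    (hCD : ∀ r, D r ∈ localComp π (e r) (C r)) : 𝒞 (prodMod hπ hD h) := by
  refine h𝒞.quotMod hπ hCl hd hM hs hh _ (mem_prodSub_of_mul_idem hπ hD)
    (fun f hf r => (hD r).le (hf r)) ?_ fun k l => ?_
  · rw [finrank_prodSub, finrank_prodSub]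
    exact Finset.sum_congr rfl fun r _ => by rw [finrank_eq_of_mem_localComp (hCD r)]
  · rw [layer_inf_prodSub, layer_inf_prodSub, finrank_submodule_pi, finrank_submodule_pi]
    exact Finset.sum_congr rfl fun r _ => finrank_map_of_mem_localComp hπ (hCD r)
      (truncProj_truncProj hπ k l) fun C hC c hc => hC.truncProj_mem hπ k l hc

end GrMod

end ProductModules

theorem finrank_eq_of_unipotent {K : Type u} [Field K] {P : Type*} [AddCommGroup P] [Module K P]
    {φ : P →ₗ[K] P} (hφ : ∀ f, φ (φ f) = 0) {A B : Submodule K P}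
    (h : ∀ f, f ∈ A ↔ f + φ f ∈ B) : finrank K A = finrank K B := by
  let F : P ≃ₗ[K] P := LinearEquiv.ofLinearMap (LinearMap.id + φ) (LinearMap.id - φ)
    (LinearMap.ext fun f => by simp [hφ]) (LinearMap.ext fun f => by simp [hφ])
  have h1 : A = B.comap F.toLinearMap := by
    ext f; exact h f
  rw [h1, Submodule.comap_equiv_eq_map_symm]
  exact LinearEquiv.finrank_map_eq _ _

section Rigidity

variable (hπ : IsPathLengthGraded π) {t : ℕ} {e : Fin t → V} {C : Fin t → Submodule K Λ}

/-- A linear map inducing a homomorphism of graded modules `C → Λ e_v / C'`, where `C` and `C'` are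
homogeneous submodules of `Λ e_v`. -/
structure IsGradedHomMod (v : V) (C C' : Submodule K Λ) (ψ : Λ →ₗ[K] Λ) : Prop where
  mul : ∀ a : Λ, ∀ c ∈ C, a * ψ c - ψ (a * c) ∈ C'
  proj : ∀ l, ∀ c ∈ C, algProj hπ l (ψ c) - ψ (algProj hπ l c) ∈ C'
  mul_idem : ∀ c ∈ C, ψ c * idem π v - ψ c ∈ C'

namespace IsGradedHomMod

variable {hπ} {v : V} {D D' : Submodule K Λ} {ψ : Λ →ₗ[K] Λ} (hψ : IsGradedHomMod hπ v D D' ψ)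
  (hD : IsLocalSub hπ v D) (hD' : IsLocalSub hπ v D')

include hψ in
theorem algProjZ (n : ℤ) {c : Λ} (hc : c ∈ D) :
    algProjZ hπ n (ψ c) - ψ (_root_.algProjZ hπ n c) ∈ D' := by
  by_cases hn : 0 ≤ n
  · lift n to ℕ using hn
    rw [algProjZ_natCast]; exact hψ.proj _ _ hc
  · rw [algProjZ_of_neg hπ (by omega : n < 0)]; simp

include hψ hD hD' in
theorem mem_algGE {c : Λ} (hc : c ∈ D) : ψ c ∈ algGE hπ 1 := by
  have h1 := hψ.proj 0 c hc
  rw [(_root_.mem_algGE hπ).1 (hD.le hc) 0 one_pos, map_zero, sub_zero] at h1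
  refine (_root_.mem_algGE hπ).2 fun m hm => ?_
  obtain rfl : m = 0 := by omega
  have h2 := (_root_.mem_algGE hπ).1 (hD'.le h1) 0 one_pos
  rwa [algProj_algProj, if_pos rfl] at h2

include hψ hD hD' in
theorem truncProj (k : V) (l : ℕ) {c : Λ} (hc : c ∈ D) :
    truncProj hπ k l (ψ c) - ψ (_root_.truncProj hπ k l c) ∈ D' := by
  let c' := c - ∑ m ∈ Finset.range l, algProj hπ m c
  have hc' : c' ∈ D := sub_mem hc (sum_mem fun m _ => hD.proj_mem m c hc)
  have h1 : _root_.truncProj hπ k l (ψ c) - ψ (_root_.truncProj hπ k l c) =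
      (idem π k * ψ c' - ψ (idem π k * c')) - idem π k *
        ∑ m ∈ Finset.range l, (algProj hπ m (ψ c) - ψ (algProj hπ m c)) := by
    rw [truncProj_apply, truncProj_apply, Finset.sum_sub_distrib, ← map_sum]
    simp only [c', map_sub, mul_sub]
    abel
  rw [h1]
  exact sub_mem (hψ.mul _ _ hc')
    (hD'.mul_mem _ _ (sum_mem fun m _ => hψ.proj m c hc))

end IsGradedHomMod

/-- The relations of the extension of the direct sum of the modules `Λ e_r / C_r`, `r ≠ i`, by
`Λ e_i / C_i` given by a homomorphism `C_j → Λ e_i / C_i`. -/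
def twistSub (hC : ∀ r, IsLocalSub hπ (e r) (C r)) {i j : Fin t} (hij : i ≠ j)
    {ψ : Λ →ₗ[K] Λ} (hψ : IsGradedHomMod hπ (e j) (C j) (C i) ψ) :
    Submodule Λ (Fin t → Λ) where
  carrier := {f | (∀ r, r ≠ i → f r * idem π (e r) ∈ C r) ∧
    f i * idem π (e i) - ψ (f j * idem π (e j)) ∈ C i}
  add_mem' {f g} ha hb := by
    refine ⟨fun r hr => ?_, ?_⟩
    · rw [Pi.add_apply, add_mul]; exact add_mem (ha.1 r hr) (hb.1 r hr)
    · have h1 := add_mem ha.2 hb.2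
      rw [Pi.add_apply, add_mul, Pi.add_apply, add_mul, map_add, add_sub_add_comm]
      exact h1
  zero_mem' := by
    refine ⟨fun r _ => ?_, ?_⟩
    · rw [Pi.zero_apply, zero_mul]; exact zero_mem _
    · rw [Pi.zero_apply, zero_mul, Pi.zero_apply, zero_mul, map_zero, sub_zero]; exact zero_mem _
  smul_mem' a f hf := by
    refine ⟨fun r hr => ?_, ?_⟩
    · rw [Pi.smul_apply, smul_eq_mul, mul_assoc]; exact (hC r).mul_mem _ _ (hf.1 r hr)
    · have h1 := add_mem ((hC i).mul_mem a _ hf.2) (hψ.mul a _ (hf.1 j hij.symm))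
      rw [mul_sub, sub_add_sub_cancel] at h1
      rw [Pi.smul_apply, Pi.smul_apply, smul_eq_mul, smul_eq_mul, mul_assoc, mul_assoc]
      exact h1

namespace GrMod

variable {h : Fin t → ℤ} {d : ℕ} {H : Set (Fin t → ℤ)} {𝒞 : GrMod π → Prop}

section

variable (hC : ∀ r, IsLocalSub hπ (e r) (C r)) {i j : Fin t} (hij : i ≠ j) {ψ : Λ →ₗ[K] Λ}
  (hψ : IsGradedHomMod hπ (e j) (C j) (C i) ψ)

theorem freeProj_mem_twistSub (hh : h i = h j) (n : ℤ) (f : Fin t → Λ)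
    (hf : f ∈ twistSub hπ hC hij hψ) : freeProj hπ h n f ∈ twistSub hπ hC hij hψ := by
  refine ⟨fun r hr => ?_, ?_⟩
  · rw [freeProj_apply, ← algProjZ_mul_idem]
    exact (hC r).algProjZ_mem hπ _ (hf.1 r hr)
  · rw [freeProj_apply, freeProj_apply, ← algProjZ_mul_idem, ← algProjZ_mul_idem, hh]
    have h1 := add_mem ((hC i).algProjZ_mem hπ (n - h j) hf.2)
      (hψ.algProjZ (n - h j) (hf.1 j hij.symm))
    rwa [map_sub, sub_add_sub_cancel] at h1

theorem mem_twistSub_of_mul_idem (f : Fin t → Λ) (hf : ∀ r, f r * idem π (e r) = 0) :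
    f ∈ twistSub hπ hC hij hψ := by
  refine ⟨fun r _ => ?_, ?_⟩
  · rw [hf r]; exact zero_mem _
  · rw [hf, hf, map_zero, sub_zero]; exact zero_mem _

variable (he : e i = e j)

include he in
theorem mul_idem_mem_of_mem_twistSub (f : Fin t → Λ) (hf : f ∈ twistSub hπ hC hij hψ) (r : Fin t) :
    f r * idem π (e r) ∈ algGE hπ 1 := by
  by_cases hr : r = i
  · subst hr
    have h1 := (hC r).le hf.2
    have h2 := hψ.mem_algGE (hC j) (he ▸ hC r) (hf.1 j hij.symm)
    have := add_mem h1 h2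
    rwa [sub_add_cancel] at this
  · exact (hC r).le (hf.1 r hr)

include he in
theorem finrank_twistSub : finrank K ((twistSub hπ hC hij hψ).restrictScalars K) =
    finrank K ((prodSub hπ hC).restrictScalars K) := by
  let φ : (Fin t → Λ) →ₗ[K] (Fin t → Λ) := LinearMap.single K (fun _ : Fin t => Λ) i ∘ₗ ψ ∘ₗ
    LinearMap.mulRight K (idem π (e j)) ∘ₗ LinearMap.proj j
  have hφ : ∀ f, φ f = Pi.single i (ψ (f j * idem π (e j))) := fun f => rfl
  refine (finrank_eq_of_unipotent (φ := φ) (fun f => ?_) fun f => ?_).symm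
  · rw [hφ, hφ, Pi.single_eq_of_ne hij.symm, zero_mul, map_zero, Pi.single_zero]
  · have h1 : ∀ r, r ≠ i → (f + φ f) r = f r := fun r hr => by
      rw [Pi.add_apply, hφ, Pi.single_eq_of_ne hr, add_zero]
    have h2 : (f + φ f) i = f i + ψ (f j * idem π (e j)) := by
      rw [Pi.add_apply, hφ, Pi.single_eq_same]
    have h3 : f + φ f ∈ twistSub hπ hC hij hψ ↔ (∀ r, r ≠ i → f r * idem π (e r) ∈ C r) ∧
        f i * idem π (e i) + (ψ (f j * idem π (e j)) * idem π (e j) - ψ (f j * idem π (e j)))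
          ∈ C i := by
      refine and_congr (forall_congr' fun r => forall_congr' fun hr => by rw [h1 r hr]) ?_
      rw [h2, h1 j hij.symm, add_mul, ← add_sub_assoc, he]
    change f ∈ prodSub hπ hC ↔ f + φ f ∈ twistSub hπ hC hij hψ
    rw [h3]
    constructor
    · exact fun hf => ⟨fun r _ => hf r, add_mem (hf i) (hψ.mul_idem _ (hf j))⟩
    · rintro ⟨hf, hf'⟩ r
      by_cases hr : r = i
      · subst hr
        exact (add_mem_cancel_right (hψ.mul_idem _ (hf j hij.symm))).1 hf'
      · exact hf r hr

include he in
theorem finrank_layer_inf_twistSub (k : V) (l : ℕ) :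
    finrank K (quotMod.layer hπ e k l ⊓ (twistSub hπ hC hij hψ).restrictScalars K :
      Submodule K (Fin t → Λ)) =
    finrank K (quotMod.layer hπ e k l ⊓ (prodSub hπ hC).restrictScalars K :
      Submodule K (Fin t → Λ)) := by
  let φ : (Fin t → Λ) →ₗ[K] (Fin t → Λ) := LinearMap.single K (fun _ : Fin t => Λ) i ∘ₗ
    LinearMap.mulRight K (idem π (e j)) ∘ₗ truncProj hπ k l ∘ₗ ψ ∘ₗ LinearMap.proj j
  have hφ : ∀ f, φ f = Pi.single i (truncProj hπ k l (ψ (f j)) * idem π (e j)) := fun f => rfl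
  refine (finrank_eq_of_unipotent (φ := φ) (fun f => ?_) fun f => ?_).symm
  · rw [hφ, hφ, Pi.single_eq_of_ne hij.symm, map_zero, map_zero, zero_mul, Pi.single_zero]
  · have h1 : ∀ r, r ≠ i → (f + φ f) r = f r := fun r hr => by
      rw [Pi.add_apply, hφ, Pi.single_eq_of_ne hr, add_zero]
    have h2 : (f + φ f) i = f i + truncProj hπ k l (ψ (f j)) * idem π (e j) := by
      rw [Pi.add_apply, hφ, Pi.single_eq_same]
    have h0 : φ f ∈ quotMod.layer hπ e k l := by
      intro r
      rw [hφ]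
      by_cases hr : r = i
      · subst hr
        rw [Pi.single_eq_same, he]
        refine ⟨quotMod.algGE_mul_right hπ (truncProj_mem hπ k l _) _, ?_, ?_⟩
        · rw [← mul_assoc, idem_mul_truncProj]
        · rw [mul_assoc, idem_mul_self]
      · rw [Pi.single_eq_of_ne hr]
        exact ⟨zero_mem _, mul_zero _, zero_mul _⟩
    change f ∈ quotMod.layer hπ e k l ∧ f ∈ prodSub hπ hC ↔
      f + φ f ∈ quotMod.layer hπ e k l ∧ f + φ f ∈ twistSub hπ hC hij hψ
    rw [add_mem_cancel_right h0]
    refine and_congr_right fun hf => ?_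
    have hfj := hf j
    have h3 : f + φ f ∈ twistSub hπ hC hij hψ ↔ (∀ r, r ≠ i → f r * idem π (e r) ∈ C r) ∧
        f i * idem π (e i) + (truncProj hπ k l (ψ (f j)) * idem π (e j) - ψ (f j)) ∈ C i := by
      refine and_congr (forall_congr' fun r => forall_congr' fun hr => by rw [h1 r hr]) ?_
      rw [h2, h1 j hij.symm, add_mul, he, mul_assoc _ (idem π (e j)), idem_mul_self, hfj.2.2,
        ← add_sub_assoc]
    have h4 : f j ∈ C j → truncProj hπ k l (ψ (f j)) * idem π (e j) - ψ (f j) ∈ C i := by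
      intro hc
      have h5 := (hC i).truncProj_mem hπ k l (hψ.mul_idem _ hc)
      have h6 := hψ.truncProj (hC j) (he ▸ hC i) k l hc
      rw [truncProj_eq_self hπ hfj.1 hfj.2.1] at h6
      have h7 := add_mem h5 h6
      rwa [map_sub, sub_add_sub_cancel, truncProj_mul_idem] at h7
    rw [h3]
    constructor
    · refine fun hf' => ⟨fun r _ => hf' r, add_mem (hf' i) (h4 ?_)⟩
      rw [← hfj.2.2]; exact hf' j
    · rintro ⟨hf', hf''⟩ r
      by_cases hr : r = i
      · subst hr
        refine (add_mem_cancel_right (h4 ?_)).1 hf''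
        rw [← hfj.2.2]; exact hf' j hij.symm
      · exact hf' r hr

end

/-- If all modules in the class are direct sums of local modules, then there are no homomorphisms
from `C_j` to `Λ e_i / C_i` for a direct sum of modules `Λ e_r / C_r` in the class which has two
summands generated at the same vertex in the same degree with `C_j ≤ C_i`. -/
theorem IsClass.rigid [FiniteDimensional K Λ] (h𝒞 : IsClass π d e H 𝒞) (hd : 0 < d)
    (hloc : ∀ M, 𝒞 M → M.IsDirectSumOfLocals) (hC : ∀ r, IsLocalSub hπ (e r) (C r))
    (hM : 𝒞 (_root_.prodMod hπ hC h)) (hhH : h ∈ H) {i j : Fin t} (hij : i ≠ j) (he : e i = e j)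
    (hh : h i = h j) (hle : C j ≤ C i) {ψ : Λ →ₗ[K] Λ}
    (hψ : IsGradedHomMod hπ (e j) (C j) (C i) ψ) {c : Λ} (hc : c ∈ C j) : ψ c ∈ C i := by
  have hNe := mem_twistSub_of_mul_idem hπ hC hij hψ
  have hN := freeProj_mem_twistSub hπ hC hij hψ hh
  have hne := h𝒞.idem_ne_zero hM
  have h𝒞' : 𝒞 (_root_.quotMod hπ h (twistSub hπ hC hij hψ) hN) := by
    refine h𝒞.quotMod hπ hC hd hM (s := 0) (h' := h) ?_ hhH hN hNe
      (mul_idem_mem_of_mem_twistSub hπ hC hij hψ he) (finrank_twistSub hπ hC hij hψ he)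
      (finrank_layer_inf_twistSub hπ hC hij hψ he)
    simpa only [add_zero] using prodMod_splitsAs hπ hC h
  have hm := quotMod.isTopSystem hπ (hN := hN) hNe
    (mul_idem_mem_of_mem_twistSub hπ hC hij hψ he) hne
  obtain ⟨C', hs, hC'⟩ := exists_splitsAs hπ (hloc _ h𝒞') hm.hasTop
  obtain ⟨n, hn, -, hind⟩ := hs.exists_isTopSystem hπ hC' hne
  choose F hF hF' using fun r => hn.exists_expansion hπ (hm.mem r) (hm.idem_smul r)
  choose G hG hG' using fun a => hm.exists_expansion hπ (hn.mem a) (hn.idem_smul a)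
  set m := quotMod.gen hπ h (twistSub hπ hC hij hψ) hN e with hm_def
  have hcj := (hC j).mul_idem c hc
  -- the relation given by `c`
  have hrel : c • m j + ψ c • m i = 0 := by
    have h1 : (Pi.single j c + Pi.single i (ψ c) : Fin t → Λ) ∈ twistSub hπ hC hij hψ := by
      refine ⟨fun r hr => ?_, ?_⟩
      · rw [Pi.add_apply, Pi.single_eq_of_ne hr, add_zero]
        by_cases hrj : r = j
        · subst hrj; rw [Pi.single_eq_same, hcj]; exact hc
        · rw [Pi.single_eq_of_ne hrj, zero_mul]; exact zero_mem _
      · rw [Pi.add_apply, Pi.add_apply, Pi.single_eq_same, Pi.single_eq_of_ne hij, zero_add,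
          Pi.single_eq_same, Pi.single_eq_of_ne hij.symm, add_zero, hcj, he]
        exact hψ.mul_idem c hc
    rw [← quotMod.sum_smul_gen_eq_zero_iff hπ (hN := hN) hNe] at h1
    simp only [Pi.add_apply, add_smul, Finset.sum_add_distrib] at h1
    rw [Finset.sum_eq_single j (fun r _ hr => by rw [Pi.single_eq_of_ne hr, zero_smul])
      (fun h => absurd (Finset.mem_univ _) h), Pi.single_eq_same,
      Finset.sum_eq_single i (fun r _ hr => by rw [Pi.single_eq_of_ne hr, zero_smul])
      (fun h => absurd (Finset.mem_univ _) h), Pi.single_eq_same] at h1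
    exact h1
  have hrel' : ∀ a, (c * F j a + ψ c * F i a) • n a = 0 := by
    refine hind (fun a => c * F j a + ψ c * F i a) ?_
    simp only [add_smul, mul_smul, Finset.sum_add_distrib, ← Finset.smul_sum, ← hF]
    exact hrel
  let wv : Fin t → Λ := fun a =>
    hn.coef hπ (m j) a • c + hn.coef hπ (m i) a • (ψ c * idem π (e j))
  have hwe : ∀ a, wv a * idem π (e j) = wv a := by
    intro a
    simp only [wv, add_mul, smul_mul_assoc, mul_assoc, idem_mul_self, hcj]
  have hw : ∀ a, hm.coef hπ (n a) j ≠ 0 →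
      hm.coef hπ (n a) j • wv a ∈ C j ∧ ψ (hm.coef hπ (n a) j • wv a) ∈ C i := by
    intro a ha
    obtain ⟨hea, hha⟩ := (hG' a j).2.2.2.2.2 ha
    have h1 : wv a • n a = 0 := by
      have h2 := hrel' a
      rw [(hF' j a).2.2.2.1 hha.le, (hF' i a).2.2.2.1 (hh.trans hha).le, he, mul_smul_comm,
        mul_smul_comm, hcj] at h2
      exact h2
    have h3 : (fun r => wv a * G a r) ∈ twistSub hπ hC hij hψ := by
      rw [← quotMod.sum_smul_gen_eq_zero_iff hπ (hN := hN) hNe]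
      simp only [mul_smul, ← Finset.smul_sum]
      rw [← hm_def, ← hG, h1]
    have h4 : wv a * G a j * idem π (e j) = hm.coef hπ (n a) j • wv a := by
      rw [(hG' a j).2.2.2.1 hha.ge, ← hea, mul_smul_comm, smul_mul_assoc, hwe, hwe]
    have h5 : wv a * G a i * idem π (e i) = hm.coef hπ (n a) i • wv a := by
      rw [(hG' a i).2.2.2.1 (hh.trans hha).ge, ← hea, he, mul_smul_comm, smul_mul_assoc, hwe, hwe]
    have h6 : hm.coef hπ (n a) j • wv a ∈ C j := by
      rw [← h4]; exact h3.1 j hij.symm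
    refine ⟨h6, ?_⟩
    have h7 : wv a ∈ C i := hle ((Submodule.smul_mem_iff _ ha).1 h6)
    have h8 : hm.coef hπ (n a) i • wv a - ψ (hm.coef hπ (n a) j • wv a) ∈ C i := by
      rw [← h4, ← h5]; exact h3.2
    have h9 := sub_mem (Submodule.smul_mem _ (hm.coef hπ (n a) i) h7) h8
    rwa [sub_sub_cancel] at h9
  have hsum : c = ∑ a, hm.coef hπ (n a) j • wv a := by
    have h1 := IsTopSystem.coef_mul_coef hπ hm hn j j
    have h2 := IsTopSystem.coef_mul_coef hπ hm hn j i
    rw [if_pos rfl] at h1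
    rw [if_neg hij.symm] at h2
    simp only [wv, smul_add, smul_smul, Finset.sum_add_distrib, ← Finset.sum_smul]
    rw [h1, h2, one_smul, zero_smul, add_zero]
  rw [hsum, map_sum]
  refine sum_mem fun a _ => ?_
  by_cases ha : hm.coef hπ (n a) j = 0
  · rw [ha, zero_smul, map_zero]; exact zero_mem _
  · exact (hw a ha).2

end GrMod

end Rigidity

section Comparability

open SpaceWithFunctions

variable [FiniteDimensional K Λ] (hπ : IsPathLengthGraded π)

theorem isClopen_localComp (i : V) (C : Submodule K Λ) (δ : ℕ) :
    IsClopen {x : localGrass π i δ | localGrass.submodule x ∈ localComp π i C} := by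
  by_cases h : ∃ x : localGrass π i δ, localGrass.submodule x ∈ localComp π i C
  · obtain ⟨x, hx⟩ := h
    have := finite_connectedComponents (α := localGrass π i δ)
    convert isClopen_connectedComponent_of_finite x using 1
    ext y
    change localGrass.submodule y ∈ localComp π i C ↔ _
    rw [← localComp_eq hx, localGrass.mem_localComp]
  · push Not at h
    convert isClopen_empty using 1
    exact Set.eq_empty_of_forall_notMem h

/-- A property of homogeneous submodules which is locally constant on a connected component of the
local graded Grassmannian is constant there. -/
theorem iff_of_mem_localComp' {i : V} {P : Submodule K Λ → Prop} {C D : Submodule K Λ}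
    (hP : ∀ (δ : ℕ) (x : localGrass π i δ), localGrass.submodule x ∈ localComp π i C →
      ∀ᶠ y in 𝓝 x, P (localGrass.submodule y) ↔ P (localGrass.submodule x))
    (hC : IsLocalSub hπ i C) (h : D ∈ localComp π i C) : P D ↔ P C := by
  have h1 := iff_of_mem_localComp (P := fun E => E ∈ localComp π i C ∧ P E) (fun δ x => ?_) h
  · simpa [h, hC.mem_localComp hπ] using h1
  · have hcl := isClopen_localComp (π := π) i C δ
    by_cases hx : localGrass.submodule x ∈ localComp π i C
    · filter_upwards [hP δ x hx, hcl.isOpen.eventually_mem hx] with y h1 h2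
      exact and_congr (iff_of_true h2 hx) h1
    · filter_upwards [hcl.compl.isOpen.eventually_mem hx] with y h1
      exact iff_of_false (fun h2 => h1 h2.1) fun h2 => hx h2.1

theorem RegSub.eventually_not_le {W : Type*} [AddCommGroup W] [Module K W]
    {X : SpaceWithFunctions K} [X.IsGood] {x : X} {C C' : X → Submodule K W} (hC : RegSub C x)
    (hC' : RegSub C' x) (h : ¬ C x ≤ C' x) : ∀ᶠ y in 𝓝 x, ¬ C y ≤ C' y := by
  obtain ⟨c, hc, hcC'⟩ := Set.not_subset.1 h
  obtain ⟨b, hb, hbC, hbm⟩ := hC.exists_section hc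
  filter_upwards [hbm, hC'.eventually_notMem hb (by rw [hbC]; exact hcC')] with y h1 h2 h3
    using h2 (h3 h1)

/-- The inclusion of two homogeneous submodules is locally constant in families where it is
rigid. -/
theorem eventually_le_iff {X : SpaceWithFunctions K} [X.IsGood] {x : X} {v : V}
    {C C' : X → Submodule K Λ} (hC : RegSub C x) (hC' : RegSub C' x)
    (hCl : ∀ y, IsLocalSub hπ v (C y)) (hCl' : ∀ y, IsLocalSub hπ v (C' y))
    (hrig : C x ≤ C' x → ∀ ψ, IsGradedHomMod hπ v (C x) (C' x) ψ → ∀ c ∈ C x, ψ c ∈ C' x) :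
    ∀ᶠ y in 𝓝 x, C y ≤ C' y ↔ C x ≤ C' x := by
  by_cases h : C x ≤ C' x
  · let β := Module.finBasis K Λ
    let o : (Fin (finrank K Λ) ⊕ Fin (algBound hπ)) ⊕ Unit → Λ →ₗ[K] Λ :=
      Sum.elim (Sum.elim (fun i => LinearMap.mulLeft K (β i)) fun l => algProj hπ l)
        fun _ => LinearMap.mulRight K (idem π v)
    have ho : ∀ D : Submodule K Λ, IsLocalSub hπ v D → ∀ i, ∀ c ∈ D, o i c ∈ D := by
      rintro D hD ((i | l) | -) c hc
      · exact hD.mul_mem _ _ hc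
      · exact hD.proj_mem _ _ hc
      · change c * idem π v ∈ D
        rwa [hD.mul_idem c hc]
    have h1 := hC.eventually_le_of_rigid hC' o (Eventually.of_forall fun y => ho _ (hCl y))
      (Eventually.of_forall fun y => ho _ (hCl' y)) fun ψ hψ c hc => by
        refine hrig h ψ ⟨fun a c hc => ?_, fun l c hc => ?_, fun c hc => ?_⟩ c hc
        · have h2 : a * ψ c - ψ (a * c) =
              ∑ i, β.repr a i • (β i * ψ c - ψ (β i * c)) := by
            conv_lhs => rw [← β.sum_repr a]
            simp only [Finset.sum_mul, smul_mul_assoc, map_sum, map_smul, smul_sub,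
              Finset.sum_sub_distrib]
          rw [h2]
          exact sum_mem fun i _ => smul_mem _ _ (hψ (.inl (.inl i)) c hc)
        · by_cases hl : l < algBound hπ
          · exact hψ (.inl (.inr ⟨l, hl⟩)) c hc
          · rw [algProj_eq_zero hπ (not_lt.1 hl), algProj_eq_zero hπ (not_lt.1 hl), map_zero,
              sub_zero]
            exact zero_mem _
        · have h2 : ψ c * idem π v - ψ (c * idem π v) ∈ C' x := hψ (.inr ()) c hc
          rwa [(hCl x).mul_idem c hc] at h2
    filter_upwards [h1] with y hy using iff_of_true hy h
  · filter_upwards [RegSub.eventually_not_le hC hC' h] with y hy using iff_of_false hy h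

namespace GrMod

variable {t : ℕ} {e : Fin t → V} {C : Fin t → Submodule K Λ} {h : Fin t → ℤ} {d : ℕ}
  {H : Set (Fin t → ℤ)} {𝒞 : GrMod π → Prop} (h𝒞 : IsClass π d e H 𝒞) (hd : 0 < d)
  (hloc : ∀ M, 𝒞 M → M.IsDirectSumOfLocals) (hC : ∀ r, IsLocalSub hπ (e r) (C r))
  (hM : 𝒞 (_root_.prodMod hπ hC h)) (hh : h ∈ H)

include h𝒞 hd hM hh in
theorem IsClass.prodMod_of_mem {D : Fin t → Submodule K Λ}
    (hCD : ∀ r, D r ∈ localComp π (e r) (C r)) :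
    𝒞 (_root_.prodMod hπ (fun r => isLocalSub_of_mem_localComp hπ (hCD r)) h) :=
  h𝒞.prodMod hπ hd hM (s := 0) (h' := h)
    (by simpa only [add_zero] using prodMod_splitsAs hπ hC h) hh hC _ hCD

include h𝒞 hd hloc hM hh in
/-- On a product of connected components of local graded Grassmannians which belongs to the class,
the inclusion relation between the factors with generators at the same vertex and in the same degree
is constant. -/
theorem IsClass.le_iff {i j : Fin t} (hij : i ≠ j) (he : e i = e j) (hhij : h i = h j)
    {E E' F F' : Submodule K Λ} (hE : E ∈ localComp π (e j) (C j))
    (hE' : E' ∈ localComp π (e j) (C j)) (hF : F ∈ localComp π (e i) (C i))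
    (hF' : F' ∈ localComp π (e i) (C i)) : E' ≤ F' ↔ E ≤ F := by
  have hrig : ∀ E ∈ localComp π (e j) (C j), ∀ F ∈ localComp π (e i) (C i), E ≤ F →
      ∀ ψ, IsGradedHomMod hπ (e j) E F ψ → ∀ c ∈ E, ψ c ∈ F := by
    intro E hE F hF hle ψ hψ c hc
    let D : Fin t → Submodule K Λ := Function.update (Function.update C j E) i F
    have hDi : D i = F := Function.update_self _ _ _
    have hDj : D j = E := by
      rw [← Function.update_self j E C]
      exact Function.update_of_ne hij.symm _ _
    have hD : ∀ r, D r ∈ localComp π (e r) (C r) := by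
      intro r
      by_cases hri : r = i
      · subst hri; rw [hDi]; exact hF
      · by_cases hrj : r = j
        · subst hrj; rw [hDj]; exact hE
        · have : D r = C r := by
            change Function.update (Function.update C j E) i F r = _
            rw [Function.update_of_ne hri, Function.update_of_ne hrj]
          rw [this]; exact (hC r).mem_localComp hπ
    have h1 := h𝒞.rigid hπ hd hloc _ (h𝒞.prodMod_of_mem hπ hd hC hM hh hD) hh hij he hhij
      (by rw [hDi, hDj]; exact hle) (ψ := ψ) (by rw [hDi, hDj]; exact hψ) (c := c)
      (by rw [hDj]; exact hc)
    rwa [hDi] at h1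
  have hEl := isLocalSub_of_mem_localComp hπ hE
  have hFl := isLocalSub_of_mem_localComp hπ hF
  have hEl' := isLocalSub_of_mem_localComp hπ hE'
  have hFl' := isLocalSub_of_mem_localComp hπ hF'
  have h1 : E' ≤ F ↔ E ≤ F := by
    refine iff_of_mem_localComp' hπ (i := e j) (P := fun E => E ≤ F) (fun δ x hx => ?_) hEl
      (by rwa [localComp_eq hE])
    rw [localComp_eq hE] at hx
    exact eventually_le_iff hπ (v := e j) (localGrass.regSub x) (RegSub.const F)
      (localGrass.isLocalSub hπ) (fun _ => he ▸ hFl) (hrig _ hx F hF)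
  have h2 : E' ≤ F' ↔ E' ≤ F := by
    refine iff_of_mem_localComp' hπ (i := e i) (P := fun F => E' ≤ F) (fun δ x hx => ?_) hFl
      (by rwa [localComp_eq hF])
    rw [localComp_eq hF] at hx
    exact eventually_le_iff hπ (v := e j) (RegSub.const E') (localGrass.regSub x)
      (fun _ => hEl') (fun y => he ▸ localGrass.isLocalSub hπ y) (hrig E' hE' _ hx)
  exact h2.trans h1

include h𝒞 hd hloc hM hh in
theorem IsClass.eq_of_localComp_eq {i j : Fin t} (hij : i ≠ j) (he : e i = e j)
    (hhij : h i = h j) (hc : localComp π (e i) (C i) = localComp π (e j) (C j))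
    {E F : Submodule K Λ} (hE : E ∈ localComp π (e i) (C i))
    (hF : F ∈ localComp π (e i) (C i)) : E = F := by
  have key : ∀ E ∈ localComp π (e i) (C i), ∀ F ∈ localComp π (e i) (C i), E ≤ F := by
    intro E hE F hF
    exact (h𝒞.le_iff hπ hd hloc hC hM hh hij he hhij (E := E) (F := E) (hc ▸ hE) (hc ▸ hE) hE
      hF).2 le_rfl
  exact le_antisymm (key E hE F hF) (key F hF E hE)

end GrMod

end Comparability

namespace SpaceWithFunctions

section ProductOfGrassmannians

variable {W : Type u} [AddCommGroup W] [Module K W]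
  [FiniteDimensional K W] {t : ℕ} {k : Fin t → ℕ} (A : ∀ r, Set (grassmannian K W (k r)))
  (B : ∀ r, Set ((grassmannian K W (k r)).sub (A r)))

omit [FiniteDimensional K W] in
theorem map_proj_pi (C : Fin t → Submodule K W) (r : Fin t) :
    (Submodule.pi Set.univ C).map (LinearMap.proj r) = C r := by
  ext c
  constructor
  · rintro ⟨f, hf, rfl⟩
    exact hf r trivial
  · intro hc
    refine ⟨(Pi.single r c : Fin t → W), fun i _ => ?_, Pi.single_eq_same (M := fun _ => W) r c⟩
    by_cases hi : i = r
    · subst hi; rwa [Pi.single_eq_same]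
    · rw [Pi.single_eq_of_ne hi]; exact zero_mem _

omit [FiniteDimensional K W] in
theorem eq_pi_of_stable {D : Submodule K (Fin t → W)}
    (h : ∀ r, ∀ f ∈ D, (LinearMap.single K (fun _ => W) r ∘ₗ LinearMap.proj r) f ∈ D) :
    D = Submodule.pi Set.univ fun r => D.map (LinearMap.proj r) := by
  refine le_antisymm (fun f hf r _ => ⟨f, hf, rfl⟩) fun f hf => ?_
  rw [← Finset.univ_sum_single f]
  refine sum_mem fun r _ => ?_
  obtain ⟨g, hg, hgf⟩ := hf r trivial
  rw [← show (LinearMap.proj r : (Fin t → W) →ₗ[K] W) g = f r from hgf]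
  exact h r g hg

/-- The subspaces `∏ C r` of `W ^ t`, with `C r` in given sets of subspaces. -/
def prodSet : Set (grassmannian K (Fin t → W) (∑ r, k r)) :=
  {D | ∃ C : ∀ r, (grassmannian K W (k r)).sub (A r), (∀ r, C r ∈ B r) ∧
    D.1 = Submodule.pi Set.univ fun r => (C r).1.1}

/-- The product of subspaces of Grassmannians, as a subspace of the Grassmannian of `W ^ t`. -/
abbrev prodSpace : SpaceWithFunctions K := (grassmannian K (Fin t → W) (∑ r, k r)).sub (prodSet A B)

variable {A B}

/-- The factors of a point of the product. -/
def factor (r : Fin t) (z : prodSpace A B) : ((grassmannian K W (k r)).sub (A r)).sub (B r) :=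
  ⟨z.2.choose r, z.2.choose_spec.1 r⟩

omit [FiniteDimensional K W] in
theorem eq_pi_factor (z : prodSpace A B) :
    z.1.1 = Submodule.pi Set.univ fun r => (factor r z).1.1.1 := z.2.choose_spec.2

omit [FiniteDimensional K W] in
theorem factor_eq (r : Fin t) (z : prodSpace A B) :
    (factor r z).1.1.1 = z.1.1.map (LinearMap.proj r) := by
  rw [eq_pi_factor z, map_proj_pi]

theorem regSub_factor (r : Fin t) (z : prodSpace A B) :
    RegSub (fun z => (factor r z).1.1.1) z := by
  have h : RegSub (fun z : prodSpace A B => z.1.1) z :=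
    (regSub_taut z.1).comp (Hom.homAt (Hom.incl _) z)
  simp only [factor_eq]
  refine h.map _ (Eventually.of_forall fun y => ?_)
  rw [← factor_eq, ← factor_eq]
  exact (factor r y).1.1.2.trans (factor r z).1.1.2.symm

theorem homAt_factor (r : Fin t) (z : prodSpace A B) : HomAt (factor (A := A) (B := B) r) z :=
  homAt_sub (homAt_sub (homAt_grassmannian_iff.2 (regSub_factor r z)) fun z => (factor r z).1.2)
    fun z => (factor r z).2

/-- The point of the product with given factors. -/
def prodPt (C : ∀ r, ((grassmannian K W (k r)).sub (A r)).sub (B r)) : prodSpace A B :=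
  ⟨⟨Submodule.pi Set.univ fun r => (C r).1.1.1, by
    rw [finrank_submodule_pi]
    exact Finset.sum_congr rfl fun r _ => (C r).1.1.2⟩, fun r => (C r).1, fun r => (C r).2, rfl⟩

theorem factor_prodPt (C : ∀ r, ((grassmannian K W (k r)).sub (A r)).sub (B r)) (r : Fin t) :
    factor r (prodPt C) = C r :=
  Subtype.ext (Subtype.ext (Subtype.ext ((factor_eq r _).trans (map_proj_pi _ r))))

omit [FiniteDimensional K W] in
theorem prodSpace_ext {z z' : prodSpace A B} (h : ∀ r, (factor r z).1.1.1 = (factor r z').1.1.1) :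
    z = z' :=
  Subtype.ext (Subtype.ext (by rw [eq_pi_factor z, eq_pi_factor z', funext h]))

theorem homAt_prodPt {X : SpaceWithFunctions K} [X.IsGood] {x : X}
    {f : X → ∀ r, ((grassmannian K W (k r)).sub (A r)).sub (B r)}
    (hf : ∀ r, RegSub (fun y => (f y r).1.1.1) x) : HomAt (fun y => prodPt (f y)) x :=
  homAt_sub (homAt_grassmannian_iff.2 (RegSub.pi hf)) fun y => (prodPt (f y)).2

variable (W k) in
/-- The subspaces of `W ^ t` which are products of subspaces of dimensions `k r`. -/
def splitSet : Set (grassmannian K (Fin t → W) (∑ r, k r)) :=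
  {D | (∀ r, ∀ f ∈ D.1, (LinearMap.single K (fun _ => W) r ∘ₗ LinearMap.proj r) f ∈ D.1) ∧
    ∀ r, finrank K (D.1.map (LinearMap.proj r : (Fin t → W) →ₗ[K] W)) ≤ k r}

theorem isClosed_splitSet : IsClosed (splitSet (K := K) W k) := by
  have h1 : ∀ r, IsClosed {D : grassmannian K (Fin t → W) (∑ r, k r) |
      finrank K (D.1.map (LinearMap.proj r : (Fin t → W) →ₗ[K] W)) ≤ k r} := fun r => by
    rw [← isOpen_compl_iff, isOpen_iff_eventually]
    intro D hD
    filter_upwards [(regSub_taut D).eventually_finrank_map_le (LinearMap.proj r)] with D' h1 h2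
    exact hD (h1.trans h2)
  have h2 := isClosed_iInter fun r : Fin t => isClosed_stable (k := ∑ r, k r)
    (LinearMap.single K (fun _ => W) r ∘ₗ LinearMap.proj r)
  have h3 := h2.inter (isClosed_iInter h1)
  convert h3 using 1
  ext D
  refine and_congr ?_ ?_
  · rw [Set.mem_iInter]; rfl
  · rw [Set.mem_iInter]; rfl

theorem finrank_map_proj_of_mem {D : grassmannian K (Fin t → W) (∑ r, k r)}
    (hD : D ∈ splitSet W k) (r : Fin t) :
    finrank K (D.1.map (LinearMap.proj r : (Fin t → W) →ₗ[K] W)) = k r := by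
  have h1 : ∑ r, finrank K (D.1.map (LinearMap.proj r : (Fin t → W) →ₗ[K] W)) =
      ∑ r, k r := by
    rw [← finrank_submodule_pi, ← eq_pi_of_stable hD.1]
    exact D.2
  exact (Finset.sum_eq_sum_iff_of_le fun r _ => hD.2 r).1 h1 r (Finset.mem_univ r)

/-- The factors of a split subspace. -/
def splitFactor (r : Fin t) :
    Hom ((grassmannian K (Fin t → W) (∑ r, k r)).sub (splitSet W k)) (grassmannian K W (k r)) :=
  Hom.mk' (fun D => ⟨D.1.1.map (LinearMap.proj r : (Fin t → W) →ₗ[K] W),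
      finrank_map_proj_of_mem (D := D.1) D.2 r⟩)
    fun D => by
      have h : RegSub (fun D : (grassmannian K (Fin t → W) (∑ r, k r)).sub (splitSet W k) =>
          D.1.1) D := (regSub_taut D.1).comp (Hom.homAt (Hom.incl _) D)
      have h2 : ∀ D' : (grassmannian K (Fin t → W) (∑ r, k r)).sub (splitSet W k),
          finrank K (D'.1.1.map (LinearMap.proj r : (Fin t → W) →ₗ[K] W)) = k r :=
        fun D' => finrank_map_proj_of_mem (D := D'.1) D'.2 r
      have h3 := h.map (LinearMap.proj r : (Fin t → W) →ₗ[K] W)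
        (Eventually.of_forall fun D' => (h2 D').trans (h2 D).symm)
      exact homAt_grassmannian_iff.2 h3

omit [FiniteDimensional K W] in
theorem mem_splitSet_of_mem_prodSet {D : grassmannian K (Fin t → W) (∑ r, k r)}
    (hD : D ∈ prodSet A B) : D ∈ splitSet W k := by
  obtain ⟨C, -, hD⟩ := hD
  refine ⟨fun r g hg => ?_, fun r => ?_⟩
  · rw [hD] at hg ⊢
    intro i _
    change (Pi.single r (g r) : Fin t → W) i ∈ _
    by_cases hi : i = r
    · subst hi; rw [Pi.single_eq_same]; exact hg i trivial
    · rw [Pi.single_eq_of_ne hi]; exact zero_mem _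
  · rw [hD, map_proj_pi]
    exact (C r).1.2.le

theorem isClosed_prodSet (hA : ∀ r, IsClosed (A r)) (hB : ∀ r, IsClosed (B r)) :
    IsClosed (prodSet A B) := by
  have hAB : ∀ r, IsClosed (Subtype.val '' B r : Set (grassmannian K W (k r))) := fun r =>
    (hA r).isClosedEmbedding_subtypeVal.isClosedMap _ (hB r)
  have h : prodSet A B =
      Subtype.val '' (⋂ r, splitFactor (K := K) (W := W) r ⁻¹' (Subtype.val '' B r)) := by
    ext D
    constructor
    · intro hD
      refine ⟨⟨D, mem_splitSet_of_mem_prodSet hD⟩, Set.mem_iInter.2 fun r => ?_, rfl⟩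
      obtain ⟨C, hC, hD'⟩ := hD
      exact ⟨C r, hC r, Subtype.ext ((map_proj_pi (fun r => (C r).1.1) r).symm.trans
        (congrArg (Submodule.map (LinearMap.proj r)) hD'.symm))⟩
    · rintro ⟨D, hD, rfl⟩
      choose C hC hCD using fun r => Set.mem_iInter.1 hD r
      refine ⟨C, hC, (eq_pi_of_stable D.2.1).trans ?_⟩
      refine congrArg _ (funext fun r => ?_)
      exact congrArg Subtype.val (hCD r).symm
  rw [h]
  exact isClosed_splitSet.isClosedEmbedding_subtypeVal.isClosedMap _
    (isClosed_iInter fun r => (hAB r).preimage (splitFactor r).continuous_toFun)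

theorem isProductOfVarieties_prodSpace (hA : ∀ r, IsClosed (A r)) (hB : ∀ r, IsClosed (B r)) :
    IsProductOfVarieties (fun r => ((grassmannian K W (k r)).sub (A r)).sub (B r)) (prodSpace A B)
      fun r => Hom.mk' (factor r) (homAt_factor r) := by
  refine ⟨isVariety_grassmannian_sub (isClosed_prodSet hA hB), fun X hX f => ?_⟩
  have := hX.isGood
  refine ⟨Hom.mk' (fun x => prodPt fun r => f r x) fun x => homAt_prodPt fun r => ?_,
    fun r x => factor_prodPt _ r, fun g hg => Hom.ext fun x => prodSpace_ext fun r => ?_⟩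
  · exact homAt_grassmannian_iff.1 ((Hom.homAt (Hom.incl _) _).comp
      ((Hom.homAt (Hom.incl _) _).comp ((f r).homAt x)))
  · have h1 : factor r (g x) = f r x := hg r x
    have h2 : factor r (prodPt fun r => f r x) = f r x := factor_prodPt _ r
    rw [h1]
    exact congrArg (fun y => y.1.1.1) h2.symm

end ProductOfGrassmannians

end SpaceWithFunctions

section UniversalFamily

open SpaceWithFunctions

variable (hπ : IsPathLengthGraded π)

/-- A family of vectors which is a basis modulo one member of a regular family of subspaces is a
basis modulo the neighbouring ones, with regular coordinates. -/
theorem SpaceWithFunctions.RegSub.exists_coords_mod {W : Type*} [AddCommGroup W]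
    [Module K W] [FiniteDimensional K W]
    {X : SpaceWithFunctions K} [X.IsGood] {x : X} {N : X → Submodule K W} (hN : RegSub N x) {d : ℕ}
    (hd : d + finrank K (N x) = finrank K W) {F : Fin d → W}
    (hF : ∀ c : Fin d → K, ∑ p, c p • F p ∈ N x → c = 0) :
    (∀ᶠ y in 𝓝 x, ∀ c : Fin d → K, ∑ p, c p • F p ∈ N y → c = 0) ∧
    ∀ f : W, ∃ c : Fin d → X → K, (∀ p, c p ∈ X.regAlg x) ∧
      ∀ᶠ y in 𝓝 x, f - ∑ p, c p y • F p ∈ N y := by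
  obtain ⟨b, hb, hbN⟩ := hN.exists_frame rfl
  let B : Fin d ⊕ Fin (finrank K (N x)) → X → W := Sum.elim (fun p _ => F p) b
  have hB : ∀ i, VReg (X.regAlg x) (B i) := by
    rintro (p | i)
    · exact VReg.const _
    · exact hb i
  have hspan : ∀ y, span K (range fun i => b i y) = N y → ∀ c : _ → K,
      ∑ i, c i • b i y ∈ N y := fun y hy c => by
    rw [← hy]
    exact sum_mem fun i _ => smul_mem _ _ (subset_span ⟨i, rfl⟩)
  have hx : LinearIndependent K fun i => B i x := by
    obtain ⟨h1, h2⟩ := hbN.self_of_nhds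
    rw [Fintype.linearIndependent_iff]
    intro g hg
    rw [Fintype.sum_sum_type] at hg
    change ∑ p, g (.inl p) • F p + ∑ i, g (.inr i) • b i x = 0 at hg
    have h3 := hF (fun p => g (.inl p)) (by
      rw [eq_neg_of_add_eq_zero_left hg]
      exact neg_mem (hspan x h2 _))
    have h4 : ∀ p, g (.inl p) = 0 := congrFun h3
    simp only [h4, zero_smul, Finset.sum_const_zero, zero_add] at hg
    rintro (p | i)
    · exact h4 p
    · exact Fintype.linearIndependent_iff.1 h1 _ hg i
  have hev := eventually_linearIndependent hB hx
  refine ⟨?_, fun f => ?_⟩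
  · filter_upwards [hbN, hev] with y h1 h2 c hc
    rw [← h1.2, mem_span_range_iff_exists_fun] at hc
    obtain ⟨g, hg⟩ := hc
    have h3 := Fintype.linearIndependent_iff.1 h2 (Sum.elim c fun i => - g i) (by
      rw [Fintype.sum_sum_type]
      change ∑ p, c p • F p + ∑ i, (- g i) • b i y = 0
      simp only [neg_smul, Finset.sum_neg_distrib, hg, add_neg_cancel])
    exact funext fun p => h3 (.inl p)
  · obtain ⟨c, hc, h⟩ := exists_regular_coords hB hx (v := fun _ => f) (VReg.const f) (by
      filter_upwards [hev] with y hy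
      rw [hy.span_eq_top_of_card_eq_finrank' (by simp [hd])]
      trivial)
    refine ⟨fun p => c (.inl p), fun p => hc _, ?_⟩
    filter_upwards [h, hbN] with y h1 h2
    rw [Fintype.sum_sum_type] at h1
    change f = ∑ p, c (.inl p) y • F p + ∑ i, c (.inr i) y • b i y at h1
    rw [sub_eq_of_eq_add' h1]
    exact hspan y h2.2 _

variable [FiniteDimensional K Λ] {t : ℕ} {e : Fin t → V}

/-- The quotient map onto the direct sum of the modules `Λ e_r / C_r`. -/
def prodMod.mk {C : Fin t → Submodule K Λ} (hC : ∀ r, IsLocalSub hπ (e r) (C r)) (h : Fin t → ℤ) :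
    (Fin t → Λ) →ₗ[Λ] prodMod hπ hC h :=
  quotMod.mk hπ h (prodSub hπ hC) (freeProj_mem_prodSub hπ hC h)

omit [FiniteDimensional K Λ] in
theorem prodMod.mk_surjective {C : Fin t → Submodule K Λ} (hC : ∀ r, IsLocalSub hπ (e r) (C r))
    (h : Fin t → ℤ) : Function.Surjective (prodMod.mk hπ hC h) := quotMod.mk_surjective hπ

omit [FiniteDimensional K Λ] in
theorem prodMod.sum_smul_mk_eq_zero {C : Fin t → Submodule K Λ}
    (hC : ∀ r, IsLocalSub hπ (e r) (C r)) (h : Fin t → ℤ) {d : ℕ} {c : Fin d → K}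
    {F : Fin d → Fin t → Λ} :
    ∑ p, c p • prodMod.mk hπ hC h (F p) = 0 ↔ ∑ p, c p • F p ∈ prodSub hπ hC := by
  have h1 : ∑ p, c p • prodMod.mk hπ hC h (F p) = prodMod.mk hπ hC h (∑ p, c p • F p) := by
    rw [map_sum]
    rfl
  rw [h1]
  exact quotMod.mk_eq_zero hπ

omit [FiniteDimensional K Λ] in
theorem prodMod.mk_eq_sum {C : Fin t → Submodule K Λ}
    (hC : ∀ r, IsLocalSub hπ (e r) (C r)) (h : Fin t → ℤ) {d : ℕ} {c : Fin d → K}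
    {F : Fin d → Fin t → Λ} {f : Fin t → Λ} (hf : f - ∑ p, c p • F p ∈ prodSub hπ hC) :
    prodMod.mk hπ hC h f = ∑ p, c p • prodMod.mk hπ hC h (F p) := by
  have h1 := (quotMod.mk_eq_zero hπ (h := h) (hN := freeProj_mem_prodSub hπ hC h)).2 hf
  rw [map_sub, sub_eq_zero, map_sum] at h1
  exact h1

theorem regSub_prodSub {X : SpaceWithFunctions K} [X.IsGood] {x : X}
    {C : X → Fin t → Submodule K Λ} (hC : ∀ x r, IsLocalSub hπ (e r) (C x r))
    (hreg : ∀ r, RegSub (fun y => C y r) x) :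
    RegSub (fun y => (prodSub hπ (hC y)).restrictScalars K) x := by
  have h1 : ∀ y, (prodSub hπ (hC y)).restrictScalars K =
      Submodule.pi Set.univ fun r => (C y r).comap (LinearMap.mulRight K (idem π (e r))) := by
    intro y
    ext f
    exact ⟨fun hf r _ => hf r, fun hf r => hf r trivial⟩
  simp only [h1]
  refine RegSub.pi fun r => (hreg r).comap (fun _ => VReg.const _) ?_
  have h2 : ∀ y, C y r ≤ LinearMap.range (LinearMap.mulRight K (idem π (e r))) :=
    fun y c hc => ⟨c, (hC y r).mul_idem c hc⟩
  filter_upwards [(hreg r).finrank_eq] with y hy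
  rw [finrank_comap_eq _ (h2 y), finrank_comap_eq _ (h2 x), hy]

variable {X : SpaceWithFunctions K} [X.IsGood] {C : X → Fin t → Submodule K Λ}
  (hC : ∀ x r, IsLocalSub hπ (e r) (C x r)) (hreg : ∀ x r, RegSub (fun y => C y r) x)
  (h : Fin t → ℤ) {d : ℕ} (hdim : ∀ x, finrank K (prodMod hπ (hC x) h) = d)

include hreg h hdim in
theorem exists_coords_prodSub (F : Fin d → Fin t → Λ) (f : Fin t → Λ) :
    ∃ A : Fin d → X → K, ∀ x, (∀ c : Fin d → K, ∑ p, c p • F p ∈ prodSub hπ (hC x) → c = 0) →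
      (∀ p, X.RegAt (A p) x) ∧ f - ∑ p, A p x • F p ∈ prodSub hπ (hC x) := by
  classical
  have h0 : ∀ x, d + finrank K ((prodSub hπ (hC x)).restrictScalars K) =
      finrank K (Fin t → Λ) := fun x => by
    rw [← hdim x]; exact quotMod.finrank_eq hπ
  have h1 := fun x (hx : ∀ c : Fin d → K, ∑ p, c p • F p ∈ prodSub hπ (hC x) → c = 0) =>
    (regSub_prodSub hπ hC (hreg x)).exists_coords_mod (h0 x) hx
  have h2 : ∀ x, ∃ a : Fin d → K, (∀ c : Fin d → K, ∑ p, c p • F p ∈ prodSub hπ (hC x) → c = 0) →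
      f - ∑ p, a p • F p ∈ prodSub hπ (hC x) := by
    intro x
    by_cases hx : ∀ c : Fin d → K, ∑ p, c p • F p ∈ prodSub hπ (hC x) → c = 0
    · obtain ⟨c, -, hc⟩ := (h1 x hx).2 f
      exact ⟨fun p => c p x, fun _ => hc.self_of_nhds⟩
    · exact ⟨0, fun h => absurd h hx⟩
  choose a ha using h2
  refine ⟨fun p x => a x p, fun x hx => ⟨fun p => ?_, ha x hx⟩⟩
  obtain ⟨c, hc, hcf⟩ := (h1 x hx).2 f
  refine X.regAt_congr ?_ (hc p)
  filter_upwards [hcf, (h1 x hx).1] with y h3 h4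
  have h5 := h4 (fun p => a y p - c p y) (by
    have := sub_mem h3 (ha y h4)
    rw [sub_sub_sub_cancel_left, ← Finset.sum_sub_distrib] at this
    simpa only [sub_smul] using this)
  exact (sub_eq_zero.1 (congrFun h5 p)).symm

omit [X.IsGood] in
include hdim in
theorem exists_homogeneous_frame (x : X) : ∃ (F : Fin d → Fin t → Λ) (n : Fin d → ℤ),
    (∀ p, freeProj hπ h (n p) (F p) = F p) ∧
      ∀ c : Fin d → K, ∑ p, c p • F p ∈ prodSub hπ (hC x) → c = 0 := by
  let mk := prodMod.mk hπ (hC x) h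
  let s : Set (prodMod hπ (hC x) h) := {m | ∃ n f, freeProj hπ h n f = f ∧ m = mk f}
  have hs : span K s = ⊤ := by
    refine eq_top_iff.2 fun m _ => ?_
    obtain ⟨f, rfl⟩ := prodMod.mk_surjective hπ (hC x) h m
    have h1 : (⨆ n, LinearMap.range (freeProj hπ h n)) ≤
        (span K s).comap (mk.restrictScalars K) := by
      refine iSup_le fun n => ?_
      rintro _ ⟨g, rfl⟩
      exact subset_span ⟨n, _, by rw [freeProj_freeProj, if_pos rfl], rfl⟩
    exact h1 (mem_iSup_range_freeProj hπ h f)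
  obtain ⟨b, hbs, hb, hbl⟩ := exists_linearIndependent K s
  rw [hs] at hb
  let β : Module.Basis b K (prodMod hπ (hC x) h) :=
    Module.Basis.mk hbl (by rw [Subtype.range_coe, hb])
  have : Module.Finite K (prodMod hπ (hC x) h) :=
    Module.Finite.of_surjective (mk.restrictScalars K) (prodMod.mk_surjective hπ (hC x) h)
  have : Fintype b := FiniteDimensional.fintypeBasisIndex β
  let E : Fin d ≃ b := (Fintype.equivFinOfCardEq (by
    rw [← Module.finrank_eq_card_basis β, hdim])).symm
  choose n F hF hbF using fun p => hbs (E p).2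
  refine ⟨F, n, hF, fun c hc => ?_⟩
  have h1 : LinearIndependent K fun p => ((E p : b) : prodMod hπ (hC x) h) :=
    hbl.comp E E.injective
  refine funext (Fintype.linearIndependent_iff.1 h1 c ?_)
  rw [← (prodMod.sum_smul_mk_eq_zero hπ (hC x) h).2 hc]
  exact Finset.sum_congr rfl fun p _ => by rw [hbF p]

/-- The family of the modules `⨁ r, Λ e_r / C_r`, for regular families `C_r` of homogeneous
submodules. -/
def prodFamily (he : ∀ r, idem π (e r) ≠ 0) : GradedFamily π d X where
  fib x := prodMod hπ (hC x) h
  chart := {F : (Fin d → Fin t → Λ) × (Fin d → ℤ) //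
    ∀ p, freeProj hπ h (F.2 p) (F.1 p) = F.1 p}
  U F := {x | ∀ c : Fin d → K, ∑ p, c p • F.1.1 p ∈ prodSub hπ (hC x) → c = 0}
  isOpen_U F := isOpen_iff_eventually.2 fun x hx =>
    ((regSub_prodSub hπ hC (hreg x)).exists_coords_mod
      (by rw [← hdim x]; exact quotMod.finrank_eq hπ) hx).1
  cover x := by
    obtain ⟨F, n, hF, hx⟩ := exists_homogeneous_frame hπ hC h hdim x
    exact ⟨⟨(F, n), hF⟩, hx⟩
  frame F x p := prodMod.mk hπ (hC x) h (F.1.1 p)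
  deg F := F.1.2
  frame_linearIndependent F x hx := Fintype.linearIndependent_iff.2 fun c hc p =>
    congrFun (hx c ((prodMod.sum_smul_mk_eq_zero hπ (hC x) h).1 hc)) p
  frame_span F x hx := by
    refine eq_top_iff.2 fun m _ => ?_
    obtain ⟨f, rfl⟩ := prodMod.mk_surjective hπ (hC x) h m
    obtain ⟨A, hA⟩ := exists_coords_prodSub hπ hC hreg h hdim F.1.1 f
    rw [prodMod.mk_eq_sum hπ (hC x) h (hA x hx).2]
    exact sum_mem fun p _ => smul_mem _ (A p x)
      (subset_span ⟨p, rfl⟩)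
  frame_mem F x _ p := quotMod.mk_mem hπ (F.2 p)
  transition F G := by
    choose A hA using fun p => exists_coords_prodSub hπ hC hreg h hdim F.1.1 (G.1.1 p)
    exact ⟨A, fun x hx => ⟨fun p q => (hA p x hx.1).1 q, fun p =>
      prodMod.mk_eq_sum hπ (hC x) h (hA p x hx.1).2⟩⟩
  action F a := by
    choose A hA using fun p => exists_coords_prodSub hπ hC hreg h hdim F.1.1 (a • F.1.1 p)
    exact ⟨A, fun x hx => ⟨fun p q => (hA p x hx).1 q, fun p =>
      ((prodMod.mk hπ (hC x) h).map_smul a _).symm.trans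
        (prodMod.mk_eq_sum hπ (hC x) h (hA p x hx).2)⟩⟩
  sameTop := ⟨t, e, h, fun x => prodMod_hasTop hπ (hC x) h he⟩

end UniversalFamily

section Blocks

variable (hπ : IsPathLengthGraded π) {ι : Type*}

variable (K Λ) in
/-- Extension of a tuple by zero. -/
def extendZero (p : ι → Prop) [DecidablePred p] : (Subtype p → Λ) →ₗ[K] (ι → Λ) :=
  LinearMap.pi fun r => if hr : p r then LinearMap.proj ⟨r, hr⟩ else 0

theorem extendZero_apply_of {p : ι → Prop} [DecidablePred p] (f : Subtype p → Λ) {r : ι}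
    (hr : p r) : extendZero K Λ p f r = f ⟨r, hr⟩ := by
  rw [extendZero, LinearMap.pi_apply, dif_pos hr]
  rfl

theorem extendZero_apply_of_not {p : ι → Prop} [DecidablePred p] (f : Subtype p → Λ) {r : ι}
    (hr : ¬ p r) : extendZero K Λ p f r = 0 := by
  rw [extendZero, LinearMap.pi_apply, dif_neg hr]
  rfl

theorem sum_extendZero [Fintype ι] {M : Type*} [AddCommGroup M] [Module Λ M] {p : ι → Prop}
    [DecidablePred p] (f : Subtype p → Λ) (m : ι → M) :
    ∑ r, extendZero K Λ p f r • m r = ∑ i, f i • m i := by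
  rw [← Fintype.sum_subtype_add_sum_subtype p]
  have h0 : ∑ i : {r // ¬ p r}, extendZero K Λ p f i • m i = 0 :=
    Finset.sum_eq_zero fun i _ => by rw [extendZero_apply_of_not f i.2, zero_smul]
  rw [h0, add_zero]
  exact Finset.sum_congr rfl fun i _ => by rw [extendZero_apply_of f i.2]

variable (Λ) in
/-- The tuples which involve only generators of degree less than `n`. -/
def lowGen (h : ι → ℤ) (n : ℤ) : Submodule Λ (ι → Λ) where
  carrier := {g | ∀ r, n ≤ h r → g r = 0}
  add_mem' ha hb r hr := by rw [Pi.add_apply, ha r hr, hb r hr, add_zero]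
  zero_mem' _ _ := rfl
  smul_mem' a g hg r hr := by rw [Pi.smul_apply, hg r hr, smul_zero]

variable (Λ) in
/-- The submodule generated by the generators of degree less than `n`. -/
def low [Fintype ι] {M : Type*} [AddCommGroup M] [Module Λ M] (m : ι → M) (h : ι → ℤ) (n : ℤ) :
    Submodule Λ M :=
  (lowGen Λ h n).map (Fintype.linearCombination Λ m)

theorem mem_low [Fintype ι] {M : Type*} [AddCommGroup M] [Module Λ M] {m : ι → M} {h : ι → ℤ}
    {n : ℤ} {x : M} : x ∈ low Λ m h n ↔ ∃ g ∈ lowGen Λ h n, ∑ r, g r • m r = x := Iff.rfl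

namespace GrMod

variable {M : GrMod π}

namespace IsTopSystem

variable {ι' : Type*} [Fintype ι] [Fintype ι'] {e : ι → V} {h : ι → ℤ} {m : ι → M}
  {e' : ι' → V} {h' : ι' → ℤ} {m' : ι' → M}

include hπ in
theorem of_span (hm : M.IsTopSystem e h m) (hcard : Fintype.card ι = Fintype.card ι')
    (h1 : ∀ r, m' r ∈ M.gr (h' r)) (h2 : ∀ r, idem π (e' r) • m' r = m' r)
    (h3 : Submodule.span Λ (range m') = ⊤) : M.IsTopSystem e' h' m' :=
  ⟨h1, h2, h3, linearIndependent_of_top_le_span_of_card_eq_finrank (span_top_mkQ hπ h3 h2).ge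
    (by rw [Module.finrank_eq_card_basis (hm.basis hπ), hcard])⟩

include hπ in
theorem shift_eq [Nonempty ι] {s s' : ℤ} {n : ι → M} (hm : M.IsTopSystem e (fun r => h r + s) m)
    (hn : M.IsTopSystem e (fun r => h r + s') n) : s = s' := by
  obtain ⟨σ, hσ⟩ := hm.exists_equiv hπ hn
  have h1 : ∀ a, h (σ a) + s = h a + s' := fun a => by
    obtain ⟨f, -, hf⟩ := hm.exists_expansion hπ (hn.mem a) (hn.idem_smul a)
    exact ((hf (σ a)).2.2.2.2.2 (hσ a)).2
  have h2 := Finset.sum_congr (s₁ := Finset.univ) rfl fun a _ => h1 a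
  rw [Finset.sum_add_distrib, Finset.sum_add_distrib, Equiv.sum_comp σ h, add_right_inj] at h2
  simpa using h2

include hπ in
theorem low_le (hm : M.IsTopSystem e h m) (hm' : M.IsTopSystem e' h' m') (n : ℤ) :
    low Λ m h n ≤ low Λ m' h' n := by
  rintro _ ⟨g, hg, rfl⟩
  refine sum_mem fun r _ => ?_
  change g r • m r ∈ _
  by_cases hr : n ≤ h r
  · rw [hg r hr, zero_smul]
    exact zero_mem _
  · obtain ⟨f, hf, hf'⟩ := hm'.exists_expansion hπ (hm.mem r) (hm.idem_smul r)
    refine Submodule.smul_mem _ _ (mem_low.2 ⟨f, fun a ha => ?_, hf.symm⟩)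
    obtain ⟨-, -, -, h1, -, h2⟩ := hf' a
    have h3 : hm'.coef hπ (m r) a = 0 := by
      by_contra h3
      have := (h2 h3).2
      omega
    rw [h1 (by omega), h3, zero_smul]

include hπ in
/-- The generators of the same degree `k` at the same vertex `v` of two top systems are related by
an invertible matrix modulo the submodule generated in smaller degrees. -/
theorem exists_block_matrix [DecidableEq V] [DecidableEq ι] {n : ι → M} {C : ι → Submodule K Λ}
    (hm : M.IsTopSystem e h m) (hn : M.IsTopSystem e h n)
    (hrel : ∀ f : ι → Λ, ∑ r, f r • n r = 0 ↔ ∀ r, f r * idem π (e r) ∈ C r) (v : V) (k : ℤ) :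
    ∃ G : Matrix {r // e r = v ∧ h r = k} {r // e r = v ∧ h r = k} K, IsUnit G ∧ (m = n → G = 1) ∧
      ∀ f : {r // e r = v ∧ h r = k} → Λ, ∑ i, f i • m i ∈ low Λ m h k ↔
        ∀ i : {r // e r = v ∧ h r = k}, matAct K _ Λ G f i * idem π v ∈ C i := by
  choose F hF hF' using fun r => hn.exists_expansion hπ (hm.mem r) (hm.idem_smul r)
  let G : Matrix {r // e r = v ∧ h r = k} {r // e r = v ∧ h r = k} K :=
    Matrix.of fun a i => hn.coef hπ (m i) a
  let G' : Matrix {r // e r = v ∧ h r = k} {r // e r = v ∧ h r = k} K :=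
    Matrix.of fun i a => hm.coef hπ (n a) i
  have hGG : G * G' = 1 := by
    ext a b
    have h1 := coef_mul_coef hπ hn hm (a : ι) b
    rw [← Fintype.sum_subtype_add_sum_subtype fun r => e r = v ∧ h r = k, add_eq_left.2] at h1
    · rw [Matrix.mul_apply, Matrix.one_apply]
      refine h1.trans ?_
      simp only [Subtype.ext_iff]
    · refine Finset.sum_eq_zero fun i _ => ?_
      by_contra h2
      obtain ⟨h3, h4⟩ := (hF' i a).2.2.2.2.2 (left_ne_zero_of_mul h2)
      exact i.2 ⟨h3.symm.trans a.2.1, h4.symm.trans a.2.2⟩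
  have hlow : low Λ m h k = low Λ n h k := le_antisymm (hm.low_le hπ hn k) (hn.low_le hπ hm k)
  have hmn : ∀ i : {r // e r = v ∧ h r = k},
      m i - ∑ a : {r // e r = v ∧ h r = k}, (G a i • idem π v) • n a ∈ low Λ n h k := by
    intro i
    have h1 : ∀ a : {r // e r = v ∧ h r = k}, G a i • idem π v = F i a := fun a => by
      rw [(hF' i a).2.2.2.1 (by rw [a.2.2, i.2.2]), i.2.1]
      rfl
    simp only [h1]
    rw [← sum_extendZero (K := K) (p := fun r => e r = v ∧ h r = k) (fun a => F i a) n]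
    refine mem_low.2 ⟨F i - extendZero K Λ (fun r => e r = v ∧ h r = k) fun a => F i a,
      fun r hr => ?_, ?_⟩
    · by_cases hrp : e r = v ∧ h r = k
      · rw [Pi.sub_apply, extendZero_apply_of (K := K) (p := fun r => e r = v ∧ h r = k) _ hrp,
          sub_self]
      · rw [Pi.sub_apply, extendZero_apply_of_not (K := K) (p := fun r => e r = v ∧ h r = k) _ hrp,
          sub_zero,
          (hF' i r).2.2.2.1 (by rw [i.2.2]; exact hr)]
        have h3 : hn.coef hπ (m i) r = 0 := by
          by_contra h3
          obtain ⟨h4, h5⟩ := (hF' i r).2.2.2.2.2 h3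
          exact hrp ⟨h4.trans i.2.1, h5.trans i.2.2⟩
        rw [h3, zero_smul]
    · simp only [Pi.sub_apply, sub_smul, Finset.sum_sub_distrib]
      rw [← hF]
  refine ⟨G, IsUnit.of_mul_eq_one _ hGG, fun hmn => ?_, fun f => ?_⟩
  · ext a i
    change hn.coef hπ (m i) a = _
    rw [hmn, coef, ← hn.basis_apply (hπ := hπ), Module.Basis.repr_self, Finsupp.single_apply,
      Matrix.one_apply]
    simp only [Subtype.ext_iff, eq_comm]
  have h1 : ∑ i, f i • m i - ∑ a : {r // e r = v ∧ h r = k},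
      (matAct K _ Λ G f a * idem π v) • n a ∈ low Λ n h k := by
    have h2 : ∑ a : {r // e r = v ∧ h r = k}, (matAct K _ Λ G f a * idem π v) • n a =
        ∑ i, f i • ∑ a : {r // e r = v ∧ h r = k}, (G a i • idem π v) • n a := by
      simp only [matAct_apply, Finset.smul_sum, Finset.sum_mul, Finset.sum_smul]
      rw [Finset.sum_comm]
      refine Finset.sum_congr rfl fun i _ => Finset.sum_congr rfl fun a _ => ?_
      rw [smul_smul, smul_mul_assoc, mul_smul_comm]
    rw [h2, ← Finset.sum_sub_distrib]
    simp only [← smul_sub]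
    exact Submodule.sum_mem _ fun i _ => Submodule.smul_mem _ _ (hmn i)
  rw [hlow, ← sub_add_cancel (∑ i, f i • m i) (∑ a : {r // e r = v ∧ h r = k},
    (matAct K _ Λ G f a * idem π v) • n a), Submodule.add_mem_iff_right _ h1]
  constructor
  · intro h2 i
    obtain ⟨g, hg, hgf⟩ := mem_low.1 h2
    rw [← sum_extendZero (K := K) (p := fun r => e r = v ∧ h r = k)
      (fun a => matAct K _ Λ G f a * idem π v) n, ← sub_eq_zero, ← Finset.sum_sub_distrib] at hgf
    simp only [← sub_smul] at hgf
    have h3 := (hrel _).1 hgf i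
    rw [hg i i.2.2.ge, extendZero_apply_of (p := fun r => e r = v ∧ h r = k) _ i.2, zero_sub, neg_mul,
      mul_assoc, i.2.1,
      idem_mul_self] at h3
    exact neg_mem_iff.1 h3
  · intro h2
    have h3 : ∑ a : {r // e r = v ∧ h r = k}, (matAct K _ Λ G f a * idem π v) • n a = 0 := by
      rw [← sum_extendZero (K := K) (p := fun r => e r = v ∧ h r = k)]
      refine (hrel _).2 fun r => ?_
      by_cases hr : e r = v ∧ h r = k
      · rw [extendZero_apply_of (K := K) (p := fun r => e r = v ∧ h r = k) _ hr, mul_assoc, hr.1,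
          idem_mul_self]
        exact h2 ⟨r, hr⟩
      · rw [extendZero_apply_of_not (K := K) (p := fun r => e r = v ∧ h r = k) _ hr, zero_mul]
        exact zero_mem _
    rw [h3]
    exact zero_mem _

end IsTopSystem

variable [FiniteDimensional K Λ] [Fintype ι] {e : ι → V} {h : ι → ℤ} {C : ι → Submodule K Λ}

theorem finrank_low {n : ι → M}
    (hrel : ∀ f : ι → Λ, ∑ r, f r • n r = 0 ↔ ∀ r, f r * idem π (e r) ∈ C r)
    (hC : ∀ r, ∀ c ∈ C r, c * idem π (e r) = c) (k : ℤ) :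
    finrank K ((low Λ n h k).restrictScalars K) +
      ∑ r, (if h r < k then finrank K (C r) +
        finrank K (LinearMap.ker (LinearMap.mulRight K (idem π (e r)))) else 0) =
      finrank K ((lowGen Λ h k).restrictScalars K) := by
  have h1 : (lowGen Λ h k).restrictScalars K ⊓
      LinearMap.ker ((Fintype.linearCombination Λ n).restrictScalars K) =
      Submodule.pi Set.univ fun r =>
        if h r < k then (C r).comap (LinearMap.mulRight K (idem π (e r))) else ⊥ := by
    ext f
    constructor
    · rintro ⟨hf, hf'⟩ r -
      change f r ∈ if h r < k then (C r).comap (LinearMap.mulRight K (idem π (e r))) else ⊥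
      split_ifs with hr
      · exact (hrel f).1 hf' r
      · exact hf r (not_lt.1 hr)
    · intro hf
      have h2 : ∀ r, n r = n r ∧ (k ≤ h r → f r = 0) ∧ f r * idem π (e r) ∈ C r := fun r => by
        have h3 := hf r trivial
        by_cases hr : h r < k
        · simp only [if_pos hr] at h3
          exact ⟨rfl, fun h => absurd hr (not_lt.2 h), h3⟩
        · simp only [if_neg hr] at h3
          replace h3 : f r = 0 := h3
          exact ⟨rfl, fun _ => h3, by rw [h3, zero_mul]; exact zero_mem _⟩
      exact ⟨fun r => (h2 r).2.1, (hrel f).2 fun r => (h2 r).2.2⟩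
  rw [← finrank_map_add_finrank_inf_ker ((lowGen Λ h k).restrictScalars K)
    ((Fintype.linearCombination Λ n).restrictScalars K), h1, finrank_submodule_pi]
  congr 1
  refine Finset.sum_congr rfl fun r _ => ?_
  by_cases hr : h r < k
  · rw [if_pos hr, if_pos hr]
    exact (finrank_comap_eq (LinearMap.mulRight K (idem π (e r)))
      fun c hc => ⟨c, hC r c hc⟩).symm
  · rw [if_neg hr, if_neg hr]
    exact (finrank_bot K Λ).symm

end GrMod

theorem finrank_of_matAct [FiniteDimensional K Λ] [Fintype ι] [DecidableEq ι]
    {D : Submodule K (ι → Λ)} {G : Matrix ι ι K} (hG : IsUnit G) {v : V} {C : ι → Submodule K Λ}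
    (hD : ∀ f, f ∈ D ↔ ∀ i, matAct K ι Λ G f i * idem π v ∈ C i)
    (hC : ∀ i, ∀ c ∈ C i, c * idem π v = c) : finrank K D =
      ∑ i, (finrank K (C i) +
        finrank K (LinearMap.ker (LinearMap.mulRight K (idem π v)))) := by
  have hbij := (Module.End.isUnit_iff _).1 (hG.map (matAct K ι Λ))
  have h1 : D = (Submodule.pi Set.univ fun i =>
      (C i).comap (LinearMap.mulRight K (idem π v))).comap (matAct K ι Λ G) := by
    ext f
    exact (hD f).trans ⟨fun h i _ => h i, fun h i => h i trivial⟩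
  rw [h1, finrank_comap_eq _ (by rw [LinearMap.range_eq_top.2 hbij.2]; exact le_top),
    LinearMap.ker_eq_bot.2 hbij.1, finrank_bot, add_zero, finrank_submodule_pi]
  exact Finset.sum_congr rfl fun i _ => finrank_comap_eq _ fun c hc => ⟨c, hC i c hc⟩

end Blocks

section ClassifyingMap

open SpaceWithFunctions

variable [FiniteDimensional K Λ] (hπ : IsPathLengthGraded π)

/-- The connected components of the local graded Grassmannian are separated by polynomial functions
of frames. -/
theorem exists_polynomial_localComp {i : V} {C C₀ : Submodule K Λ} (hC : C ∈ localComp π i C₀) :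
    ∃ (k : ℕ) (c : Fin k → Λ), LinearIndependent K c ∧ span K (range c) = C ∧
      ∃ Φ ∈ polyFun K (Fin k → Λ), Φ c ≠ 0 ∧ ∀ b : Fin k → Λ, LinearIndependent K b →
        IsLocalSub hπ i (span K (range b)) → Φ b ≠ 0 →
          span K (range b) ∈ localComp π i C₀ := by
  obtain ⟨δ, x, rfl⟩ := (isLocalSub_of_mem_localComp hπ hC).exists_point hπ
  obtain ⟨b₀, hb₀⟩ := exists_spanPt x.1
  have h1 := (isClopen_localComp (π := π) i C₀ δ).isOpen.eventually_mem (x := x) hC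
  replace h1 := eventually_comap.1 ((nhds_sub x).ge h1)
  rw [← hb₀] at h1
  have h2 : Continuous (spanPt (K := K) (W := Λ)
      (k := finrank K (Ideal.span {idem π i} : Ideal Λ) - δ)) := continuous_quot
  have h3 := h2.continuousAt.eventually h1
  replace h3 := eventually_comap.1 ((nhds_sub b₀).ge h3)
  obtain ⟨Φ, hΦ, hΦb, h4⟩ := affine_eventually.1 h3
  refine ⟨_, b₀.1, b₀.2, congrArg Subtype.val hb₀, Φ, hΦ, hΦb, fun b hb hbl hbΦ => ?_⟩
  refine h4 b hbΦ ⟨b, hb⟩ rfl ⟨spanPt ⟨b, hb⟩, ?_⟩ rfl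
  refine ⟨?_, (isLocalSub_iff hπ).1 hbl⟩
  have h5 := localGrass.finrank_add x
  have h6 : finrank K (localGrass.submodule x) = _ := x.1.2
  have h7 : finrank K (spanPt ⟨b, hb⟩ : SpaceWithFunctions.grassmannian K Λ _).1 = _ :=
    (spanPt ⟨b, hb⟩ : SpaceWithFunctions.grassmannian K Λ _).2
  rw [h7, ← h6, h5]

namespace GrMod

variable {M : GrMod π} {t : ℕ} {e : Fin t → V} {h : Fin t → ℤ}

omit [FiniteDimensional K Λ] in
include hπ in
theorem SplitsAs.exists_isTopSystem_relations {C : Fin t → Submodule K Λ} (hs : M.SplitsAs e h C)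
    (hC : ∀ r, C r ≤ algGE hπ 1) (he : ∀ r, idem π (e r) ≠ 0) :
    ∃ m : Fin t → M, M.IsTopSystem e h m ∧
      ∀ f : Fin t → Λ, ∑ r, f r • m r = 0 ↔ ∀ r, f r * idem π (e r) ∈ C r := by
  obtain ⟨m, hm, h1, h2⟩ := hs.exists_isTopSystem hπ hC he
  refine ⟨m, hm, fun f => ⟨fun hf r => (h1 r _).1 (h2 f hf r), fun hf => ?_⟩⟩
  exact Finset.sum_eq_zero fun r _ => (h1 r _).2 (hf r)

end GrMod

variable {X : SpaceWithFunctions K} [X.IsGood] {d t : ℕ} {e : Fin t → V} {h : Fin t → ℤ}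

omit [FiniteDimensional K Λ] in
/-- Homogeneous generators of one fibre of a family extend to regular sections, which generate the
neighbouring fibres. -/
theorem GradedFamily.exists_sections (Δ : GradedFamily π d X) {x : X} {m₀ : Fin t → Δ.fib x}
    (h1 : ∀ r, m₀ r ∈ (Δ.fib x).gr (h r)) (h2 : ∀ r, idem π (e r) • m₀ r = m₀ r)
    (h3 : span Λ (range m₀) = ⊤) :
    ∃ (m : ∀ y, Fin t → Δ.fib y) (L : X → (Fin t → Λ) →ₗ[K] (Fin d → K)), m x = m₀ ∧
      (∀ f, VReg (X.regAlg x) fun y => L y f) ∧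
      ∀ᶠ y in 𝓝 x, (∀ r, m y r ∈ (Δ.fib y).gr (h r)) ∧ (∀ r, idem π (e r) • m y r = m y r) ∧
        span Λ (range (m y)) = ⊤ ∧
        ∃ E : Δ.fib y ≃ₗ[K] (Fin d → K), ∀ f : Fin t → Λ, L y f = E (∑ r, f r • m y r) := by
  classical
  obtain ⟨i, hi⟩ := Δ.cover x
  let B : ∀ y, y ∈ Δ.U i → Module.Basis (Fin d) K (Δ.fib y) := fun y hy =>
    Module.Basis.mk (Δ.frame_linearIndependent i y hy) (Δ.frame_span i y hy).ge
  have hB : ∀ y hy p, B y hy p = Δ.frame i y p := fun y hy p => Module.Basis.mk_apply _ _ _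
  have hc : ∀ r, ∃ c : Fin d → K, (∀ p, c p ≠ 0 → Δ.deg i p = h r) ∧
      m₀ r = ∑ p, c p • Δ.frame i x p := by
    intro r
    refine ⟨fun p => if h r = Δ.deg i p then (B x hi).repr (m₀ r) p else 0,
      fun p hp => ?_, ?_⟩
    · by_contra h
      exact hp (if_neg (Ne.symm h))
    · conv_lhs => rw [← (GrMod.mem_gr_iff _).1 (h1 r), ← (B x hi).sum_repr (m₀ r), map_sum]
      refine Finset.sum_congr rfl fun p _ => ?_
      rw [map_smul, hB x hi, GrMod.proj_of_mem _ (Δ.frame_mem i x hi p)]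
      change _ = (if h r = Δ.deg i p then (B x hi).repr (m₀ r) p else 0) • _
      split_ifs
      · rfl
      · rw [smul_zero, zero_smul]
  choose c hcd hcm using hc
  let m : ∀ y, Fin t → Δ.fib y := fun y r => idem π (e r) • ∑ p, c r p • Δ.frame i y p
  let E : ∀ y, y ∈ Δ.U i → Δ.fib y ≃ₗ[K] (Fin d → K) := fun y hy => (B y hy).equivFun
  let L : X → (Fin t → Λ) →ₗ[K] (Fin d → K) := fun y => if hy : y ∈ Δ.U i then
    (E y hy).toLinearMap ∘ₗ (Fintype.linearCombination Λ (m y)).restrictScalars K else 0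
  have hL : ∀ y (hy : y ∈ Δ.U i) f, L y f = E y hy (∑ r, f r • m y r) := fun y hy f => by
    change (if hy : y ∈ Δ.U i then _ else _ : (Fin t → Λ) →ₗ[K] (Fin d → K)) f = _
    rw [dif_pos hy]
    rfl
  have hU := (Δ.isOpen_U i).eventually_mem hi
  have hmx : m x = m₀ := funext fun r => by
    change idem π (e r) • ∑ p, c r p • Δ.frame i x p = _
    rw [← hcm, h2]
  have hLreg : ∀ f, VReg (X.regAlg x) fun y => L y f := by
    intro f
    choose A hA using fun a => Δ.action i a
    refine VReg.congr (b := fun y q => ∑ r, ∑ p, c r p * A (f r * idem π (e r)) p q y)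
      (vreg_pi.2 fun q => vreg_field.2 (sum_mem' _ fun r _ => sum_mem' _ fun p _ =>
        (X.regAlg x).mul_mem (const_mem _) ((hA _ x hi).1 p q))) ?_
    filter_upwards [hU] with y hy
    rw [hL y hy]
    refine (((E y hy).symm_apply_eq).1 ?_)
    rw [Module.Basis.equivFun_symm_apply]
    simp only [hB, Finset.sum_smul, mul_smul]
    rw [Finset.sum_comm]
    refine Finset.sum_congr rfl fun r _ => ?_
    change _ = f r • idem π (e r) • ∑ p, c r p • Δ.frame i y p
    rw [Finset.sum_comm, smul_smul, Finset.smul_sum]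
    refine Finset.sum_congr rfl fun p _ => ?_
    rw [← Finset.smul_sum, ← (hA _ y hy).2 p, smul_comm]
  refine ⟨m, L, hmx, hLreg, ?_⟩
  have hLx : ∀ p : Fin d, ∃ f, L x f = Pi.single p 1 := by
    intro p
    have h4 : (E x hi).symm (Pi.single p 1) ∈ span Λ (range m₀) := by
      rw [h3]; trivial
    obtain ⟨f, hf⟩ := (mem_span_range_iff_exists_fun Λ).1 h4
    exact ⟨f, by rw [hL x hi, hmx, hf, LinearEquiv.apply_symm_apply]⟩
  choose f hf using hLx
  have hev := eventually_linearIndependent (x := x) (b := fun p y => L y (f p))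
    (fun p => hLreg (f p)) (by
      simp only [hf]
      exact Pi.linearIndependent_single_one (Fin d) K)
  filter_upwards [hU, hev] with y hy h4
  refine ⟨fun r => ?_, fun r => ?_, eq_top_iff.2 fun x _ => ?_, E y hy, hL y hy⟩
  · have h5 : ∑ p, c r p • Δ.frame i y p ∈ (Δ.fib y).gr (h r) := by
      refine sum_mem fun p _ => ?_
      by_cases hp : c r p = 0
      · rw [hp, zero_smul]
        exact zero_mem _
      · rw [← hcd r p hp]
        exact smul_mem _ _ (Δ.frame_mem i y hy p)
    have h6 := (Δ.fib y).smul_mem 0 (h r) _ _ (idem_mem (e r)) h5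
    rwa [Nat.cast_zero, zero_add] at h6
  · change idem π (e r) • idem π (e r) • _ = _
    rw [smul_smul, idem_mul_self]
  · have h5 : E y hy x ∈ span K (range fun p => L y (f p)) := by
      rw [h4.span_eq_top_of_card_eq_finrank' (by simp)]
      trivial
    obtain ⟨a, ha⟩ := (mem_span_range_iff_exists_fun K).1 h5
    simp only [hL y hy, ← map_smul, ← map_sum] at ha
    rw [← (E y hy).injective ha]
    refine sum_mem fun p _ => Submodule.smul_of_tower_mem _ (a p)
      (sum_mem fun r _ => smul_mem _ _ (subset_span ⟨r, rfl⟩))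

end ClassifyingMap

section ClassifyingMap

open SpaceWithFunctions

variable [IsAlgClosed K] [FiniteDimensional K Λ] (hπ : IsPathLengthGraded π)

variable {X : SpaceWithFunctions K} [X.IsGood] {d t : ℕ} {e : Fin t → V} {h : Fin t → ℤ}

omit [IsAlgClosed K] in
include hπ in
/-- The subspaces which describe the relations between generators of a fixed degree at a fixed
vertex of a family of split modules, modulo the generators of smaller degrees. -/
theorem exists_regSub_block {M : X → GrMod π} {x : X} {C : X → Fin t → Submodule K Λ}
    (hC : ∀ y r, ∀ c ∈ C y r, c * idem π (e r) = c)
    (hCf : ∀ y r, finrank K (C y r) = finrank K (C x r)) {m : ∀ y, Fin t → M y}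
    {L : X → (Fin t → Λ) →ₗ[K] (Fin d → K)} (hL : ∀ f, VReg (X.regAlg x) fun y => L y f)
    (hm : ∀ᶠ y in 𝓝 x, (M y).IsTopSystem e h (m y) ∧
      (∃ E : M y ≃ₗ[K] (Fin d → K), ∀ f : Fin t → Λ, L y f = E (∑ r, f r • m y r)) ∧
      ∃ n : Fin t → M y, (M y).IsTopSystem e h n ∧
        ∀ f : Fin t → Λ, ∑ r, f r • n r = 0 ↔ ∀ r, f r * idem π (e r) ∈ C y r)
    (hmx : ∀ f : Fin t → Λ, ∑ r, f r • m x r = 0 ↔ ∀ r, f r * idem π (e r) ∈ C x r)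
    [DecidableEq V] (v : V) (k : ℤ) :
    ∃ D : X → Submodule K ({r // e r = v ∧ h r = k} → Λ), RegSub D x ∧
      (D x = Submodule.pi Set.univ fun i : {r // e r = v ∧ h r = k} => C x i) ∧
      ∀ᶠ y in 𝓝 x, ∃ G : Matrix {r // e r = v ∧ h r = k} {r // e r = v ∧ h r = k} K, IsUnit G ∧
        ∀ f, f ∈ D y ↔ ∀ i : {r // e r = v ∧ h r = k}, matAct K _ Λ G f i ∈ C y i := by
  let P := (lowGen Λ h k).restrictScalars K
  let F : X → Submodule K (Fin d → K) := fun y => P.map (L y)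
  have hF : ∀ y, ∀ E : M y ≃ₗ[K] (Fin d → K), (∀ f : Fin t → Λ, L y f = E (∑ r, f r • m y r)) →
      F y = ((low Λ (m y) h k).restrictScalars K).map E.toLinearMap := by
    intro y E hE
    ext a
    constructor
    · rintro ⟨g, hg, rfl⟩
      exact ⟨_, mem_low.2 ⟨g, hg, rfl⟩, (hE g).symm⟩
    · rintro ⟨b, hb, rfl⟩
      obtain ⟨g, hg, rfl⟩ := mem_low.1 hb
      exact ⟨g, hg, hE g⟩
  have hFf : ∀ᶠ y in 𝓝 x, finrank K (F y) = finrank K (F x) := by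
    have h1 : ∀ᶠ y in 𝓝 x, finrank K (F y) +
        ∑ r, (if h r < k then finrank K (C x r) +
          finrank K (LinearMap.ker (LinearMap.mulRight K (idem π (e r)))) else 0) =
        finrank K ((lowGen Λ h k).restrictScalars K) := by
      filter_upwards [hm] with y ⟨h1, ⟨E, hE⟩, n, h2, h3⟩
      have h4 : low Λ (m y) h k = low Λ n h k :=
        le_antisymm (h1.low_le hπ h2 k) (h2.low_le hπ h1 k)
      rw [← GrMod.finrank_low h3 (hC y) k, hF y E hE, h4]
      simp only [hCf y]
      congr 1
      exact LinearEquiv.finrank_map_eq E _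
    have h2 := h1.self_of_nhds
    filter_upwards [h1] with y hy
    omega
  have hFreg : RegSub F x := by
    let B := Module.finBasis K P
    have h1 : ∀ y, F y = span K (range fun j => L y (B j)) := fun y => by
      change P.map (L y) = _
      conv_lhs => rw [← span_range_coe_basis B]
      rw [Submodule.map_span, ← Set.range_comp]
      rfl
    refine (RegSub.of_span (fun j y => L y (B j)) (fun j => hL _) (hFf.mono fun y hy => ?_)).congr
      (Eventually.of_forall fun y => (h1 y).symm)
    rw [← h1, ← h1]
    exact hy
  let A : X → ({r // e r = v ∧ h r = k} → Λ) →ₗ[K] (Fin d → K) := fun y =>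
    L y ∘ₗ extendZero K Λ fun r => e r = v ∧ h r = k
  let D' : X → Submodule K ({r // e r = v ∧ h r = k} → Λ) := fun y => (F y).comap (A y)
  have hD' : ∀ y (E : M y ≃ₗ[K] (Fin d → K)),
      (∀ f : Fin t → Λ, L y f = E (∑ r, f r • m y r)) → ∀ f, f ∈ D' y ↔
        ∑ i : {r // e r = v ∧ h r = k}, f i • m y i ∈ low Λ (m y) h k := by
    intro y E hE f
    change L y (extendZero K Λ (fun r => e r = v ∧ h r = k) f) ∈ F y ↔ _
    rw [hE, sum_extendZero, hF y E hE]
    exact ⟨fun ⟨b, hb, hbf⟩ => E.injective hbf ▸ hb, fun hf => ⟨_, hf, rfl⟩⟩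
  have hG : ∀ᶠ y in 𝓝 x, ∃ G : Matrix {r // e r = v ∧ h r = k} {r // e r = v ∧ h r = k} K,
      IsUnit G ∧ ∀ f, f ∈ D' y ↔
        ∀ i : {r // e r = v ∧ h r = k}, matAct K _ Λ G f i * idem π v ∈ C y i := by
    filter_upwards [hm] with y ⟨h1, ⟨E, hE⟩, n, h2, h3⟩
    obtain ⟨G, hG, -, h4⟩ := h1.exists_block_matrix hπ h2 h3 v k
    exact ⟨G, hG, fun f => (hD' y E hE f).trans (h4 f)⟩
  have hCv : ∀ y (i : {r // e r = v ∧ h r = k}), ∀ c ∈ C y i, c * idem π v = c := fun y i c hc => by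
    have := hC y i c hc
    rwa [i.2.1] at this
  have hD'reg : RegSub D' x := by
    refine hFreg.comap (A := A) (fun f => hL _) ?_
    obtain ⟨G, hGu, h1⟩ := hG.self_of_nhds
    filter_upwards [hG] with y ⟨G', hGu', h2⟩
    exact (finrank_of_matAct hGu' h2 (hCv y)).trans
      ((Finset.sum_congr rfl fun i _ => by rw [hCf y]).trans (finrank_of_matAct hGu h1 (hCv x)).symm)
  let ρ : ({r // e r = v ∧ h r = k} → Λ) →ₗ[K] ({r // e r = v ∧ h r = k} → Λ) :=
    LinearMap.pi fun i => LinearMap.mulRight K (idem π v) ∘ₗ LinearMap.proj i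
  have hρ : ∀ f, ρ (ρ f) = ρ f := fun f => funext fun i => by
    change f i * idem π v * idem π v = f i * idem π v
    rw [mul_assoc, idem_mul_self]
  have hρG : ∀ (G : Matrix {r // e r = v ∧ h r = k} {r // e r = v ∧ h r = k} K) f i,
      matAct K _ Λ G (ρ f) i = matAct K _ Λ G f i * idem π v := fun G f i => by
    rw [matAct_apply, matAct_apply, Finset.sum_mul]
    exact Finset.sum_congr rfl fun j _ => (smul_mul_assoc _ _ _).symm
  have hρD : ∀ᶠ y in 𝓝 x, ∀ f ∈ D' y, ρ f ∈ D' y := by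
    filter_upwards [hG] with y ⟨G, _, h2⟩ f hf
    refine (h2 _).2 fun i => ?_
    rw [hρG, mul_assoc, idem_mul_self]
    exact (h2 f).1 hf i
  have hD : ∀ y (G : Matrix {r // e r = v ∧ h r = k} {r // e r = v ∧ h r = k} K), IsUnit G →
      (∀ f, f ∈ D' y ↔ ∀ i : {r // e r = v ∧ h r = k}, matAct K _ Λ G f i * idem π v ∈ C y i) →
      ∀ f, f ∈ (D' y).map ρ ↔ ∀ i : {r // e r = v ∧ h r = k}, matAct K _ Λ G f i ∈ C y i := by
    intro y G hGu h1 f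
    constructor
    · rintro ⟨g, hg, rfl⟩ i
      rw [hρG]
      exact (h1 g).1 hg i
    · intro hf
      have h2 : ∀ i, matAct K _ Λ G f i * idem π v = matAct K _ Λ G f i :=
        fun i => hCv y i _ (hf i)
      refine ⟨f, (h1 f).2 fun i => by rw [h2]; exact hf i, ?_⟩
      refine ((Module.End.isUnit_iff _).1 (hGu.map (matAct K _ Λ))).1 (funext fun i => ?_)
      rw [hρG, h2]
  refine ⟨fun y => (D' y).map ρ, hD'reg.map ρ (hD'reg.eventually_finrank_map_eq hρ hρD), ?_, ?_⟩
  · obtain ⟨h1, ⟨E, hE⟩, -⟩ := hm.self_of_nhds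
    obtain ⟨G, hGu, hG1, h4⟩ := h1.exists_block_matrix hπ h1 hmx v k
    ext f
    have h5 := hD x G hGu (fun f => (hD' x E hE f).trans (h4 f)) f
    rw [hG1 rfl] at h5
    simp only [matAct_one] at h5
    exact h5.trans ⟨fun h i _ => h i, fun h i => h i trivial⟩
  · filter_upwards [hG] with y ⟨G, hGu, h2⟩
    exact ⟨G, hGu, hD y G hGu h2⟩

variable {H : Set (Fin t → ℤ)} {𝒞 : GrMod π → Prop} (h𝒞 : GrMod.IsClass π d e H 𝒞) (hd : 0 < d)
  (hloc : ∀ M, 𝒞 M → M.IsDirectSumOfLocals) {C₀ : Fin t → Submodule K Λ}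
  (hC₀ : ∀ r, IsLocalSub hπ (e r) (C₀ r)) (hM : 𝒞 (prodMod hπ hC₀ h)) (hh : h ∈ H)

include hd hloc h𝒞 hM hh in
/-- The relations of the local summands in a family of direct sums of graded local modules form
regular families. -/
theorem regSub_of_splitsAs [Nonempty (Fin t)] (Δ : GradedFamily π d X) {s : X → ℤ}
    {C : X → Fin t → Submodule K Λ} (hC : ∀ x r, C x r ∈ localComp π (e r) (C₀ r))
    (hs : ∀ x, (Δ.fib x).SplitsAs e (fun r => h r + s x) (C x)) (x : X) (j₀ : Fin t) :
    RegSub (fun y => C y j₀) x := by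
  classical
  have he := h𝒞.idem_ne_zero hM
  have hCl : ∀ y r, IsLocalSub hπ (e r) (C y r) := fun y r =>
    isLocalSub_of_mem_localComp hπ (hC y r)
  have hCf : ∀ y r, finrank K (C y r) = finrank K (C x r) := fun y r =>
    (finrank_eq_of_mem_localComp (hC y r)).trans (finrank_eq_of_mem_localComp (hC x r)).symm
  have hsp := fun y => (hs y).exists_isTopSystem_relations hπ (fun r => (hCl y r).le) he
  obtain ⟨m₀, hm₀, hrel⟩ := hsp x
  obtain ⟨m, L, hmx, hL, hev⟩ := Δ.exists_sections hm₀.mem hm₀.idem_smul hm₀.span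
  have hm : ∀ᶠ y in 𝓝 x, (Δ.fib y).IsTopSystem e (fun r => h r + s x) (m y) ∧
      (∃ E : Δ.fib y ≃ₗ[K] (Fin d → K), ∀ f : Fin t → Λ, L y f = E (∑ r, f r • m y r)) ∧
      ∃ n : Fin t → Δ.fib y, (Δ.fib y).IsTopSystem e (fun r => h r + s x) n ∧
        ∀ f : Fin t → Λ, ∑ r, f r • n r = 0 ↔ ∀ r, f r * idem π (e r) ∈ C y r := by
    filter_upwards [hev] with y ⟨h1, h2, h3, h4⟩
    obtain ⟨n, hn, hn'⟩ := hsp y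
    have h5 := hn.of_span hπ rfl h1 h2 h3
    have h6 := h5.shift_eq hπ hn
    exact ⟨h5, h4, n, h6 ▸ hn, hn'⟩
  obtain ⟨D, hD, hDx, hDG⟩ := exists_regSub_block hπ (fun y r => (hCl y r).mul_idem) hCf hL hm
    (by rw [hmx]; exact hrel) (e j₀) (h j₀ + s x)
  by_cases hcase : ∃ j, j ≠ j₀ ∧ e j = e j₀ ∧ h j = h j₀ ∧
      localComp π (e j) (C₀ j) = localComp π (e j₀) (C₀ j₀)
  · obtain ⟨j, hj, hej, hhj, hloc'⟩ := hcase
    refine (RegSub.const (C x j₀)).congr (Eventually.of_forall fun y => ?_)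
    exact h𝒞.eq_of_localComp_eq hπ hd hloc hC₀ hM hh hj.symm hej.symm hhj.symm hloc'.symm
      (hC x j₀) (hC y j₀)
  · obtain ⟨k, c, hc, hcC, Φ, hΦ, hΦc, hΦb⟩ := exists_polynomial_localComp hπ (hC x j₀)
    have hblk : ∀ i : {r // e r = e j₀ ∧ h r + s x = h j₀ + s x}, h i = h j₀ := fun i =>
      add_right_cancel i.2.2
    refine RegSub.of_splitting (ι := {r // e r = e j₀ ∧ h r + s x = h j₀ + s x}) hD
      (C := fun i y => C y i) hDx hDG (Eventually.of_forall fun y i j => ?_)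
      (j₀ := ⟨j₀, rfl, rfl⟩) hc hcC hΦ hΦc (Eventually.of_forall fun y i b hb hbC hbΦ => ?_)
      (Eventually.of_forall fun y => ?_)
    · by_cases hij : i = j
      · subst hij
        exact iff_of_true le_rfl le_rfl
      · exact h𝒞.le_iff hπ hd hloc hC₀ hM hh (fun h => hij (Subtype.ext h.symm))
          (j.2.1.trans i.2.1.symm) ((hblk j).trans (hblk i).symm) (hC x i) (hC y i)
            (hC x j) (hC y j)
    · by_contra hij
      refine hcase ⟨i, fun h => hij (Subtype.ext h), i.2.1, hblk i, ?_⟩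
      have h1 := hCl y i
      rw [← hbC, i.2.1] at h1
      have h2 := hΦb b hb h1 hbΦ
      rw [hbC] at h2
      have h3 := hC y i
      rw [← localComp_eq h3, ← localComp_eq h2, i.2.1]
    · rw [hCf y, ← hcC, finrank_span_eq_card hc, Fintype.card_fin]

end ClassifyingMap

section FineModuli

open SpaceWithFunctions

variable (hπ : IsPathLengthGraded π) {d t : ℕ} {e : Fin t → V} {h h' : Fin t → ℤ}

namespace GrMod

variable {H : Set (Fin t → ℤ)} {𝒞 : GrMod π → Prop}

/-- The members of `𝒞` which are direct sums of modules `Λ e_r / C_r` with `C_r ∈ W_r`, generated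
in degrees `h r`, up to a shift. -/
def splitClass (𝒞 : GrMod π → Prop) (e : Fin t → V) (h : Fin t → ℤ)
    (W : Fin t → Set (Submodule K Λ)) (M : GrMod π) : Prop :=
  𝒞 M ∧ ∃ (s : ℤ) (C : Fin t → Submodule K Λ), (∀ r, C r ∈ W r) ∧
    M.SplitsAs e (fun r => h r + s) C

theorem splitClass_shift {W : Fin t → Set (Submodule K Λ)} (c : ℤ) :
    splitClass 𝒞 e (fun r => h r + c) W = splitClass 𝒞 e h W := by
  funext M
  refine propext (and_congr Iff.rfl ⟨?_, ?_⟩)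
  · rintro ⟨s, C, hC, hs⟩
    exact ⟨c + s, C, hC, by simpa only [add_assoc] using hs⟩
  · rintro ⟨s, C, hC, hs⟩
    exact ⟨s - c, C, hC, by simpa only [add_assoc, add_sub_cancel] using hs⟩

theorem splitClass.of_gradedIso {W : Fin t → Set (Submodule K Λ)} {M N : GrMod π}
    (hM : splitClass 𝒞 e h W M) (hN : 𝒞 N) (hMN : M.GradedIso N) : splitClass 𝒞 e h W N := by
  obtain ⟨-, s, C, hC, hs⟩ := hM
  obtain ⟨F, u, hF⟩ := hMN
  exact ⟨hN, s + u, C, hC, by simpa only [add_assoc] using hs.congr_iso hF⟩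

variable [FiniteDimensional K Λ] (h𝒞 : IsClass π d e H 𝒞)

include hπ h𝒞 in
theorem splitClass_le {C₀ C₀' : Fin t → Submodule K Λ} {M : GrMod π}
    (hM : splitClass 𝒞 e h (fun r => localComp π (e r) (C₀ r)) M)
    (hM' : splitClass 𝒞 e h' (fun r => localComp π (e r) (C₀' r)) M) {N : GrMod π}
    (hN : splitClass 𝒞 e h (fun r => localComp π (e r) (C₀ r)) N) :
    splitClass 𝒞 e h' (fun r => localComp π (e r) (C₀' r)) N := by
  obtain ⟨h1, s, C, hC, hs⟩ := hM
  obtain ⟨-, s', C', hC', hs'⟩ := hM'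
  obtain ⟨h2, u, E, hE, hu⟩ := hN
  obtain ⟨σ, hσ⟩ := hs.krullSchmidt hπ hs' (fun r => (isLocalSub_of_mem_localComp hπ (hC r)).le)
    (fun r => (isLocalSub_of_mem_localComp hπ (hC' r)).le) (h𝒞.idem_ne_zero h1)
    (h𝒞.idem_ne_zero h1)
  have h3 := hu.perm σ
  refine ⟨h2, s' - s + u, E ∘ σ, fun r => ?_, ?_⟩
  · have h4 : localComp π (e (σ r)) (C₀ (σ r)) = localComp π (e r) (C₀' r) := by
      rw [← localComp_eq (hC (σ r)), ← localComp_eq (hC' r), ← (hσ r).1, (hσ r).2.2]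
    change E (σ r) ∈ localComp π (e r) (C₀' r)
    rw [← h4]
    exact hE (σ r)
  · have h4 : e ∘ σ = e := funext fun r => (hσ r).1.symm
    have h5 : (fun r => h r + u) ∘ σ = fun r => h' r + (s' - s + u) := funext fun r => by
      have := (hσ r).2.1
      change h (σ r) + u = _
      omega
    rwa [h4, h5] at h3

variable (hd : 0 < d)

omit [FiniteDimensional K Λ] in
include h𝒞 hd in
theorem IsClass.nonempty_fin {M : GrMod π} (hM : 𝒞 M) : Nonempty (Fin t) := by
  by_contra hne
  rw [not_nonempty_iff] at hne
  obtain ⟨hdim, -, -, m, -, -, hspan, -⟩ := h𝒞.withTop hM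
  rw [Set.range_eq_empty, Submodule.span_empty] at hspan
  have : Subsingleton M := (Submodule.subsingleton_iff Λ).1 (subsingleton_of_bot_eq_top hspan)
  rw [Module.finrank_zero_of_subsingleton] at hdim
  omega

variable (hloc : ∀ M, 𝒞 M → M.IsDirectSumOfLocals) {C₀ : Fin t → Submodule K Λ}
  (hC₀ : ∀ r, IsLocalSub hπ (e r) (C₀ r)) (hM₀ : 𝒞 (_root_.prodMod hπ hC₀ h)) (hh : h ∈ H)

include h𝒞 hd hloc hM₀ hh in
theorem SplitsAs.unique {M : GrMod π} {C C' : Fin t → Submodule K Λ}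
    {s s' : ℤ} (hs : M.SplitsAs e (fun r => h r + s) C) (hs' : M.SplitsAs e (fun r => h r + s') C')
    (hC : ∀ r, C r ∈ localComp π (e r) (C₀ r)) (hC' : ∀ r, C' r ∈ localComp π (e r) (C₀ r)) :
    C' = C := by
  have := h𝒞.nonempty_fin hd hM₀
  obtain ⟨σ, hσ⟩ := hs.krullSchmidt hπ hs' (fun r => (isLocalSub_of_mem_localComp hπ (hC r)).le)
    (fun r => (isLocalSub_of_mem_localComp hπ (hC' r)).le) (h𝒞.idem_ne_zero hM₀)
    (h𝒞.idem_ne_zero hM₀)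
  have h1 := Finset.sum_congr (s₁ := Finset.univ) rfl fun a _ => (hσ a).2.1
  rw [Finset.sum_add_distrib, Finset.sum_add_distrib, Equiv.sum_comp σ h, add_right_inj] at h1
  have h2 : s' = s := by simpa [(Fin.pos (Classical.arbitrary (Fin t))).ne'] using h1
  funext r
  by_cases hr : σ r = r
  · rw [(hσ r).2.2, hr]
  · refine h𝒞.eq_of_localComp_eq hπ hd hloc hC₀ hM₀ hh (Ne.symm hr) (hσ r).1 ?_ ?_ (hC' r) (hC r)
    · have := (hσ r).2.1
      omega
    · rw [← localComp_eq (hC (σ r)), ← localComp_eq (hC' r), ← (hσ r).1, (hσ r).2.2]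

end GrMod

theorem localGrass.exists_of_mem_localComp {i : V} {δ : ℕ} {x : localGrass π i δ}
    {D : Submodule K Λ} (hD : D ∈ localComp π i (localGrass.submodule x)) :
    ∃ y : localGrass π i δ, localGrass.submodule y = D := by
  obtain ⟨δ', x', y, h1, rfl, -⟩ := hD
  obtain rfl := localGrass.delta_eq h1
  exact ⟨y, rfl⟩

variable [IsAlgClosed K] [FiniteDimensional K Λ] {H : Set (Fin t → ℤ)} {𝒞 : GrMod π → Prop}
  (h𝒞 : GrMod.IsClass π d e H 𝒞) (hd : 0 < d) (hloc : ∀ M, 𝒞 M → M.IsDirectSumOfLocals)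
  {C₀ : Fin t → Submodule K Λ} (hC₀ : ∀ r, IsLocalSub hπ (e r) (C₀ r))
  (hM₀ : 𝒞 (prodMod hπ hC₀ h)) (hh : h ∈ H)

include h𝒞 hd hloc hM₀ hh in
theorem exists_fineModuliSpace :
    ∃ (Z : SpaceWithFunctions K) (Γ : GradedFamily π d Z),
      IsFineModuliSpace (GrMod.splitClass 𝒞 e h fun r => localComp π (e r) (C₀ r)) Z Γ ∧
      Z.IsProjectiveVariety ∧
      ∃ (δ : Fin t → ℕ) (W : ∀ r, Set (localGrass π (e r) (δ r))), (∀ r, IsClopen (W r)) ∧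
        ∃ pr : ∀ r, SpaceWithFunctions.Hom Z ((localGrass π (e r) (δ r)).sub (W r)),
          IsProductOfVarieties (fun r => (localGrass π (e r) (δ r)).sub (W r)) Z pr ∧
          ∀ z, (Γ.fib z).SplitsAs e h (fun r => localGrass.submodule (pr r z).1) := by
  have := h𝒞.nonempty_fin hd hM₀
  have he := h𝒞.idem_ne_zero hM₀
  choose δ x₀ hx₀ using fun r => (hC₀ r).exists_point hπ
  let B : ∀ r, Set (localGrass π (e r) (δ r)) := fun r =>
    {x | localGrass.submodule x ∈ localComp π (e r) (C₀ r)}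
  have hB : ∀ r, IsClopen (B r) := fun r => isClopen_localComp _ _ _
  have hA := fun r => isClosed_localGrass (K := K) hπ (e r) (δ r)
  let Z : SpaceWithFunctions K := prodSpace (W := Λ)
    (k := fun r => finrank K (Ideal.span {idem π (e r)} : Ideal Λ) - δ r) _ B
  have hZ : Z.IsVariety := isVariety_grassmannian_sub (isClosed_prodSet hA fun r => (hB r).1)
  have hprod := isProductOfVarieties_prodSpace hA fun r => (hB r).1
  let pr : ∀ r, Hom Z ((localGrass π (e r) (δ r)).sub (B r)) := fun r =>
    Hom.mk' (factor r) (homAt_factor r)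
  let C : Z → Fin t → Submodule K Λ := fun z r => localGrass.submodule (pr r z).1
  have hC : ∀ z r, C z r ∈ localComp π (e r) (C₀ r) := fun z r => (pr r z).2
  have hCl : ∀ z r, IsLocalSub hπ (e r) (C z r) := fun z r =>
    isLocalSub_of_mem_localComp hπ (hC z r)
  have hreg : ∀ z r, RegSub (fun z => C z r) z := fun z r => regSub_factor r z
  have hmem : ∀ z, 𝒞 (prodMod hπ (hCl z) h) := fun z =>
    h𝒞.prodMod_of_mem hπ hd hC₀ hM₀ hh (hC z)
  have hsplit : ∀ z, (prodMod hπ (hCl z) h).SplitsAs e h (C z) := fun z =>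
    prodMod_splitsAs hπ (hCl z) h
  let Γ : GradedFamily π d Z :=
    prodFamily hπ hCl hreg h (fun z => (h𝒞.withTop (hmem z)).1) he
  have : Nontrivial Λ := ⟨_, _, he (Classical.arbitrary _)⟩
  have h0 : ∀ z, (prodMod hπ (hCl z) h).SplitsAs e (fun r => h r + 0) (C z) := fun z => by
    simpa only [add_zero] using hsplit z
  refine ⟨Z, Γ, ⟨hZ, fun z => ⟨hmem z, 0, C z, hC z, h0 z⟩, fun X hX Δ hΔ => ?_⟩,
    isProjectiveVariety_grassmannian_sub (isClosed_prodSet hA fun r => (hB r).1),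
    δ, B, hB, pr, hprod, hsplit⟩
  have := hX.isGood
  choose s E hE hs using fun x => (hΔ x).2
  have hEreg := regSub_of_splitsAs hπ h𝒞 hd hloc hC₀ hM₀ hh Δ hE hs
  choose y hy using fun x r => localGrass.exists_of_mem_localComp (x := x₀ r)
    (by rw [hx₀]; exact hE x r)
  have hyB : ∀ x r, y x r ∈ B r := fun x r => by
    change localGrass.submodule (y x r) ∈ localComp π (e r) (C₀ r)
    rw [hy]
    exact hE x r
  let g : X → ∀ r, (localGrass π (e r) (δ r)).sub (B r) := fun x r => ⟨y x r, hyB x r⟩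
  have hg : ∀ r, (fun x => (g x r).1.1.1) = fun x => E x r := fun r => funext fun x => hy x r
  let τ : Hom X Z := Hom.mk' (fun x => prodPt (g x)) fun x => homAt_prodPt fun r => by
    rw [hg]
    exact hEreg x r
  have hCτ : ∀ x, C (τ x) = E x := fun x => funext fun r => by
    have h1 : pr r (τ x) = g x r := factor_prodPt (g x) r
    change localGrass.submodule (pr r (τ x)).1 = _
    rw [h1]
    exact hy x r
  refine ⟨τ, fun x => ?_, fun τ' hτ' => Hom.ext fun x => prodSpace_ext fun r => ?_⟩
  · have h1 := hs x
    rw [← hCτ] at h1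
    exact (GrMod.SplitsAs.gradedIso hπ (hsplit (τ x)) h1).symm
  · obtain ⟨F, u, hF⟩ := (hτ' x).symm
    have h1 := (hsplit (τ' x)).congr_iso hF
    have h2 := GrMod.SplitsAs.unique hπ h𝒞 hd hloc hC₀ hM₀ hh (hs x) h1 (hE x) (hC (τ' x))
    exact congrFun (h2.trans (hCτ x).symm) r

end FineModuli

namespace GrMod

variable [FiniteDimensional K Λ]
  (hπ : IsPathLengthGraded π) {t : ℕ} (e : Fin t → V) (𝒞 : GrMod π → Prop)

include hπ in
theorem finite_splitClass [Nonempty (Fin t)] {H : Set (Fin t → ℤ)} {B : ℤ}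
    (hB : ∀ h ∈ H, ∀ r r', |h r - h r'| ≤ B) :
    {D | ∃ h ∈ H, ∃ C : Fin t → Submodule K Λ, (∀ r, IsLocalSub hπ (e r) (C r)) ∧
      D = splitClass 𝒞 e h fun r => localComp π (e r) (C r)}.Finite := by
  let r₀ : Fin t := Classical.arbitrary _
  have h1 := (Set.finite_Icc (fun _ : Fin t => -B) fun _ => B).prod
    (Set.Finite.pi fun r => finite_localComp hπ (e r))
  refine (h1.image fun p => splitClass 𝒞 e p.1 p.2).subset ?_
  rintro _ ⟨h, hh, C, hC, rfl⟩
  refine ⟨(fun r => h r + -h r₀, fun r => localComp π (e r) (C r)), ⟨⟨fun r => ?_, fun r => ?_⟩,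
    fun r _ => ⟨C r, hC r, rfl⟩⟩, splitClass_shift _⟩
  · exact (abs_le.1 (hB h hh r r₀)).1
  · exact (abs_le.1 (hB h hh r r₀)).2

end GrMod

end

theorem theoremB {K : Type u} [Field K] [IsAlgClosed K]
    {V : Type w} [Quiver.{v} V] [Fintype V] [∀ i j : V, Finite (i ⟶ j)]
    {Λ : Type u} [Ring Λ] [Algebra K Λ]
    (π : PathAlgebra K V →ₐ[K] Λ) (hπ : IsPathLengthGraded π)
    (d : ℕ) (hd : 0 < d) {t : ℕ} (e : Fin t → V) (H : Set (Fin t → ℤ))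
    (S : ℕ → ModuleCat.{u} Λ) (hS : ∀ l, IsSemisimpleModule Λ (S l))
    (𝒞 : GrMod π → Prop)
    (h𝒞 : 𝒞 = GrMod.withTop π d e H ∨ 𝒞 = GrMod.withLayering π d e H S) :
    ((∃ Z : SpaceWithFunctions K, IsCoarseModuliSpace d 𝒞 Z) →
      ∀ M, 𝒞 M → M.IsDirectSumOfLocals) ∧
    ((∃ B : ℤ, ∀ h ∈ H, ∀ r r', |h r - h r'| ≤ B) →
      (∀ M, 𝒞 M → M.IsDirectSumOfLocals) →
      ∃ (n : ℕ) (𝒟 : Fin n → GrMod π → Prop),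
        (∀ M, 𝒞 M ↔ ∃ i, 𝒟 i M) ∧
        (∀ i j M, 𝒟 i M → 𝒟 j M → i = j) ∧
        (∀ i M N, 𝒟 i M → 𝒞 N → M.GradedIso N → 𝒟 i N) ∧
        ∀ i, ∃ (Z : SpaceWithFunctions K) (Γ : GradedFamily π d Z),
          IsFineModuliSpace (𝒟 i) Z Γ ∧ Z.IsProjectiveVariety ∧
          ∃ h ∈ H, ∃ (δ : Fin t → ℕ) (W : ∀ r, Set (localGrass π (e r) (δ r))),
            (∀ r, IsClopen (W r)) ∧
            ∃ pr : ∀ r, SpaceWithFunctions.Hom Z ((localGrass π (e r) (δ r)).sub (W r)),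
              SpaceWithFunctions.IsProductOfVarieties
                (fun r => (localGrass π (e r) (δ r)).sub (W r)) Z pr ∧
              ∀ z, (Γ.fib z).SplitsAs e h
                (fun r => localGrass.submodule (pr r z).1)) := by
  have : FiniteDimensional K Λ := finiteDimensional_of_graded hπ
  have h𝒞' : GrMod.IsClass π d e H 𝒞 := h𝒞.imp id fun h => ⟨S, h⟩
  refine ⟨fun ⟨Z, hZ⟩ M hM => h𝒞'.isDirectSumOfLocals hπ hd hZ hM, fun ⟨B, hB⟩ hloc => ?_⟩
  let P : Set (GrMod π → Prop) := {D | ∃ h ∈ H, ∃ (C : Fin t → Submodule K Λ)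
    (hC : ∀ r, IsLocalSub hπ (e r) (C r)), 𝒞 (prodMod hπ hC h) ∧
      D = GrMod.splitClass 𝒞 e h fun r => localComp π (e r) (C r)}
  have hfin : P.Finite := by
    rcases P.eq_empty_or_nonempty with h0 | ⟨_, _, _, _, _, hM, _⟩
    · exact h0 ▸ Set.finite_empty
    · have := h𝒞'.nonempty_fin hd hM
      refine (GrMod.finite_splitClass hπ e 𝒞 hB).subset ?_
      rintro D ⟨h, hh, C, hC, -, hD⟩
      exact ⟨h, hh, C, hC, hD⟩
  obtain ⟨n, 𝒟, hinj, hran⟩ := hfin.fin_param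
  have hmem : ∀ i, 𝒟 i ∈ P := fun i => hran ▸ Set.mem_range_self i
  refine ⟨n, 𝒟, fun M => ⟨fun hM => ?_, fun ⟨i, hi⟩ => ?_⟩, fun i j M hi hj => hinj ?_,
    fun i M N hM hN hMN => ?_, fun i => ?_⟩
  · obtain ⟨-, h, hh, ht⟩ := h𝒞'.withTop hM
    obtain ⟨C, hs, hC⟩ := GrMod.exists_splitsAs hπ (hloc M hM) ht
    have hCl := fun r => hs.isLocalSub hπ hC r
    have hs' : M.SplitsAs e (fun r => h r + 0) C := by simpa only [add_zero] using hs
    have hCC := fun r => (hCl r).mem_localComp hπ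
    have h1 : (GrMod.splitClass 𝒞 e h fun r => localComp π (e r) (C r)) ∈ Set.range 𝒟 :=
      hran ▸ ⟨h, hh, C, hCl, h𝒞'.prodMod hπ hd hM hs' hh hCl hCl hCC, rfl⟩
    obtain ⟨i, hi⟩ := h1
    exact ⟨i, hi ▸ ⟨hM, 0, C, hCC, hs'⟩⟩
  · obtain ⟨h, -, C, -, -, hD⟩ := hmem i
    rw [hD] at hi
    exact hi.1
  · obtain ⟨h, -, C, -, -, hD⟩ := hmem i
    obtain ⟨h', -, C', -, -, hD'⟩ := hmem j
    rw [hD] at hi ⊢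
    rw [hD'] at hj ⊢
    exact funext fun N => propext
      ⟨GrMod.splitClass_le hπ h𝒞' hi hj, GrMod.splitClass_le hπ h𝒞' hj hi⟩
  · obtain ⟨h, -, C, -, -, hD⟩ := hmem i
    rw [hD] at hM ⊢
    exact hM.of_gradedIso hN hMN
  · obtain ⟨h, hh, C, hC, hM, hD⟩ := hmem i
    rw [hD]
    obtain ⟨Z, Γ, hZ, hproj, δ, W, hW⟩ := exists_fineModuliSpace hπ h𝒞' hd hloc hC hM hh
    exact ⟨Z, Γ, hZ, hproj, h, hh, δ, W, hW⟩
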